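/- **Setting.** Let $\mathcal A\subset\mathbb Z_{\ge 0}^d$ be a finite action set, let $n_i=\max_{a\in\mathcal A}a_i$, and assume that $n_i\ge 1$ for every $i\in[d]$. Each base arm $i$ has a distribution $\mathcal D_i$ on $[0,1]$ with mean $\ell_i$ and variance $\sigma_i^2$. In each round $t=1,\dots,T$, for each $i$, the losses $L_{i,1}(t),\dots,L_{i,n_i}(t)$ are i.i.d. from $\mathcal D_i$, and the losses of round $t$ are independent of the past and of the action $a(t)\in\mathcal A$ played in round $t$. The player observes $L_{i,j}(t)$ for $j\le a_i(t)$ and suffers the loss $\sum_i\sum_{j\le a_i(t)}L_{i,j}(t)$. Let $a^*$ be the unique minimizer of $a^\top\ell$ over $\mathcal A$, and let $$R_T=\mathbb E\Big[\sum_{t=1}^T\sum_{i}\Big(\sum_{j\le a_i(t)}L_{i,j}(t)-\sum_{j\le a^*_i}L_{i,j}(t)\Big)\Big].$$ Put $J^*=\{i:a^*_i=0\}$, $M=\max_{a\in\mathcal A}\|a\|_1$, $\lambda_{\mathcal A}=\min\{M,\sum_{i\in J^*}n_i\}$, $W=\sum_i n_i$, and $\Delta_i=\min_{a\in\mathcal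 A:\,a_i\ge1}a^\top\ell-a^{*\top}\ell$ (which is positive for $i\in J^*$). **Algorithm (GenLBINFV with horizon $T$).** Fix $\epsilon_i\in(0,n_i/2]$. In round $t$ compute $$x(t)\in\operatorname*{arg\,min}_{x\in\mathrm{conv}(\mathcal A)}\Big\{\Big\langle q(t)+\sum_{s<t}\hat\ell(s),x\Big\rangle+\sum_i\beta_i(t)\varphi_i(x_i)\Big\},$$ and sample $a(t)\in\mathcal A$ whose conditional mean, given the past, is $x(t)$. Here $k_i(t)=\frac1{a_i(t)}\sum_{j\le a_i(t)}L_{i,j}(t)$, $\hat\ell_i(t)=q_i(t)+\frac{a_i(t)}{x_i(t)}(k_i(t)-q_i(t))$, $$\varphi_i(z)=n_i\Big(\tfrac z{n_i}-1-\log\tfrac z{n_i}+\log T\,\big(\tfrac z{n_i}+(1-\tfrac z{n_i})\log(1-\tfrac z{n_i})\big)\Big)\quad(\varphi_i(0)=+\infty),$$ $$\beta_i(t)^2=\Big(1+\frac{\epsilon_i}{n_i}\Big)^2+\frac1{\log T}\sum_{s<t}\Big(\frac{a_i(s)}{n_i}\Big)^2(k_i(s)-q_i(s))^2\min\Big\{1,\frac{2(1-x_i(s)/n_i)}{(x_i(s)/n_i)^2\log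 T}\Big\},\qquad \beta_i(t)\ge 0.$$ The prediction $q(t)$ is either the least-squares one, $$q_i(t)=\frac{\frac12+\sum_{s<t}\sum_{j\le a_i(s)}L_{i,j}(s)}{1+\sum_{s<t}a_i(s)},$$ or, with a step size $\eta\in(0,\frac12)$, the gradient-descent one: $q_i(1)=\frac12$, and $q_i(t+1)=(1-\eta)q_i(t)+\eta k_i(t)$ if $a_i(t)\ge1$, $q_i(t+1)=q_i(t)$ otherwise. **Theorem.** Let $\rho>0$ and assume that $\epsilon_i\ge\rho n_i$ for all $i$. 1. (Least squares) There is a constant $C$ that depends only on $\rho$ such that, for every instance and all sufficiently large $T$ (how large depends on the instance and on $(\epsilon_i)_i$), $$R_T\le C\Big(\sum_{i\in J^*}\frac{\lambda_{\mathcal A}\sigma_i^2}{\Delta_i}+W\Big)\log T .$$ 2. (Gradient descent) For every $N$ there is a constant $C$ that depends only on $\rho$ and $N$ such that, for every instance with $\max_i n_i\le N$, every $\eta\in(0,\frac12)$, and all sufficiently large $T$ (how large depends on the instance, on $(\epsilon_i)_i$ and on $\eta$), $$R_T\le C\Big(\frac1{1-2\eta}\sum_{i\in J^*}\frac{\lambda_{\mathcal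 A}\sigma_i^2}{\Delta_i}+W\Big)\log T .$$ In particular, for a fixed instance with $\sigma_i>0$ for some $i\in J^*$, the regret is $O\big(\sum_{i\in J^*}\frac{\lambda_{\mathcal A}\sigma_i^2}{\Delta_i}\log T\big)$ and $O\big(\frac1{1-2\eta}\sum_{i\in J^*}\frac{\lambda_{\mathcal A}\sigma_i^2}{\Delta_i}\log T\big)$, respectively. -/

import Mathlib

open MeasureTheory ProbabilityTheory

namespace MPCSB

/-! ### Action sets -/

/-- `n_i`: the maximum number of samples of base arm `i` that one action can take. -/
def maxPlays {d : ℕ} (A : Finset (Fin d → ℕ)) (i : Fin d) : ℕ := A.sup fun a => a i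

/-- `M = max_{a ∈ A} ‖a‖₁`. -/
def maxNorm {d : ℕ} (A : Finset (Fin d → ℕ)) : ℕ := A.sup fun a => ∑ i, a i

/-- One round of losses: `L_{i,j}` for `i ∈ [d]` and `j = 1, …, n_i` (here `j` runs from `0`). -/
abbrev LossArray {d : ℕ} (A : Finset (Fin d → ℕ)) : Type :=
  (i : Fin d) → Fin (maxPlays A i) → ℝ

/-- `∑_{j = 1}^{a_i} L_{i,j}`. -/
noncomputable def armLoss {d : ℕ} {A : Finset (Fin d → ℕ)} (a : Fin d → ℕ) (l : LossArray A)
    (i : Fin d) : ℝ :=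
  ∑ j ∈ (Finset.univ : Finset (Fin (maxPlays A i))).filter (fun j => j.val < a i), l i j

/-- The linear loss `f(a, L) = ∑_i ∑_{j = 1}^{a_i} L_{i,j}`. -/
noncomputable def linLoss {d : ℕ} {A : Finset (Fin d → ℕ)} (a : Fin d → ℕ) (l : LossArray A) : ℝ :=
  ∑ i, armLoss a l i

/-- `k_i`, the average observed loss of arm `i` (only ever used multiplied by `a_i`, or when
`a_i ≥ 1`). -/
noncomputable def avgLoss {d : ℕ} {A : Finset (Fin d → ℕ)} (a : Fin d → ℕ) (l : LossArray A)
    (i : Fin d) : ℝ :=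
  armLoss a l i / (a i : ℝ)

/-! ### Stochastic instances -/

/-- An instance of the multi-play combinatorial semi-bandit in the stochastic regime with linear
loss: a finite action set in which every arm is playable, a loss distribution on `[0, 1]` for every
base arm, and the unique action that is optimal in expectation. -/
structure Instance (d : ℕ) where
  /-- the action set -/
  A : Finset (Fin d → ℕ)
  /-- the loss distributions of the base arms -/
  D : Fin d → Measure ℝ
  /-- the optimal action -/
  aStar : Fin d → ℕ
  arm_playable : ∀ i, ∃ a ∈ A, 1 ≤ a i
  D_prob : ∀ i, IsProbabilityMeasure (D i)
  D_supp : ∀ i, ∀ᵐ y ∂(D i), y ∈ Set.Icc (0 : ℝ) 1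
  aStar_mem : aStar ∈ A
  aStar_opt : ∀ a ∈ A, a ≠ aStar →
    ∑ i, (aStar i : ℝ) * ∫ y, y ∂(D i) < ∑ i, (a i : ℝ) * ∫ y, y ∂(D i)

namespace Instance

variable {d : ℕ} (I : Instance d)

/-- `n_i`. -/
def n (i : Fin d) : ℕ := maxPlays I.A i

/-- The mean loss `ℓ_i` of arm `i`. -/
noncomputable def mean (i : Fin d) : ℝ := ∫ y, y ∂(I.D i)

/-- The variance `σ_i²` of arm `i`. -/
noncomputable def sigmaSq (i : Fin d) : ℝ := variance id (I.D i)

/-- `aᵀ ℓ - a*ᵀ ℓ`. -/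
noncomputable def gap (a : Fin d → ℕ) : ℝ :=
  ∑ i, (a i : ℝ) * I.mean i - ∑ i, (I.aStar i : ℝ) * I.mean i

/-- `Δ_i = min_{a ∈ A, a_i ≥ 1} aᵀ ℓ - a*ᵀ ℓ`, the minimum of a finite non-empty set. -/
noncomputable def Delta (i : Fin d) : ℝ := sInf (I.gap '' {a | a ∈ I.A ∧ 1 ≤ a i})

/-- `J*`, the arms that the optimal action does not play. -/
def J : Finset (Fin d) := {i | I.aStar i = 0}

/-- `λ_A = min {M, ∑_{i ∈ J*} n_i}`. -/
def lam : ℕ := min (maxNorm I.A) (∑ i ∈ I.J, I.n i)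

/-- `∑_{i ∈ J*} λ_A σ_i² / Δ_i`. -/
noncomputable def complexity : ℝ := ∑ i ∈ I.J, (I.lam : ℝ) * I.sigmaSq i / I.Delta i

/-- `W = ∑_i n_i`. -/
def W : ℕ := ∑ i, I.n i

end Instance

/-! ### The algorithm

Rounds are numbered from `0`, so that the sums over `s < t` below are over the rounds that precede
round `t`. The arguments `a`, `l`, `x` are the played actions, the losses and the points chosen by
the algorithm. -/

/-- A rule for the optimistic prediction `q_i(t)`, a function of the played actions and the losses
(both rules below only use observed losses from the rounds before `t`). -/
abbrev Prediction {d : ℕ} (A : Finset (Fin d → ℕ)) : Type :=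
  (ℕ → Fin d → ℕ) → (ℕ → LossArray A) → ℕ → Fin d → ℝ

/-- The least-squares prediction. -/
noncomputable def lsPred {d : ℕ} (A : Finset (Fin d → ℕ)) : Prediction A := fun a l t i =>
  (1 / 2 + ∑ s ∈ Finset.range t, armLoss (a s) (l s) i) /
    (1 + ∑ s ∈ Finset.range t, (a s i : ℝ))

/-- The gradient-descent prediction with step size `η`. -/
noncomputable def gdPred {d : ℕ} (A : Finset (Fin d → ℕ)) (η : ℝ) : Prediction A
  | _, _, 0, _ => 1 / 2
  | a, l, t + 1, i =>
    if 1 ≤ a t i then (1 - η) * gdPred A η a l t i + η * avgLoss (a t) (l t) i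
    else gdPred A η a l t i

section Algorithm

variable {d : ℕ} {A : Finset (Fin d → ℕ)} (q : ℕ → Fin d → ℝ) (ε : Fin d → ℝ) (T : ℕ)
  (a : ℕ → Fin d → ℕ) (l : ℕ → LossArray A) (x : ℕ → Fin d → ℝ)

/-- The loss estimator `ℓ̂_i(t) = q_i(t) + a_i(t) / x_i(t) * (k_i(t) - q_i(t))`. -/
noncomputable def lossEst (t : ℕ) (i : Fin d) : ℝ :=
  q t i + (a t i : ℝ) / x t i * (avgLoss (a t) (l t) i - q t i)

/-- The regularization parameter `β_i(t)`. -/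
noncomputable def beta (t : ℕ) (i : Fin d) : ℝ :=
  √((1 + ε i / maxPlays A i) ^ 2 +
    1 / Real.log T * ∑ s ∈ Finset.range t,
      ((a s i : ℝ) / maxPlays A i) ^ 2 * (avgLoss (a s) (l s) i - q s i) ^ 2 *
        min 1 (2 * (1 - x s i / maxPlays A i) / ((x s i / maxPlays A i) ^ 2 * Real.log T)))

/-- The log-barrier plus entropy function
`φ(z) = n (z/n - 1 - log (z/n) + log T * (z/n + (1 - z/n) log (1 - z/n)))` for `0 < z ≤ n`. -/
noncomputable def phi (n T : ℕ) (z : ℝ) : ℝ :=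
  n * (z / n - 1 - Real.log (z / n) +
    Real.log T * (z / n + (1 - z / n) * Real.log (1 - z / n)))

/-- `X = conv(A)`, restricted to the domain `{x | ∀ i, 0 < x_i}` of the log-barrier (which is `+∞`
where some coordinate vanishes). -/
def feasible (A : Finset (Fin d → ℕ)) : Set (Fin d → ℝ) :=
  convexHull ℝ ((fun b : Fin d → ℕ => fun i => (b i : ℝ)) '' (A : Set (Fin d → ℕ))) ∩
    {z | ∀ i, 0 < z i}

/-- The objective `⟨q(t) + ∑_{s<t} ℓ̂(s), z⟩ + ∑_i β_i(t) φ_i(z_i)` minimized in round `t`. -/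
noncomputable def objective (t : ℕ) (z : Fin d → ℝ) : ℝ :=
  ∑ i, (q t i + ∑ s ∈ Finset.range t, lossEst q a l x s i) * z i +
    ∑ i, beta q ε T a l x t i * phi (maxPlays A i) T (z i)

end Algorithm

/-! ### Random runs and regret -/

/-- The σ-algebra generated by the actions and losses of the rounds before `t`. -/
abbrev history {d : ℕ} {A : Finset (Fin d → ℕ)} {Ω : Type*}
    (a : ℕ → Ω → Fin d → ℕ) (l : ℕ → Ω → LossArray A) (t : ℕ) : MeasurableSpace Ω :=
  ⨆ s ∈ Finset.range t, MeasurableSpace.comap (fun ω => (a s ω, l s ω)) inferInstance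

/-- The processes `a` (actions), `l` (losses), `x` (points of `conv(A)`) form a run, with horizon
`T`, of GenLBINFV with hyperparameters `ε` and prediction rule `pred` on the stochastic instance
`I`. Losses of different arms in the same round are not required to be independent. -/
structure IsRun {d : ℕ} (I : Instance d) (pred : Prediction I.A) (ε : Fin d → ℝ) (T : ℕ)
    {Ω : Type*} [MeasurableSpace Ω] (μ : Measure Ω)
    (a : ℕ → Ω → Fin d → ℕ) (l : ℕ → Ω → LossArray I.A) (x : ℕ → Ω → Fin d → ℝ) : Prop where
  measurable_a : ∀ t, Measurable (a t)
  measurable_l : ∀ t, Measurable (l t)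
  /-- every `L_{i,j}(t)` has law `D_i` -/
  law : ∀ t < T, ∀ i j, μ.map (fun ω => l t ω i j) = I.D i
  /-- the `n_i` losses of one arm in one round are independent -/
  indep_samples : ∀ t < T, ∀ i, iIndepFun (fun j ω => l t ω i j) μ
  /-- the losses of round `t` are independent of the past and of the action of round `t` -/
  indep_rounds : ∀ t < T,
    Indep (MeasurableSpace.comap (l t) inferInstance)
      (history a l t ⊔ MeasurableSpace.comap (a t) inferInstance) μ
  /-- `x(t)` is the OFTRL point -/
  oftrl : ∀ t < T, ∀ᵐ ω ∂μ, x t ω ∈ feasible I.A ∧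
    IsMinOn (objective (pred (fun s => a s ω) (fun s => l s ω)) ε T
      (fun s => a s ω) (fun s => l s ω) (fun s => x s ω) t) (feasible I.A) (x t ω)
  /-- the action is sampled from `A`, with conditional mean `x(t)` -/
  mem : ∀ t < T, ∀ᵐ ω ∂μ, a t ω ∈ I.A
  sampling : ∀ t < T, ∀ i, μ[fun ω => (a t ω i : ℝ) | history a l t] =ᵐ[μ] fun ω => x t ω i

/-- The regret `R_T = E[∑_t (f(a(t), L(t)) - f(a*, L(t)))]`. -/
noncomputable def regret {d : ℕ} (I : Instance d) (T : ℕ) {Ω : Type*} [MeasurableSpace Ω]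
    (μ : Measure Ω) (a : ℕ → Ω → Fin d → ℕ) (l : ℕ → Ω → LossArray I.A) : ℝ :=
  ∫ ω, ∑ t ∈ Finset.range T, (linLoss (a t ω) (l t ω) - linLoss I.aStar (l t ω)) ∂μ

end MPCSB

/-!
The algorithm is an optimistic follow-the-regularized-leader scheme. Along one sample path, its
estimated regret against a fixed point `u` telescopes into a potential difference of order
`W log T` and a sum of one-round costs (`stepCost`). The Bregman divergence of the regularizer
splits into a log-barrier and an entropy part, and the Fenchel–Young inequalities of both
(`barrierDiv_conj`, `entropyDiv_conj`, combined in `stability_le`) bound the cost of a round by the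
growth of the regularization parameters, `log T · ∑ n_i (β_i(t+1) - β_i(t))` up to a constant
(`IsPath.stepCost_le`). For an arm with `a*_i = 0` the final value of `β_i` is governed by the
squared prediction errors. These are of the order of the variances, by a potential argument for
either prediction rule (`RegularRun.sum_sq_le_of_lsPred`, `RegularRun.sum_sq_le_of_gdPred`), so that
the growth is at most a constant times `√(σ_i² P_i log T)` with `P_i` the expected number of plays,
plus a multiple of `n_i log T`. Since `∑_{i ∈ J*} Δ_i z_i ≤ λ ⟨ℓ, z - a*⟩` on `conv(A)`
(`Instance.sum_Delta_mul_le`), the inequality between the arithmetic and the geometric mean turns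
this into `∑ λ σ_i² / Δ_i log T` plus a small multiple of the regret itself. For an arm with
`a*_i = n_i` the growth is bounded by the distance to `a*` divided by `√(log T)`, and hence
negligible, by `RegularRun.integral_mul_alpha_le`.

This leaves the arms with `0 < a*_i < n_i`, for which the growth of `β_i` is not controlled by
the distance to `a*` and would exceed the claimed bound. Here the rounds are grouped
into blocks of a length `B` that depends on the instance, and a whole block is compared with a single
step of the algorithm (`sum_stepCost_block`, `IsPath.sum_stepCost_good_block`). In a block that
starts close to `a*`, the loss estimates of these arms are bounded, so that their errors are
martingale differences whose sum is only of order `√B` (`RegularRun.integral_mul_abs_sum_noise_le`);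
it enters multiplied by the distance to `a*`. What is left of the cost of the block telescopes
(`driftTerm`) or has mean zero (`noiseTerm`). Averaging over all positions of the blocks, the
distance appears with a factor `B^(-1/2)`. The distance is at most a constant of the instance times
the excess loss (`Instance.exists_optDist_le`), so a large `B` allows it to be absorbed into the
regret.

The argument requires the end point of a block to be close to `a*` whenever it is close to the face
of `conv(A)` on which the extremal arms (`a*_i ∈ {0, n_i}`) are played as by `a*`. This holds as soon
as the estimated losses identify `a*` within this face (`IsPath.optDist_le_faceDist`). The rounds in
which they do not (`tieInd`) number `O(log T)` plus a multiple of the regret, by Chebyshev's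
inequality. They, the blocks with a play of an arm outside `a*`, and the blocks that start far from
`a*` cost only `O(1 / √(log T))` each in expectation (`IsPath.sum_stepCost_block_le`,
`RegularRun.integral_far_alphaSum_le`), so that their total is absorbed for large `T`.
-/

open MeasureTheory ProbabilityTheory

namespace MPCSB

set_option linter.unusedSectionVars false

/-! ### Scalar divergences -/

/-- The Bregman divergence of `-log`, as a function of the ratio of its arguments. -/
noncomputable def barrierDiv (r : ℝ) : ℝ := r - 1 - Real.log r

/-- The Bregman divergence from `w` to `v` of `z ↦ z + (1 - z) log (1 - z)`. -/
noncomputable def entropyDiv (v w : ℝ) : ℝ :=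
  (1 - v) * Real.log ((1 - v) / (1 - w)) + (v - w)

/-- The Bregman divergence of the regularizer `phi` in normalized coordinates, with weight `L` on
its entropy part. -/
noncomputable def regDiv (L v w : ℝ) : ℝ := barrierDiv (v / w) + L * entropyDiv v w

lemma barrierDiv_nonneg {r : ℝ} (hr : 0 < r) : 0 ≤ barrierDiv r := by
  have := Real.log_le_sub_one_of_pos hr
  unfold barrierDiv; linarith

/-- Fenchel–Young inequality for the log-barrier. -/
lemma barrierDiv_conj {r b g : ℝ} (hr : 0 < r) (hb : 0 < b) (hbg : 0 < b + g) :
    g * (1 - r) ≤ b * barrierDiv r + g ^ 2 / (b + g) := by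
  have h1 := Real.log_le_sub_one_of_pos (x := (b + g) / b * r) (by positivity)
  rw [Real.log_mul (by positivity) hr.ne'] at h1
  have h2 := Real.one_sub_inv_le_log_of_pos (x := (b + g) / b) (by positivity)
  have h3 : b * Real.log r ≤ (b + g) * r - b - b * (1 - ((b + g) / b)⁻¹) := by
    calc b * Real.log r ≤ b * ((b + g) / b * r - 1 - (1 - ((b + g) / b)⁻¹)) := by
          apply mul_le_mul_of_nonneg_left _ hb.le; linarith
      _ = _ := by field_simp
  have h4 : b * (1 - ((b + g) / b)⁻¹) = g - g ^ 2 / (b + g) := by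
    field_simp; ring
  unfold barrierDiv
  nlinarith

/-- Fenchel–Young inequality for the entropy part. -/
lemma entropyDiv_conj {v w : ℝ} (hv : v ≤ 1) (hw : w < 1) (h : ℝ) :
    h * (w - v) ≤ entropyDiv v w + (1 - w) * (Real.exp h - 1 - h) := by
  unfold entropyDiv
  rcases hv.eq_or_lt with rfl | hv
  · have := Real.exp_pos h
    simp only [sub_self, zero_mul]
    nlinarith [mul_pos (sub_pos.2 hw) this]
  · have hs : 0 < 1 - v := by linarith
    have hp : 0 < 1 - w := by linarith
    have h1 := Real.log_le_sub_one_of_pos (x := (1 - w) / (1 - v) * Real.exp h) (by positivity)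
    rw [Real.log_mul (by positivity) (by positivity), Real.log_exp,
      ← neg_neg (Real.log ((1 - w) / (1 - v))), ← Real.log_inv, inv_div] at h1
    have h2 := mul_le_mul_of_nonneg_left h1 hs.le
    have h3 : (1 - v) * ((1 - w) / (1 - v) * Real.exp h - 1) = (1 - w) * Real.exp h - (1 - v) := by
      field_simp
    rw [h3] at h2
    nlinarith

lemma entropyDiv_self_one : entropyDiv 1 1 = 0 := by simp [entropyDiv]

lemma entropyDiv_nonneg {v w : ℝ} (hv : v ≤ 1) (hw : w ≤ 1) (h1 : w = 1 → v = 1) :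
    0 ≤ entropyDiv v w := by
  rcases hw.eq_or_lt with rfl | hw
  · rw [h1 rfl, entropyDiv_self_one]
  · simpa using entropyDiv_conj hv hw 0

lemma exp_sub_le_sq {h : ℝ} (hh : |h| ≤ 1) : Real.exp h - 1 - h ≤ h ^ 2 :=
  (le_abs_self _).trans (Real.abs_exp_sub_one_sub_id_le hh)

lemma exp_sub_nonneg (h : ℝ) : 0 ≤ Real.exp h - 1 - h := by
  have := Real.add_one_le_exp h
  linarith

lemma sq_le_entropyDiv {v w : ℝ} (hv0 : 0 ≤ v) (hv : v ≤ 1) (hw0 : 0 ≤ w) (hw : w ≤ 1)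
    (h1 : w = 1 → v = 1) : (w - v) ^ 2 / 4 ≤ entropyDiv v w := by
  rcases hw.eq_or_lt with rfl | hw
  · rw [h1 rfl, entropyDiv_self_one]; norm_num
  · have h2 := entropyDiv_conj hv hw ((w - v) / 2)
    have h3 : |(w - v) / 2| ≤ 1 := by
      rw [abs_le]; constructor <;> linarith
    have h4 := exp_sub_le_sq h3
    have h5 := exp_sub_nonneg ((w - v) / 2)
    nlinarith

/-- The mass `1 - v` exceeds `2 (1 - w)` only at the cost of the entropy divergence. -/
lemma one_sub_le_entropyDiv {v w : ℝ} (hv : v ≤ 1) (hw : w ≤ 1) (h1 : w = 1 → v = 1) :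
    1 - v ≤ entropyDiv v w + 2 * (1 - w) := by
  rcases hw.eq_or_lt with rfl | hw
  · rw [h1 rfl, entropyDiv_self_one]; norm_num
  · have h2 := entropyDiv_conj hv hw 1
    have h3 : Real.exp 1 - 1 - 1 ≤ 1 := by
      have := Real.exp_one_lt_d9; norm_num at this ⊢; linarith
    nlinarith

lemma regDiv_nonneg {L v w : ℝ} (hL : 0 ≤ L) (hv0 : 0 < v) (hv : v ≤ 1) (hw0 : 0 < w)
    (hw : w ≤ 1) (h1 : w = 1 → v = 1) : 0 ≤ regDiv L v w :=
  add_nonneg (barrierDiv_nonneg (by positivity)) (mul_nonneg hL (entropyDiv_nonneg hv hw h1))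

/-- A small log-barrier divergence forces a ratio close to `1`. -/
lemma abs_one_sub_le_of_barrierDiv {r θ : ℝ} (hr : 0 < r) (hθ : 0 < θ) (hθ2 : θ ≤ 1 / 2)
    (h : barrierDiv r ≤ θ ^ 2) : |1 - r| ≤ 3 * θ := by
  have key : ∀ g : ℝ, |g| = θ → g * (1 - r) ≤ 3 * θ ^ 2 := by
    intro g hg
    have hg' : -θ ≤ g := hg ▸ neg_abs_le g
    have h1 := barrierDiv_conj hr one_pos (g := g) (by linarith)
    have h2 : g ^ 2 / (1 + g) ≤ 2 * θ ^ 2 := by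
      rw [← sq_abs, hg, div_le_iff₀ (by linarith)]
      nlinarith [sq_nonneg θ]
    linarith
  have h1 := key θ (abs_of_pos hθ)
  have h2 := key (-θ) (by rw [abs_neg, abs_of_pos hθ])
  rw [abs_le]
  constructor
  · by_contra hc
    push Not at hc
    nlinarith
  · by_contra hc
    push Not at hc
    nlinarith

/-- The stability of one coordinate. The log-barrier alone gives the bound with `1` in place of the
minimum, which suffices where `w L ≤ 1`; where `1 ≤ w L` the entropy part gives the other one. -/
lemma stability_le {ρ g b L w v : ℝ} (hρ : 0 < ρ) (hg : |g| ≤ 1) (hb : 1 + ρ ≤ b) (hL : 2 ≤ L)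
    (hw0 : 0 < w) (hw : w ≤ 1) (hv0 : 0 < v) (hv : v ≤ 1) (h1 : w = 1 → v = 1) :
    g / w * (w - v) - b * regDiv L v w ≤
      (1 + ρ) / ρ * (g ^ 2 * min 1 (2 * (1 - w) / (w ^ 2 * L))) / b := by
  have hb0 : 0 < b := by linarith
  have hg1 := abs_le.1 hg
  have e1 : 0 ≤ entropyDiv v w := entropyDiv_nonneg hv hw h1
  have e2 : 0 ≤ barrierDiv (v / w) := barrierDiv_nonneg (by positivity)
  have hρ1 : 1 ≤ (1 + ρ) / ρ := by rw [le_div_iff₀ hρ]; linarith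
  have hA : g / w * (w - v) - b * regDiv L v w ≤ (1 + ρ) / ρ * g ^ 2 / b := by
    have h2 := barrierDiv_conj (r := v / w) (b := b) (g := g) (by positivity) hb0 (by linarith)
    have h3 : g * (1 - v / w) = g / w * (w - v) := by field_simp
    have h4 : g ^ 2 / (b + g) ≤ (1 + ρ) / ρ * g ^ 2 / b := by
      rw [div_le_div_iff₀ (by linarith) hb0, div_mul_eq_mul_div, div_mul_eq_mul_div,
        le_div_iff₀ hρ]
      have : b * ρ ≤ (1 + ρ) * (b + g) := by nlinarith
      nlinarith [sq_nonneg g]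
    unfold regDiv
    have : 0 ≤ b * (L * entropyDiv v w) := by positivity
    linarith
  rcases le_total (w * L) 1 with hwL | hwL
  · have : min 1 (2 * (1 - w) / (w ^ 2 * L)) = 1 := by
      apply min_eq_left
      rw [le_div_iff₀ (by positivity)]
      nlinarith
    rw [this, mul_one]; exact hA
  · have hB : g / w * (w - v) - b * regDiv L v w ≤
        (1 + ρ) / ρ * (g ^ 2 * (2 * (1 - w) / (w ^ 2 * L))) / b := by
      rcases hw.eq_or_lt with rfl | hw
      · rw [h1 rfl]
        simp [regDiv, barrierDiv, entropyDiv]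
      · have hp : 0 < 1 - w := by linarith
        -- the slope at which `b L` times the entropy divergence is conjugate to `g / w`
        set h := g / (w * b * L) with hh
        have h2 := entropyDiv_conj hv hw h
        have h3 : |h| ≤ 1 := by
          rw [hh, abs_div, abs_of_pos (a := w * b * L) (by positivity),
            div_le_one (by positivity)]
          nlinarith
        have h4 := exp_sub_le_sq h3
        have h5 : h * (w - v) ≤ entropyDiv v w + (1 - w) * h ^ 2 := by nlinarith
        have h6 := mul_le_mul_of_nonneg_left h5 (show 0 ≤ b * L by positivity)
        have h7 : b * L * (h * (w - v)) = g / w * (w - v) := by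
          rw [hh]; field_simp
        have h8 : b * L * ((1 - w) * h ^ 2) = g ^ 2 * ((1 - w) / (w ^ 2 * L)) / b := by
          rw [hh]; field_simp
        have h9 : g ^ 2 * ((1 - w) / (w ^ 2 * L)) / b ≤
            (1 + ρ) / ρ * (g ^ 2 * (2 * (1 - w) / (w ^ 2 * L))) / b := by
          apply div_le_div_of_nonneg_right _ hb0.le
          have hX : 0 ≤ g ^ 2 * ((1 - w) / (w ^ 2 * L)) := by positivity
          have : g ^ 2 * (2 * (1 - w) / (w ^ 2 * L)) = 2 * (g ^ 2 * ((1 - w) / (w ^ 2 * L))) := by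
            ring
          rw [this]; nlinarith
        unfold regDiv
        nlinarith [mul_nonneg hb0.le e2]
    rcases le_total 1 (2 * (1 - w) / (w ^ 2 * L)) with hm | hm
    · rw [min_eq_left hm, mul_one]; exact hA
    · rw [min_eq_right hm]; exact hB

/-! ### The regularizer -/

/-- The derivative of `phi`. -/
noncomputable def phiDeriv (n T : ℕ) (z : ℝ) : ℝ :=
  1 - (z / n)⁻¹ - Real.log T * Real.log (1 - z / n)

/-- `phi` minus its tangent is the divergence `regDiv`. -/
lemma phi_sub_tangent {n T : ℕ} (hn : 1 ≤ n) {x y : ℝ} (hx0 : 0 < x) (hx : x < n) (hy0 : 0 < y)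
    (hy : y ≤ n) :
    phi n T y - phi n T x - phiDeriv n T x * (y - x) =
      n * regDiv (Real.log T) (y / n) (x / n) := by
  have hn0 : (0 : ℝ) < n := by exact_mod_cast hn
  have hw : 0 < x / n := by positivity
  have hv : 0 < y / n := by positivity
  have hw1 : 0 < 1 - x / n := by rw [sub_pos, div_lt_one hn0]; exact hx
  have hv1 : 0 ≤ 1 - y / n := by rw [sub_nonneg, div_le_one hn0]; exact hy
  have hxn : y - x = n * (y / n - x / n) := by field_simp
  unfold phi phiDeriv regDiv barrierDiv entropyDiv
  rw [hxn, Real.log_div hv.ne' hw.ne']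
  rcases hv1.eq_or_lt with h0 | h0
  · rw [← h0]; simp only [zero_mul]
    have hv' : y / n = 1 := by linarith
    rw [hv']; field_simp; ring
  · rw [Real.log_div h0.ne' hw1.ne']
    field_simp; ring

lemma phi_nonneg {n T : ℕ} (hn : 1 ≤ n) {x : ℝ} (hx0 : 0 < x) (hx : x ≤ n) : 0 ≤ phi n T x := by
  have hn0 : (0 : ℝ) < n := by exact_mod_cast hn
  have hw : 0 < x / n := by positivity
  have hw1 : x / n ≤ 1 := by rw [div_le_one hn0]; exact hx
  have h1 := barrierDiv_nonneg hw
  have h2 := entropyDiv_nonneg hw1 zero_le_one (by norm_num)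
  have h3 := Real.log_natCast_nonneg T
  unfold phi
  unfold barrierDiv at h1
  unfold entropyDiv at h2
  simp only [sub_zero, div_one] at h2
  apply mul_nonneg hn0.le
  have := mul_nonneg h3 h2
  nlinarith

/-- An upper bound on `phi` away from `0`. -/
lemma phi_le {n T : ℕ} (hn : 1 ≤ n) {x c : ℝ} (hc : 0 < c) (hcx : c ≤ x / n) (hx : x ≤ n) :
    phi n T x ≤ n * (- Real.log c + Real.log T) := by
  have hn0 : (0 : ℝ) < n := by exact_mod_cast hn
  have hw1 : x / n ≤ 1 := by rw [div_le_one hn0]; exact hx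
  have h3 := Real.log_natCast_nonneg T
  unfold phi
  apply mul_le_mul_of_nonneg_left _ hn0.le
  have h4 : Real.log c ≤ Real.log (x / n) := Real.log_le_log hc hcx
  have h5 : (1 - x / n) * Real.log (1 - x / n) ≤ 0 := by
    apply Real.mul_log_nonpos <;> linarith
  have : Real.log T * (x / n + (1 - x / n) * Real.log (1 - x / n)) ≤ Real.log T * 1 := by
    apply mul_le_mul_of_nonneg_left _ h3; linarith
  linarith

lemma phi_sub_le_of_tangent {n T : ℕ} (hn : 1 ≤ n) {x y : ℝ} (hx0 : 0 < x) (hx : x < n)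
    (hy0 : 0 < y) (hy : y ≤ n) : phi n T x - phi n T y ≤ phiDeriv n T x * (x - y) := by
  have hn0 : (0 : ℝ) < n := by exact_mod_cast hn
  have h1 := phi_sub_tangent (T := T) hn hx0 hx hy0 hy
  have h2 := regDiv_nonneg (L := Real.log T) (v := y / n) (w := x / n)
    (Real.log_natCast_nonneg T) (by positivity) (by rw [div_le_one hn0]; exact hy)
    (by positivity) (by rw [div_le_one hn0]; exact hx.le)
    (fun h => absurd h (by rw [div_eq_one_iff_eq hn0.ne']; exact hx.ne))
  nlinarith [mul_nonneg hn0.le h2]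

/-- `phi` is Lipschitz away from `0` and `n`, with a constant proportional to `log T`. -/
lemma phi_sub_le_mul_abs {n T : ℕ} (hn : 1 ≤ n) {x y c : ℝ} (hc : 0 < c)
    (hL : 1 ≤ Real.log T) (hx : x ∈ Set.Icc c (n - c)) (hy0 : 0 < y) (hy : y ≤ n) :
    phi n T x - phi n T y ≤ 2 * (n / c) * Real.log T * |x - y| := by
  obtain ⟨h1, h2⟩ := hx
  have hn0 : (0 : ℝ) < n := by exact_mod_cast hn
  have hx0 : 0 < x := hc.trans_le h1
  have hcn : c ≤ n := by linarith
  refine (phi_sub_le_of_tangent hn hx0 (by linarith) hy0 hy).trans ?_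
  refine (le_abs_self _).trans ?_
  rw [abs_mul]
  apply mul_le_mul_of_nonneg_right _ (abs_nonneg _)
  have hnc : 1 ≤ n / c := by rw [le_div_iff₀ hc]; linarith
  have e1 : (x / n)⁻¹ ≤ n / c := by
    rw [inv_div]; exact div_le_div_of_nonneg_left hn0.le hc h1
  have e1' : 1 ≤ (x / n)⁻¹ := by
    rw [inv_div, le_div_iff₀ hx0]; linarith
  have hp : c / n ≤ 1 - x / n := by
    have : c / n + x / n ≤ 1 := by rw [← add_div, div_le_one hn0]; linarith
    linarith
  have hp1 : 1 - x / n ≤ 1 := by linarith [div_pos hx0 hn0]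
  have hp0 : 0 < 1 - x / n := (div_pos hc hn0).trans_le hp
  have e2 : Real.log (1 - x / n) ≤ 0 := Real.log_nonpos hp0.le hp1
  have e3 : -(n / c) ≤ Real.log (1 - x / n) := by
    have := Real.one_sub_inv_le_log_of_pos hp0
    have h5 : (1 - x / n)⁻¹ ≤ n / c := by
      rw [← inv_div c]; exact inv_anti₀ (by positivity) hp
    linarith
  unfold phiDeriv
  rw [abs_le]
  constructor <;> nlinarith

/-! ### Optimality of the regularized minimizer -/

section Optimality

open Filter Topology

variable {ι : Type*} [Fintype ι] {S : Set (ι → ℝ)} {n : ι → ℕ} {T : ℕ} {G b : ι → ℝ}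
  {x y : ι → ℝ}

/-- The divergence to a point in the interior of the segment from the minimizer `x` to `y`. All
coordinates of such a point at which the regularizer is not differentiable are constant along the
segment. -/
lemma sum_regDiv_lineMap_le (hS : Convex ℝ S) (hn : ∀ i, 1 ≤ n i)
    (hSb : ∀ z ∈ S, ∀ i, 0 < z i ∧ z i ≤ n i) (hb : ∀ i, 0 < b i) (hx : x ∈ S) (hy : y ∈ S)
    (hmin : ∀ z ∈ S, ∑ i, G i * x i + ∑ i, b i * phi (n i) T (x i) ≤
      ∑ i, G i * z i + ∑ i, b i * phi (n i) T (z i)) {θ : ℝ} (h0 : 0 < θ) (h1 : θ < 1) :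
    ∑ i, b i * (n i * regDiv (Real.log T) (y i / n i) ((x i + θ * (y i - x i)) / n i)) ≤
      (∑ i, G i * y i + ∑ i, b i * phi (n i) T (y i)) -
        (∑ i, G i * x i + ∑ i, b i * phi (n i) T (x i)) := by
  set z : ι → ℝ := fun i => x i + θ * (y i - x i) with hz
  have hzS : z ∈ S := by
    have := hS hx hy (a := 1 - θ) (b := θ) (by linarith) h0.le (by ring)
    convert this using 1
    ext i; simp [hz]; ring
  have hL := Real.log_natCast_nonneg T
  have key : ∀ i, θ * (n i * regDiv (Real.log T) (y i / n i) (z i / n i)) ≤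
      θ * (phi (n i) T (y i) - phi (n i) T (z i)) +
        (1 - θ) * (phi (n i) T (x i) - phi (n i) T (z i)) := by
    intro i
    have hn0 : (0 : ℝ) < n i := by exact_mod_cast hn i
    obtain ⟨hx0, hxn⟩ := hSb x hx i
    obtain ⟨hy0, hyn⟩ := hSb y hy i
    obtain ⟨hz0, hzn⟩ := hSb z hzS i
    have hzi : z i = x i + θ * (y i - x i) := rfl
    rcases hzn.eq_or_lt with he | hlt
    · have hxe : x i = n i := by nlinarith
      have hye : y i = n i := by nlinarith
      rw [he, hxe, hye, div_self hn0.ne']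
      simp [regDiv, barrierDiv, entropyDiv]
    · have e1 := phi_sub_tangent (T := T) (hn i) hz0 hlt hy0 hyn
      have e2 := phi_sub_tangent (T := T) (hn i) hz0 hlt hx0 hxn
      have e3 : 0 ≤ regDiv (Real.log T) (x i / n i) (z i / n i) := by
        apply regDiv_nonneg hL (by positivity) (by rwa [div_le_one hn0]) (by positivity)
          (by rwa [div_le_one hn0])
        intro h
        rw [div_eq_one_iff_eq hn0.ne'] at h
        exact absurd h hlt.ne
      have e4 : y i - z i = (1 - θ) * (y i - x i) := by rw [hzi]; ring
      have e5 : x i - z i = - θ * (y i - x i) := by rw [hzi]; ring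
      have e6 : 0 ≤ (1 - θ) * (n i * regDiv (Real.log T) (x i / n i) (z i / n i)) := by
        have : 0 ≤ 1 - θ := by linarith
        positivity
      rw [← e2, e5] at e6
      rw [← e1, e4]
      nlinarith
  have hsum : θ * ∑ i, b i * (n i * regDiv (Real.log T) (y i / n i) (z i / n i)) ≤
      θ * (∑ i, b i * phi (n i) T (y i) - ∑ i, b i * phi (n i) T (z i)) +
        (1 - θ) * (∑ i, b i * phi (n i) T (x i) - ∑ i, b i * phi (n i) T (z i)) := by
    simp only [Finset.mul_sum, ← Finset.sum_sub_distrib, ← Finset.sum_add_distrib]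
    apply Finset.sum_le_sum
    intro i _
    have := mul_le_mul_of_nonneg_left (key i) (hb i).le
    nlinarith
  have hlin : ∑ i, G i * z i = (1 - θ) * ∑ i, G i * x i + θ * ∑ i, G i * y i := by
    simp only [Finset.mul_sum, ← Finset.sum_add_distrib]
    refine Finset.sum_congr rfl fun i _ => ?_
    simp only [hz]; ring
  have hm := hmin z hzS
  set Fx := ∑ i, b i * phi (n i) T (x i)
  set Fy := ∑ i, b i * phi (n i) T (y i)
  set Fz := ∑ i, b i * phi (n i) T (z i)
  set Dv := ∑ i, b i * (n i * regDiv (Real.log T) (y i / n i) (z i / n i))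
  have h3 : θ * Dv ≤ θ * ((∑ i, G i * y i + Fy) - (∑ i, G i * x i + Fx)) := by nlinarith
  exact le_of_mul_le_mul_left h3 h0

/-- The regularizer has infinite slope where a coordinate equals its maximum `n i`, so that a
minimizer attains such a value only if the coordinate is constant. -/
lemma eq_of_minimizer_eq (hS : Convex ℝ S) (hn : ∀ i, 1 ≤ n i) (hT : 0 < Real.log T)
    (hSb : ∀ z ∈ S, ∀ i, 0 < z i ∧ z i ≤ n i) (hb : ∀ i, 0 < b i) (hx : x ∈ S) (hy : y ∈ S)
    (hmin : ∀ z ∈ S, ∑ i, G i * x i + ∑ i, b i * phi (n i) T (x i) ≤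
      ∑ i, G i * z i + ∑ i, b i * phi (n i) T (z i)) {i : ι} (hi : x i = n i) : y i = n i := by
  by_contra hne
  have hn0 : (0 : ℝ) < n i := by exact_mod_cast hn i
  have hyn : y i < n i := lt_of_le_of_ne (hSb y hy i).2 hne
  set s := 1 - y i / n i with hs
  have hs0 : 0 < s := by rw [hs, sub_pos, div_lt_one hn0]; exact hyn
  set Cst := (∑ i, G i * y i + ∑ i, b i * phi (n i) T (y i)) -
        (∑ i, G i * x i + ∑ i, b i * phi (n i) T (x i)) with hC
  have key : ∀ θ : ℝ, 0 < θ → θ < 1 →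
      b i * n i * (Real.log T * (s * (- Real.log θ) - s)) ≤ Cst := by
    intro θ h0 h1
    refine le_trans ?_ (sum_regDiv_lineMap_le hS hn hSb hb hx hy hmin h0 h1)
    have hzS : (fun k => x k + θ * (y k - x k)) ∈ S := by
      have := hS hx hy (a := 1 - θ) (b := θ) (by linarith) h0.le (by ring)
      convert this using 1
      ext i; simp; ring
    have hnn : ∀ k, 0 ≤ b k *
        (n k * regDiv (Real.log T) (y k / n k) ((x k + θ * (y k - x k)) / n k)) := by
      intro k
      have hk0 : (0 : ℝ) < n k := by exact_mod_cast hn k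
      obtain ⟨hx0, hxn⟩ := hSb x hx k
      obtain ⟨hy0, hyn⟩ := hSb y hy k
      obtain ⟨hz0, hzn⟩ := hSb _ hzS k
      refine mul_nonneg (hb k).le (mul_nonneg hk0.le (regDiv_nonneg hT.le (by positivity)
        (by rwa [div_le_one hk0]) (by positivity) (by rwa [div_le_one hk0]) ?_))
      intro h
      rw [div_eq_one_iff_eq hk0.ne'] at h ⊢
      nlinarith
    refine le_trans ?_ (Finset.single_le_sum (fun k _ => hnn k) (Finset.mem_univ i))
    rw [mul_assoc]
    apply mul_le_mul_of_nonneg_left _ (hb i).le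
    apply mul_le_mul_of_nonneg_left _ hn0.le
    have hw : (x i + θ * (y i - x i)) / n i = 1 - θ * s := by
      rw [hi, hs]; field_simp; ring
    rw [hw]
    have hw0 : 0 < 1 - θ * s := by
      have : s < 1 := by
        rw [hs]; linarith [div_pos (hSb y hy i).1 hn0]
      nlinarith
    have hv : y i / n i = 1 - s := by rw [hs]; ring
    have e1 := barrierDiv_nonneg (r := y i / n i / (1 - θ * s))
      (div_pos (div_pos (hSb y hy i).1 hn0) hw0)
    unfold regDiv
    have e2 : entropyDiv (y i / n i) (1 - θ * s) = s * (- Real.log θ) + (θ * s - s) := by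
      unfold entropyDiv
      rw [hv]
      have : (1 - (1 - s)) / (1 - (1 - θ * s)) = θ⁻¹ := by
        rw [sub_sub_cancel, sub_sub_cancel]; field_simp
      rw [this, Real.log_inv]; ring
    rw [e2]
    have : 0 ≤ Real.log T * (θ * s) := by positivity
    nlinarith
  have hbn : 0 < b i * n i * (Real.log T * s) := by have := hb i; positivity
  set K := (|Cst| + 1) / (b i * n i * (Real.log T * s)) + 1 with hK
  have hK0 : 0 < K := by positivity
  have h1 := key (Real.exp (-K)) (Real.exp_pos _) (by rw [Real.exp_lt_one_iff]; linarith)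
  rw [Real.log_exp, neg_neg] at h1
  have h2 : b i * n i * (Real.log T * (s * K - s)) = |Cst| + 1 := by
    rw [hK]
    have := hb i
    field_simp; ring
  rw [h2] at h1
  linarith [le_abs_self Cst]

/-- A minimizer of the regularized objective is optimal with the margin of a Bregman divergence. -/
lemma sum_regDiv_le_of_minimizer (hS : Convex ℝ S) (hn : ∀ i, 1 ≤ n i) (hT : 0 < Real.log T)
    (hSb : ∀ z ∈ S, ∀ i, 0 < z i ∧ z i ≤ n i) (hb : ∀ i, 0 < b i) (hx : x ∈ S) (hy : y ∈ S)
    (hmin : ∀ z ∈ S, ∑ i, G i * x i + ∑ i, b i * phi (n i) T (x i) ≤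
      ∑ i, G i * z i + ∑ i, b i * phi (n i) T (z i)) :
    ∑ i, b i * (n i * regDiv (Real.log T) (y i / n i) (x i / n i)) ≤
      (∑ i, G i * y i + ∑ i, b i * phi (n i) T (y i)) -
        (∑ i, G i * x i + ∑ i, b i * phi (n i) T (x i)) := by
  have hlim : Tendsto (fun θ : ℝ => ∑ i, b i * (n i * regDiv (Real.log T) (y i / n i)
      ((x i + θ * (y i - x i)) / n i))) (𝓝[>] 0)
      (𝓝 (∑ i, b i * (n i * regDiv (Real.log T) (y i / n i) (x i / n i)))) := by
    apply tendsto_finsetSum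
    intro i _
    have hn0 : (0 : ℝ) < n i := by exact_mod_cast hn i
    obtain ⟨hx0, hxn⟩ := hSb x hx i
    obtain ⟨hy0, hyn⟩ := hSb y hy i
    rcases hxn.eq_or_lt with he | hlt
    · have hye := eq_of_minimizer_eq hS hn hT hSb hb hx hy hmin he
      simp only [hye, he, sub_self, mul_zero, add_zero]
      exact tendsto_const_nhds
    · have hw0 : x i / n i ≠ 0 := by positivity
      have hw1 : 1 - x i / n i ≠ 0 := by
        have : x i / n i < 1 := by rwa [div_lt_one hn0]
        linarith
      have hc : ContinuousAt (fun θ : ℝ => b i * (n i * regDiv (Real.log T) (y i / n i)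
          ((x i + θ * (y i - x i)) / n i))) 0 := by
        unfold regDiv barrierDiv entropyDiv
        rcases eq_or_ne (1 - y i / n i) 0 with h0 | h0
        · simp only [h0, zero_mul]
          have : y i / n i / ((x i + 0 * (y i - x i)) / n i) ≠ 0 := by
            simp only [zero_mul, add_zero]; positivity
          have h2 : (x i + 0 * (y i - x i)) / n i ≠ 0 := by simpa using hw0
          fun_prop (disch := assumption)
        · have : y i / n i / ((x i + 0 * (y i - x i)) / n i) ≠ 0 := by
            simp only [zero_mul, add_zero]; positivity
          have h2 : (x i + 0 * (y i - x i)) / n i ≠ 0 := by simpa using hw0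
          have h3 : 1 - (x i + 0 * (y i - x i)) / n i ≠ 0 := by simpa using hw1
          have h4 : (1 - y i / n i) / (1 - (x i + 0 * (y i - x i)) / n i) ≠ 0 :=
            div_ne_zero h0 h3
          fun_prop (disch := assumption)
      have := hc.tendsto.mono_left (nhdsWithin_le_nhds (s := Set.Ioi 0))
      simpa using this
  refine le_of_tendsto hlim ?_
  filter_upwards [Ioo_mem_nhdsGT (zero_lt_one' ℝ)] with θ hθ
  exact sum_regDiv_lineMap_le hS hn hSb hb hx hy hmin hθ.1 hθ.2

end Optimality

/-! ### Sample paths of the algorithm -/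

/-- One coordinate of the comparison of two consecutive minimizers; `g` and `q1` stem from the loss
estimate and the new prediction, `D` is the increment of the regularization parameter `b`. -/
lemma entropy_step_le {ρ L b D α g q1 w v : ℝ} (hρ : 0 < ρ) (hL : 2 ≤ L) (e2 : 1 + ρ ≤ b)
    (hD : 0 ≤ D) (e4 : L * D ≤ α / 2) (e5 : α ≤ 1) (e7 : -1 ≤ g ∧ g ≤ 1) (e8 : 0 ≤ q1)
    (e9 : q1 ≤ 1) (w0 : 0 < w) (w1 : w ≤ 1) (v0 : 0 < v) (v1 : v ≤ 1) (hwv : w = 1 → v = 1) :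
    L * entropyDiv v w ≤ b * regDiv L v w - ((g / w + q1) * (w - v) +
        D * ((w - 1 - Real.log w + L * (w + (1 - w) * Real.log (1 - w))) -
          (v - 1 - Real.log v + L * (v + (1 - v) * Real.log (1 - v))))) + (2 / ρ + 2) := by
  have hD4 : D ≤ 1 / 4 := by nlinarith
  have c1 := barrierDiv_conj (r := v / w) (b := b + D) (g := g - D) (by positivity)
    (by linarith) (by linarith)
  have c2 : (g - D) ^ 2 / (b + D + (g - D)) ≤ 2 / ρ := by
    apply div_le_div₀ (by norm_num) _ hρ (by linarith)
    have f1 := mul_nonneg hD (show 0 ≤ g + 1 by linarith)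
    have f2 : g ^ 2 ≤ 1 := by rw [sq_le_one_iff_abs_le_one, abs_le]; exact e7
    have f3 : D ^ 2 ≤ D * (1 / 4) := by rw [sq]; exact mul_le_mul_of_nonneg_left hD4 hD
    nlinarith only [f1, f2, f3, hD4]
  have c3 : (g - D) * (1 - v / w) = g / w * (w - v) - D * (1 - v / w) := by
    field_simp
  have c4 := entropyDiv_nonneg v1 w1 hwv
  have c5 := entropyDiv_nonneg v1 zero_le_one (by norm_num)
  have c6 : (1 - w) * Real.log (1 - w) ≤ 0 := by
    apply Real.mul_log_nonpos <;> linarith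
  have c7 : Real.log (v / w) = Real.log v - Real.log w := Real.log_div v0.ne' w0.ne'
  have c8 : q1 * (w - v) ≤ 1 :=
    (mul_le_mul_of_nonneg_left (by linarith) e8).trans (by linarith : q1 * 1 ≤ 1)
  have c9 : D * (w - v) ≤ 1 / 4 :=
    (mul_le_mul_of_nonneg_left (by linarith) hD).trans (by linarith : D * 1 ≤ 1 / 4)
  have c10 : D * L * ((w + (1 - w) * Real.log (1 - w)) - (v + (1 - v) * Real.log (1 - v)))
      ≤ D * L * 1 := by
    apply mul_le_mul_of_nonneg_left _ (by nlinarith)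
    unfold entropyDiv at c5
    simp only [sub_zero, div_one] at c5
    linarith
  have c11 : L * entropyDiv v w ≤ b * (L * entropyDiv v w) :=
    le_mul_of_one_le_left (mul_nonneg (by linarith) c4) (by linarith)
  have c12 : D * barrierDiv (v / w) =
      D * (v / w - 1) - D * (Real.log v - Real.log w) := by
    unfold barrierDiv; rw [c7]; ring
  have c13 : g / w * (w - v) ≤ b * barrierDiv (v / w) - D * (Real.log v - Real.log w) + 2 / ρ := by
    linarith
  unfold regDiv
  linarith

section Paths

variable {d : ℕ} {A : Finset (Fin d → ℕ)}

/-- The summand that round `t` contributes to the sum in `beta ^ 2`. -/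
noncomputable def alpha (q : ℕ → Fin d → ℝ) (T : ℕ) (a : ℕ → Fin d → ℕ) (l : ℕ → LossArray A)
    (x : ℕ → Fin d → ℝ) (t : ℕ) (i : Fin d) : ℝ :=
  ((a t i : ℝ) / maxPlays A i) ^ 2 * (avgLoss (a t) (l t) i - q t i) ^ 2 *
    min 1 (2 * (1 - x t i / maxPlays A i) / ((x t i / maxPlays A i) ^ 2 * Real.log T))

/-- The cumulative estimated loss of arm `i` over the rounds before `t`. -/
noncomputable def cumLoss (q : ℕ → Fin d → ℝ) (a : ℕ → Fin d → ℕ) (l : ℕ → LossArray A)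
    (x : ℕ → Fin d → ℝ) (t : ℕ) (i : Fin d) : ℝ :=
  ∑ s ∈ Finset.range t, lossEst q a l x s i

/-- The objective of round `t` without the prediction. -/
noncomputable def potential (q : ℕ → Fin d → ℝ) (ε : Fin d → ℝ) (T : ℕ) (a : ℕ → Fin d → ℕ)
    (l : ℕ → LossArray A) (x : ℕ → Fin d → ℝ) (t : ℕ) (z : Fin d → ℝ) : ℝ :=
  ∑ i, cumLoss q a l x t i * z i + ∑ i, beta q ε T a l x t i * phi (maxPlays A i) T (z i)

/-- The part of the estimated regret of round `t` against `u` that is not accounted for by the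
change of the potential difference between the chosen point and `u`. -/
noncomputable def stepCost (q : ℕ → Fin d → ℝ) (ε : Fin d → ℝ) (T : ℕ) (a : ℕ → Fin d → ℕ)
    (l : ℕ → LossArray A) (x : ℕ → Fin d → ℝ) (u : Fin d → ℝ) (t : ℕ) : ℝ :=
  ∑ i, lossEst q a l x t i * (x t i - u i) -
    ((potential q ε T a l x (t + 1) (x (t + 1)) - potential q ε T a l x (t + 1) u) -
      (potential q ε T a l x t (x t) - potential q ε T a l x t u))

/-- The deterministic properties of almost every sample path of a run. -/
structure IsPath (A : Finset (Fin d → ℕ)) (ρ : ℝ) (ε : Fin d → ℝ) (T : ℕ) (q : ℕ → Fin d → ℝ)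
    (a : ℕ → Fin d → ℕ) (l : ℕ → LossArray A) (x : ℕ → Fin d → ℝ) : Prop where
  rho_pos : 0 < ρ
  n_pos : ∀ i, 1 ≤ maxPlays A i
  eps : ∀ i, ρ * maxPlays A i ≤ ε i ∧ ε i ≤ maxPlays A i / 2
  two_le_log : 2 ≤ Real.log T
  x_mem : ∀ t < T, x t ∈ feasible A
  x_min : ∀ t < T, IsMinOn (objective q ε T a l x t) (feasible A) (x t)
  a_mem : ∀ t < T, a t ∈ A
  l_mem : ∀ t < T, ∀ i j, l t i j ∈ Set.Icc (0 : ℝ) 1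
  q_mem : ∀ t ≤ T, ∀ i, q t i ∈ Set.Icc (0 : ℝ) 1
  q_succ : ∀ t < T, ∀ i, a t i = 0 → q (t + 1) i = q t i

lemma le_maxPlays {a : Fin d → ℕ} (ha : a ∈ A) (i : Fin d) : a i ≤ maxPlays A i :=
  Finset.le_sup (f := fun a : Fin d → ℕ => a i) ha

lemma exists_weights {z : Fin d → ℝ}
    (hz : z ∈ convexHull ℝ ((fun b : Fin d → ℕ => fun i => (b i : ℝ)) '' (A : Set (Fin d → ℕ)))) :
    ∃ δ : (Fin d → ℕ) → ℝ, (∀ b ∈ A, 0 ≤ δ b) ∧ ∑ b ∈ A, δ b = 1 ∧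
      ∀ i, z i = ∑ b ∈ A, δ b * b i := by
  classical
  have hinj : Function.Injective (fun b : Fin d → ℕ => fun i => (b i : ℝ)) := by
    intro b c h
    ext i
    have := congrFun h i
    simpa using this
  rw [← Finset.coe_image, Finset.mem_convexHull'] at hz
  obtain ⟨w, h0, h1, h2⟩ := hz
  refine ⟨fun b => w (fun i => (b i : ℝ)), ?_, ?_, ?_⟩
  · intro b hb
    exact h0 _ (Finset.mem_image_of_mem _ hb)
  · rw [Finset.sum_image (fun b _ c _ h => hinj h)] at h1
    exact h1
  · intro i
    rw [← h2, Finset.sum_image (fun b _ c _ h => hinj h), Finset.sum_apply]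
    simp

lemma weights_mem_convexHull {z : Fin d → ℝ} {δ : (Fin d → ℕ) → ℝ} (h0 : ∀ b ∈ A, 0 ≤ δ b)
    (h1 : ∑ b ∈ A, δ b = 1) (hz : ∀ i, z i = ∑ b ∈ A, δ b * b i) :
    z ∈ convexHull ℝ ((fun b : Fin d → ℕ => fun i => (b i : ℝ)) '' (A : Set (Fin d → ℕ))) := by
  have : z = ∑ b ∈ A, δ b • (fun i => (b i : ℝ)) := by
    ext i; rw [hz, Finset.sum_apply]; simp
  rw [this]
  apply (convex_convexHull ℝ _).sum_mem h0 h1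
  intro b hb
  exact subset_convexHull _ _ (Set.mem_image_of_mem _ hb)

lemma convex_feasible : Convex ℝ (feasible A) := by
  apply (convex_convexHull ℝ _).inter
  intro x hx y hy a b ha hb hab i
  simp only [Pi.add_apply, Pi.smul_apply, smul_eq_mul]
  have := hx i
  have := hy i
  rcases ha.eq_or_lt with rfl | ha
  · simp only [zero_add] at hab
    subst hab; simpa
  · positivity

lemma feasible_bounds {z : Fin d → ℝ} (hz : z ∈ feasible A) (i : Fin d) :
    0 < z i ∧ z i ≤ maxPlays A i := by
  refine ⟨hz.2 i, ?_⟩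
  obtain ⟨δ, h0, h1, h2⟩ := exists_weights hz.1
  rw [h2 i]
  calc ∑ b ∈ A, δ b * b i ≤ ∑ b ∈ A, δ b * maxPlays A i := by
        apply Finset.sum_le_sum
        intro b hb
        apply mul_le_mul_of_nonneg_left _ (h0 b hb)
        exact_mod_cast le_maxPlays hb i
    _ = _ := by rw [← Finset.sum_mul, h1, one_mul]

lemma objective_eq_potential (q : ℕ → Fin d → ℝ) (ε : Fin d → ℝ) (T : ℕ)
    (a : ℕ → Fin d → ℕ) (l : ℕ → LossArray A) (x : ℕ → Fin d → ℝ) (t : ℕ) (z : Fin d → ℝ) :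
    objective q ε T a l x t z = ∑ i, q t i * z i + potential q ε T a l x t z := by
  unfold objective potential cumLoss
  simp only [← Finset.sum_add_distrib]
  exact Finset.sum_congr rfl fun i _ => by ring

lemma cumLoss_eq_add (q : ℕ → Fin d → ℝ) (a : ℕ → Fin d → ℕ) (l : ℕ → LossArray A)
    (x : ℕ → Fin d → ℝ) {t e : ℕ} (h : t ≤ e) (i : Fin d) :
    cumLoss q a l x e i = cumLoss q a l x t i + ∑ s ∈ Finset.Ico t e, lossEst q a l x s i := by
  unfold cumLoss
  rw [Finset.sum_range_add_sum_Ico _ h]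

lemma sum_stepCost_eq (q : ℕ → Fin d → ℝ) (ε : Fin d → ℝ) (T : ℕ)
    (a : ℕ → Fin d → ℕ) (l : ℕ → LossArray A) (x : ℕ → Fin d → ℝ) (u : Fin d → ℝ) {t e : ℕ}
    (h : t ≤ e) :
    ∑ s ∈ Finset.Ico t e, stepCost q ε T a l x u s =
      ∑ s ∈ Finset.Ico t e, ∑ i, lossEst q a l x s i * (x s i - u i) -
        ((potential q ε T a l x e (x e) - potential q ε T a l x e u) -
          (potential q ε T a l x t (x t) - potential q ε T a l x t u)) := by
  unfold stepCost
  rw [Finset.sum_sub_distrib, Finset.sum_Ico_sub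
    (fun t => potential q ε T a l x t (x t) - potential q ε T a l x t u) h]

/-- The cost of a block of rounds, with the block treated as one step of the algorithm. -/
lemma sum_stepCost_block (q : ℕ → Fin d → ℝ) (ε : Fin d → ℝ) (T : ℕ)
    (a : ℕ → Fin d → ℕ) (l : ℕ → LossArray A) (x : ℕ → Fin d → ℝ) (u : Fin d → ℝ) {t e : ℕ}
    (h : t ≤ e) :
    ∑ s ∈ Finset.Ico t e, stepCost q ε T a l x u s =
      ∑ i, (∑ s ∈ Finset.Ico t e, lossEst q a l x s i * (x s i - x e i) -
          q t i * (x t i - x e i) +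
        (beta q ε T a l x e i - beta q ε T a l x t i) *
          (phi (maxPlays A i) T (u i) - phi (maxPlays A i) T (x e i))) -
        (objective q ε T a l x t (x e) - objective q ε T a l x t (x t)) := by
  rw [sum_stepCost_eq q ε T a l x u h, Finset.sum_comm, objective_eq_potential,
    objective_eq_potential]
  unfold potential
  simp only [← Finset.sum_add_distrib, ← Finset.sum_sub_distrib]
  refine Finset.sum_congr rfl fun i _ => ?_
  rw [cumLoss_eq_add q a l x h i]
  have e1 : ∑ s ∈ Finset.Ico t e, lossEst q a l x s i * (x s i - u i) =
      ∑ s ∈ Finset.Ico t e, lossEst q a l x s i * (x s i - x e i) +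
        (∑ s ∈ Finset.Ico t e, lossEst q a l x s i) * (x e i - u i) := by
    rw [Finset.sum_mul, ← Finset.sum_add_distrib]
    exact Finset.sum_congr rfl fun s _ => by ring
  rw [e1]
  ring

lemma objective_sub_objective (q : ℕ → Fin d → ℝ) (ε : Fin d → ℝ) (T : ℕ)
    (a : ℕ → Fin d → ℕ) (l : ℕ → LossArray A) (x : ℕ → Fin d → ℝ) {t e : ℕ}
    (h : t ≤ e) (y z : Fin d → ℝ) :
    objective q ε T a l x t y - objective q ε T a l x t z =
      objective q ε T a l x e y - objective q ε T a l x e z +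
      ∑ i, ((∑ s ∈ Finset.Ico t e, lossEst q a l x s i + q e i - q t i) * (z i - y i) +
        (beta q ε T a l x e i - beta q ε T a l x t i) *
          (phi (maxPlays A i) T (z i) - phi (maxPlays A i) T (y i))) := by
  simp only [objective_eq_potential]
  unfold potential
  simp only [← Finset.sum_add_distrib, ← Finset.sum_sub_distrib]
  refine Finset.sum_congr rfl fun i _ => ?_
  rw [cumLoss_eq_add q a l x h i]
  ring

lemma armLoss_mem {a : Fin d → ℕ} {l : LossArray A} {i : Fin d}
    (hl : ∀ j, l i j ∈ Set.Icc (0 : ℝ) 1) : armLoss a l i ∈ Set.Icc (0 : ℝ) (a i) := by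
  unfold armLoss
  constructor
  · exact Finset.sum_nonneg fun j _ => (hl j).1
  · calc _ ≤ ∑ j ∈ (Finset.univ : Finset (Fin (maxPlays A i))).filter (fun j => j.val < a i),
          (1 : ℝ) := Finset.sum_le_sum fun j _ => (hl j).2
      _ = (((Finset.univ : Finset (Fin (maxPlays A i))).filter
          (fun j => j.val < a i)).card : ℝ) := by
        simp
      _ ≤ a i := by
        have : ((Finset.univ : Finset (Fin (maxPlays A i))).filter (fun j => j.val < a i)).card
            ≤ (Finset.range (a i)).card := by
          apply Finset.card_le_card_of_injOn (fun j => j.val)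
          · intro j hj
            simpa using hj
          · intro j _ k _ h
            exact Fin.ext h
        simpa using this

lemma avgLoss_mem {a : Fin d → ℕ} {l : LossArray A} {i : Fin d}
    (hl : ∀ j, l i j ∈ Set.Icc (0 : ℝ) 1) : avgLoss a l i ∈ Set.Icc (0 : ℝ) 1 := by
  obtain ⟨h1, h2⟩ := armLoss_mem (a := a) hl
  unfold avgLoss
  exact ⟨by positivity, div_le_one_of_le₀ h2 (by positivity)⟩

variable {ρ : ℝ} {ε : Fin d → ℝ} {T : ℕ} {q : ℕ → Fin d → ℝ} {a : ℕ → Fin d → ℕ}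
  {l : ℕ → LossArray A} {x : ℕ → Fin d → ℝ}

lemma alpha_eq (t : ℕ) (i : Fin d) : alpha q T a l x t i =
    ((a t i : ℝ) / maxPlays A i * (avgLoss (a t) (l t) i - q t i)) ^ 2 *
    min 1 (2 * (1 - x t i / maxPlays A i) / ((x t i / maxPlays A i) ^ 2 * Real.log T)) := by
  unfold alpha; rw [mul_pow]

lemma beta_nonneg (t : ℕ) (i : Fin d) : 0 ≤ beta q ε T a l x t i := Real.sqrt_nonneg _

lemma beta_eq_of_no_play {t e : ℕ} (hte : t ≤ e) (i : Fin d)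
    (h : ∀ s ∈ Finset.Ico t e, a s i = 0) : beta q ε T a l x e i = beta q ε T a l x t i := by
  unfold beta
  rw [← Finset.sum_range_add_sum_Ico _ hte, Finset.sum_eq_zero (s := Finset.Ico t e), add_zero]
  intro s hs
  simp [h s hs]

lemma beta_sub_eq_sum {t e : ℕ} (hte : t ≤ e) (i : Fin d) :
    beta q ε T a l x e i - beta q ε T a l x t i =
      ∑ s ∈ Finset.Ico t e, (beta q ε T a l x (s + 1) i - beta q ε T a l x s i) := by
  rw [Finset.sum_Ico_sub (fun s => beta q ε T a l x s i) hte]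

namespace IsPath

variable (hp : IsPath A ρ ε T q a l x)

include hp

lemma n_cast_pos (i : Fin d) : (0 : ℝ) < maxPlays A i := by exact_mod_cast hp.n_pos i

lemma one_le_n_cast (i : Fin d) : (1 : ℝ) ≤ maxPlays A i := by exact_mod_cast hp.n_pos i

lemma log_pos : 0 < Real.log T := by linarith [hp.two_le_log]

lemma x_bounds {t : ℕ} (ht : t < T) (i : Fin d) : 0 < x t i ∧ x t i ≤ maxPlays A i :=
  feasible_bounds (hp.x_mem t ht) i

lemma w_pos {t : ℕ} (ht : t < T) (i : Fin d) : 0 < x t i / maxPlays A i :=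
  div_pos (hp.x_bounds ht i).1 (hp.n_cast_pos i)

lemma w_le {t : ℕ} (ht : t < T) (i : Fin d) : x t i / maxPlays A i ≤ 1 := by
  rw [div_le_one (hp.n_cast_pos i)]; exact (hp.x_bounds ht i).2

lemma abs_avgLoss_sub_le {t : ℕ} (ht : t < T) (i : Fin d) :
    |avgLoss (a t) (l t) i - q t i| ≤ 1 := by
  obtain ⟨h1, h2⟩ := avgLoss_mem (a := a t) (hp.l_mem t ht i)
  obtain ⟨h3, h4⟩ := hp.q_mem t ht.le i
  rw [abs_le]; constructor <;> linarith

lemma a_div_le {t : ℕ} (ht : t < T) (i : Fin d) : (a t i : ℝ) / maxPlays A i ≤ 1 := by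
  rw [div_le_one (hp.n_cast_pos i)]; exact_mod_cast le_maxPlays (hp.a_mem t ht) i

lemma abs_g_le {t : ℕ} (ht : t < T) (i : Fin d) :
    |(a t i : ℝ) / maxPlays A i * (avgLoss (a t) (l t) i - q t i)| ≤ 1 := by
  rw [abs_mul, abs_of_nonneg (by positivity)]
  exact mul_le_one₀ (hp.a_div_le ht i) (abs_nonneg _) (hp.abs_avgLoss_sub_le ht i)

lemma min_nonneg {t : ℕ} (ht : t < T) (i : Fin d) :
    0 ≤ min 1 (2 * (1 - x t i / maxPlays A i) / ((x t i / maxPlays A i) ^ 2 * Real.log T)) := by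
  have h1 := hp.w_le ht i
  have h2 := hp.w_pos ht i
  have h3 := hp.log_pos
  apply le_min zero_le_one
  have : 0 ≤ 1 - x t i / maxPlays A i := by linarith
  positivity

lemma alpha_nonneg {t : ℕ} (ht : t < T) (i : Fin d) : 0 ≤ alpha q T a l x t i :=
  mul_nonneg (by positivity) (hp.min_nonneg ht i)

lemma alpha_le_one {t : ℕ} (ht : t < T) (i : Fin d) : alpha q T a l x t i ≤ 1 := by
  rw [alpha_eq]
  apply mul_le_one₀ _ (hp.min_nonneg ht i) (min_le_left _ _)
  rw [sq_le_one_iff_abs_le_one]; exact hp.abs_g_le ht i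

lemma alpha_le_mul_min {t : ℕ} (ht : t < T) (i : Fin d) : alpha q T a l x t i ≤
    (a t i : ℝ) / maxPlays A i *
    min 1 (2 * (1 - x t i / maxPlays A i) / ((x t i / maxPlays A i) ^ 2 * Real.log T)) := by
  apply mul_le_mul_of_nonneg_right _ (hp.min_nonneg ht i)
  have h1 := hp.a_div_le ht i
  have h2 : (avgLoss (a t) (l t) i - q t i) ^ 2 ≤ 1 := by
    rw [sq_le_one_iff_abs_le_one]; exact hp.abs_avgLoss_sub_le ht i
  have h3 : (0 : ℝ) ≤ (a t i : ℝ) / maxPlays A i := by positivity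
  calc ((a t i : ℝ) / maxPlays A i) ^ 2 * (avgLoss (a t) (l t) i - q t i) ^ 2
      ≤ ((a t i : ℝ) / maxPlays A i) ^ 2 * 1 := by gcongr
    _ ≤ _ := by nlinarith

lemma alpha_le_of_w {t : ℕ} (ht : t < T) (i : Fin d) {c : ℝ} (hc : 0 < c)
    (hcx : c ≤ x t i / maxPlays A i) :
    alpha q T a l x t i ≤ 2 * (1 - x t i / maxPlays A i) / (c ^ 2 * Real.log T) := by
  have h1 := hp.w_le ht i
  have h3 := hp.log_pos
  have h4 : 0 ≤ 1 - x t i / maxPlays A i := by linarith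
  calc _ ≤ (a t i : ℝ) / maxPlays A i *
        min 1 (2 * (1 - x t i / maxPlays A i) / ((x t i / maxPlays A i) ^ 2 * Real.log T)) :=
        hp.alpha_le_mul_min ht i
    _ ≤ 1 * (2 * (1 - x t i / maxPlays A i) / ((x t i / maxPlays A i) ^ 2 * Real.log T)) :=
        mul_le_mul (hp.a_div_le ht i) (min_le_right _ _) (hp.min_nonneg ht i) zero_le_one
    _ ≤ _ := by
        rw [one_mul]
        apply div_le_div_of_nonneg_left (by positivity) (by positivity)
        gcongr

lemma beta_sq {t : ℕ} (ht : t ≤ T) (i : Fin d) : beta q ε T a l x t i ^ 2 =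
    (1 + ε i / maxPlays A i) ^ 2 +
      1 / Real.log T * ∑ s ∈ Finset.range t, alpha q T a l x s i := by
  unfold beta
  rw [Real.sq_sqrt]
  · rfl
  · have h3 := hp.log_pos
    exact add_nonneg (sq_nonneg _) (mul_nonneg (by positivity) (Finset.sum_nonneg fun s hs =>
      hp.alpha_nonneg ((Finset.mem_range.1 hs).trans_le ht) i))

lemma beta_succ_sq {t : ℕ} (ht : t < T) (i : Fin d) : beta q ε T a l x (t + 1) i ^ 2 =
    beta q ε T a l x t i ^ 2 + alpha q T a l x t i / Real.log T := by
  rw [hp.beta_sq ht, hp.beta_sq ht.le, Finset.sum_range_succ]; ring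

lemma rho_le_eps (i : Fin d) : ρ ≤ ε i / maxPlays A i := by
  rw [le_div_iff₀ (hp.n_cast_pos i)]; exact (hp.eps i).1

lemma one_add_rho_le_beta {t : ℕ} (ht : t ≤ T) (i : Fin d) : 1 + ρ ≤ beta q ε T a l x t i := by
  have h0 := hp.rho_pos
  have h1 := hp.rho_le_eps i
  have h2 := hp.beta_sq ht i
  have h3 := hp.log_pos
  have h4 : 0 ≤ 1 / Real.log T * ∑ s ∈ Finset.range t, alpha q T a l x s i :=
    mul_nonneg (by positivity) (Finset.sum_nonneg fun s hs =>
      hp.alpha_nonneg ((Finset.mem_range.1 hs).trans_le ht) i)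
  apply le_of_sq_le_sq _ (beta_nonneg t i)
  nlinarith

lemma beta_zero_le (i : Fin d) : beta q ε T a l x 0 i ≤ 3 / 2 := by
  have h0 := hp.rho_pos
  have h1 := hp.rho_le_eps i
  have h2 := hp.beta_sq (Nat.zero_le T) i
  have h3 : ε i / maxPlays A i ≤ 1 / 2 := by
    rw [div_le_iff₀ (hp.n_cast_pos i)]; linarith [(hp.eps i).2]
  simp only [Finset.range_zero, Finset.sum_empty, mul_zero, add_zero] at h2
  have h4 : 0 ≤ beta q ε T a l x 0 i := beta_nonneg ..
  nlinarith

lemma one_le_beta {t : ℕ} (ht : t ≤ T) (i : Fin d) : 1 ≤ beta q ε T a l x t i := by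
  linarith [hp.one_add_rho_le_beta ht i, hp.rho_pos]

lemma beta_le_succ {t : ℕ} (ht : t < T) (i : Fin d) :
    beta q ε T a l x t i ≤ beta q ε T a l x (t + 1) i := by
  apply le_of_sq_le_sq _ (beta_nonneg _ i)
  rw [hp.beta_succ_sq ht]
  have := div_nonneg (hp.alpha_nonneg ht i) hp.log_pos.le
  linarith

lemma log_mul_beta_succ_sub {t : ℕ} (ht : t < T) (i : Fin d) :
    Real.log T * (beta q ε T a l x (t + 1) i - beta q ε T a l x t i) ≤
      alpha q T a l x t i / 2 := by
  have h1 := hp.beta_succ_sq ht i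
  have h2 := hp.one_le_beta ht.le i
  have h3 := hp.beta_le_succ ht i
  have h4 := hp.log_pos
  have h5 : Real.log T * (beta q ε T a l x (t + 1) i ^ 2 - beta q ε T a l x t i ^ 2) =
      alpha q T a l x t i := by
    rw [h1]; field_simp; ring
  nlinarith [mul_nonneg h4.le (sub_nonneg.2 h3)]

lemma alpha_div_beta_le {t : ℕ} (ht : t < T) (i : Fin d) :
    alpha q T a l x t i / beta q ε T a l x t i ≤
      3 * Real.log T * (beta q ε T a l x (t + 1) i - beta q ε T a l x t i) := by
  have h1 := hp.beta_succ_sq ht i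
  have h2 := hp.one_le_beta ht.le i
  have h3 := hp.beta_le_succ ht i
  have h4 := hp.two_le_log
  have h5 : Real.log T * (beta q ε T a l x (t + 1) i ^ 2 - beta q ε T a l x t i ^ 2) =
      alpha q T a l x t i := by
    rw [h1]; field_simp; ring
  have h6 := hp.alpha_le_one ht i
  have h7 : alpha q T a l x t i / Real.log T ≤ 1 := by
    rw [div_le_one (by linarith)]; linarith
  have h8 : beta q ε T a l x (t + 1) i ≤ 2 * beta q ε T a l x t i := by
    apply le_of_sq_le_sq _ (by linarith)
    nlinarith
  rw [div_le_iff₀ (by linarith), ← h5]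
  have h9 : 0 ≤ Real.log T * (beta q ε T a l x (t + 1) i - beta q ε T a l x t i) :=
    mul_nonneg (by linarith) (by linarith)
  nlinarith

lemma q_eq_of_no_play {t e : ℕ} (hte : t ≤ e) (he : e ≤ T) (i : Fin d)
    (h : ∀ s ∈ Finset.Ico t e, a s i = 0) : q e i = q t i := by
  induction e, hte using Nat.le_induction with
  | base => rfl
  | succ k hk ih =>
    rw [hp.q_succ k (by omega) i (h k (by simp; omega))]
    exact ih (by omega) fun s hs => h s (by simp at hs ⊢; omega)

lemma beta_mono {t e : ℕ} (hte : t ≤ e) (he : e ≤ T) (i : Fin d) :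
    beta q ε T a l x t i ≤ beta q ε T a l x e i := by
  rw [← sub_nonneg, beta_sub_eq_sum hte]
  exact Finset.sum_nonneg fun s hs => sub_nonneg.2 (hp.beta_le_succ
    (by simp only [Finset.mem_Ico] at hs; omega) i)

lemma log_mul_beta_sub_le {t e : ℕ} (hte : t ≤ e) (he : e ≤ T) (i : Fin d) :
    Real.log T * (beta q ε T a l x e i - beta q ε T a l x t i) ≤
      (∑ s ∈ Finset.Ico t e, alpha q T a l x s i) / 2 := by
  rw [beta_sub_eq_sum hte, Finset.mul_sum, Finset.sum_div]
  exact Finset.sum_le_sum fun s hs => hp.log_mul_beta_succ_sub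
    (by simp only [Finset.mem_Ico] at hs; omega) i

lemma lossEst_eq {t : ℕ} (ht : t < T) (i : Fin d) :
    lossEst q a l x t i = q t i +
      (a t i : ℝ) / maxPlays A i * (avgLoss (a t) (l t) i - q t i) / (x t i / maxPlays A i) := by
  have h1 := (hp.x_bounds ht i).1
  have h2 := hp.n_cast_pos i
  unfold lossEst
  field_simp

/-- First-order optimality, with the Bregman divergence of the regularizer. -/
lemma sum_regDiv_le {t : ℕ} (ht : t < T) {y : Fin d → ℝ} (hy : y ∈ feasible A) :
    ∑ i, beta q ε T a l x t i * (maxPlays A i *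
        regDiv (Real.log T) (y i / maxPlays A i) (x t i / maxPlays A i)) ≤
      objective q ε T a l x t y - objective q ε T a l x t (x t) := by
  have := sum_regDiv_le_of_minimizer (S := feasible A) (n := fun i => maxPlays A i) (T := T)
    (G := fun i => q t i + ∑ s ∈ Finset.range t, lossEst q a l x s i)
    (b := fun i => beta q ε T a l x t i) (x := x t) (y := y) convex_feasible hp.n_pos hp.log_pos
    (fun z hz i => feasible_bounds hz i)
    (fun i => by linarith [hp.one_le_beta ht.le i]) (hp.x_mem t ht) hy
    (fun z hz => hp.x_min t ht hz)
  exact this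

lemma eq_n_of_eq_n {t : ℕ} (ht : t < T) {y : Fin d → ℝ} (hy : y ∈ feasible A) {i : Fin d}
    (h : x t i / maxPlays A i = 1) : y i / maxPlays A i = 1 := by
  rw [div_eq_one_iff_eq (hp.n_cast_pos i).ne'] at h ⊢
  exact eq_of_minimizer_eq (S := feasible A) (n := fun i => maxPlays A i) (T := T)
    (G := fun i => q t i + ∑ s ∈ Finset.range t, lossEst q a l x s i)
    (b := fun i => beta q ε T a l x t i) (x := x t) (y := y) convex_feasible hp.n_pos hp.log_pos
    (fun z hz i => feasible_bounds hz i)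
    (fun i => by linarith [hp.one_le_beta ht.le i]) (hp.x_mem t ht) hy
    (fun z hz => hp.x_min t ht hz) h

/-- The cost of one round is at most the growth of the regularization parameters. -/
lemma stepCost_le {u : Fin d → ℝ}
    (hphi : ∀ i, phi (maxPlays A i) T (u i) ≤ 3 * maxPlays A i * Real.log T) {t : ℕ}
    (ht : t + 1 < T) :
    stepCost q ε T a l x u t ≤ ∑ i, (3 * ((1 + ρ) / ρ) + 3) * maxPlays A i * Real.log T *
      (beta q ε T a l x (t + 1) i - beta q ε T a l x t i) := by
  have ht' : t < T := by omega
  have h1 := sum_stepCost_block q ε T a l x u (Nat.le_succ t)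
  simp only [Nat.succ_eq_add_one, Nat.Ico_succ_singleton, Finset.sum_singleton] at h1
  rw [h1]
  have h2 := hp.sum_regDiv_le ht' (hp.x_mem (t + 1) ht)
  refine (sub_le_sub_left h2 _).trans ?_
  rw [← Finset.sum_sub_distrib]
  apply Finset.sum_le_sum
  intro i _
  have hn := hp.n_cast_pos i
  have hρ := hp.rho_pos
  set n : ℝ := (maxPlays A i : ℝ) with hnd
  set g := (a t i : ℝ) / n * (avgLoss (a t) (l t) i - q t i) with hg
  set w := x t i / n with hw
  set v := x (t + 1) i / n with hv
  have e1 := stability_le (g := g) (b := beta q ε T a l x t i) (L := Real.log T) (w := w) (v := v)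
    hρ (hp.abs_g_le ht' i) (hp.one_add_rho_le_beta ht'.le i) hp.two_le_log (hp.w_pos ht' i)
    (hp.w_le ht' i) (hp.w_pos ht i) (hp.w_le ht i)
    (fun h => hp.eq_n_of_eq_n ht' (hp.x_mem _ ht) h)
  rw [hg, hw, ← alpha_eq t i, ← hw, ← hg, mul_div_assoc ((1 + ρ) / ρ)] at e1
  have e2 := hp.alpha_div_beta_le ht' i
  have e3 : lossEst q a l x t i - q t i = g / w := by rw [hp.lossEst_eq ht' i]; ring
  have e4 : x t i = n * w := by rw [hw]; field_simp
  have e5 : x (t + 1) i = n * v := by rw [hv]; field_simp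
  have e6 : 0 ≤ phi (maxPlays A i) T (x (t + 1) i) :=
    phi_nonneg (hp.n_pos i) (hp.x_bounds ht i).1 (hp.x_bounds ht i).2
  have e7 := hp.beta_le_succ ht' i
  set D := beta q ε T a l x (t + 1) i - beta q ε T a l x t i with hD
  have e8 : D * (phi (maxPlays A i) T (u i) - phi (maxPlays A i) T (x (t + 1) i)) ≤
      D * (3 * n * Real.log T) := by
    apply mul_le_mul_of_nonneg_left _ (by linarith)
    linarith [hphi i]
  have e9 : lossEst q a l x t i * (x t i - x (t + 1) i) - q t i * (x t i - x (t + 1) i) =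
      n * (g / w * (w - v)) := by
    rw [← sub_mul, e3]; rw [e4, e5]; ring
  have e10 : (1 + ρ) / ρ * (alpha q T a l x t i / beta q ε T a l x t i) ≤
      (1 + ρ) / ρ * (3 * Real.log T * D) := mul_le_mul_of_nonneg_left e2 (by positivity)
  have e11 : n * (g / w * (w - v) - beta q ε T a l x t i * regDiv (Real.log T) v w) ≤
      n * ((1 + ρ) / ρ * (3 * Real.log T * D)) :=
    mul_le_mul_of_nonneg_left (e1.trans e10) hn.le
  rw [e9]
  nlinarith

/-- Reverse optimality: the point of a later round is a minimizer, too. -/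
lemma objective_sub_le {t e : ℕ} (hte : t ≤ e) (he : e < T) :
    objective q ε T a l x t (x e) - objective q ε T a l x t (x t) ≤
      ∑ i, ((∑ s ∈ Finset.Ico t e, lossEst q a l x s i + q e i - q t i) * (x t i - x e i) +
        (beta q ε T a l x e i - beta q ε T a l x t i) *
          (phi (maxPlays A i) T (x t i) - phi (maxPlays A i) T (x e i))) := by
  rw [objective_sub_objective q ε T a l x hte]
  have := hp.x_min e he (hp.x_mem t (by omega))
  simp only [Set.mem_ofPred_eq] at this
  linarith

/-- Consecutive points are close, by the strong convexity of the entropy part. -/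
lemma sq_sub_succ_le {t : ℕ} (ht : t + 1 < T) (i : Fin d) :
    (x t i / maxPlays A i - x (t + 1) i / maxPlays A i) ^ 2 ≤
      8 * (1 / ρ + 1) * (∑ i, (maxPlays A i : ℝ)) / Real.log T := by
  have ht' : t < T := by omega
  have hρ := hp.rho_pos
  have hL := hp.two_le_log
  have h1 := hp.sum_regDiv_le ht' (hp.x_mem (t + 1) ht)
  have h2 := h1.trans (hp.objective_sub_le (Nat.le_succ t) ht)
  simp only [Nat.Ico_succ_singleton, Finset.sum_singleton] at h2
  have key : ∀ k, maxPlays A k * (Real.log T *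
      entropyDiv (x (t + 1) k / maxPlays A k) (x t k / maxPlays A k)) ≤
      beta q ε T a l x t k * (maxPlays A k *
        regDiv (Real.log T) (x (t + 1) k / maxPlays A k) (x t k / maxPlays A k)) -
      ((lossEst q a l x t k + q (t + 1) k - q t k) * (x t k - x (t + 1) k) +
        (beta q ε T a l x (t + 1) k - beta q ε T a l x t k) *
          (phi (maxPlays A k) T (x t k) - phi (maxPlays A k) T (x (t + 1) k))) +
      (2 / ρ + 2) * maxPlays A k := by
    intro k
    have hn := hp.n_cast_pos k
    have e2 := hp.one_add_rho_le_beta ht'.le k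
    have e3 := hp.beta_le_succ ht' k
    have e4 := hp.log_mul_beta_succ_sub ht' k
    have e5 := hp.alpha_le_one ht' k
    have e6 := hp.lossEst_eq ht' k
    have e7 := abs_le.1 (hp.abs_g_le ht' k)
    obtain ⟨e8, e9⟩ := hp.q_mem (t + 1) ht.le k
    have w0 := hp.w_pos ht' k
    have w1 := hp.w_le ht' k
    have v0 := hp.w_pos ht k
    have v1 := hp.w_le ht k
    have hwv : x t k / maxPlays A k = 1 → x (t + 1) k / maxPlays A k = 1 :=
      fun h => hp.eq_n_of_eq_n ht' (hp.x_mem _ ht) h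
    unfold phi
    have hx : x t k - x (t + 1) k =
        maxPlays A k * (x t k / maxPlays A k - x (t + 1) k / maxPlays A k) := by field_simp
    rw [e6, hx]
    generalize (maxPlays A k : ℝ) = n at *
    generalize x t k / n = w at *
    generalize x (t + 1) k / n = v at *
    generalize (a t k : ℝ) / n * (avgLoss (a t) (l t) k - q t k) = g at *
    generalize q t k = q0 at *
    generalize q (t + 1) k = q1 at *
    have hD : 0 ≤ beta q ε T a l x (t + 1) k - beta q ε T a l x t k := sub_nonneg.2 e3
    generalize beta q ε T a l x (t + 1) k - beta q ε T a l x t k = D at *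
    generalize beta q ε T a l x t k = b at *
    generalize Real.log T = L at *
    have main := entropy_step_le hρ hL e2 hD e4 e5 e7 e8 e9 w0 w1 v0 v1 hwv
    have := mul_le_mul_of_nonneg_left main hn.le
    linarith
  have hsum := Finset.sum_le_sum (s := Finset.univ) fun k _ => key k
  rw [Finset.sum_add_distrib, Finset.sum_sub_distrib, ← Finset.mul_sum] at hsum
  have hnn : ∀ k, 0 ≤ maxPlays A k * (Real.log T *
      entropyDiv (x (t + 1) k / maxPlays A k) (x t k / maxPlays A k)) := fun k =>
    mul_nonneg (hp.n_cast_pos k).le (mul_nonneg (by linarith)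
      (entropyDiv_nonneg (hp.w_le ht k) (hp.w_le ht' k)
        (fun h => hp.eq_n_of_eq_n ht' (hp.x_mem _ ht) h)))
  have h3 := Finset.single_le_sum (fun k _ => hnn k) (Finset.mem_univ i)
  have h4 := sq_le_entropyDiv (hp.w_pos ht i).le (hp.w_le ht i) (hp.w_pos ht' i).le
    (hp.w_le ht' i) (fun h => hp.eq_n_of_eq_n ht' (hp.x_mem _ ht) h)
  have h5 := hp.one_le_n_cast i
  have h6 : Real.log T * entropyDiv (x (t + 1) i / maxPlays A i) (x t i / maxPlays A i) ≤
      (2 / ρ + 2) * ∑ k, (maxPlays A k : ℝ) := by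
    have : 0 ≤ Real.log T * entropyDiv (x (t + 1) i / maxPlays A i) (x t i / maxPlays A i) :=
      mul_nonneg (by linarith) (h4.trans' (by positivity))
    nlinarith
  rw [le_div_iff₀ (by linarith)]
  have h7 : 8 * (1 / ρ + 1) * (∑ k, (maxPlays A k : ℝ)) =
      4 * ((2 / ρ + 2) * ∑ k, (maxPlays A k : ℝ)) := by ring
  nlinarith

end IsPath

end Paths

/-! ### Geometry of the action set around the optimal action -/

namespace Instance

variable {d : ℕ} (I : Instance d)

/-- `‖z - a*‖₁`. -/
def optDist (z : Fin d → ℝ) : ℝ := ∑ i, |z i - I.aStar i|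

/-- The expected excess loss `⟨ℓ, z - a*⟩` of a point `z` of `conv(A)`. -/
noncomputable def excess (z : Fin d → ℝ) : ℝ := ∑ i, (z i - I.aStar i) * I.mean i

/-- The distance, over the arms at which `a*` is extremal, to the face of `conv(A)` on which these
arms are played as by `a*`. -/
def faceDist (z : Fin d → ℝ) : ℝ :=
  ∑ i, if I.aStar i = 0 then z i else if I.aStar i = maxPlays I.A i then maxPlays I.A i - z i else 0

/-- The arms that the optimal action plays, but less than `n_i` times. -/
abbrev IsMid (i : Fin d) : Prop := 0 < I.aStar i ∧ I.aStar i < maxPlays I.A i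

/-- `W` as a real number. -/
def Wr : ℝ := ∑ i, (maxPlays I.A i : ℝ)

lemma Wr_eq : I.Wr = I.W := by
  unfold Wr W n; push_cast; rfl

lemma n_pos (i : Fin d) : 1 ≤ maxPlays I.A i := by
  obtain ⟨a, ha, h⟩ := I.arm_playable i
  exact h.trans (le_maxPlays ha i)

lemma one_le_n (i : Fin d) : (1 : ℝ) ≤ maxPlays I.A i := by exact_mod_cast I.n_pos i

lemma n_le_Wr (i : Fin d) : (maxPlays I.A i : ℝ) ≤ I.Wr :=
  Finset.single_le_sum (f := fun i => (maxPlays I.A i : ℝ)) (fun _ _ => Nat.cast_nonneg _)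
    (Finset.mem_univ i)

lemma one_le_Wr (i : Fin d) : 1 ≤ I.Wr := (I.one_le_n i).trans (I.n_le_Wr i)

lemma Wr_nonneg : 0 ≤ I.Wr := Finset.sum_nonneg fun _ _ => Nat.cast_nonneg _

lemma card_le_Wr : (d : ℝ) ≤ I.Wr := by
  calc (d : ℝ) = ∑ _i : Fin d, (1 : ℝ) := by simp
    _ ≤ _ := Finset.sum_le_sum fun i _ => I.one_le_n i

lemma aStar_le (i : Fin d) : I.aStar i ≤ maxPlays I.A i := le_maxPlays I.aStar_mem i

lemma mean_mem (i : Fin d) : I.mean i ∈ Set.Icc (0 : ℝ) 1 := by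
  have := I.D_prob i
  have hs := I.D_supp i
  constructor
  · exact integral_nonneg_of_ae (hs.mono fun y hy => hy.1)
  · have hint : Integrable (fun y : ℝ => y) (I.D i) :=
      Integrable.of_mem_Icc 0 1 aemeasurable_id hs
    calc I.mean i ≤ ∫ _y, (1 : ℝ) ∂(I.D i) :=
          integral_mono_ae hint (integrable_const _) (hs.mono fun y hy => hy.2)
      _ = 1 := by simp

lemma optDist_nonneg (z : Fin d → ℝ) : 0 ≤ I.optDist z :=
  Finset.sum_nonneg fun _ _ => abs_nonneg _

lemma abs_sub_le_optDist (z : Fin d → ℝ) (i : Fin d) : |z i - I.aStar i| ≤ I.optDist z :=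
  Finset.single_le_sum (f := fun i => |z i - I.aStar i|) (fun _ _ => abs_nonneg _)
    (Finset.mem_univ i)

lemma sum_abs_sub_le_Wr {b : Fin d → ℕ} (hb : b ∈ I.A) : ∑ i, |(b i : ℝ) - I.aStar i| ≤ I.Wr := by
  apply Finset.sum_le_sum
  intro i _
  have h1 : (b i : ℝ) ≤ maxPlays I.A i := by exact_mod_cast le_maxPlays hb i
  have h2 : (I.aStar i : ℝ) ≤ maxPlays I.A i := by exact_mod_cast I.aStar_le i
  have h3 : (0 : ℝ) ≤ b i := by positivity
  have h4 : (0 : ℝ) ≤ I.aStar i := by positivity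
  rw [abs_le]; constructor <;> linarith

lemma gap_eq (b : Fin d → ℕ) : I.gap b = ∑ i, ((b i : ℝ) - I.aStar i) * I.mean i := by
  unfold gap; rw [← Finset.sum_sub_distrib]
  exact Finset.sum_congr rfl fun i _ => by ring

lemma gap_aStar : I.gap I.aStar = 0 := by simp [gap]

lemma gap_pos {b : Fin d → ℕ} (hb : b ∈ I.A) (hne : b ≠ I.aStar) : 0 < I.gap b :=
  sub_pos.2 (I.aStar_opt b hb hne)

lemma gap_nonneg {b : Fin d → ℕ} (hb : b ∈ I.A) : 0 ≤ I.gap b := by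
  by_cases h : b = I.aStar
  · rw [h, gap_aStar]
  · exact (I.gap_pos hb h).le

lemma exists_gap_lower_bound : ∃ Δ : ℝ, 0 < Δ ∧ ∀ b ∈ I.A, b ≠ I.aStar → Δ ≤ I.gap b := by
  classical
  by_cases h : (I.A.erase I.aStar).Nonempty
  · obtain ⟨b, hb, hmin⟩ := Finset.exists_min_image _ I.gap h
    rw [Finset.mem_erase] at hb
    exact ⟨I.gap b, I.gap_pos hb.2 hb.1, fun c hc hne => hmin c (Finset.mem_erase.2 ⟨hne, hc⟩)⟩
  · refine ⟨1, one_pos, fun b hb hne => ?_⟩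
    exact absurd ⟨b, Finset.mem_erase.2 ⟨hne, hb⟩⟩ h

lemma excess_eq_sum {z : Fin d → ℝ} {δ : (Fin d → ℕ) → ℝ} (h1 : ∑ b ∈ I.A, δ b = 1)
    (hz : ∀ i, z i = ∑ b ∈ I.A, δ b * b i) : I.excess z = ∑ b ∈ I.A, δ b * I.gap b := by
  have : ∀ i, (z i - I.aStar i) * I.mean i =
      ∑ b ∈ I.A, δ b * (((b i : ℝ) - I.aStar i) * I.mean i) := by
    intro i
    have : (I.aStar i : ℝ) = ∑ b ∈ I.A, δ b * I.aStar i := by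
      rw [← Finset.sum_mul, h1, one_mul]
    rw [hz i]
    nth_rw 1 [this]
    rw [← Finset.sum_sub_distrib, Finset.sum_mul]
    exact Finset.sum_congr rfl fun b _ => by ring
  unfold excess
  rw [Finset.sum_congr rfl fun i _ => this i, Finset.sum_comm]
  refine Finset.sum_congr rfl fun b _ => ?_
  rw [gap_eq, Finset.mul_sum]

lemma optDist_le_sum {z : Fin d → ℝ} {δ : (Fin d → ℕ) → ℝ} (h0 : ∀ b ∈ I.A, 0 ≤ δ b)
    (h1 : ∑ b ∈ I.A, δ b = 1)
    (hz : ∀ i, z i = ∑ b ∈ I.A, δ b * b i) :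
    I.optDist z ≤ ∑ b ∈ I.A, δ b * ∑ i, |(b i : ℝ) - I.aStar i| := by
  have : ∀ i, |z i - I.aStar i| ≤ ∑ b ∈ I.A, δ b * |(b i : ℝ) - I.aStar i| := by
    intro i
    have : (I.aStar i : ℝ) = ∑ b ∈ I.A, δ b * I.aStar i := by
      rw [← Finset.sum_mul, h1, one_mul]
    rw [hz i]
    nth_rw 1 [this]
    rw [← Finset.sum_sub_distrib]
    refine (Finset.abs_sum_le_sum_abs _ _).trans (Finset.sum_le_sum fun b hb => ?_)
    rw [← mul_sub, abs_mul, abs_of_nonneg (h0 b hb)]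
  refine (Finset.sum_le_sum fun i _ => this i).trans_eq ?_
  rw [Finset.sum_comm]
  exact Finset.sum_congr rfl fun b _ => (Finset.mul_sum _ _ _).symm

lemma faceDist_eq_sum {z : Fin d → ℝ} {δ : (Fin d → ℕ) → ℝ} (h1 : ∑ b ∈ I.A, δ b = 1)
    (hz : ∀ i, z i = ∑ b ∈ I.A, δ b * b i) :
    I.faceDist z = ∑ b ∈ I.A, δ b * I.faceDist (fun i => b i) := by
  unfold faceDist
  simp only [Finset.mul_sum]
  rw [Finset.sum_comm]
  refine Finset.sum_congr rfl fun i _ => ?_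
  split_ifs
  · rw [hz i]
  · have : (maxPlays I.A i : ℝ) = ∑ b ∈ I.A, δ b * maxPlays I.A i := by
      rw [← Finset.sum_mul, h1, one_mul]
    rw [hz i]
    nth_rw 1 [this]
    rw [← Finset.sum_sub_distrib]
    exact Finset.sum_congr rfl fun b _ => by ring
  · simp

/-- The excess loss dominates the distance to the optimal action. -/
lemma exists_optDist_le : ∃ K : ℝ, 0 < K ∧ ∀ z ∈ feasible I.A, I.optDist z ≤ K * I.excess z := by
  obtain ⟨Δ, hΔ, hgap⟩ := I.exists_gap_lower_bound
  have hW := I.Wr_nonneg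
  refine ⟨I.Wr / Δ + 1, by positivity, fun z hz => ?_⟩
  obtain ⟨δ, h0, h1, h2⟩ := exists_weights hz.1
  refine (I.optDist_le_sum h0 h1 h2).trans ?_
  rw [I.excess_eq_sum h1 h2, Finset.mul_sum]
  apply Finset.sum_le_sum
  intro b hb
  by_cases hne : b = I.aStar
  · subst hne; simp [gap_aStar]
  · rw [mul_left_comm]
    apply mul_le_mul_of_nonneg_left _ (h0 b hb)
    have h3 := hgap b hb hne
    calc _ ≤ I.Wr := I.sum_abs_sub_le_Wr hb
      _ = I.Wr / Δ * Δ := by field_simp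
      _ ≤ I.Wr / Δ * I.gap b := by gcongr
      _ ≤ _ := by nlinarith

lemma excess_nonneg {z : Fin d → ℝ} (hz : z ∈ feasible I.A) : 0 ≤ I.excess z := by
  obtain ⟨δ, h0, h1, h2⟩ := exists_weights hz.1
  rw [I.excess_eq_sum h1 h2]
  exact Finset.sum_nonneg fun b hb => mul_nonneg (h0 b hb) (I.gap_nonneg hb)

lemma faceDist_le_optDist {z : Fin d → ℝ} : I.faceDist z ≤ I.optDist z := by
  apply Finset.sum_le_sum
  intro i _
  split_ifs with h1 h2
  · rw [h1]; simpa using le_abs_self (z i)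
  · rw [← h2, abs_sub_comm]; exact le_abs_self _
  · exact abs_nonneg _

/-- Off the face, an action differs from `a*` by at least one play of an extremal arm. -/
lemma one_le_faceDist {b : Fin d → ℕ} (hb : b ∈ I.A)
    (h : ¬ ∀ i, ¬ I.IsMid i → b i = I.aStar i) : 1 ≤ I.faceDist (fun i => b i) := by
  push Not at h
  obtain ⟨i, hi, hne⟩ := h
  have hnn : ∀ k, (0 : ℝ) ≤ if I.aStar k = 0 then (b k : ℝ) else
      if I.aStar k = maxPlays I.A k then maxPlays I.A k - (b k : ℝ) else 0 := by
    intro k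
    have : (b k : ℝ) ≤ maxPlays I.A k := by exact_mod_cast le_maxPlays hb k
    split_ifs
    · positivity
    · linarith
    · exact le_rfl
  refine le_trans ?_ (Finset.single_le_sum (fun k _ => hnn k) (Finset.mem_univ i))
  by_cases h0 : I.aStar i = 0
  · rw [if_pos h0]
    have : 1 ≤ b i := by omega
    exact_mod_cast this
  · have h1 : I.aStar i = maxPlays I.A i := by
      have := I.aStar_le i
      by_contra hc
      exact hi ⟨by omega, by omega⟩
    rw [if_neg h0, if_pos h1]
    have h2 := le_maxPlays hb i
    have : b i + 1 ≤ maxPlays I.A i := by omega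
    have : (b i : ℝ) + 1 ≤ maxPlays I.A i := by exact_mod_cast this
    linarith

end Instance

namespace IsPath

variable {d : ℕ} {I : Instance d} {ρ : ℝ} {ε : Fin d → ℝ} {T : ℕ} {q : ℕ → Fin d → ℝ}
  {a : ℕ → Fin d → ℕ} {l : ℕ → LossArray I.A} {x : ℕ → Fin d → ℝ} (hp : IsPath I.A ρ ε T q a l x)

include hp

lemma log_mul_beta_le {t : ℕ} (ht : t ≤ T) (i : Fin d) :
    Real.log T * beta q ε T a l x t i ≤ 3 / 2 * Real.log T + √(t * Real.log T) := by
  have h1 := hp.log_pos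
  have h2 := hp.beta_sq (Nat.zero_le T) i
  have h3 := hp.beta_sq ht i
  simp only [Finset.range_zero, Finset.sum_empty, mul_zero, add_zero] at h2
  have h4 : ∑ s ∈ Finset.range t, alpha q T a l x s i ≤ t := by
    calc _ ≤ ∑ _s ∈ Finset.range t, (1 : ℝ) := Finset.sum_le_sum fun s hs =>
          hp.alpha_le_one ((Finset.mem_range.1 hs).trans_le ht) i
      _ = t := by simp
  have h5 := hp.beta_zero_le i
  have h6 : 0 ≤ beta q ε T a l x 0 i := beta_nonneg ..
  have h7 : beta q ε T a l x t i ^ 2 ≤ (3 / 2) ^ 2 + t / Real.log T := by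
    rw [h3, ← h2]
    have : 1 / Real.log T * ∑ s ∈ Finset.range t, alpha q T a l x s i ≤ t / Real.log T := by
      rw [one_div_mul_eq_div]; gcongr
    nlinarith
  have h8 : 0 ≤ √(t * Real.log T) := Real.sqrt_nonneg _
  have h9 : √(t * Real.log T) ^ 2 = t * Real.log T := Real.sq_sqrt (by positivity)
  apply le_of_sq_le_sq _ (by positivity)
  have h10 : Real.log T ^ 2 * beta q ε T a l x t i ^ 2 ≤
      Real.log T ^ 2 * ((3 / 2) ^ 2 + t / Real.log T) := by gcongr
  have h11 : Real.log T ^ 2 * ((3 / 2) ^ 2 + t / Real.log T) =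
      (3 / 2 * Real.log T) ^ 2 + t * Real.log T := by field_simp
  nlinarith [mul_nonneg h1.le h8]

/-- While the estimated losses of the arms in the interior of their range favour `a*` over the
other actions of the face clearly enough, the chosen point puts no weight on these actions. -/
lemma optDist_le_faceDist {Δ c : ℝ} (hgap : ∀ b ∈ I.A, b ≠ I.aStar → Δ ≤ I.gap b)
    (hc : c * I.Wr ≤ Δ / 2) {t : ℕ} (ht : t < T) (hclose : I.optDist (x t) ≤ 1 / 4)
    (hconc : ∀ i, I.IsMid i → |cumLoss q a l x t i - t * I.mean i| ≤ c * t)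
    (hreg : I.Wr + 4 * I.Wr ^ 2 * (3 / 2 * Real.log T + √(t * Real.log T)) < t * (Δ / 2)) :
    I.optDist (x t) ≤ I.Wr * I.faceDist (x t) := by
  classical
  have hL := hp.log_pos
  have hL2 := hp.two_le_log
  obtain ⟨δ, h0, h1, h2⟩ := exists_weights (hp.x_mem t ht).1
  have hzero : ∀ b ∈ I.A, b ≠ I.aStar → (∀ i, ¬ I.IsMid i → b i = I.aStar i) → δ b = 0 := by
    intro b hb hne hface
    by_contra hδ
    have hδ0 : 0 < δ b := lt_of_le_of_ne (h0 b hb) (Ne.symm hδ)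
    have hW1 : 1 ≤ I.Wr := by
      obtain ⟨i, -⟩ := Function.ne_iff.1 hne
      exact I.one_le_Wr i
    -- moving mass `θ` from `b` to `a*` would decrease the objective
    set θ := min (δ b) (1 / (4 * I.Wr)) with hθ
    have hθ0 : 0 < θ := lt_min hδ0 (by positivity)
    have hθ1 : θ * I.Wr ≤ 1 / 4 := by
      calc θ * I.Wr ≤ 1 / (4 * I.Wr) * I.Wr := by gcongr; exact min_le_right _ _
        _ = 1 / 4 := by field_simp
    have hθ2 : θ ≤ δ b := min_le_left _ _
    set y : Fin d → ℝ := fun i => x t i + θ * ((I.aStar i : ℝ) - b i) with hy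
    have hdiff : ∀ i, |(I.aStar i : ℝ) - b i| ≤ I.Wr := fun i => by
      rw [abs_sub_comm]
      exact (Finset.single_le_sum (f := fun i => |(b i : ℝ) - I.aStar i|)
        (fun _ _ => abs_nonneg _) (Finset.mem_univ i)).trans (I.sum_abs_sub_le_Wr hb)
    have hymid : ∀ i, I.IsMid i → y i ∈ Set.Icc (1 / 2 : ℝ) (maxPlays I.A i - 1 / 2) := by
      intro i hi
      have e1 := abs_le.1 ((I.abs_sub_le_optDist (x t) i).trans hclose)
      have e2 : |θ * ((I.aStar i : ℝ) - b i)| ≤ 1 / 4 := by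
        rw [abs_mul, abs_of_pos hθ0]
        exact (mul_le_mul_of_nonneg_left (hdiff i) hθ0.le).trans hθ1
      have e3 := abs_le.1 e2
      have e4 : (1 : ℝ) ≤ I.aStar i := by exact_mod_cast hi.1
      have e5 : (I.aStar i : ℝ) + 1 ≤ maxPlays I.A i := by exact_mod_cast hi.2
      simp only [hy]
      constructor <;> linarith
    have hyne : ∀ i, ¬ I.IsMid i → y i = x t i := by
      intro i hi
      simp [hy, hface i hi]
    have hyf : y ∈ feasible I.A := by
      constructor
      · apply weights_mem_convexHull
          (δ := fun c => δ c + (if c = I.aStar then θ else 0) - (if c = b then θ else 0))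
        · intro c hc
          have := h0 c hc
          by_cases hcb : c = b
          · subst hcb
            simp only [if_true, if_neg hne]; linarith
          · simp only [if_neg hcb]
            split_ifs <;> linarith
        · rw [Finset.sum_sub_distrib, Finset.sum_add_distrib, h1]
          simp [I.aStar_mem, hb]
        · intro i
          have e1 : ∀ c ∈ I.A,
              (δ c + (if c = I.aStar then θ else 0) - (if c = b then θ else 0)) * (c i : ℝ) =
              δ c * c i + (if c = I.aStar then θ * c i else 0) -
                (if c = b then θ * c i else 0) := by
            intro c _
            split_ifs <;> ring
          rw [Finset.sum_congr rfl e1, Finset.sum_sub_distrib, Finset.sum_add_distrib, ← h2 i]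
          simp [I.aStar_mem, hb, hy]; ring
      · intro i
        by_cases hi : I.IsMid i
        · linarith [(hymid i hi).1]
        · rw [hyne i hi]; exact (hp.x_bounds ht i).1
    have hmin := hp.x_min t ht hyf
    simp only [Set.mem_ofPred_eq, objective_eq_potential] at hmin
    unfold potential at hmin
    have key : ∀ i, q t i * y i + (cumLoss q a l x t i * y i +
        beta q ε T a l x t i * phi (maxPlays I.A i) T (y i)) -
        (q t i * x t i + (cumLoss q a l x t i * x t i +
        beta q ε T a l x t i * phi (maxPlays I.A i) T (x t i))) ≤
        θ * (maxPlays I.A i + (t * I.mean i * ((I.aStar i : ℝ) - b i) +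
          c * t * |(b i : ℝ) - I.aStar i|) +
          4 * maxPlays I.A i * (3 / 2 * Real.log T + √(t * Real.log T)) * I.Wr) := by
      intro i
      have hc0 : ∀ i, I.IsMid i → 0 ≤ c * t := fun i hi => (abs_nonneg _).trans (hconc i hi)
      have hn := I.one_le_n i
      by_cases hi : I.IsMid i
      · have e1 := phi_sub_le_mul_abs (T := T) (hp.n_pos i) (c := 1 / 2) (by norm_num) (by linarith)
          (hymid i hi) (hp.x_bounds ht i).1 (hp.x_bounds ht i).2
        have e2 : |y i - x t i| = θ * |(I.aStar i : ℝ) - b i| := by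
          simp only [hy, add_sub_cancel_left, abs_mul, abs_of_pos hθ0]
        have e3 := hp.log_mul_beta_le ht.le i
        have e4 : 0 ≤ beta q ε T a l x t i := beta_nonneg ..
        have e5 := mul_le_mul_of_nonneg_left e1 e4
        have e6 : beta q ε T a l x t i * (2 * (maxPlays I.A i / (1 / 2)) * Real.log T *
            |y i - x t i|) ≤
            θ * (4 * maxPlays I.A i * (3 / 2 * Real.log T + √(t * Real.log T)) * I.Wr) := by
          rw [e2]
          calc _ = θ * (4 * maxPlays I.A i * (Real.log T * beta q ε T a l x t i) *
                |(I.aStar i : ℝ) - b i|) := by ring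
            _ ≤ _ := by
                gcongr
                exact hdiff i
        have e7 : q t i * ((I.aStar i : ℝ) - b i) ≤ maxPlays I.A i := by
          obtain ⟨q0, q1⟩ := hp.q_mem t ht.le i
          have b0 : (0 : ℝ) ≤ b i := by positivity
          have : (I.aStar i : ℝ) ≤ maxPlays I.A i := by exact_mod_cast I.aStar_le i
          nlinarith
        have e8 : (cumLoss q a l x t i - t * I.mean i) * ((I.aStar i : ℝ) - b i) ≤
            c * t * |(b i : ℝ) - I.aStar i| := by
          refine (le_abs_self _).trans ?_
          rw [abs_mul, abs_sub_comm (I.aStar i : ℝ)]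
          exact mul_le_mul_of_nonneg_right (hconc i hi) (abs_nonneg _)
        have e9 : y i = x t i + θ * ((I.aStar i : ℝ) - b i) := rfl
        rw [mul_sub] at e5
        have e10 := mul_le_mul_of_nonneg_left (add_le_add e7 e8) hθ0.le
        have e11 : (q t i + cumLoss q a l x t i) * (y i - x t i) = θ * (
          q t i * ((I.aStar i : ℝ) - b i) + (cumLoss q a l x t i - t * I.mean i) *
          ((I.aStar i : ℝ) - b i)) + θ * (t * I.mean i * ((I.aStar i : ℝ) - b i)) := by
          rw [e9]; ring
        linarith
      · rw [hyne i hi, hface i hi]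
        simp only [sub_self, mul_zero, abs_zero, add_zero]
        have : 0 ≤ √(t * Real.log T) := Real.sqrt_nonneg _
        positivity
    have hsum := Finset.sum_le_sum (s := Finset.univ) fun i _ => key i
    simp only [Finset.sum_sub_distrib, Finset.sum_add_distrib, ← Finset.mul_sum,
      ← Finset.sum_mul] at hsum
    have e1 : ∑ i, (t : ℝ) * I.mean i * ((I.aStar i : ℝ) - b i) = - (t * I.gap b) := by
      rw [Instance.gap_eq, Finset.mul_sum, ← Finset.sum_neg_distrib]
      exact Finset.sum_congr rfl fun i _ => by ring
    have e2 := hgap b hb hne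
    have e3 := I.sum_abs_sub_le_Wr hb
    have hsumW : ∑ i, (maxPlays I.A i : ℝ) = I.Wr := rfl
    rw [e1, hsumW] at hsum
    have hct : c * t * ∑ i, |(b i : ℝ) - I.aStar i| ≤ t * (Δ / 2) := by
      obtain ⟨i, hi⟩ := Function.ne_iff.1 hne
      have hmid : I.IsMid i := by
        by_contra h
        exact hi (hface i h)
      have hc0 : 0 ≤ c * t := (abs_nonneg _).trans (hconc i hmid)
      calc _ ≤ c * t * I.Wr := by gcongr
        _ = t * (c * I.Wr) := by ring
        _ ≤ _ := by gcongr
    have e4 : (t : ℝ) * Δ ≤ t * I.gap b := by gcongr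
    have hneg : I.Wr + (-(t * I.gap b) + c * t * ∑ i, |(b i : ℝ) - I.aStar i|) +
        4 * I.Wr * (3 / 2 * Real.log T + √(t * Real.log T)) * I.Wr < 0 := by nlinarith
    have := mul_neg_of_pos_of_neg hθ0 hneg
    linarith
  refine (I.optDist_le_sum h0 h1 h2).trans ?_
  rw [I.faceDist_eq_sum h1 h2, Finset.mul_sum]
  apply Finset.sum_le_sum
  intro b hb
  by_cases hne : b = I.aStar
  · have : I.faceDist (fun i => (b i : ℝ)) = 0 := by
      subst hne
      unfold Instance.faceDist
      apply Finset.sum_eq_zero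
      intro i _
      split_ifs with h1 h2
      · simp [h1]
      · simp [h2]
      · rfl
    rw [this, hne]; simp
  · by_cases hface : ∀ i, ¬ I.IsMid i → b i = I.aStar i
    · rw [hzero b hb hne hface]; simp
    · have e1 := I.one_le_faceDist hb hface
      have e2 := I.sum_abs_sub_le_Wr hb
      have e3 := I.Wr_nonneg
      have e4 := h0 b hb
      calc _ ≤ δ b * I.Wr := by gcongr
        _ ≤ δ b * I.Wr * I.faceDist (fun i => b i) := le_mul_of_one_le_right (by positivity) e1
        _ = _ := by ring

end IsPath

/-! ### The cost of a block of rounds -/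

section Blocks

variable {d : ℕ} (I : Instance d)

/-- The estimation error of the loss of arm `i`, truncated to the rounds in which `x_i` is bounded
away from `0` and the estimate is therefore bounded. -/
noncomputable def noise (q : ℕ → Fin d → ℝ) (a : ℕ → Fin d → ℕ) (l : ℕ → LossArray I.A)
    (x : ℕ → Fin d → ℝ) (t : ℕ) (i : Fin d) : ℝ :=
  if 1 / 2 ≤ x t i then lossEst q a l x t i - I.mean i else 0

/-- The constant in the bound on the distance between consecutive points. -/
noncomputable def moveConst (ρ : ℝ) : ℝ := I.Wr * √(8 * (1 / ρ + 1) * I.Wr)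

lemma moveConst_nonneg (ρ : ℝ) : 0 ≤ moveConst I ρ :=
  mul_nonneg I.Wr_nonneg (Real.sqrt_nonneg _)

/-- The expected loss of the arms that `a*` plays moves by this amount over a block; these terms
telescope when the blocks start at every round. -/
noncomputable def driftTerm (x : ℕ → Fin d → ℝ) (t e : ℕ) : ℝ :=
  ∑ i, if I.aStar i = 0 then 0 else ∑ s ∈ Finset.Ico t e, I.mean i * (x s i - x e i)

/-- A sum of martingale differences, given the past of round `t`. -/
noncomputable def noiseTerm (q : ℕ → Fin d → ℝ) (a : ℕ → Fin d → ℕ) (l : ℕ → LossArray I.A)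
    (x : ℕ → Fin d → ℝ) (t e : ℕ) : ℝ :=
  ∑ i, if I.aStar i = 0 then 0 else
    ∑ s ∈ Finset.Ico t e, noise I q a l x s i * (x s i - x t i)

/-- The part of the cost of a block that stems from the growth of the regularization parameters of
the arms whose number of plays in `a*` is extremal. -/
noncomputable def growthTerm (ρ : ℝ) (q : ℕ → Fin d → ℝ) (ε : Fin d → ℝ) (T : ℕ)
    (a : ℕ → Fin d → ℕ) (l : ℕ → LossArray I.A) (x : ℕ → Fin d → ℝ) (t e : ℕ) : ℝ :=
  ∑ i, if I.IsMid i then 0 else (3 * ((1 + ρ) / ρ) + 3) * maxPlays I.A i * Real.log T *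
    (beta q ε T a l x e i - beta q ε T a l x t i)

end Blocks

namespace IsPath

variable {d : ℕ} {I : Instance d} {ρ : ℝ} {ε : Fin d → ℝ} {T : ℕ} {q : ℕ → Fin d → ℝ}
  {a : ℕ → Fin d → ℕ} {l : ℕ → LossArray I.A} {x : ℕ → Fin d → ℝ} (hp : IsPath I.A ρ ε T q a l x)

include hp

lemma abs_sub_succ_le {t : ℕ} (ht : t + 1 < T) (i : Fin d) :
    |x t i - x (t + 1) i| ≤ moveConst I ρ / √(Real.log T) := by
  have h1 := hp.sq_sub_succ_le ht i
  have hn := hp.n_cast_pos i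
  have hρ := hp.rho_pos
  have h2 := Real.abs_le_sqrt h1
  rw [Real.sqrt_div' _ hp.log_pos.le] at h2
  have h3 : x t i - x (t + 1) i =
      maxPlays I.A i * (x t i / maxPlays I.A i - x (t + 1) i / maxPlays I.A i) := by field_simp
  rw [h3, abs_mul, abs_of_pos hn]
  unfold moveConst
  rw [mul_div_assoc]
  exact mul_le_mul (I.n_le_Wr i) h2 (abs_nonneg _) I.Wr_nonneg

lemma abs_sub_le {t e B : ℕ} (hte : t ≤ e) (hB : e ≤ t + B) (he : e < T) (i : Fin d) :
    |x t i - x e i| ≤ B * (moveConst I ρ / √(Real.log T)) := by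
  have hm := moveConst_nonneg I ρ
  have h1 : |x t i - x e i| ≤ (e - t : ℕ) * (moveConst I ρ / √(Real.log T)) := by
    induction e, hte using Nat.le_induction with
    | base => simp
    | succ k hk ih =>
      have e1 := ih (by omega) (by omega)
      have e2 := hp.abs_sub_succ_le he i
      have e3 : ((k + 1 - t : ℕ) : ℝ) = (k - t : ℕ) + 1 := by
        rw [Nat.succ_sub hk]; push_cast; ring
      rw [e3]
      have := _root_.abs_sub_le (x t i) (x k i) (x (k + 1) i)
      linarith
  refine h1.trans (mul_le_mul_of_nonneg_right ?_ (by positivity))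
  exact_mod_cast (by omega : e - t ≤ B)

/-- In a block that starts close to `a*`, the arms of `a*` stay away from `0`. -/
lemma half_le {t s B : ℕ} (hts : t ≤ s) (hB : s ≤ t + B) (hs : s < T)
    (hclose : I.optDist (x t) ≤ 1 / 8)
    (hmove : I.Wr * (B * (moveConst I ρ / √(Real.log T))) ≤ 1 / 8) {i : Fin d}
    (hi : I.aStar i ≠ 0) : 1 / 2 ≤ x s i := by
  have h1 := abs_le.1 (hp.abs_sub_le hts hB hs i)
  have h2 := abs_le.1 ((I.abs_sub_le_optDist (x t) i).trans hclose)
  have h3 : (1 : ℝ) ≤ I.aStar i := by exact_mod_cast Nat.one_le_iff_ne_zero.2 hi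
  have h4 := I.one_le_Wr i
  have h5 : 0 ≤ B * (moveConst I ρ / √(Real.log T)) := by
    have := moveConst_nonneg I ρ
    positivity
  nlinarith

lemma optDist_le_of_block {t s B : ℕ} (hts : t ≤ s) (hB : s ≤ t + B) (hs : s < T)
    (hclose : I.optDist (x t) ≤ 1 / 8)
    (hmove : I.Wr * (B * (moveConst I ρ / √(Real.log T))) ≤ 1 / 8) :
    I.optDist (x s) ≤ 1 / 4 := by
  have h0 : 0 ≤ B * (moveConst I ρ / √(Real.log T)) := by
    have := moveConst_nonneg I ρ
    positivity
  have h1 : I.optDist (x s) ≤ I.optDist (x t) + ∑ _i : Fin d,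
      B * (moveConst I ρ / √(Real.log T)) := by
    unfold Instance.optDist
    rw [← Finset.sum_add_distrib]
    apply Finset.sum_le_sum
    intro i _
    have e1 := hp.abs_sub_le hts hB hs i
    have e2 := _root_.abs_sub_le (x s i) (x t i) (I.aStar i)
    rw [abs_sub_comm (x s i) (x t i)] at e2
    linarith
  simp only [Finset.sum_const, Finset.card_univ, Fintype.card_fin, nsmul_eq_mul] at h1
  have h2 := mul_le_mul_of_nonneg_right I.card_le_Wr h0
  linarith

lemma abs_lossEst_sub_le {t : ℕ} (ht : t < T) {i : Fin d} (hx : 1 / 2 ≤ x t i) :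
    |lossEst q a l x t i| ≤ 3 * maxPlays I.A i ∧
      |lossEst q a l x t i - I.mean i| ≤ 3 * maxPlays I.A i := by
  have hn := I.one_le_n i
  obtain ⟨q0, q1⟩ := hp.q_mem t ht.le i
  obtain ⟨m0, m1⟩ := I.mean_mem i
  have h1 := hp.abs_avgLoss_sub_le ht i
  have h2 : |(a t i : ℝ) / x t i * (avgLoss (a t) (l t) i - q t i)| ≤ 2 * maxPlays I.A i := by
    rw [abs_mul, abs_of_nonneg (by have := (hp.x_bounds ht i).1; positivity)]
    calc _ ≤ (maxPlays I.A i : ℝ) / (1 / 2) * 1 := by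
          gcongr
          exact_mod_cast le_maxPlays (hp.a_mem t ht) i
      _ = _ := by ring
  have h3 := abs_le.1 h2
  unfold lossEst
  constructor <;> rw [abs_le] <;> constructor <;> linarith

lemma abs_noise_le {t : ℕ} (ht : t < T) (i : Fin d) : |noise I q a l x t i| ≤ 3 * I.Wr := by
  unfold noise
  split_ifs with h
  · exact (hp.abs_lossEst_sub_le ht h).2.trans (by linarith [I.n_le_Wr i])
  · simpa using I.Wr_nonneg

/-- Away from `0` the increments of the squared regularization parameters are of order
`1 / log T`. -/
lemma alpha_le_of_half {t : ℕ} (ht : t < T) {i : Fin d} (hx : 1 / 2 ≤ x t i) :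
    alpha q T a l x t i ≤ 8 * (maxPlays I.A i : ℝ) ^ 2 / Real.log T := by
  have hn := hp.n_cast_pos i
  have hL := hp.log_pos
  have h1 := hp.alpha_le_of_w ht i (c := 1 / 2 / maxPlays I.A i) (by positivity) (by gcongr)
  refine h1.trans ?_
  have h2 := hp.w_pos ht i
  have h3 : 2 * (1 - x t i / maxPlays I.A i) ≤ 2 := by linarith
  calc _ ≤ 2 / ((1 / 2 / maxPlays I.A i) ^ 2 * Real.log T) := by gcongr
    _ = _ := by field_simp; ring

lemma log_mul_beta_sub_le_of_half {t e B : ℕ} (hte : t ≤ e) (hB : e ≤ t + B) (he : e ≤ T)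
    {i : Fin d} (hx : ∀ s ∈ Finset.Ico t e, 1 / 2 ≤ x s i) :
    Real.log T * (beta q ε T a l x e i - beta q ε T a l x t i) ≤
      4 * B * (maxPlays I.A i : ℝ) ^ 2 / Real.log T := by
  have hL := hp.log_pos
  have h1 := hp.log_mul_beta_sub_le hte he i
  have h2 : ∑ s ∈ Finset.Ico t e, alpha q T a l x s i ≤
      B * (8 * (maxPlays I.A i : ℝ) ^ 2 / Real.log T) := by
    calc _ ≤ ∑ _s ∈ Finset.Ico t e, 8 * (maxPlays I.A i : ℝ) ^ 2 / Real.log T :=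
          Finset.sum_le_sum fun s hs => hp.alpha_le_of_half
            (by simp only [Finset.mem_Ico] at hs; omega) (hx s hs)
      _ = (e - t : ℕ) * (8 * (maxPlays I.A i : ℝ) ^ 2 / Real.log T) := by simp
      _ ≤ _ := by
        gcongr
        omega
  calc _ ≤ B * (8 * (maxPlays I.A i : ℝ) ^ 2 / Real.log T) / 2 := by linarith
    _ = _ := by ring

/-- If no arm outside `a*` is played in a block that starts close to `a*`, then the coordinates
of these arms change by a factor close to `1`. -/
lemma barrierDiv_le_of_no_play {t e B : ℕ} (hB1 : 1 ≤ B) (hte : t ≤ e) (hB : e ≤ t + B)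
    (he : e < T) (hclose : I.optDist (x t) ≤ 1 / 8)
    (hmove : I.Wr * (B * (moveConst I ρ / √(Real.log T))) ≤ 1 / 8)
    (hplay : ∀ i, I.aStar i = 0 → ∀ s ∈ Finset.Ico t e, a s i = 0) (j : Fin d) :
    barrierDiv (x e j / x t j) ≤
      I.Wr * (4 * I.Wr * B * (B * moveConst I ρ) + 12 * B * I.Wr ^ 4) / √(Real.log T) := by
  have ht : t < T := by omega
  have hL := hp.two_le_log
  have hL0 := hp.log_pos
  have hm := moveConst_nonneg I ρ
  have hB1' : (1 : ℝ) ≤ B := by exact_mod_cast hB1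
  have hsq : √(Real.log T) ≤ Real.log T := by
    rw [Real.sqrt_le_left hL0.le]; nlinarith
  have hsq0 : 0 < √(Real.log T) := Real.sqrt_pos.2 hL0
  have h1 := (hp.sum_regDiv_le ht (hp.x_mem e he)).trans (hp.objective_sub_le hte he)
  have hnn : ∀ k, 0 ≤ beta q ε T a l x t k * (maxPlays I.A k *
      regDiv (Real.log T) (x e k / maxPlays I.A k) (x t k / maxPlays I.A k)) := fun k =>
    mul_nonneg (beta_nonneg ..) (mul_nonneg (hp.n_cast_pos k).le
      (regDiv_nonneg hL0.le (hp.w_pos he k) (hp.w_le he k) (hp.w_pos ht k) (hp.w_le ht k)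
        (fun h => hp.eq_n_of_eq_n ht (hp.x_mem _ he) h)))
  have h2 := (Finset.single_le_sum (fun k _ => hnn k) (Finset.mem_univ j)).trans h1
  have h3 : barrierDiv (x e j / x t j) ≤ beta q ε T a l x t j * (maxPlays I.A j *
      regDiv (Real.log T) (x e j / maxPlays I.A j) (x t j / maxPlays I.A j)) := by
    have e1 : x e j / maxPlays I.A j / (x t j / maxPlays I.A j) = x e j / x t j := by
      have := hp.n_cast_pos j
      field_simp
    have e2 := entropyDiv_nonneg (hp.w_le he j) (hp.w_le ht j)
      (fun h => hp.eq_n_of_eq_n ht (hp.x_mem _ he) h)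
    have e3 := barrierDiv_nonneg (r := x e j / x t j)
      (div_pos (hp.x_bounds he j).1 (hp.x_bounds ht j).1)
    unfold regDiv
    rw [e1, ← mul_assoc]
    have e4 : 1 ≤ beta q ε T a l x t j * maxPlays I.A j :=
      one_le_mul_of_one_le_of_one_le (hp.one_le_beta ht.le j) (hp.one_le_n_cast j)
    have e5 : 0 ≤ Real.log T *
      entropyDiv (x e j / maxPlays I.A j) (x t j / maxPlays I.A j) := mul_nonneg hL0.le e2
    exact (le_add_of_nonneg_right e5).trans (le_mul_of_one_le_left (add_nonneg e3 e5) e4)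
  refine h3.trans (h2.trans ?_)
  have key : ∀ i, (∑ s ∈ Finset.Ico t e, lossEst q a l x s i + q e i - q t i) *
      (x t i - x e i) + (beta q ε T a l x e i - beta q ε T a l x t i) *
          (phi (maxPlays I.A i) T (x t i) - phi (maxPlays I.A i) T (x e i)) ≤
      (4 * I.Wr * B * (B * moveConst I ρ) + 12 * B * I.Wr ^ 4) / √(Real.log T) := by
    intro i
    have hW := I.one_le_Wr i
    have hnW := I.n_le_Wr i
    have hn := I.one_le_n i
    have m1 := hp.abs_sub_le hte hB he i
    have lin : ∀ c : ℝ, |c| ≤ 4 * I.Wr * B → c * (x t i - x e i) ≤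
        4 * I.Wr * B * (B * moveConst I ρ) / √(Real.log T) := by
      intro c hc
      refine (le_abs_self _).trans ?_
      rw [abs_mul, mul_div_assoc, mul_div_assoc]
      exact mul_le_mul hc m1 (abs_nonneg _) (by positivity)
    rw [add_div]
    by_cases hi : I.aStar i = 0
    · have hb := beta_eq_of_no_play (q := q) (ε := ε) (T := T) (l := l) (x := x) hte i (hplay i hi)
      have hq := hp.q_eq_of_no_play hte he.le i (hplay i hi)
      rw [hb, sub_self, zero_mul, add_zero]
      have e1 : |∑ s ∈ Finset.Ico t e, lossEst q a l x s i + q e i - q t i| ≤ 4 * I.Wr * B := by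
        rw [hq, add_sub_cancel_right]
        calc _ ≤ ∑ s ∈ Finset.Ico t e, |lossEst q a l x s i| := Finset.abs_sum_le_sum_abs _ _
          _ ≤ ∑ s ∈ Finset.Ico t e, (1 : ℝ) := by
              apply Finset.sum_le_sum
              intro s hs
              have hs' : s < T := by simp only [Finset.mem_Ico] at hs; omega
              unfold lossEst
              rw [hplay i hi s hs]
              simp only [Nat.cast_zero, zero_div, zero_mul, add_zero]
              obtain ⟨q0, q1⟩ := hp.q_mem s hs'.le i
              rw [abs_of_nonneg q0]; exact q1
          _ = (e - t : ℕ) := by simp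
          _ ≤ (B : ℝ) := by exact_mod_cast (by omega : e - t ≤ B)
          _ ≤ _ := le_mul_of_one_le_left (by linarith) (by linarith)
      have := lin _ e1
      have : 0 ≤ 12 * B * I.Wr ^ 4 / √(Real.log T) := by positivity
      linarith
    · have hhalf : ∀ s, t ≤ s → s ≤ e → 1 / 2 ≤ x s i := fun s h1 h2 =>
        hp.half_le h1 (by omega) (by omega) hclose hmove hi
      have e1 : |∑ s ∈ Finset.Ico t e, lossEst q a l x s i + q e i - q t i| ≤ 4 * I.Wr * B := by
        have e2 : |∑ s ∈ Finset.Ico t e, lossEst q a l x s i| ≤ B * (3 * I.Wr) := by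
          calc _ ≤ ∑ s ∈ Finset.Ico t e, |lossEst q a l x s i| := Finset.abs_sum_le_sum_abs _ _
            _ ≤ ∑ s ∈ Finset.Ico t e, (3 * I.Wr) := by
                apply Finset.sum_le_sum
                intro s hs
                simp only [Finset.mem_Ico] at hs
                refine (hp.abs_lossEst_sub_le (by omega) (hhalf s hs.1 hs.2.le)).1.trans ?_
                linarith
            _ = (e - t : ℕ) * (3 * I.Wr) := by simp
            _ ≤ _ := by
                gcongr
                omega
        obtain ⟨q0, q1⟩ := hp.q_mem t ht.le i
        obtain ⟨q2, q3⟩ := hp.q_mem e he.le i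
        have e3 := abs_le.1 e2
        have : (1 : ℝ) ≤ I.Wr * B := one_le_mul_of_one_le_of_one_le hW hB1'
        rw [abs_le]; constructor <;> linarith
      have e2 := lin _ e1
      have e3 := hp.log_mul_beta_sub_le_of_half hte hB he.le (i := i) (fun s hs => by
        simp only [Finset.mem_Ico] at hs; exact hhalf s hs.1 hs.2.le)
      have e4 : 0 ≤ beta q ε T a l x e i - beta q ε T a l x t i :=
        sub_nonneg.2 (hp.beta_mono hte he.le i)
      have e5 : 0 ≤ phi (maxPlays I.A i) T (x e i) :=
        phi_nonneg (hp.n_pos i) (hp.x_bounds he i).1 (hp.x_bounds he i).2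
      have e6 : phi (maxPlays I.A i) T (x t i) ≤ 3 * (maxPlays I.A i : ℝ) ^ 2 * Real.log T := by
        have f1 := phi_le (T := T) (hp.n_pos i) (x := x t i) (c := 1 / 2 / maxPlays I.A i)
          (by positivity) (by have := hhalf t le_rfl hte; gcongr) (hp.x_bounds ht i).2
        have f2 : - Real.log (1 / 2 / (maxPlays I.A i : ℝ)) ≤ 2 * maxPlays I.A i := by
          rw [← Real.log_inv]
          have : (1 / 2 / (maxPlays I.A i : ℝ))⁻¹ = 2 * maxPlays I.A i := by
            field_simp
          rw [this]
          linarith [Real.log_le_sub_one_of_pos (x := 2 * (maxPlays I.A i : ℝ)) (by positivity)]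
        refine f1.trans ?_
        have f3 : - Real.log (1 / 2 / (maxPlays I.A i : ℝ)) + Real.log T ≤
            3 * maxPlays I.A i * Real.log T := by
          linarith [mul_le_mul_of_nonneg_right hn hL0.le,
            mul_le_mul_of_nonneg_left hL (zero_le_one.trans hn)]
        linarith [mul_le_mul_of_nonneg_left f3 (zero_le_one.trans hn)]
      have e7 : (beta q ε T a l x e i - beta q ε T a l x t i) *
          (phi (maxPlays I.A i) T (x t i) - phi (maxPlays I.A i) T (x e i)) ≤
          12 * B * I.Wr ^ 4 / √(Real.log T) := by
        calc _ ≤ (beta q ε T a l x e i - beta q ε T a l x t i) *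
              (3 * (maxPlays I.A i : ℝ) ^ 2 * Real.log T) := by gcongr; linarith
          _ = 3 * (maxPlays I.A i : ℝ) ^ 2 *
              (Real.log T * (beta q ε T a l x e i - beta q ε T a l x t i)) := by ring
          _ ≤ 3 * (maxPlays I.A i : ℝ) ^ 2 * (4 * B * (maxPlays I.A i : ℝ) ^ 2 / Real.log T) := by
              gcongr
          _ = 12 * B * (maxPlays I.A i : ℝ) ^ 4 / Real.log T := by ring
          _ ≤ _ := by gcongr
      linarith
  calc _ ≤ ∑ _i : Fin d,
        (4 * I.Wr * B * (B * moveConst I ρ) + 12 * B * I.Wr ^ 4) / √(Real.log T) :=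
        Finset.sum_le_sum fun i _ => key i
    _ = d * ((4 * I.Wr * B * (B * moveConst I ρ) + 12 * B * I.Wr ^ 4) / √(Real.log T)) := by simp
    _ ≤ I.Wr * ((4 * I.Wr * B * (B * moveConst I ρ) + 12 * B * I.Wr ^ 4) / √(Real.log T)) := by
        have := I.Wr_nonneg
        gcongr
        exact I.card_le_Wr
    _ = _ := by ring

set_option maxHeartbeats 1000000 in
/-- On a good block, only the telescoping drift, the martingale `noiseTerm` and the accumulated
noise, times the distance to `a*`, remain of the cost of the arms in the interior of their range:
the whole block is treated as one step of the algorithm. -/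
lemma sum_stepCost_good_block {u : Fin d → ℝ}
    (hphi : ∀ i, phi (maxPlays I.A i) T (u i) ≤ 3 * maxPlays I.A i * Real.log T)
    (hu_mid : ∀ i, I.IsMid i → u i ∈ Set.Icc (1 / 2 : ℝ) (maxPlays I.A i - 1 / 2))
    {t e B : ℕ} (hB1 : 1 ≤ B) (hte : t ≤ e) (hB : e ≤ t + B) (he : e < T)
    (hclose : I.optDist (x t) ≤ 1 / 8)
    (hmove : I.Wr * (B * (moveConst I ρ / √(Real.log T))) ≤ 1 / 8)
    (hplay : ∀ i, I.aStar i = 0 → ∀ s ∈ Finset.Ico t e, a s i = 0)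
    (hratio : I.Wr * (4 * I.Wr * B * (B * moveConst I ρ) + 12 * B * I.Wr ^ 4) / √(Real.log T) ≤
      (1 / (3 * B)) ^ 2)
    (hlarge : (4 * B * I.Wr ^ 2 + 1) * I.Wr ^ 2 + 16 * B * I.Wr ^ 5 ≤ Real.log T)
    (hlarge' : 32 * B * I.Wr ^ 4 ≤ Real.log T)
    (hface : I.optDist (x e) ≤ I.Wr * I.faceDist (x e)) :
    ∑ s ∈ Finset.Ico t e, stepCost q ε T a l x u s ≤
      growthTerm I ρ q ε T a l x t e + driftTerm I x t e + noiseTerm I q a l x t e +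
      I.Wr * (3 * (∑ i, |∑ s ∈ Finset.Ico t e, noise I q a l x s i|) + 9) * I.optDist (x t) +
      I.optDist u := by
  have ht : t < T := by omega
  have hL := hp.two_le_log
  have hL0 := hp.log_pos
  have hρ := hp.rho_pos
  have hB1' : (1 : ℝ) ≤ B := by exact_mod_cast hB1
  have hDt := I.optDist_nonneg (x t)
  have hDu := I.optDist_nonneg u
  rcases Nat.eq_zero_or_pos d with rfl | hd
  · have h1 := sum_stepCost_block q ε T a l x u hte
    have h2 := hp.x_min t ht (hp.x_mem e he)
    simp only [Set.mem_ofPred_eq] at h2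
    simp only [Finset.univ_eq_empty, Finset.sum_empty] at h1
    simp only [growthTerm, driftTerm, noiseTerm, Finset.univ_eq_empty, Finset.sum_empty]
    have : I.Wr = 0 := by simp [Instance.Wr]
    rw [h1, this]; linarith
  have hW : 1 ≤ I.Wr := I.one_le_Wr ⟨0, hd⟩
  set m := ∑ i, |∑ s ∈ Finset.Ico t e, noise I q a l x s i| with hm
  have hm0 : 0 ≤ m := Finset.sum_nonneg fun _ _ => abs_nonneg _
  have hmW : m ≤ 3 * B * I.Wr ^ 2 := by
    calc m ≤ ∑ _i : Fin d, B * (3 * I.Wr) := by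
          apply Finset.sum_le_sum
          intro i _
          calc _ ≤ ∑ s ∈ Finset.Ico t e, |noise I q a l x s i| := Finset.abs_sum_le_sum_abs _ _
            _ ≤ ∑ _s ∈ Finset.Ico t e, 3 * I.Wr := Finset.sum_le_sum fun s hs =>
                hp.abs_noise_le (by simp only [Finset.mem_Ico] at hs; omega) i
            _ = (e - t : ℕ) * (3 * I.Wr) := by simp
            _ ≤ _ := by
                gcongr
                omega
      _ = d * (B * (3 * I.Wr)) := by simp
      _ ≤ I.Wr * (B * (3 * I.Wr)) := by
          gcongr
          exact I.card_le_Wr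
      _ = _ := by ring
  set c := 16 * B * I.Wr ^ 3 / Real.log T with hc
  have hc0 : 0 ≤ c := by positivity
  have hcW : 2 * I.Wr * c ≤ 1 := by
    rw [hc]
    have : 2 * I.Wr * (16 * B * I.Wr ^ 3 / Real.log T) = 32 * B * I.Wr ^ 4 / Real.log T := by
      ring
    rw [this, div_le_one hL0]; exact hlarge'
  have hc1 : c ≤ 1 := by linarith [mul_le_mul_of_nonneg_right hW hc0]
  -- the relative change of the coordinates of unplayed arms
  have hJ : ∀ j, I.aStar j = 0 → ∀ s, t ≤ s → s ≤ e → |x s j - x t j| ≤ x t j / B := by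
    intro j hj s hts hse
    have hx := (hp.x_bounds ht j).1
    have hxs := (hp.x_bounds (by omega : s < T) j).1
    have e1 := hp.barrierDiv_le_of_no_play hB1 hts (by omega : s ≤ t + B) (by omega) hclose hmove
      (fun i hi s' hs' => hplay i hi s' (by simp only [Finset.mem_Ico] at hs' ⊢; omega)) j
    have e2 := abs_one_sub_le_of_barrierDiv (div_pos hxs hx) (θ := 1 / (3 * B)) (by positivity)
      (by rw [div_le_div_iff₀ (by positivity) (by norm_num)]; linarith) (e1.trans hratio)
    have e3 : x s j - x t j = - (x t j * (1 - x s j / x t j)) := by field_simp; ring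
    rw [e3, abs_neg, abs_mul, abs_of_pos hx]
    calc _ ≤ x t j * (3 * (1 / (3 * B))) := by gcongr
      _ = _ := by field_simp
  -- the entropy divergence of the arms with `a*_i = n_i` is not spent on their own cost: it pays
  -- for the distance of the end point to the face, and through `hface` to `a*`
  set κ : Fin d → ℝ := fun i => if I.aStar i = maxPlays I.A i ∧ I.aStar i ≠ 0 then
    entropyDiv (x e i / maxPlays I.A i) (x t i / maxPlays I.A i) else 0 with hκ
  have hent : ∀ i, 0 ≤ entropyDiv (x e i / maxPlays I.A i) (x t i / maxPlays I.A i) := fun i =>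
    entropyDiv_nonneg (hp.w_le he i) (hp.w_le ht i) (fun h => hp.eq_n_of_eq_n ht (hp.x_mem _ he) h)
  have hκ0 : ∀ i, 0 ≤ κ i := by
    intro i; simp only [hκ]; split_ifs
    · exact hent i
    · exact le_rfl
  have hface_e : I.faceDist (x e) ≤ 2 * I.optDist (x t) + I.Wr * ∑ i, κ i := by
    have : I.faceDist (x e) ≤ 2 * I.faceDist (x t) + I.Wr * ∑ i, κ i := by
      unfold Instance.faceDist
      rw [Finset.mul_sum, Finset.mul_sum, ← Finset.sum_add_distrib]
      apply Finset.sum_le_sum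
      intro i _
      have hWκ : 0 ≤ I.Wr * κ i := mul_nonneg (by linarith) (hκ0 i)
      split_ifs with h1 h2
      · have e1 := abs_le.1 (hJ i h1 e hte le_rfl)
        have hx := (hp.x_bounds ht i).1
        have e2 : x t i / B ≤ x t i := div_le_self hx.le hB1'
        linarith
      · have e1 := one_sub_le_entropyDiv (hp.w_le he i) (hp.w_le ht i)
          (fun h => hp.eq_n_of_eq_n ht (hp.x_mem _ he) h)
        have hn := hp.n_cast_pos i
        have e2 : κ i = entropyDiv (x e i / maxPlays I.A i) (x t i / maxPlays I.A i) := by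
          simp only [hκ]; rw [if_pos ⟨h2, h1⟩]
        rw [← e2] at e1
        have e3 := mul_le_mul_of_nonneg_left e1 hn.le
        have e4 : maxPlays I.A i * (1 - x e i / maxPlays I.A i) = maxPlays I.A i - x e i := by
          field_simp
        have e5 : maxPlays I.A i * (κ i + 2 * (1 - x t i / maxPlays I.A i)) =
            maxPlays I.A i * κ i + 2 * (maxPlays I.A i - x t i) := by field_simp
        have e6 := mul_le_mul_of_nonneg_right (I.n_le_Wr i) (hκ0 i)
        linarith
      · linarith
    linarith [I.faceDist_le_optDist (z := x t)]
  have hDe : I.optDist (x e) ≤ 2 * I.Wr * I.optDist (x t) + I.Wr ^ 2 * ∑ i, κ i := by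
    have := mul_le_mul_of_nonneg_left hface_e (by linarith : 0 ≤ I.Wr)
    linarith
  rw [sum_stepCost_block q ε T a l x u hte]
  have hopt := hp.sum_regDiv_le ht (hp.x_mem e he)
  -- the summands of `growthTerm`, `driftTerm` and `noiseTerm`, kept opaque
  obtain ⟨gT, hgT⟩ : ∃ f : Fin d → ℝ, f = fun i => (if I.IsMid i then 0 else
        (3 * ((1 + ρ) / ρ) + 3) * maxPlays I.A i * Real.log T *
          (beta q ε T a l x e i - beta q ε T a l x t i)) := ⟨_, rfl⟩
  obtain ⟨dT, hdT⟩ : ∃ f : Fin d → ℝ, f = fun i => (if I.aStar i = 0 then 0 else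
        ∑ s ∈ Finset.Ico t e, I.mean i * (x s i - x e i)) := ⟨_, rfl⟩
  obtain ⟨nT, hnT⟩ : ∃ f : Fin d → ℝ, f = fun i => (if I.aStar i = 0 then 0 else
        ∑ s ∈ Finset.Ico t e, noise I q a l x s i * (x s i - x t i)) := ⟨_, rfl⟩
  have key : ∀ i, (∑ s ∈ Finset.Ico t e, lossEst q a l x s i * (x s i - x e i) -
          q t i * (x t i - x e i) +
        (beta q ε T a l x e i - beta q ε T a l x t i) *
          (phi (maxPlays I.A i) T (u i) - phi (maxPlays I.A i) T (x e i))) -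
        beta q ε T a l x t i * (maxPlays I.A i *
          regDiv (Real.log T) (x e i / maxPlays I.A i) (x t i / maxPlays I.A i)) ≤
      gT i + dT i + nT i + 4 * |x t i - I.aStar i| +
      (m + 1) * (|x t i - I.aStar i| + |x e i - I.aStar i|) +
      c * (|u i - I.aStar i| + |x e i - I.aStar i|) - Real.log T * κ i := by
    intro i
    have hgi := congrFun hgT i
    have hdi := congrFun hdT i
    have hni := congrFun hnT i
    rw [hgi, hdi, hni]
    have hn := hp.one_le_n_cast i
    have hreg : 0 ≤ beta q ε T a l x t i * (maxPlays I.A i *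
        regDiv (Real.log T) (x e i / maxPlays I.A i) (x t i / maxPlays I.A i)) :=
      mul_nonneg (beta_nonneg ..) (mul_nonneg (hp.n_cast_pos i).le
        (regDiv_nonneg hL0.le (hp.w_pos he i) (hp.w_le he i) (hp.w_pos ht i) (hp.w_le ht i)
          (fun h => hp.eq_n_of_eq_n ht (hp.x_mem _ he) h)))
    have a1 : 0 ≤ (m + 1) * (|x t i - I.aStar i| + |x e i - I.aStar i|) := by positivity
    have a2 : 0 ≤ c * (|u i - I.aStar i| + |x e i - I.aStar i|) := by positivity
    by_cases hi : I.aStar i = 0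
    · have hmid : ¬ I.IsMid i := fun h => by have := h.1; omega
      have hb := beta_eq_of_no_play (q := q) (ε := ε) (T := T) (l := l) (x := x) hte i (hplay i hi)
      have hκi : κ i = 0 := by simp only [hκ]; rw [if_neg (fun h => h.2 hi)]
      rw [if_neg hmid, if_pos hi, if_pos hi, hκi, hb]
      simp only [sub_self, mul_zero, zero_mul, add_zero, sub_zero, hi, Nat.cast_zero] at a1 a2 ⊢
      have hx := (hp.x_bounds ht i).1
      have diff : ∀ s, t ≤ s → s ≤ e → |x s i - x e i| ≤ 2 * (x t i / B) := by
        intro s h1 h2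
        have e1 := abs_le.1 (hJ i hi s h1 h2)
        have e2 := abs_le.1 (hJ i hi e hte le_rfl)
        rw [abs_le]; constructor <;> linarith
      have e1 : ∑ s ∈ Finset.Ico t e, lossEst q a l x s i * (x s i - x e i) ≤ 2 * x t i := by
        calc _ ≤ ∑ _s ∈ Finset.Ico t e, 2 * (x t i / B) := by
              apply Finset.sum_le_sum
              intro s hs
              have hs' := Finset.mem_Ico.1 hs
              unfold lossEst
              rw [hplay i hi s hs]
              simp only [Nat.cast_zero, zero_div, zero_mul, add_zero]
              obtain ⟨q0, q1⟩ := hp.q_mem s (by omega) i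
              have e2 := (abs_le.1 (diff s hs'.1 hs'.2.le)).2
              have e3 : 0 ≤ 2 * (x t i / B) := by positivity
              exact (mul_le_mul_of_nonneg_left e2 q0).trans (mul_le_of_le_one_left e3 q1)
          _ = (e - t : ℕ) * (2 * (x t i / B)) := by simp
          _ ≤ B * (2 * (x t i / B)) := by
              gcongr
              omega
          _ = 2 * x t i := by field_simp
      have e2 : - (q t i * (x t i - x e i)) ≤ 2 * x t i := by
        obtain ⟨q0, q1⟩ := hp.q_mem t ht.le i
        have e3 := (abs_le.1 (diff t le_rfl hte)).1
        have e4 : x t i / B ≤ x t i := div_le_self hx.le hB1'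
        have e5 : -(x t i - x e i) ≤ 2 * x t i := by linarith
        rw [← mul_neg]
        exact (mul_le_mul_of_nonneg_left e5 q0).trans (mul_le_of_le_one_left (by linarith) q1)
      rw [abs_of_pos hx] at a1 ⊢
      linarith
    · have hhalf : ∀ s, t ≤ s → s ≤ e → 1 / 2 ≤ x s i := fun s h1 h2 =>
        hp.half_le h1 (by omega) (by omega) hclose hmove hi
      rw [if_neg hi, if_neg hi]
      have e1 : ∑ s ∈ Finset.Ico t e, lossEst q a l x s i * (x s i - x e i) =
          ∑ s ∈ Finset.Ico t e, I.mean i * (x s i - x e i) +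
          ∑ s ∈ Finset.Ico t e, noise I q a l x s i * (x s i - x t i) +
          (∑ s ∈ Finset.Ico t e, noise I q a l x s i) * (x t i - x e i) := by
        rw [Finset.sum_mul, ← Finset.sum_add_distrib, ← Finset.sum_add_distrib]
        apply Finset.sum_congr rfl
        intro s hs
        have hs' := Finset.mem_Ico.1 hs
        unfold noise
        rw [if_pos (hhalf s hs'.1 hs'.2.le)]
        ring
      have e2 : (∑ s ∈ Finset.Ico t e, noise I q a l x s i) * (x t i - x e i) -
          q t i * (x t i - x e i) ≤
          (m + 1) * (|x t i - I.aStar i| + |x e i - I.aStar i|) := by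
        rw [← sub_mul]
        refine (le_abs_self _).trans ?_
        rw [abs_mul]
        obtain ⟨q0, q1⟩ := hp.q_mem t ht.le i
        have f1 : |∑ s ∈ Finset.Ico t e, noise I q a l x s i| ≤ m :=
          Finset.single_le_sum (f := fun i => |∑ s ∈ Finset.Ico t e, noise I q a l x s i|)
            (fun _ _ => abs_nonneg _) (Finset.mem_univ i)
        have f2 := abs_le.1 f1
        apply mul_le_mul _ _ (abs_nonneg _) (by linarith)
        · rw [abs_le]; constructor <;> linarith
        · have := _root_.abs_sub_le (x t i) (I.aStar i) (x e i)
          rwa [abs_sub_comm (I.aStar i : ℝ)] at this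
      have e4 : 0 ≤ beta q ε T a l x e i - beta q ε T a l x t i :=
        sub_nonneg.2 (hp.beta_mono hte he.le i)
      by_cases hmid : I.IsMid i
      · have hκi : κ i = 0 := by
          simp only [hκ]; rw [if_neg (fun h => hmid.2.ne h.1)]
        rw [if_pos hmid, hκi, mul_zero, sub_zero]
        have e3 := hp.log_mul_beta_sub_le_of_half hte hB he.le (i := i) (fun s hs => by
          simp only [Finset.mem_Ico] at hs; exact hhalf s hs.1 hs.2.le)
        have e5 := phi_sub_le_mul_abs (T := T) (hp.n_pos i) (c := 1 / 2) (by norm_num)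
          (by linarith) (hu_mid i hmid) (hp.x_bounds he i).1 (hp.x_bounds he i).2
        have e6 : |u i - x e i| ≤ |u i - I.aStar i| + |x e i - I.aStar i| := by
          have := _root_.abs_sub_le (u i) (I.aStar i) (x e i)
          rwa [abs_sub_comm (I.aStar i : ℝ)] at this
        have e7 : (beta q ε T a l x e i - beta q ε T a l x t i) *
            (phi (maxPlays I.A i) T (u i) - phi (maxPlays I.A i) T (x e i)) ≤
            c * (|u i - I.aStar i| + |x e i - I.aStar i|) := by
          calc _ ≤ (beta q ε T a l x e i - beta q ε T a l x t i) *
                (2 * (maxPlays I.A i / (1 / 2)) * Real.log T * |u i - x e i|) := by gcongr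
            _ = 4 * maxPlays I.A i *
                (Real.log T * (beta q ε T a l x e i - beta q ε T a l x t i)) * |u i - x e i| := by
                ring
            _ ≤ 4 * maxPlays I.A i * (4 * B * (maxPlays I.A i : ℝ) ^ 2 / Real.log T) *
                (|u i - I.aStar i| + |x e i - I.aStar i|) := by gcongr
            _ = 16 * B * (maxPlays I.A i : ℝ) ^ 3 / Real.log T *
                (|u i - I.aStar i| + |x e i - I.aStar i|) := by ring
            _ ≤ _ := by
                rw [hc]
                have := I.n_le_Wr i
                gcongr
        have a3 : 0 ≤ 4 * |x t i - I.aStar i| := by positivity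
        linarith
      · rw [if_neg hmid]
        have hful : I.aStar i = maxPlays I.A i := by
          have := I.aStar_le i
          by_contra hcon
          exact hmid ⟨by omega, by omega⟩
        have hκi : κ i = entropyDiv (x e i / maxPlays I.A i) (x t i / maxPlays I.A i) := by
          simp only [hκ]; rw [if_pos ⟨hful, hi⟩]
        have e5 : 0 ≤ phi (maxPlays I.A i) T (x e i) :=
          phi_nonneg (hp.n_pos i) (hp.x_bounds he i).1 (hp.x_bounds he i).2
        have e7 : (beta q ε T a l x e i - beta q ε T a l x t i) *
            (phi (maxPlays I.A i) T (u i) - phi (maxPlays I.A i) T (x e i)) ≤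
            (3 * ((1 + ρ) / ρ) + 3) * maxPlays I.A i * Real.log T *
            (beta q ε T a l x e i - beta q ε T a l x t i) := by
          calc _ ≤ (beta q ε T a l x e i - beta q ε T a l x t i) *
                (3 * maxPlays I.A i * Real.log T) := by
                gcongr
                linarith [hphi i]
            _ = 3 * maxPlays I.A i * Real.log T *
                (beta q ε T a l x e i - beta q ε T a l x t i) := by ring
            _ ≤ _ := by
                gcongr
                have : 0 ≤ (1 + ρ) / ρ := by positivity
                linarith
        have e8 : Real.log T * κ i ≤ beta q ε T a l x t i * (maxPlays I.A i *
            regDiv (Real.log T) (x e i / maxPlays I.A i) (x t i / maxPlays I.A i)) := by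
          rw [hκi, ← mul_assoc]
          unfold regDiv
          have f1 := barrierDiv_nonneg (r := x e i / maxPlays I.A i / (x t i / maxPlays I.A i))
            (div_pos (hp.w_pos he i) (hp.w_pos ht i))
          have f2 : 1 ≤ beta q ε T a l x t i * maxPlays I.A i :=
            one_le_mul_of_one_le_of_one_le (hp.one_le_beta ht.le i) (hp.one_le_n_cast i)
          have f3 := mul_nonneg hL0.le (hent i)
          exact (le_add_of_nonneg_left f1).trans
            (le_mul_of_one_le_left (add_nonneg f1 f3) f2)
        have a3 : 0 ≤ 4 * |x t i - I.aStar i| := by positivity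
        linarith
  refine (sub_le_sub_left hopt _).trans ?_
  rw [← Finset.sum_sub_distrib]
  refine (Finset.sum_le_sum fun i _ => key i).trans ?_
  simp only [Finset.sum_sub_distrib, Finset.sum_add_distrib, ← Finset.mul_sum]
  have hG : ∑ i, gT i = growthTerm I ρ q ε T a l x t e := by rw [hgT]; rfl
  have hD : ∑ i, dT i = driftTerm I x t e := by rw [hdT]; rfl
  have hN : ∑ i, nT i = noiseTerm I q a l x t e := by rw [hnT]; rfl
  have hO : ∀ z : Fin d → ℝ, ∑ i, |z i - I.aStar i| = I.optDist z := fun _ => rfl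
  rw [hG, hD, hN, hO, hO, hO]
  have hK0 : 0 ≤ ∑ i, κ i := Finset.sum_nonneg fun i _ => hκ0 i
  set Kp := ∑ i, κ i
  have f1 : (m + 1) * I.optDist (x e) ≤
      (m + 1) * (2 * I.Wr * I.optDist (x t) + I.Wr ^ 2 * Kp) := by gcongr
  have f2 : c * I.optDist (x e) ≤ c * (2 * I.Wr * I.optDist (x t) + I.Wr ^ 2 * Kp) := by gcongr
  have f3 : c * (I.Wr ^ 2) ≤ 16 * B * I.Wr ^ 5 := by
    rw [hc]
    have : 16 * B * I.Wr ^ 3 / Real.log T * I.Wr ^ 2 = 16 * B * I.Wr ^ 5 / Real.log T := by ring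
    rw [this]
    exact div_le_self (by positivity) (by linarith)
  have f4 : ((m + 1) * I.Wr ^ 2 + c * I.Wr ^ 2) * Kp ≤ Real.log T * Kp := by
    apply mul_le_mul_of_nonneg_right _ hK0
    have : (m + 1) * I.Wr ^ 2 ≤ (4 * B * I.Wr ^ 2 + 1) * I.Wr ^ 2 := by
      gcongr
      linarith [mul_nonneg (by linarith : (0 : ℝ) ≤ B) (sq_nonneg I.Wr)]
    linarith
  have f5 : c * (2 * I.Wr * I.optDist (x t)) ≤ I.optDist (x t) := by
    linarith [mul_le_mul_of_nonneg_right hcW hDt]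
  have f6 : c * I.optDist u ≤ I.optDist u := mul_le_of_le_one_left hDu hc1
  have f7 : (m + 1) * I.optDist (x t) ≤ I.Wr * ((m + 1) * I.optDist (x t)) :=
    le_mul_of_one_le_left (by positivity) hW
  have f8 : 5 * I.optDist (x t) ≤ I.Wr * (5 * I.optDist (x t)) :=
    le_mul_of_one_le_left (by positivity) hW
  have f9 : 0 ≤ I.Wr * I.optDist (x t) := by positivity
  linarith

end IsPath

/-! ### Summation over all blocks -/

section BlockSums

/-- Summing over all blocks of length `B` counts every round `B` times, except near the ends. -/
lemma mul_sum_le_sum_blocks {c : ℕ → ℝ} {K : ℝ} {N B : ℕ} (hBN : B ≤ N)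
    (hK : ∀ s < N, c s ≤ K) :
    B * ∑ s ∈ Finset.range N, c s ≤
      ∑ t ∈ Finset.range (N - B), ∑ s ∈ Finset.Ico t (t + B), c s + B * (B * K) := by
  have h1 : ∑ t ∈ Finset.range (N - B), ∑ s ∈ Finset.Ico t (t + B), c s =
      ∑ k ∈ Finset.range B, ∑ s ∈ Finset.Ico k (k + (N - B)), c s := by
    calc _ = ∑ t ∈ Finset.range (N - B), ∑ k ∈ Finset.range B, c (t + k) := by
          refine Finset.sum_congr rfl fun t _ => ?_
          rw [Finset.sum_Ico_eq_sum_range, Nat.add_sub_cancel_left]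
      _ = ∑ k ∈ Finset.range B, ∑ t ∈ Finset.range (N - B), c (t + k) := Finset.sum_comm
      _ = _ := by
          refine Finset.sum_congr rfl fun k _ => ?_
          rw [Finset.sum_Ico_eq_sum_range, Nat.add_sub_cancel_left]
          exact Finset.sum_congr rfl fun t _ => by rw [add_comm]
  have h2 : ∀ k ∈ Finset.range B, ∑ s ∈ Finset.range N, c s ≤
      ∑ s ∈ Finset.Ico k (k + (N - B)), c s + B * K := by
    intro k hk
    rw [Finset.mem_range] at hk
    rw [← Finset.sum_range_add_sum_Ico _ (by omega : k + (N - B) ≤ N),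
      ← Finset.sum_range_add_sum_Ico _ (by omega : k ≤ k + (N - B))]
    have e1 : ∑ s ∈ Finset.range k, c s ≤ k * K := by
      calc _ ≤ ∑ _s ∈ Finset.range k, K := Finset.sum_le_sum fun s hs => hK s (by
            rw [Finset.mem_range] at hs; omega)
        _ = _ := by simp
    have e2 : ∑ s ∈ Finset.Ico (k + (N - B)) N, c s ≤ (B - k : ℕ) * K := by
      calc _ ≤ ∑ _s ∈ Finset.Ico (k + (N - B)) N, K := Finset.sum_le_sum fun s hs => hK s (by
            rw [Finset.mem_Ico] at hs; omega)
        _ = (N - (k + (N - B)) : ℕ) * K := by simp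
        _ = _ := by congr 2; omega
    rw [Nat.cast_sub hk.le] at e2
    linarith
  have h3 := Finset.sum_le_sum h2
  rw [Finset.sum_const, Finset.card_range, nsmul_eq_mul, Finset.sum_add_distrib, ← h1,
    Finset.sum_const, Finset.card_range, nsmul_eq_mul] at h3
  exact h3

lemma sum_blocks_le_mul_sum {c : ℕ → ℝ} {N B : ℕ} (hBN : B ≤ N) (hc : ∀ s < N, 0 ≤ c s) :
    ∑ t ∈ Finset.range (N - B), ∑ s ∈ Finset.Ico t (t + B), c s ≤
      B * ∑ s ∈ Finset.range N, c s := by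
  have := mul_sum_le_sum_blocks (c := fun s => - c s) (K := 0) hBN
    (fun s hs => neg_nonpos.2 (hc s hs))
  simp only [Finset.sum_neg_distrib, mul_zero, add_zero, mul_neg] at this
  linarith

end BlockSums

section BlockCases

variable {d : ℕ} (I : Instance d)

/-- How large `log T` has to be for blocks of length `B`. -/
structure LargeLog (ρ : ℝ) (B : ℕ) (L : ℝ) : Prop where
  move : I.Wr * (B * (moveConst I ρ / √L)) ≤ 1 / 8
  ratio : I.Wr * (4 * I.Wr * B * (B * moveConst I ρ) + 12 * B * I.Wr ^ 4) / √L ≤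
      (1 / (3 * B)) ^ 2
  large : (4 * B * I.Wr ^ 2 + 1) * I.Wr ^ 2 + 16 * B * I.Wr ^ 5 ≤ L
  large' : 32 * B * I.Wr ^ 4 ≤ L

open Classical in
/-- The indicator that `z` is close to `a*`. -/
noncomputable def closeInd (z : Fin d → ℝ) : ℝ := if I.optDist z ≤ 1 / 8 then 1 else 0

open Classical in
/-- The indicator that the estimated losses before round `t` of the arms in the interior of their
range do not yet identify `a*` within its face. -/
noncomputable def tieInd (K c L : ℝ) (q : ℕ → Fin d → ℝ) (a : ℕ → Fin d → ℕ)
    (l : ℕ → LossArray I.A) (x : ℕ → Fin d → ℝ) (t : ℕ) : ℝ :=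
  if K * L ≤ t ∧ ∀ i, I.IsMid i → |cumLoss q a l x t i - t * I.mean i| ≤ c * t then 0 else 1

/-- The number of plays in `[t, e)` of arms that `a*` does not play. -/
def extraPlays (a : ℕ → Fin d → ℕ) (t e : ℕ) : ℝ :=
  ∑ s ∈ Finset.Ico t e, ∑ i, if I.aStar i = 0 then (a s i : ℝ) else 0

/-- `∑ alpha` over a block. -/
noncomputable def alphaSum (q : ℕ → Fin d → ℝ) (T : ℕ) (a : ℕ → Fin d → ℕ)
    (l : ℕ → LossArray I.A) (x : ℕ → Fin d → ℝ) (t e : ℕ) : ℝ :=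
  ∑ s ∈ Finset.Ico t e, ∑ i, alpha q T a l x s i

/-- The constant that multiplies the probability of a bad block. -/
noncomputable def badConst (ρ : ℝ) (B : ℕ) : ℝ :=
  (3 * ((1 + ρ) / ρ) + 3) * (4 * B * I.Wr ^ 4) + 4 * B * I.Wr ^ 2 * (B * moveConst I ρ)

lemma closeInd_nonneg (z : Fin d → ℝ) : 0 ≤ closeInd I z := by
  unfold closeInd; split_ifs <;> norm_num

lemma closeInd_le_one (z : Fin d → ℝ) : closeInd I z ≤ 1 := by
  unfold closeInd; split_ifs <;> norm_num

lemma one_sub_closeInd_le (z : Fin d → ℝ) : 1 - closeInd I z ≤ 8 * I.optDist z := by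
  have := I.optDist_nonneg z
  unfold closeInd; split_ifs with h
  · linarith
  · push Not at h; linarith

lemma tieInd_nonneg (K c L : ℝ) (q : ℕ → Fin d → ℝ) (a : ℕ → Fin d → ℕ)
    (l : ℕ → LossArray I.A) (x : ℕ → Fin d → ℝ) (t : ℕ) : 0 ≤ tieInd I K c L q a l x t := by
  unfold tieInd; split_ifs <;> norm_num

lemma extraPlays_nonneg (a : ℕ → Fin d → ℕ) (t e : ℕ) : 0 ≤ extraPlays I a t e :=
  Finset.sum_nonneg fun _ _ => Finset.sum_nonneg fun i _ => by split_ifs <;> positivity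

lemma badConst_nonneg {ρ : ℝ} (hρ : 0 < ρ) (B : ℕ) : 0 ≤ badConst I ρ B := by
  have := I.Wr_nonneg
  have := moveConst_nonneg I ρ
  unfold badConst; positivity

end BlockCases

namespace IsPath

variable {d : ℕ} {I : Instance d} {ρ : ℝ} {ε : Fin d → ℝ} {T : ℕ} {q : ℕ → Fin d → ℝ}
  {a : ℕ → Fin d → ℕ} {l : ℕ → LossArray I.A} {x : ℕ → Fin d → ℝ} (hp : IsPath I.A ρ ε T q a l x)

include hp

lemma alphaSum_nonneg {t e : ℕ} (he : e ≤ T) : 0 ≤ alphaSum I q T a l x t e :=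
  Finset.sum_nonneg fun s hs => Finset.sum_nonneg fun i _ => hp.alpha_nonneg (by
    rw [Finset.mem_Ico] at hs; omega) i

/-- The cost of a block without any cancellation among the estimation errors. -/
lemma sum_stepCost_le {u : Fin d → ℝ}
    (hphi : ∀ i, phi (maxPlays I.A i) T (u i) ≤ 3 * maxPlays I.A i * Real.log T)
    {t e : ℕ} (hte : t ≤ e) (he : e < T) :
    ∑ s ∈ Finset.Ico t e, stepCost q ε T a l x u s ≤ growthTerm I ρ q ε T a l x t e +
      ∑ i, if I.IsMid i then (3 * ((1 + ρ) / ρ) + 3) * maxPlays I.A i * (Real.log T *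
        (beta q ε T a l x e i - beta q ε T a l x t i)) else 0 := by
  calc _ ≤ ∑ s ∈ Finset.Ico t e, ∑ i, (3 * ((1 + ρ) / ρ) + 3) * maxPlays I.A i * Real.log T *
        (beta q ε T a l x (s + 1) i - beta q ε T a l x s i) :=
        Finset.sum_le_sum fun s hs => hp.stepCost_le hphi (by rw [Finset.mem_Ico] at hs; omega)
    _ = ∑ i, (3 * ((1 + ρ) / ρ) + 3) * maxPlays I.A i * Real.log T *
        (beta q ε T a l x e i - beta q ε T a l x t i) := by
        rw [Finset.sum_comm]
        refine Finset.sum_congr rfl fun i _ => ?_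
        rw [← Finset.mul_sum, ← beta_sub_eq_sum hte]
    _ = _ := by
        unfold growthTerm
        rw [← Finset.sum_add_distrib]
        refine Finset.sum_congr rfl fun i _ => ?_
        split_ifs <;> ring

lemma abs_driftTerm_le {t e B : ℕ} (hte : t ≤ e) (hB : e ≤ t + B) (he : e < T) :
    |driftTerm I x t e| ≤ I.Wr * (B * (B * (moveConst I ρ / √(Real.log T)))) := by
  have h0 : 0 ≤ B * (moveConst I ρ / √(Real.log T)) := by
    have := moveConst_nonneg I ρ
    positivity
  calc _ ≤ ∑ i : Fin d, |if I.aStar i = 0 then 0 else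
        ∑ s ∈ Finset.Ico t e, I.mean i * (x s i - x e i)| := Finset.abs_sum_le_sum_abs _ _
    _ ≤ ∑ _i : Fin d, (B * (B * (moveConst I ρ / √(Real.log T)))) := by
        apply Finset.sum_le_sum
        intro i _
        split_ifs
        · rw [abs_zero]; positivity
        · calc _ ≤ ∑ s ∈ Finset.Ico t e, |I.mean i * (x s i - x e i)| :=
                Finset.abs_sum_le_sum_abs _ _
            _ ≤ ∑ _s ∈ Finset.Ico t e, (B * (moveConst I ρ / √(Real.log T))) := by
                apply Finset.sum_le_sum
                intro s hs
                rw [Finset.mem_Ico] at hs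
                obtain ⟨m0, m1⟩ := I.mean_mem i
                rw [abs_mul, abs_of_nonneg m0]
                exact (mul_le_of_le_one_left (abs_nonneg _) m1).trans
                  (hp.abs_sub_le hs.2.le (by omega) he i)
            _ = (e - t : ℕ) * (B * (moveConst I ρ / √(Real.log T))) := by simp
            _ ≤ _ := by gcongr; omega
    _ = d * (B * (B * (moveConst I ρ / √(Real.log T)))) := by simp
    _ ≤ _ := by gcongr; exact I.card_le_Wr

lemma abs_noiseTerm_le {t e B : ℕ} (hB : e ≤ t + B) (he : e < T) :
    |noiseTerm I q a l x t e| ≤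
      I.Wr * (B * (3 * I.Wr * (B * (moveConst I ρ / √(Real.log T))))) := by
  have hW := I.Wr_nonneg
  have h0 : 0 ≤ B * (moveConst I ρ / √(Real.log T)) := by
    have := moveConst_nonneg I ρ
    positivity
  calc _ ≤ ∑ i : Fin d, |if I.aStar i = 0 then 0 else
        ∑ s ∈ Finset.Ico t e, noise I q a l x s i * (x s i - x t i)| :=
        Finset.abs_sum_le_sum_abs _ _
    _ ≤ ∑ _i : Fin d, (B * (3 * I.Wr * (B * (moveConst I ρ / √(Real.log T))))) := by
        apply Finset.sum_le_sum
        intro i _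
        split_ifs
        · rw [abs_zero]; positivity
        · calc _ ≤ ∑ s ∈ Finset.Ico t e, |noise I q a l x s i * (x s i - x t i)| :=
                Finset.abs_sum_le_sum_abs _ _
            _ ≤ ∑ _s ∈ Finset.Ico t e, (3 * I.Wr * (B * (moveConst I ρ / √(Real.log T)))) := by
                apply Finset.sum_le_sum
                intro s hs
                rw [Finset.mem_Ico] at hs
                rw [abs_mul, abs_sub_comm]
                exact mul_le_mul (hp.abs_noise_le (by omega) i)
                  (hp.abs_sub_le hs.1 (by omega) (by omega) i) (abs_nonneg _) (by positivity)
            _ = (e - t : ℕ) * (3 * I.Wr * (B * (moveConst I ρ / √(Real.log T)))) := by simp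
            _ ≤ _ := by gcongr; omega
    _ = d * (B * (3 * I.Wr * (B * (moveConst I ρ / √(Real.log T))))) := by simp
    _ ≤ _ := by gcongr; exact I.card_le_Wr

/-- The cost of an arbitrary block: a block that starts far from `a*`, contains a play of an arm
outside `a*`, or ends in a tie contributes only terms that are small for large `T`. -/
lemma sum_stepCost_block_le {u : Fin d → ℝ}
    (hphi : ∀ i, phi (maxPlays I.A i) T (u i) ≤ 3 * maxPlays I.A i * Real.log T)
    (hu_mid : ∀ i, I.IsMid i → u i ∈ Set.Icc (1 / 2 : ℝ) (maxPlays I.A i - 1 / 2))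
    {Δ c K : ℝ} (hgap : ∀ b ∈ I.A, b ≠ I.aStar → Δ ≤ I.gap b) (hc : c * I.Wr ≤ Δ / 2)
    (hreg : ∀ t : ℕ, K * Real.log T ≤ t →
      I.Wr + 4 * I.Wr ^ 2 * (3 / 2 * Real.log T + √(t * Real.log T)) < t * (Δ / 2))
    {t B : ℕ} (hB1 : 1 ≤ B) (he : t + B < T) (hlarge : LargeLog I ρ B (Real.log T)) :
    ∑ s ∈ Finset.Ico t (t + B), stepCost q ε T a l x u s ≤
      growthTerm I ρ q ε T a l x t (t + B) + driftTerm I x t (t + B) +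
      closeInd I (x t) * noiseTerm I q a l x t (t + B) +
      closeInd I (x t) * (I.Wr * (3 * (∑ i, |∑ s ∈ Finset.Ico t (t + B), noise I q a l x s i|) + 9)
        * I.optDist (x t)) +
      I.optDist u +
      badConst I ρ B / √(Real.log T) * ((1 - closeInd I (x t)) + extraPlays I a t (t + B) +
        tieInd I K c (Real.log T) q a l x (t + B)) +
      (1 - closeInd I (x t)) * ((3 * ((1 + ρ) / ρ) + 3) * I.Wr *
        alphaSum I q T a l x t (t + B)) := by
  have ht : t < T := by omega
  have hte : t ≤ t + B := by omega
  have hρ := hp.rho_pos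
  have hL := hp.two_le_log
  have hL0 := hp.log_pos
  have hW := I.Wr_nonneg
  have hM := moveConst_nonneg I ρ
  have hDt := I.optDist_nonneg (x t)
  have hDu := I.optDist_nonneg u
  have hEP := extraPlays_nonneg I a t (t + B)
  have hTI := tieInd_nonneg I K c (Real.log T) q a l x (t + B)
  have hbc := badConst_nonneg I hρ B
  have hsq : √(Real.log T) ≤ Real.log T := by
    rw [Real.sqrt_le_left hL0.le]; nlinarith
  have hsq0 : 0 < √(Real.log T) := Real.sqrt_pos.2 hL0
  have hC0 : 0 ≤ 3 * ((1 + ρ) / ρ) + 3 := by positivity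
  have hdrift := (abs_le.1 (hp.abs_driftTerm_le hte le_rfl he)).1
  have hgen := hp.sum_stepCost_le hphi hte he
  have hm0 : 0 ≤ ∑ i, |∑ s ∈ Finset.Ico t (t + B), noise I q a l x s i| :=
    Finset.sum_nonneg fun _ _ => abs_nonneg _
  rcases Nat.eq_zero_or_pos d with rfl | hd
  · have : I.Wr = 0 := by simp [Instance.Wr]
    have h0 := alphaSum_nonneg (t := t) hp he.le
    have h2 : noiseTerm I q a l x t (t + B) = 0 := by simp [noiseTerm]
    have h3 := closeInd_le_one I (x t)
    have hX : 0 ≤ badConst I ρ B / √(Real.log T) * ((1 - closeInd I (x t)) +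
        extraPlays I a t (t + B) + tieInd I K c (Real.log T) q a l x (t + B)) := by
      apply mul_nonneg (by positivity); linarith
    have h4 : driftTerm I x t (t + B) = 0 := by simp [driftTerm]
    simp only [Finset.univ_eq_empty, Finset.sum_empty, add_zero] at hgen
    rw [h2, h4, this]
    simp only [zero_mul, mul_zero]
    linarith
  have hW1 : 1 ≤ I.Wr := I.one_le_Wr ⟨0, hd⟩
  -- the drift and the martingale term of a bad block
  have hdn : I.Wr * (B * (B * (moveConst I ρ / √(Real.log T)))) +
      I.Wr * (B * (3 * I.Wr * (B * (moveConst I ρ / √(Real.log T))))) ≤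
      4 * B * I.Wr ^ 2 * (B * moveConst I ρ) / √(Real.log T) := by
    have e1 : I.Wr * (B * (B * (moveConst I ρ / √(Real.log T)))) ≤
        I.Wr * (I.Wr * (B * (B * (moveConst I ρ / √(Real.log T))))) :=
      le_mul_of_one_le_left (by positivity) hW1
    calc _ ≤ I.Wr * (I.Wr * (B * (B * (moveConst I ρ / √(Real.log T))))) +
        I.Wr * (B * (3 * I.Wr * (B * (moveConst I ρ / √(Real.log T))))) := by linarith
      _ = _ := by ring
  have hpos1 : 0 ≤ (3 * ((1 + ρ) / ρ) + 3) * (4 * B * I.Wr ^ 4) / √(Real.log T) := by positivity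
  have hpos2 : 0 ≤ I.Wr * (B * (3 * I.Wr * (B * (moveConst I ρ / √(Real.log T))))) := by
    positivity
  have hsplit : badConst I ρ B / √(Real.log T) =
      (3 * ((1 + ρ) / ρ) + 3) * (4 * B * I.Wr ^ 4) / √(Real.log T) +
      4 * B * I.Wr ^ 2 * (B * moveConst I ρ) / √(Real.log T) := by
    unfold badConst; rw [add_div]
  by_cases hclose : I.optDist (x t) ≤ 1 / 8
  · have hci : closeInd I (x t) = 1 := if_pos hclose
    rw [hci]
    simp only [sub_self, zero_mul, add_zero, one_mul, zero_add]
    have hR : 0 ≤ I.Wr * (3 * (∑ i, |∑ s ∈ Finset.Ico t (t + B), noise I q a l x s i|) + 9) *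
        I.optDist (x t) := by positivity
    by_cases hgood : (∀ i, I.aStar i = 0 → ∀ s ∈ Finset.Ico t (t + B), a s i = 0) ∧
        (K * Real.log T ≤ (t + B : ℕ) ∧ ∀ i, I.IsMid i →
          |cumLoss q a l x (t + B) i - (t + B : ℕ) * I.mean i| ≤ c * (t + B : ℕ))
    · obtain ⟨hplay, htie⟩ := hgood
      have hface := hp.optDist_le_faceDist hgap hc he
        (hp.optDist_le_of_block hte le_rfl he hclose hlarge.move) htie.2 (hreg _ htie.1)
      have := hp.sum_stepCost_good_block hphi hu_mid hB1 hte le_rfl he hclose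
        hlarge.move hplay hlarge.ratio hlarge.large hlarge.large' hface
      have hX : 0 ≤ badConst I ρ B / √(Real.log T) * (extraPlays I a t (t + B) +
          tieInd I K c (Real.log T) q a l x (t + B)) := by positivity
      linarith
    · have hbad : 1 ≤ extraPlays I a t (t + B) + tieInd I K c (Real.log T) q a l x (t + B) := by
        by_cases htie : K * Real.log T ≤ (t + B : ℕ) ∧ ∀ i, I.IsMid i →
          |cumLoss q a l x (t + B) i - (t + B : ℕ) * I.mean i| ≤ c * (t + B : ℕ)
        · have hnp : ¬ ∀ i, I.aStar i = 0 → ∀ s ∈ Finset.Ico t (t + B), a s i = 0 :=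
            fun h => hgood ⟨h, htie⟩
          push Not at hnp
          obtain ⟨i, hi, s, hs, hne⟩ := hnp
          have e1 : (1 : ℝ) ≤ ∑ i, if I.aStar i = 0 then (a s i : ℝ) else 0 := by
            refine le_trans ?_ (Finset.single_le_sum
              (f := fun i => if I.aStar i = 0 then (a s i : ℝ) else 0)
              (fun k _ => by split_ifs <;> positivity) (Finset.mem_univ i))
            simp only [if_pos hi]
            exact_mod_cast Nat.one_le_iff_ne_zero.2 hne
          have e2 : (1 : ℝ) ≤ extraPlays I a t (t + B) :=
            e1.trans (Finset.single_le_sum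
              (f := fun s => ∑ i, if I.aStar i = 0 then (a s i : ℝ) else 0)
              (fun s _ => Finset.sum_nonneg fun k _ => by split_ifs <;> positivity) hs)
          linarith
        · have : tieInd I K c (Real.log T) q a l x (t + B) = 1 := if_neg htie
          linarith
      have hmid : (∑ i, if I.IsMid i then (3 * ((1 + ρ) / ρ) + 3) * maxPlays I.A i *
          (Real.log T * (beta q ε T a l x (t + B) i - beta q ε T a l x t i)) else 0) ≤
          (3 * ((1 + ρ) / ρ) + 3) * (4 * B * I.Wr ^ 4) / √(Real.log T) := by
        calc _ ≤ ∑ _i : Fin d, (3 * ((1 + ρ) / ρ) + 3) * (4 * B * I.Wr ^ 3) / √(Real.log T) := by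
              apply Finset.sum_le_sum
              intro i _
              split_ifs with h
              · have e3 := hp.log_mul_beta_sub_le_of_half hte le_rfl he.le (i := i)
                  (fun s hs => by
                    simp only [Finset.mem_Ico] at hs
                    exact hp.half_le hs.1 (by omega) (by omega) hclose hlarge.move
                      (by have := h.1; omega))
                have hnW := I.n_le_Wr i
                calc _ ≤ (3 * ((1 + ρ) / ρ) + 3) * maxPlays I.A i *
                      (4 * B * (maxPlays I.A i : ℝ) ^ 2 / Real.log T) := by gcongr
                  _ ≤ (3 * ((1 + ρ) / ρ) + 3) * I.Wr * (4 * B * I.Wr ^ 2 / √(Real.log T)) := by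
                      gcongr
                  _ = _ := by ring
              · positivity
          _ = d * ((3 * ((1 + ρ) / ρ) + 3) * (4 * B * I.Wr ^ 3) / √(Real.log T)) := by simp
          _ ≤ I.Wr * ((3 * ((1 + ρ) / ρ) + 3) * (4 * B * I.Wr ^ 3) / √(Real.log T)) := by
              gcongr; exact I.card_le_Wr
          _ = _ := by ring
      have hnoise := (abs_le.1 (hp.abs_noiseTerm_le (t := t) le_rfl he)).1
      have hX : badConst I ρ B / √(Real.log T) ≤ badConst I ρ B / √(Real.log T) *
          (extraPlays I a t (t + B) + tieInd I K c (Real.log T) q a l x (t + B)) :=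
        le_mul_of_one_le_right (by positivity) hbad
      linarith
  · have hci : closeInd I (x t) = 0 := if_neg hclose
    rw [hci]
    simp only [zero_mul, add_zero, sub_zero, one_mul]
    have hmid : (∑ i, if I.IsMid i then (3 * ((1 + ρ) / ρ) + 3) * maxPlays I.A i *
        (Real.log T * (beta q ε T a l x (t + B) i - beta q ε T a l x t i)) else 0) ≤
        (3 * ((1 + ρ) / ρ) + 3) * I.Wr * alphaSum I q T a l x t (t + B) := by
      unfold alphaSum
      rw [Finset.sum_comm, Finset.mul_sum]
      apply Finset.sum_le_sum
      intro i _
      have hα : 0 ≤ ∑ s ∈ Finset.Ico t (t + B), alpha q T a l x s i :=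
        Finset.sum_nonneg fun s hs => hp.alpha_nonneg (by rw [Finset.mem_Ico] at hs; omega) i
      split_ifs with h
      · have e3 := hp.log_mul_beta_sub_le hte he.le i
        have hnW := I.n_le_Wr i
        calc _ ≤ (3 * ((1 + ρ) / ρ) + 3) * maxPlays I.A i *
              (∑ s ∈ Finset.Ico t (t + B), alpha q T a l x s i) := by gcongr; linarith
          _ ≤ _ := by gcongr
      · positivity
    have hX : badConst I ρ B / √(Real.log T) ≤ badConst I ρ B / √(Real.log T) *
        (1 + extraPlays I a t (t + B) + tieInd I K c (Real.log T) q a l x (t + B)) :=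
      le_mul_of_one_le_right (by positivity) (by linarith)
    linarith

lemma stepCost_le_const {u : Fin d → ℝ}
    (hphi : ∀ i, phi (maxPlays I.A i) T (u i) ≤ 3 * maxPlays I.A i * Real.log T) {t : ℕ}
    (ht : t + 1 < T) :
    stepCost q ε T a l x u t ≤ (3 * ((1 + ρ) / ρ) + 3) * I.Wr := by
  have hρ := hp.rho_pos
  refine (hp.stepCost_le hphi ht).trans ?_
  unfold Instance.Wr
  rw [Finset.mul_sum]
  apply Finset.sum_le_sum
  intro i _
  have h1 := hp.log_mul_beta_succ_sub (by omega : t < T) i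
  have h2 := hp.alpha_le_one (by omega : t < T) i
  rw [mul_assoc]
  exact mul_le_of_le_one_right (by positivity) (by linarith)

lemma sum_driftTerm_le {N B : ℕ} (hBN : B ≤ N) (hN : N ≤ T) :
    ∑ t ∈ Finset.range (N - B), driftTerm I x t (t + B) ≤ B * (B * I.Wr) := by
  unfold driftTerm
  rw [Finset.sum_comm]
  unfold Instance.Wr
  rw [Finset.mul_sum, Finset.mul_sum]
  apply Finset.sum_le_sum
  intro i _
  by_cases hi : I.aStar i = 0
  · simp only [if_pos hi, Finset.sum_const_zero]; positivity
  simp only [if_neg hi]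
  obtain ⟨m0, m1⟩ := I.mean_mem i
  have hf : ∀ s < N, 0 ≤ I.mean i * x s i ∧ I.mean i * x s i ≤ maxPlays I.A i := by
    intro s hs
    obtain ⟨h1, h2⟩ := hp.x_bounds (hs.trans_le hN) i
    exact ⟨mul_nonneg m0 h1.le, (mul_le_of_le_one_left h1.le m1).trans h2⟩
  have h1 := sum_blocks_le_mul_sum (c := fun s => I.mean i * x s i) hBN (fun s hs => (hf s hs).1)
  have h2 : ∑ s ∈ Finset.range N, I.mean i * x s i ≤
      ∑ t ∈ Finset.range (N - B), I.mean i * x (t + B) i + B * maxPlays I.A i := by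
    rw [← Finset.sum_range_add_sum_Ico _ hBN, Finset.sum_Ico_eq_sum_range, add_comm]
    apply add_le_add
    · exact le_of_eq (Finset.sum_congr rfl fun t _ => by rw [add_comm])
    · calc _ ≤ ∑ _s ∈ Finset.range B, (maxPlays I.A i : ℝ) := Finset.sum_le_sum fun s hs =>
            (hf s (by rw [Finset.mem_range] at hs; omega)).2
        _ = _ := by simp
  have h3 : ∑ t ∈ Finset.range (N - B), ∑ s ∈ Finset.Ico t (t + B),
      I.mean i * (x s i - x (t + B) i) =
      ∑ t ∈ Finset.range (N - B), ∑ s ∈ Finset.Ico t (t + B), I.mean i * x s i -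
        B * ∑ t ∈ Finset.range (N - B), I.mean i * x (t + B) i := by
    rw [Finset.mul_sum, ← Finset.sum_sub_distrib]
    refine Finset.sum_congr rfl fun t _ => ?_
    simp only [mul_sub, Finset.sum_sub_distrib]
    simp
  rw [h3]
  have h4 := mul_le_mul_of_nonneg_left h2 (Nat.cast_nonneg (α := ℝ) B)
  linarith

lemma sum_growthTerm_le {N B : ℕ} (hBN : B ≤ N) (hN : N ≤ T) :
    ∑ t ∈ Finset.range (N - B), growthTerm I ρ q ε T a l x t (t + B) ≤
      B * growthTerm I ρ q ε T a l x 0 N := by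
  have hρ := hp.rho_pos
  have hL0 := hp.log_pos
  unfold growthTerm
  rw [Finset.sum_comm, Finset.mul_sum]
  apply Finset.sum_le_sum
  intro i _
  split_ifs with h
  · simp
  have h1 := sum_blocks_le_mul_sum
    (c := fun s => beta q ε T a l x (s + 1) i - beta q ε T a l x s i) hBN
    (fun s hs => sub_nonneg.2 (hp.beta_le_succ (by omega) i))
  rw [← Finset.mul_sum]
  have h2 : ∀ t, beta q ε T a l x (t + B) i - beta q ε T a l x t i =
      ∑ s ∈ Finset.Ico t (t + B), (beta q ε T a l x (s + 1) i - beta q ε T a l x s i) :=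
    fun t => beta_sub_eq_sum (by omega) i
  simp only [h2 _]
  rw [mul_left_comm]
  have h3 : 0 ≤ (3 * ((1 + ρ) / ρ) + 3) * maxPlays I.A i * Real.log T := by positivity
  have h4 : beta q ε T a l x N i - beta q ε T a l x 0 i =
      ∑ s ∈ Finset.range N, (beta q ε T a l x (s + 1) i - beta q ε T a l x s i) := by
    rw [Finset.range_eq_Ico]
    exact beta_sub_eq_sum (Nat.zero_le N) i
  rw [h4]
  exact mul_le_mul_of_nonneg_left h1 h3

/-- The telescoped potential differences. -/
lemma potential_diff_le {u : Fin d → ℝ} (hu : u ∈ feasible I.A)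
    (hphi : ∀ i, phi (maxPlays I.A i) T (u i) ≤ 3 * maxPlays I.A i * Real.log T)
    {N : ℕ} (hN : N < T) :
    ∑ t ∈ Finset.range N, ∑ i, lossEst q a l x t i * (x t i - u i) ≤
      ∑ t ∈ Finset.range N, stepCost q ε T a l x u t + I.Wr + 9 / 2 * I.Wr * Real.log T := by
  have h1 := sum_stepCost_eq q ε T a l x u (Nat.zero_le N)
  rw [← Finset.range_eq_Ico] at h1
  have h2 := hp.x_min N hN hu
  simp only [Set.mem_ofPred_eq, objective_eq_potential] at h2
  have h3 : ∑ i, q N i * u i ≤ I.Wr := by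
    apply Finset.sum_le_sum
    intro i _
    obtain ⟨q0, q1⟩ := hp.q_mem N hN.le i
    obtain ⟨u0, u1⟩ := feasible_bounds hu i
    exact (mul_le_of_le_one_left u0.le q1).trans u1
  have h4 : 0 ≤ ∑ i, q N i * x N i := Finset.sum_nonneg fun i _ =>
    mul_nonneg (hp.q_mem N hN.le i).1 (hp.x_bounds hN i).1.le
  have h5 : potential q ε T a l x 0 u ≤ 9 / 2 * I.Wr * Real.log T := by
    unfold potential cumLoss Instance.Wr
    simp only [Finset.range_zero, Finset.sum_empty, zero_mul, Finset.sum_const_zero, zero_add]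
    rw [Finset.mul_sum, Finset.sum_mul]
    apply Finset.sum_le_sum
    intro i _
    have e1 := hp.beta_zero_le i
    have e2 : 0 ≤ phi (maxPlays I.A i) T (u i) :=
      phi_nonneg (hp.n_pos i) (feasible_bounds hu i).1 (feasible_bounds hu i).2
    have e3 := hphi i
    have e4 : beta q ε T a l x 0 i * phi (maxPlays I.A i) T (u i) ≤
      3 / 2 * phi (maxPlays I.A i) T (u i) := by gcongr
    linarith
  have h6 : 0 ≤ potential q ε T a l x 0 (x 0) := by
    unfold potential cumLoss
    simp only [Finset.range_zero, Finset.sum_empty, zero_mul, Finset.sum_const_zero, zero_add]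
    exact Finset.sum_nonneg fun i _ => mul_nonneg (beta_nonneg ..)
      (phi_nonneg (hp.n_pos i) (hp.x_bounds (by omega) i).1 (hp.x_bounds (by omega) i).2)
  linarith

end IsPath

/-! ### Conditional means and independent rounds -/

section CondExp

variable {Ω : Type*} {m : MeasurableSpace Ω} [mΩ : MeasurableSpace Ω] {μ : Measure Ω}
  [IsProbabilityMeasure μ]

lemma integral_mul_of_condExp_eq (hm : m ≤ mΩ) {f x G : Ω → ℝ}
    (hG : Measurable[m] G) (hf : Integrable f μ) (hGf : Integrable (fun ω => G ω * f ω) μ)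
    (hx : μ[f|m] =ᵐ[μ] x) : ∫ ω, G ω * f ω ∂μ = ∫ ω, G ω * x ω ∂μ := by
  rw [← integral_condExp hm]
  refine integral_congr_ae ?_
  have h1 := condExp_mul_of_stronglyMeasurable_left (μ := μ) (m := m) (f := G) (g := f)
    hG.stronglyMeasurable hGf hf
  filter_upwards [h1, hx] with ω h2 h3
  have h4 : (fun ω => G ω * f ω) = G * f := rfl
  rw [h4, h2, Pi.mul_apply, h3]

/-- The importance weight `f / x` is integrable if `x` is the conditional mean of `f`. -/
lemma integrable_div_of_condExp_eq (hm : m ≤ mΩ) {f x : Ω → ℝ}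
    (hx : Measurable[m] x) (hf : Integrable f μ) (hfm : Measurable f) (hf0 : ∀ᵐ ω ∂μ, 0 ≤ f ω)
    (hx0 : ∀ᵐ ω ∂μ, 0 < x ω) (h : μ[f|m] =ᵐ[μ] x) :
    Integrable (fun ω => (x ω)⁻¹ * f ω) μ := by
  have hG : ∀ k : ℕ, Measurable[m] (fun ω => min (x ω)⁻¹ k) := fun k =>
    hx.inv.min measurable_const
  have hxm : Measurable x := hx.mono hm le_rfl
  have hGm : ∀ k : ℕ, Measurable (fun ω => min (x ω)⁻¹ k) := fun k => (hG k).mono hm le_rfl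
  have hint : ∀ k : ℕ, Integrable (fun ω => min (x ω)⁻¹ k * f ω) μ := by
    intro k
    refine hf.bdd_mul (c := k) (hGm k).aestronglyMeasurable ?_
    filter_upwards [hx0] with ω h0
    rw [Real.norm_of_nonneg (by positivity)]
    exact min_le_right _ _
  have hle : ∀ k : ℕ, ∫⁻ ω, ENNReal.ofReal (min (x ω)⁻¹ k * f ω) ∂μ ≤ 1 := by
    intro k
    rw [← ofReal_integral_eq_lintegral_ofReal (hint k), ← ENNReal.ofReal_one]
    · apply ENNReal.ofReal_le_ofReal
      rw [integral_mul_of_condExp_eq hm (hG k) hf (hint k) h]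
      calc _ ≤ ∫ _ω, (1 : ℝ) ∂μ := by
            apply integral_mono_of_nonneg _ (integrable_const _)
            · filter_upwards [hx0] with ω h0
              calc _ ≤ (x ω)⁻¹ * x ω := mul_le_mul_of_nonneg_right (min_le_left _ _) h0.le
                _ = 1 := inv_mul_cancel₀ h0.ne'
            · filter_upwards [hx0] with ω h0
              exact mul_nonneg (by positivity) h0.le
        _ = 1 := by simp
    · filter_upwards [hx0, hf0] with ω h0 h1
      exact mul_nonneg (by positivity) h1
  have hlim : ∫⁻ ω, ENNReal.ofReal ((x ω)⁻¹ * f ω) ∂μ ≤ 1 := by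
    refine le_of_tendsto' (lintegral_tendsto_of_tendsto_of_monotone
      (fun k => ((hGm k).mul hfm).ennreal_ofReal.aemeasurable) ?_ ?_) hle
    · filter_upwards [hf0] with ω h1 j k hjk
      apply ENNReal.ofReal_le_ofReal
      apply mul_le_mul_of_nonneg_right _ h1
      exact min_le_min_left _ (by exact_mod_cast hjk)
    · filter_upwards with ω
      apply tendsto_const_nhds.congr'
      obtain ⟨k, hk⟩ := exists_nat_ge (x ω)⁻¹
      filter_upwards [Filter.eventually_ge_atTop k] with j hj
      have : (x ω)⁻¹ ≤ j := hk.trans (by exact_mod_cast hj)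
      simp only [Pi.mul_apply, min_eq_left this]
  refine ⟨(hxm.inv.mul hfm).aestronglyMeasurable, ?_⟩
  rw [hasFiniteIntegral_iff_ofReal]
  · exact hlim.trans_lt ENNReal.one_lt_top
  · filter_upwards [hx0, hf0] with ω h0 h1
    exact mul_nonneg (by positivity) h1

lemma integral_mul_of_indep (hm : m ≤ mΩ) {f G : Ω → ℝ}
    (hG : Measurable[m] G) (hf : Measurable f)
    (h : Indep (MeasurableSpace.comap f inferInstance) m μ) :
    ∫ ω, G ω * f ω ∂μ = (∫ ω, G ω ∂μ) * ∫ ω, f ω ∂μ := by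
  have h1 : IndepFun G f μ := by
    rw [IndepFun_iff_Indep]
    exact (indep_of_indep_of_le_right h hG.comap_le).symm
  exact h1.integral_fun_mul_eq_mul_integral (hG.mono hm le_rfl).aestronglyMeasurable
    hf.aestronglyMeasurable

end CondExp

/-- The trajectory of a process. -/
abbrev traj {Ω β : Type*} (f : ℕ → Ω → β) (ω : Ω) : ℕ → β := fun t => f t ω

section Measurability

variable {d : ℕ} {A : Finset (Fin d → ℕ)}

lemma measurable_armLoss (i : Fin d) :
    Measurable (fun p : (Fin d → ℕ) × LossArray A => armLoss p.1 p.2 i) := by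
  unfold armLoss
  simp only [Finset.sum_filter]
  refine Finset.measurable_sum _ fun j _ => Measurable.ite ?_ ?_ measurable_const
  · exact measurableSet_lt measurable_const ((measurable_pi_apply i).comp measurable_fst)
  · exact (measurable_pi_apply j).comp ((measurable_pi_apply i).comp measurable_snd)

lemma measurable_avgLoss {Ω : Type*} {_ : MeasurableSpace Ω} {f : Ω → (Fin d → ℕ) × LossArray A}
    (hf : Measurable f) (i : Fin d) : Measurable (fun ω => avgLoss (f ω).1 (f ω).2 i) := by
  have h : Measurable (fun p : (Fin d → ℕ) × LossArray A => avgLoss p.1 p.2 i) :=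
    (measurable_armLoss i).div (measurable_from_top.comp
      ((measurable_pi_apply i).comp measurable_fst))
  exact h.comp hf

variable {Ω : Type*} [mΩ : MeasurableSpace Ω] {a : ℕ → Ω → Fin d → ℕ} {l : ℕ → Ω → LossArray A}

lemma history_le (ha : ∀ t, Measurable (a t)) (hl : ∀ t, Measurable (l t)) (t : ℕ) :
    history a l t ≤ mΩ :=
  iSup₂_le fun s _ => ((ha s).prodMk (hl s)).comap_le

lemma history_mono {s t : ℕ} (h : s ≤ t) : history a l s ≤ history a l t :=
  biSup_mono fun _ hr => Finset.mem_range.2 ((Finset.mem_range.1 hr).trans_le h)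

lemma measurable_history {s t : ℕ} (h : s < t) :
    Measurable[history a l t] (fun ω => (a s ω, l s ω)) := by
  rw [measurable_iff_comap_le]
  exact le_iSup₂_of_le s (Finset.mem_range.2 h) le_rfl

end Measurability

/-- A run in which the points of the algorithm are measurable functions of the past; `q` is the
process of predictions. -/
structure RegularRun {d : ℕ} (I : Instance d) (ρ : ℝ) (ε : Fin d → ℝ) (T : ℕ)
    {Ω : Type*} [MeasurableSpace Ω] (μ : Measure Ω) (q : ℕ → Ω → Fin d → ℝ)
    (a : ℕ → Ω → Fin d → ℕ) (l : ℕ → Ω → LossArray I.A) (x : ℕ → Ω → Fin d → ℝ) : Prop where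
  measurable_a : ∀ t, Measurable (a t)
  measurable_l : ∀ t, Measurable (l t)
  measurable_q : ∀ t, Measurable[history a l t] (q t)
  measurable_x : ∀ t, Measurable[history a l t] (x t)
  law : ∀ t < T, ∀ i j, μ.map (fun ω => l t ω i j) = I.D i
  indep_samples : ∀ t < T, ∀ i, iIndepFun (fun j ω => l t ω i j) μ
  indep_rounds : ∀ t < T,
    Indep (MeasurableSpace.comap (l t) inferInstance)
      (history a l t ⊔ MeasurableSpace.comap (a t) inferInstance) μ
  sampling : ∀ t < T, ∀ i, μ[fun ω => (a t ω i : ℝ) | history a l t] =ᵐ[μ] fun ω => x t ω i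
  path : ∀ᵐ ω ∂μ, IsPath I.A ρ ε T (traj q ω) (traj a ω) (traj l ω) (traj x ω)

namespace RegularRun

variable {d : ℕ} {I : Instance d} {ρ : ℝ} {ε : Fin d → ℝ} {T : ℕ} {Ω : Type*}
  [mΩ : MeasurableSpace Ω] {μ : Measure Ω} [IsProbabilityMeasure μ] {q : ℕ → Ω → Fin d → ℝ}
  {a : ℕ → Ω → Fin d → ℕ} {l : ℕ → Ω → LossArray I.A} {x : ℕ → Ω → Fin d → ℝ}
  (hr : RegularRun I ρ ε T μ q a l x)

include hr

lemma history_le (t : ℕ) : history a l t ≤ mΩ :=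
  MPCSB.history_le hr.measurable_a hr.measurable_l t

lemma measurable_x_apply (t : ℕ) (i : Fin d) : Measurable[history a l t] (fun ω => x t ω i) :=
  (measurable_pi_apply i).comp (hr.measurable_x t)

lemma measurable_q_apply (t : ℕ) (i : Fin d) : Measurable[history a l t] (fun ω => q t ω i) :=
  (measurable_pi_apply i).comp (hr.measurable_q t)

lemma measurable_lossEst {t s : ℕ} (h : t < s) (i : Fin d) : Measurable[history a l s]
    (fun ω => lossEst (traj q ω) (traj a ω) (traj l ω) (traj x ω) t i) := by
  have h1 := (hr.measurable_x_apply t i).mono (history_mono h.le) le_rfl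
  have h2 := (hr.measurable_q_apply t i).mono (history_mono h.le) le_rfl
  have h3 := measurable_history (a := a) (l := l) h
  have h4 : Measurable[history a l s] (fun ω => (a t ω i : ℝ)) :=
    measurable_from_top.comp ((measurable_pi_apply i).comp (measurable_fst.comp h3))
  have h5 : Measurable[history a l s] (fun ω => avgLoss (a t ω) (l t ω) i) :=
    measurable_avgLoss h3 i
  exact h2.add ((h4.div h1).mul (h5.sub h2))

lemma measurable_noise {t s : ℕ} (h : t < s) (i : Fin d) : Measurable[history a l s]
    (fun ω => noise I (traj q ω) (traj a ω) (traj l ω) (traj x ω) t i) := by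
  unfold noise
  refine Measurable.ite ?_ ((hr.measurable_lossEst h i).sub measurable_const) measurable_const
  exact measurableSet_le measurable_const
    ((hr.measurable_x_apply t i).mono (history_mono h.le) le_rfl)

lemma measurable_alpha (t : ℕ) (i : Fin d) :
    Measurable (fun ω => alpha (traj q ω) T (traj a ω) (traj l ω) (traj x ω) t i) := by
  have h1 := (hr.measurable_x_apply t i).mono (hr.history_le t) le_rfl
  have h2 := (hr.measurable_q_apply t i).mono (hr.history_le t) le_rfl
  have h3 := (hr.measurable_a t).prodMk (hr.measurable_l t)
  have h4 : Measurable (fun ω => (a t ω i : ℝ)) :=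
    measurable_from_top.comp ((measurable_pi_apply i).comp (measurable_fst.comp h3))
  have h5 : Measurable (fun ω => avgLoss (a t ω) (l t ω) i) := measurable_avgLoss h3 i
  unfold alpha
  exact (((h4.div_const _).pow_const 2).mul ((h5.sub h2).pow_const 2)).mul
    (measurable_const.min ((measurable_const.mul (measurable_const.sub (h1.div_const _))).div
      (((h1.div_const _).pow_const 2).mul measurable_const)))

lemma measurable_play (t : ℕ) (i : Fin d) : Measurable (fun ω => (a t ω i : ℝ)) :=
  measurable_from_top.comp ((measurable_pi_apply i).comp (hr.measurable_a t))

lemma integrable_play {t : ℕ} (ht : t < T) (i : Fin d) : Integrable (fun ω => (a t ω i : ℝ)) μ := by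
  refine Integrable.of_bound (hr.measurable_play t i).aestronglyMeasurable (maxPlays I.A i) ?_
  filter_upwards [hr.path] with ω hp
  rw [Real.norm_of_nonneg (by positivity)]
  exact_mod_cast le_maxPlays (hp.a_mem t ht) i

/-- The action of round `t` has conditional mean `x(t)`. -/
lemma integral_mul_play {t : ℕ} (ht : t < T) (i : Fin d) {G : Ω → ℝ}
    (hG : Measurable[history a l t] G) (hGa : Integrable (fun ω => G ω * (a t ω i : ℝ)) μ) :
    ∫ ω, G ω * (a t ω i : ℝ) ∂μ = ∫ ω, G ω * x t ω i ∂μ :=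
  integral_mul_of_condExp_eq (hr.history_le t) hG (hr.integrable_play ht i) hGa
    (hr.sampling t ht i)

lemma integrable_play_div {t : ℕ} (ht : t < T) (i : Fin d) :
    Integrable (fun ω => (x t ω i)⁻¹ * (a t ω i : ℝ)) μ := by
  refine integrable_div_of_condExp_eq (hr.history_le t) (hr.measurable_x_apply t i)
    (hr.integrable_play ht i) (hr.measurable_play t i)
    (Filter.Eventually.of_forall fun _ => Nat.cast_nonneg _) ?_
    (hr.sampling t ht i)
  filter_upwards [hr.path] with ω hp
  exact (hp.x_bounds ht i).1

lemma integrable_mul_play_div {t : ℕ} (ht : t < T) (i : Fin d) {G : Ω → ℝ} {C : ℝ}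
    (hG : Measurable[history a l t] G) (hC : ∀ᵐ ω ∂μ, |G ω| ≤ C) :
    Integrable (fun ω => G ω * (x t ω i)⁻¹ * (a t ω i : ℝ)) μ := by
  simp only [mul_assoc]
  exact (hr.integrable_play_div ht i).bdd_mul (c := C)
    (hG.mono (hr.history_le t) le_rfl).aestronglyMeasurable hC

lemma integral_mul_play_div {t : ℕ} (ht : t < T) (i : Fin d) {G : Ω → ℝ} {C : ℝ}
    (hG : Measurable[history a l t] G) (hC : ∀ᵐ ω ∂μ, |G ω| ≤ C) :
    ∫ ω, G ω * (x t ω i)⁻¹ * (a t ω i : ℝ) ∂μ = ∫ ω, G ω ∂μ := by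
  have h1 : Measurable[history a l t] (fun ω => G ω * (x t ω i)⁻¹) :=
    hG.mul (hr.measurable_x_apply t i).inv
  rw [hr.integral_mul_play ht i h1 (hr.integrable_mul_play_div ht i hG hC)]
  refine integral_congr_ae ?_
  filter_upwards [hr.path] with ω hp
  have := (hp.x_bounds ht i).1
  exact inv_mul_cancel_right₀ this.ne' _

lemma measurable_sample (t : ℕ) (i : Fin d) (j : Fin (maxPlays I.A i)) :
    Measurable (fun ω => l t ω i j) :=
  (measurable_pi_apply j).comp ((measurable_pi_apply i).comp (hr.measurable_l t))

lemma integral_sample {t : ℕ} (ht : t < T) (i : Fin d) (j : Fin (maxPlays I.A i)) :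
    ∫ ω, l t ω i j ∂μ = I.mean i := by
  unfold Instance.mean
  rw [← hr.law t ht i j, integral_map (f := fun y : ℝ => y)
    (hr.measurable_sample t i j).aemeasurable measurable_id.aestronglyMeasurable]

lemma indep_comp {t : ℕ} (ht : t < T) {f : LossArray I.A → ℝ} (hf : Measurable f) :
    Indep (MeasurableSpace.comap (fun ω => f (l t ω)) inferInstance)
      (history a l t ⊔ MeasurableSpace.comap (a t) inferInstance) μ := by
  refine indep_of_indep_of_le_left (hr.indep_rounds t ht) ?_
  have : (fun ω => f (l t ω)) = f ∘ l t := rfl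
  rw [this, ← MeasurableSpace.comap_comp]
  exact MeasurableSpace.comap_mono hf.comap_le

lemma past_le (t : ℕ) : history a l t ⊔ MeasurableSpace.comap (a t) inferInstance ≤ mΩ :=
  sup_le (hr.history_le t) (hr.measurable_a t).comap_le

omit hr in
lemma measurable_past_a (t : ℕ) :
    Measurable[history a l t ⊔ MeasurableSpace.comap (a t) inferInstance] (a t) := by
  rw [measurable_iff_comap_le]; exact le_sup_right

lemma ae_sample_mem {t : ℕ} (ht : t < T) (i : Fin d) (j : Fin (maxPlays I.A i)) :
    ∀ᵐ ω ∂μ, l t ω i j ∈ Set.Icc (0 : ℝ) 1 := by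
  filter_upwards [hr.path] with ω hp
  exact hp.l_mem t ht i j

omit hr in
lemma armLoss_eq_sum (b : Fin d → ℕ) (y : LossArray I.A) (i : Fin d) :
    armLoss b y i = ∑ j : Fin (maxPlays I.A i), (if j.val < b i then 1 else 0) * y i j := by
  unfold armLoss
  rw [Finset.sum_filter]
  exact Finset.sum_congr rfl fun j _ => by split_ifs <;> simp

omit hr in
lemma sum_lt_eq {n b : ℕ} (h : b ≤ n) :
    ∑ j : Fin n, (if j.val < b then (1 : ℝ) else 0) = b := by
  rw [Finset.sum_boole, Fin.card_filter_val_lt, min_eq_right h]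

/-- The loss of an action that is independent of the losses, given the past. -/
lemma integral_mul_armLoss {t : ℕ} (ht : t < T) (i : Fin d) {G : Ω → ℝ} {b : Ω → Fin d → ℕ}
    (hb : Measurable[history a l t ⊔ MeasurableSpace.comap (a t) inferInstance] b)
    (hbn : ∀ᵐ ω ∂μ, b ω i ≤ maxPlays I.A i)
    (hG : Measurable[history a l t ⊔ MeasurableSpace.comap (a t) inferInstance] G)
    (hGb : Integrable (fun ω => G ω * (b ω i : ℝ)) μ) :
    Integrable (fun ω => G ω * armLoss (b ω) (l t ω) i) μ ∧
    ∫ ω, G ω * armLoss (b ω) (l t ω) i ∂μ = I.mean i * ∫ ω, G ω * (b ω i : ℝ) ∂μ := by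
  have hH : ∀ j : Fin (maxPlays I.A i),
      Measurable[history a l t ⊔ MeasurableSpace.comap (a t) inferInstance]
        (fun ω => G ω * (if j.val < b ω i then 1 else 0)) := fun j =>
    hG.mul ((measurable_from_top (f := fun k : ℕ => if j.val < k then (1 : ℝ) else 0)).comp
      ((measurable_pi_apply i).comp hb))
  have hHi : ∀ j : Fin (maxPlays I.A i),
      Integrable (fun ω => G ω * (if j.val < b ω i then 1 else 0)) μ := by
    intro j
    refine hGb.mono ((hH j).mono (hr.past_le t) le_rfl).aestronglyMeasurable ?_
    filter_upwards with ω
    rw [norm_mul, norm_mul]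
    refine mul_le_mul_of_nonneg_left ?_ (norm_nonneg _)
    split_ifs with h
    · rw [Real.norm_of_nonneg (by positivity), Real.norm_of_nonneg (by positivity)]
      exact_mod_cast (by omega : 1 ≤ b ω i)
    · simp
  have hHl : ∀ j : Fin (maxPlays I.A i),
      Integrable (fun ω => G ω * (if j.val < b ω i then 1 else 0) * l t ω i j) μ := by
    intro j
    refine (hHi j).mul_bdd (c := 1) (hr.measurable_sample t i j).aestronglyMeasurable ?_
    filter_upwards [hr.ae_sample_mem ht i j] with ω h
    rw [Real.norm_of_nonneg h.1]; exact h.2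
  have e : ∀ ω, G ω * armLoss (b ω) (l t ω) i = ∑ j : Fin (maxPlays I.A i),
      G ω * (if j.val < b ω i then 1 else 0) * l t ω i j := by
    intro ω
    rw [armLoss_eq_sum, Finset.mul_sum]
    exact Finset.sum_congr rfl fun j _ => by ring
  simp only [e]
  refine ⟨integrable_finsetSum _ fun j _ => hHl j, ?_⟩
  rw [integral_finsetSum _ fun j _ => hHl j]
  have e2 : ∀ j : Fin (maxPlays I.A i),
      ∫ ω, G ω * (if j.val < b ω i then 1 else 0) * l t ω i j ∂μ =
        (∫ ω, G ω * (if j.val < b ω i then 1 else 0) ∂μ) * I.mean i := by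
    intro j
    rw [← hr.integral_sample ht i j]
    exact integral_mul_of_indep (hr.past_le t) (hH j) (hr.measurable_sample t i j)
      (hr.indep_comp ht (f := fun y => y i j)
        ((measurable_pi_apply j).comp (measurable_pi_apply i)))
  simp only [e2]
  rw [← Finset.sum_mul, ← integral_finsetSum _ fun j _ => hHi j, mul_comm]
  congr 1
  refine integral_congr_ae ?_
  filter_upwards [hbn] with ω h
  rw [← Finset.mul_sum, sum_lt_eq h]

lemma integral_sample_sub_mul {t : ℕ} (ht : t < T) (i : Fin d) (j k : Fin (maxPlays I.A i)) :
    ∫ ω, (l t ω i j - I.mean i) * (l t ω i k - I.mean i) ∂μ = if j = k then I.sigmaSq i else 0 := by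
  split_ifs with h
  · subst h
    unfold Instance.sigmaSq
    rw [variance_eq_integral aemeasurable_id, ← hr.law t ht i j,
      integral_map (hr.measurable_sample t i j).aemeasurable
        (by fun_prop)]
    refine integral_congr_ae (Filter.Eventually.of_forall fun ω => ?_)
    simp only [id]
    rw [hr.law t ht i j, sq]; rfl
  · have h1 : IndepFun (fun ω => l t ω i j - I.mean i) (fun ω => l t ω i k - I.mean i) μ :=
      ((hr.indep_samples t ht i).indepFun h).comp (φ := fun y => y - I.mean i)
        (ψ := fun y => y - I.mean i) (by fun_prop) (by fun_prop)
    have h2 : ∫ ω, (l t ω i j - I.mean i) ∂μ = 0 := by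
      rw [integral_sub _ (integrable_const _), hr.integral_sample ht]
      · simp
      · exact Integrable.of_mem_Icc 0 1 (hr.measurable_sample t i j).aemeasurable
          (hr.ae_sample_mem ht i j)
    rw [h1.integral_fun_mul_eq_mul_integral
      ((hr.measurable_sample t i j).sub_const _).aestronglyMeasurable
      ((hr.measurable_sample t i k).sub_const _).aestronglyMeasurable, h2, zero_mul]

/-- The variance of the observed loss of an arm is proportional to the number of plays. -/
lemma integral_sq_armLoss_sub {t : ℕ} (ht : t < T) (i : Fin d) :
    ∫ ω, (armLoss (a t ω) (l t ω) i - a t ω i * I.mean i) ^ 2 ∂μ =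
      I.sigmaSq i * ∫ ω, x t ω i ∂μ := by
  have hP : ∀ j k : Fin (maxPlays I.A i),
      Measurable[history a l t ⊔ MeasurableSpace.comap (a t) inferInstance]
        (fun ω => (if j.val < a t ω i then (1 : ℝ) else 0) *
          (if k.val < a t ω i then (1 : ℝ) else 0)) := fun j k =>
    ((measurable_from_top (f := fun m : ℕ => (if j.val < m then (1 : ℝ) else 0) *
      (if k.val < m then (1 : ℝ) else 0))).comp
        ((measurable_pi_apply i).comp (measurable_past_a t)))
  have hL : ∀ j k : Fin (maxPlays I.A i), Measurable (fun y : LossArray I.A =>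
      (y i j - I.mean i) * (y i k - I.mean i)) := fun j k =>
    Measurable.mul (f := fun y : LossArray I.A => y i j - I.mean i)
      (((measurable_pi_apply j).comp (measurable_pi_apply i)).sub_const _)
      (((measurable_pi_apply k).comp (measurable_pi_apply i)).sub_const _)
  have e1 : ∀ᵐ ω ∂μ, (armLoss (a t ω) (l t ω) i - a t ω i * I.mean i) ^ 2 =
      ∑ j : Fin (maxPlays I.A i), ∑ k : Fin (maxPlays I.A i),
        ((if j.val < a t ω i then (1 : ℝ) else 0) * (if k.val < a t ω i then (1 : ℝ) else 0)) *
          ((l t ω i j - I.mean i) * (l t ω i k - I.mean i)) := by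
    filter_upwards [hr.path] with ω hp
    have h1 : armLoss (a t ω) (l t ω) i - a t ω i * I.mean i =
        ∑ j : Fin (maxPlays I.A i), (if j.val < a t ω i then (1 : ℝ) else 0) *
          (l t ω i j - I.mean i) := by
      simp only [mul_sub, Finset.sum_sub_distrib]
      rw [← Finset.sum_mul, sum_lt_eq (le_maxPlays (hp.a_mem t ht) i), armLoss_eq_sum]
    rw [h1, sq, Finset.sum_mul_sum]
    exact Finset.sum_congr rfl fun j _ => Finset.sum_congr rfl fun k _ => by ring
  have e2 : ∀ j k : Fin (maxPlays I.A i), Integrable (fun ω =>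
      ((if j.val < a t ω i then (1 : ℝ) else 0) * (if k.val < a t ω i then (1 : ℝ) else 0)) *
          ((l t ω i j - I.mean i) * (l t ω i k - I.mean i))) μ := by
    intro j k
    refine Integrable.of_bound ((((hP j k).mono (hr.past_le t) le_rfl).mul
      ((hL j k).comp (hr.measurable_l t))).aestronglyMeasurable) 1 ?_
    filter_upwards [hr.ae_sample_mem ht i j, hr.ae_sample_mem ht i k] with ω h1 h2
    obtain ⟨m0, m1⟩ := I.mean_mem i
    have h3 : |l t ω i j - I.mean i| ≤ 1 := abs_le.2 ⟨by linarith [h1.1], by linarith [h1.2]⟩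
    have h4 : |l t ω i k - I.mean i| ≤ 1 := abs_le.2 ⟨by linarith [h2.1], by linarith [h2.2]⟩
    rw [Real.norm_eq_abs, abs_mul, abs_mul (l t ω i j - I.mean i)]
    refine mul_le_one₀ ?_ (by positivity) (mul_le_one₀ h3 (abs_nonneg _) h4)
    split_ifs <;> simp
  rw [integral_congr_ae e1,
    integral_finsetSum _ fun j _ => integrable_finsetSum _ fun k _ => e2 j k]
  have e3 : ∀ j : Fin (maxPlays I.A i), ∫ ω, ∑ k : Fin (maxPlays I.A i),
        ((if j.val < a t ω i then (1 : ℝ) else 0) * (if k.val < a t ω i then (1 : ℝ) else 0)) *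
          ((l t ω i j - I.mean i) * (l t ω i k - I.mean i)) ∂μ =
      (∫ ω, (if j.val < a t ω i then (1 : ℝ) else 0) ∂μ) * I.sigmaSq i := by
    intro j
    have e6 : ∀ k, ∫ ω, ((if j.val < a t ω i then (1 : ℝ) else 0) *
          (if k.val < a t ω i then (1 : ℝ) else 0)) *
            ((l t ω i j - I.mean i) * (l t ω i k - I.mean i)) ∂μ =
        (∫ ω, ((if j.val < a t ω i then (1 : ℝ) else 0) *
          (if k.val < a t ω i then (1 : ℝ) else 0)) ∂μ) * (if j = k then I.sigmaSq i else 0) := by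
      intro k
      rw [← hr.integral_sample_sub_mul ht i j k]
      exact integral_mul_of_indep (hr.past_le t) (hP j k) ((hL j k).comp (hr.measurable_l t))
        (hr.indep_comp ht (hL j k))
    rw [integral_finsetSum _ fun k _ => e2 j k, Finset.sum_eq_single j]
    · rw [e6, if_pos rfl]
      congr 2
      ext ω; split_ifs <;> simp
    · intro k _ hk
      rw [e6, if_neg hk.symm, mul_zero]
    · intro h; exact absurd (Finset.mem_univ j) h
  simp only [e3]
  have e4 : ∀ j : Fin (maxPlays I.A i),
      Integrable (fun ω => if j.val < a t ω i then (1 : ℝ) else 0) μ := by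
    intro j
    refine Integrable.of_bound ((measurable_from_top
      (f := fun m : ℕ => if j.val < m then (1 : ℝ) else 0)).comp
        ((measurable_pi_apply i).comp (hr.measurable_a t))).aestronglyMeasurable 1 ?_
    filter_upwards with ω
    split_ifs <;> simp
  rw [← Finset.sum_mul, mul_comm, ← integral_finsetSum _ fun j _ => e4 j]
  congr 1
  have e5 := hr.integral_mul_play ht i (G := fun _ => 1) measurable_const
    (by simpa using hr.integrable_play ht i)
  simp only [one_mul] at e5
  rw [← e5]
  refine integral_congr_ae ?_
  filter_upwards [hr.path] with ω hp
  rw [sum_lt_eq (le_maxPlays (hp.a_mem t ht) i)]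

omit hr in
lemma play_mul_avgLoss (b : Fin d → ℕ) (y : LossArray I.A) (i : Fin d) :
    (b i : ℝ) * avgLoss b y i = armLoss b y i := by
  unfold avgLoss
  rcases eq_or_ne (b i) 0 with h | h
  · simp [armLoss, h]
  · have : (b i : ℝ) ≠ 0 := by exact_mod_cast h
    field_simp

/-- The loss estimates are unbiased, given the past. -/
lemma integral_mul_lossEst {t : ℕ} (ht : t < T) (i : Fin d) {G : Ω → ℝ} {C : ℝ}
    (hG : Measurable[history a l t] G) (hC : ∀ᵐ ω ∂μ, |G ω| ≤ C) :
    Integrable (fun ω => G ω * lossEst (traj q ω) (traj a ω) (traj l ω) (traj x ω) t i) μ ∧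
    ∫ ω, G ω * lossEst (traj q ω) (traj a ω) (traj l ω) (traj x ω) t i ∂μ =
      I.mean i * ∫ ω, G ω ∂μ := by
  have hq := hr.measurable_q_apply t i
  have hx := hr.measurable_x_apply t i
  have hGq : Measurable[history a l t] (fun ω => G ω * q t ω i) := hG.mul hq
  have hGx : Measurable[history a l t] (fun ω => G ω * (x t ω i)⁻¹) := hG.mul hx.inv
  have hCq : ∀ᵐ ω ∂μ, |G ω * q t ω i| ≤ C := by
    filter_upwards [hr.path, hC] with ω hp h
    obtain ⟨q0, q1⟩ := hp.q_mem t ht.le i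
    rw [abs_mul, abs_of_nonneg q0]
    exact (mul_le_of_le_one_right (abs_nonneg _) q1).trans h
  have i1 : Integrable (fun ω => G ω * q t ω i) μ :=
    Integrable.of_bound (hGq.mono (hr.history_le t) le_rfl).aestronglyMeasurable C hCq
  have i2 := hr.integrable_mul_play_div ht i hG hC
  have i3 := hr.integrable_mul_play_div ht i hGq hCq
  obtain ⟨i4, e4⟩ := hr.integral_mul_armLoss ht i (measurable_past_a t)
    (by filter_upwards [hr.path] with ω hp using le_maxPlays (hp.a_mem t ht) i)
    (hGx.mono le_sup_left le_rfl) i2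
  have e : ∀ ω, G ω * lossEst (traj q ω) (traj a ω) (traj l ω) (traj x ω) t i =
      G ω * q t ω i + G ω * (x t ω i)⁻¹ * armLoss (a t ω) (l t ω) i -
        G ω * q t ω i * (x t ω i)⁻¹ * (a t ω i : ℝ) := by
    intro ω
    rw [← play_mul_avgLoss]
    unfold lossEst
    ring
  simp only [e]
  have i5 : Integrable (fun ω => G ω * q t ω i +
      G ω * (x t ω i)⁻¹ * armLoss (a t ω) (l t ω) i) μ := i1.add i4
  refine ⟨i5.sub i3, ?_⟩
  rw [integral_sub i5 i3, integral_add i1 i4, e4, hr.integral_mul_play_div ht i hG hC,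
    hr.integral_mul_play_div ht i hGq hCq]
  ring

end RegularRun

/-! ### Expected estimation errors -/

/-- The estimation error of the loss of arm `i` in the rounds in which `x_i` is small. -/
noncomputable def farError {d : ℕ} (I : Instance d) (q : ℕ → Fin d → ℝ) (a : ℕ → Fin d → ℕ)
    (l : ℕ → LossArray I.A) (x : ℕ → Fin d → ℝ) (t : ℕ) (i : Fin d) : ℝ :=
  if 1 / 2 ≤ x t i then 0 else |lossEst q a l x t i - I.mean i|

lemma farError_nonneg {d : ℕ} (I : Instance d) (q : ℕ → Fin d → ℝ) (a : ℕ → Fin d → ℕ)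
    (l : ℕ → LossArray I.A) (x : ℕ → Fin d → ℝ) (t : ℕ) (i : Fin d) :
    0 ≤ farError I q a l x t i := by
  unfold farError; split_ifs
  · exact le_rfl
  · exact abs_nonneg _

namespace Instance

variable {d : ℕ} (I : Instance d)

lemma optDist_le_Wr {z : Fin d → ℝ} (hz : z ∈ feasible I.A) : I.optDist z ≤ I.Wr := by
  apply Finset.sum_le_sum
  intro i _
  obtain ⟨h1, h2⟩ := feasible_bounds hz i
  have h3 : (I.aStar i : ℝ) ≤ maxPlays I.A i := by exact_mod_cast I.aStar_le i
  have h4 : (0 : ℝ) ≤ I.aStar i := by positivity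
  rw [abs_le]; constructor <;> linarith

lemma excess_le_optDist (z : Fin d → ℝ) : I.excess z ≤ I.optDist z := by
  refine Finset.sum_le_sum fun i _ => ?_
  obtain ⟨m0, m1⟩ := I.mean_mem i
  calc _ ≤ |z i - I.aStar i| * I.mean i := mul_le_mul_of_nonneg_right (le_abs_self _) m0
    _ ≤ _ := mul_le_of_le_one_right (abs_nonneg _) m1

lemma excess_le_Wr {z : Fin d → ℝ} (hz : z ∈ feasible I.A) : I.excess z ≤ I.Wr :=
  (I.excess_le_optDist z).trans (I.optDist_le_Wr hz)

lemma measurable_optDist : Measurable I.optDist := by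
  unfold optDist
  exact Finset.measurable_sum _ fun i _ => Measurable.abs
    (Measurable.sub_const (measurable_pi_apply i) _)

lemma measurable_excess : Measurable I.excess := by
  unfold excess
  exact Finset.measurable_sum _ fun i _ => Measurable.mul_const
    (Measurable.sub_const (measurable_pi_apply i) _) _

lemma measurable_closeInd : Measurable (closeInd I) :=
  Measurable.ite (measurableSet_le I.measurable_optDist measurable_const)
    measurable_const measurable_const

end Instance

/-- The deterministic bound behind the conditional expectation of `alpha`. -/
lemma mul_min_le {w L : ℝ} (hw0 : 0 < w) (hw1 : w ≤ 1) (hL : 1 ≤ L) :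
    w * min 1 (2 * (1 - w) / (w ^ 2 * L)) ≤ 4 / √L * (1 - w) := by
  have hs : 0 < √L := Real.sqrt_pos.2 (by linarith)
  have hsL : √L ≤ L := by rw [Real.sqrt_le_left (by linarith)]; nlinarith
  rcases le_or_gt (1 / 2) w with h | h
  · calc w * min 1 (2 * (1 - w) / (w ^ 2 * L)) ≤ w * (2 * (1 - w) / (w ^ 2 * L)) := by
          gcongr; exact min_le_right _ _
      _ = 2 * (1 - w) / (w * L) := by field_simp
      _ ≤ 2 * (1 - w) / (1 / 2 * √L) := by
          apply div_le_div_of_nonneg_left (by linarith) (by positivity)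
          gcongr
      _ = _ := by field_simp; ring
  · have h1 : w * min 1 (2 * (1 - w) / (w ^ 2 * L)) ≤ 2 * (1 - w) / √L := by
      rcases le_or_gt w (1 / √L) with h2 | h2
      · calc w * min 1 (2 * (1 - w) / (w ^ 2 * L)) ≤ w * 1 := by gcongr; exact min_le_left _ _
          _ ≤ 1 / √L := by linarith
          _ ≤ _ := by gcongr; linarith
      · calc w * min 1 (2 * (1 - w) / (w ^ 2 * L)) ≤ w * (2 * (1 - w) / (w ^ 2 * L)) := by
              gcongr; exact min_le_right _ _
          _ = 2 * (1 - w) / (w * L) := by field_simp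
          _ ≤ _ := by
              apply div_le_div_of_nonneg_left (by linarith) hs
              rw [div_lt_iff₀ hs] at h2
              nlinarith [Real.sq_sqrt (by linarith : (0 : ℝ) ≤ L)]
    refine h1.trans ?_
    rw [div_mul_eq_mul_div]
    gcongr
    linarith

namespace RegularRun

variable {d : ℕ} {I : Instance d} {ρ : ℝ} {ε : Fin d → ℝ} {T : ℕ} {Ω : Type*}
  [mΩ : MeasurableSpace Ω] {μ : Measure Ω} [IsProbabilityMeasure μ] {q : ℕ → Ω → Fin d → ℝ}
  {a : ℕ → Ω → Fin d → ℕ} {l : ℕ → Ω → LossArray I.A} {x : ℕ → Ω → Fin d → ℝ}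
  (hr : RegularRun I ρ ε T μ q a l x)

include hr

lemma measurable_optDist (t : ℕ) : Measurable[history a l t] (fun ω => I.optDist (x t ω)) :=
  I.measurable_optDist.comp (hr.measurable_x t)

lemma measurable_closeInd (t : ℕ) : Measurable[history a l t] (fun ω => closeInd I (x t ω)) :=
  I.measurable_closeInd.comp (hr.measurable_x t)

lemma ae_abs_optDist_le {t : ℕ} (ht : t < T) : ∀ᵐ ω ∂μ, |I.optDist (x t ω)| ≤ I.Wr := by
  filter_upwards [hr.path] with ω hp
  rw [abs_of_nonneg (I.optDist_nonneg _)]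
  exact I.optDist_le_Wr (hp.x_mem t ht)

lemma integrable_of_bdd {t : ℕ} {G : Ω → ℝ} {C : ℝ} (hG : Measurable[history a l t] G)
    (hC : ∀ᵐ ω ∂μ, |G ω| ≤ C) : Integrable G μ :=
  Integrable.of_bound (hG.mono (hr.history_le t) le_rfl).aestronglyMeasurable C hC

lemma integrable_optDist {t : ℕ} (ht : t < T) : Integrable (fun ω => I.optDist (x t ω)) μ :=
  hr.integrable_of_bdd (hr.measurable_optDist t) (hr.ae_abs_optDist_le ht)

lemma integrable_excess {t : ℕ} (ht : t < T) : Integrable (fun ω => I.excess (x t ω)) μ := by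
  refine hr.integrable_of_bdd (C := I.Wr) (I.measurable_excess.comp (hr.measurable_x t)) ?_
  filter_upwards [hr.path] with ω hp
  rw [abs_of_nonneg (I.excess_nonneg (hp.x_mem t ht))]
  exact I.excess_le_Wr (hp.x_mem t ht)

lemma integrable_x {t : ℕ} (ht : t < T) (i : Fin d) : Integrable (fun ω => x t ω i) μ := by
  refine hr.integrable_of_bdd (C := maxPlays I.A i) (hr.measurable_x_apply t i) ?_
  filter_upwards [hr.path] with ω hp
  obtain ⟨h1, h2⟩ := hp.x_bounds ht i
  rw [abs_of_pos h1]; exact h2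

lemma ae_abs_noise_le {t : ℕ} (ht : t < T) (i : Fin d) : ∀ᵐ ω ∂μ,
    |noise I (traj q ω) (traj a ω) (traj l ω) (traj x ω) t i| ≤ 3 * I.Wr := by
  filter_upwards [hr.path] with ω hp
  exact hp.abs_noise_le ht i

/-- The truncated estimation errors are martingale differences. -/
lemma integral_mul_noise {t : ℕ} (ht : t < T) (i : Fin d) {G : Ω → ℝ} {C : ℝ}
    (hG : Measurable[history a l t] G) (hC : ∀ᵐ ω ∂μ, |G ω| ≤ C) :
    Integrable (fun ω => G ω * noise I (traj q ω) (traj a ω) (traj l ω) (traj x ω) t i) μ ∧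
    ∫ ω, G ω * noise I (traj q ω) (traj a ω) (traj l ω) (traj x ω) t i ∂μ = 0 := by
  have hG' : Measurable[history a l t] (fun ω => if 1 / 2 ≤ x t ω i then G ω else 0) :=
    Measurable.ite (measurableSet_le measurable_const (hr.measurable_x_apply t i)) hG
      measurable_const
  have hC' : ∀ᵐ ω ∂μ, |if 1 / 2 ≤ x t ω i then G ω else 0| ≤ C := by
    filter_upwards [hC] with ω h
    split_ifs
    · exact h
    · rw [abs_zero]; exact (abs_nonneg _).trans h
  obtain ⟨h1, h2⟩ := hr.integral_mul_lossEst ht i hG' hC'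
  have h3 : Integrable (fun ω => (if 1 / 2 ≤ x t ω i then G ω else 0) * I.mean i) μ :=
    (hr.integrable_of_bdd hG' hC').mul_const _
  have e : ∀ ω, G ω * noise I (traj q ω) (traj a ω) (traj l ω) (traj x ω) t i =
      (if 1 / 2 ≤ x t ω i then G ω else 0) *
        lossEst (traj q ω) (traj a ω) (traj l ω) (traj x ω) t i -
      (if 1 / 2 ≤ x t ω i then G ω else 0) * I.mean i := by
    intro ω
    unfold noise
    split_ifs
    · ring
    · simp
  simp only [e]
  refine ⟨h1.sub h3, ?_⟩
  rw [integral_sub h1 h3, h2, integral_mul_const]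
  ring

/-- The untruncated errors occur only away from `a*`, and have bounded expectation there: the
importance weight is integrated against the probability of a play. -/
lemma integral_farError_le {t : ℕ} (ht : t < T) {i : Fin d} (hi : I.aStar i ≠ 0) :
    Integrable (fun ω => farError I (traj q ω) (traj a ω) (traj l ω) (traj x ω) t i) μ ∧
    ∫ ω, farError I (traj q ω) (traj a ω) (traj l ω) (traj x ω) t i ∂μ ≤
      4 * ∫ ω, I.optDist (x t ω) ∂μ := by
  have hm : Measurable[history a l t] (fun ω => if 1 / 2 ≤ x t ω i then (0 : ℝ) else 1) :=
    Measurable.ite (measurableSet_le measurable_const (hr.measurable_x_apply t i))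
      measurable_const measurable_const
  have hC : ∀ᵐ ω ∂μ, |if 1 / 2 ≤ x t ω i then (0 : ℝ) else 1| ≤ 1 := by
    filter_upwards with ω
    split_ifs <;> simp
  have i1 := hr.integrable_of_bdd hm hC
  have i2 := hr.integrable_mul_play_div ht i hm hC
  have i3 : Integrable (fun ω => (if 1 / 2 ≤ x t ω i then (0 : ℝ) else 1) +
      (if 1 / 2 ≤ x t ω i then (0 : ℝ) else 1) * (x t ω i)⁻¹ * (a t ω i : ℝ)) μ := i1.add i2
  have hle : ∀ᵐ ω ∂μ, farError I (traj q ω) (traj a ω) (traj l ω) (traj x ω) t i ≤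
      (if 1 / 2 ≤ x t ω i then (0 : ℝ) else 1) +
      (if 1 / 2 ≤ x t ω i then (0 : ℝ) else 1) * (x t ω i)⁻¹ * (a t ω i : ℝ) := by
    filter_upwards [hr.path] with ω hp
    unfold farError
    split_ifs with h
    · simp
    · obtain ⟨q0, q1⟩ := hp.q_mem t ht.le i
      obtain ⟨m0, m1⟩ := I.mean_mem i
      have h1 := hp.abs_avgLoss_sub_le ht i
      have h0 := (hp.x_bounds ht i).1
      have h2 : |(a t ω i : ℝ) / x t ω i * (avgLoss (a t ω) (l t ω) i - q t ω i)| ≤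
          (x t ω i)⁻¹ * (a t ω i : ℝ) := by
        rw [abs_mul, abs_of_nonneg (by positivity), inv_mul_eq_div]
        exact mul_le_of_le_one_right (by positivity) h1
      have h3 := abs_le.1 h2
      unfold lossEst
      rw [abs_le]; constructor <;> simp only [traj] at * <;> linarith
  have hmeas : Measurable
      (fun ω => farError I (traj q ω) (traj a ω) (traj l ω) (traj x ω) t i) := by
    unfold farError
    refine Measurable.ite (measurableSet_le measurable_const
      ((hr.measurable_x_apply t i).mono (hr.history_le t) le_rfl)) measurable_const
      ((((hr.measurable_lossEst (Nat.lt_succ_self t) i).mono (hr.history_le _)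
        le_rfl).sub_const _).abs)
  have i4 : Integrable (fun ω => farError I (traj q ω) (traj a ω) (traj l ω) (traj x ω) t i) μ := by
    refine i3.mono' hmeas.aestronglyMeasurable ?_
    filter_upwards [hle] with ω h
    rwa [Real.norm_of_nonneg (farError_nonneg ..)]
  refine ⟨i4, ?_⟩
  calc _ ≤ ∫ ω, ((if 1 / 2 ≤ x t ω i then (0 : ℝ) else 1) +
      (if 1 / 2 ≤ x t ω i then (0 : ℝ) else 1) * (x t ω i)⁻¹ * (a t ω i : ℝ)) ∂μ :=
        integral_mono_ae i4 i3 hle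
    _ = 2 * ∫ ω, (if 1 / 2 ≤ x t ω i then (0 : ℝ) else 1) ∂μ := by
        rw [integral_add i1 i2, hr.integral_mul_play_div ht i hm hC]; ring
    _ ≤ 2 * ∫ ω, 2 * I.optDist (x t ω) ∂μ := by
        apply mul_le_mul_of_nonneg_left _ zero_le_two
        refine integral_mono i1 ((hr.integrable_optDist ht).const_mul 2) fun ω => ?_
        have h0 := I.optDist_nonneg (x t ω)
        have h1 := (abs_le.1 (I.abs_sub_le_optDist (x t ω) i)).1
        have h2 : (1 : ℝ) ≤ I.aStar i := by exact_mod_cast Nat.one_le_iff_ne_zero.2 hi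
        dsimp only
        split_ifs with h
        · positivity
        · push Not at h; linarith
    _ = _ := by rw [integral_const_mul]; ring

/-- The expected growth of the regularization parameter of arm `i` is small if `x_i` is close to
`n_i`. -/
lemma integral_mul_alpha_le {t : ℕ} (ht : t < T) (i : Fin d) {G : Ω → ℝ} {C : ℝ}
    (hG : Measurable[history a l t] G) (hC : ∀ᵐ ω ∂μ, |G ω| ≤ C) (hG0 : ∀ᵐ ω ∂μ, 0 ≤ G ω) :
    Integrable (fun ω => G ω * alpha (traj q ω) T (traj a ω) (traj l ω) (traj x ω) t i) μ ∧
    ∫ ω, G ω * alpha (traj q ω) T (traj a ω) (traj l ω) (traj x ω) t i ∂μ ≤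
      4 / √(Real.log T) * ∫ ω, G ω * (1 - x t ω i / maxPlays I.A i) ∂μ := by
  have hx := hr.measurable_x_apply t i
  have hm : Measurable[history a l t] (fun ω => G ω * (min 1 (2 * (1 - x t ω i / maxPlays I.A i) /
      ((x t ω i / maxPlays I.A i) ^ 2 * Real.log T)) / maxPlays I.A i)) :=
    hG.mul ((measurable_const.min ((measurable_const.mul (measurable_const.sub
      (hx.div_const _))).div (((hx.div_const _).pow_const 2).mul_const _))).div_const _)
  have hCm : ∀ᵐ ω ∂μ, |G ω * (min 1 (2 * (1 - x t ω i / maxPlays I.A i) /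
      ((x t ω i / maxPlays I.A i) ^ 2 * Real.log T)) / maxPlays I.A i)| ≤ C := by
    filter_upwards [hr.path, hC] with ω hp h
    have h1 := hp.min_nonneg ht i
    have h2 := hp.one_le_n_cast i
    rw [abs_mul, abs_of_nonneg (by positivity : 0 ≤ _ / (maxPlays I.A i : ℝ))]
    refine (mul_le_of_le_one_right (abs_nonneg _) ?_).trans h
    rw [div_le_one (by linarith)]
    exact (min_le_left _ _).trans h2
  have hCx : ∀ᵐ ω ∂μ, |G ω * (1 - x t ω i / maxPlays I.A i)| ≤ C := by
    filter_upwards [hr.path, hC] with ω hp h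
    have h1 := hp.w_pos ht i
    have h2 := hp.w_le ht i
    simp only [traj] at h1 h2
    rw [abs_mul, abs_of_nonneg (by linarith : 0 ≤ 1 - x t ω i / maxPlays I.A i)]
    exact (mul_le_of_le_one_right (abs_nonneg _) (by linarith)).trans h
  have i1 := hr.integrable_of_bdd hm hCm
  have i2 := hr.integrable_of_bdd (hG.mul (measurable_const.sub (hx.div_const _))) hCx
  have hma := hr.measurable_alpha t i
  have i3 : Integrable (fun ω => G ω *
      alpha (traj q ω) T (traj a ω) (traj l ω) (traj x ω) t i) μ := by
    refine (hr.integrable_of_bdd hG hC).mul_bdd (c := 1) hma.aestronglyMeasurable ?_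
    filter_upwards [hr.path] with ω hp
    rw [Real.norm_of_nonneg (hp.alpha_nonneg ht i)]
    exact hp.alpha_le_one ht i
  have i4 : Integrable (fun ω => G ω * (min 1 (2 * (1 - x t ω i / maxPlays I.A i) /
      ((x t ω i / maxPlays I.A i) ^ 2 * Real.log T)) / maxPlays I.A i) * (a t ω i : ℝ)) μ :=
    (hr.integrable_play ht i).bdd_mul (c := C)
      (hm.mono (hr.history_le t) le_rfl).aestronglyMeasurable hCm
  refine ⟨i3, ?_⟩
  calc _ ≤ ∫ ω, G ω * (min 1 (2 * (1 - x t ω i / maxPlays I.A i) /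
      ((x t ω i / maxPlays I.A i) ^ 2 * Real.log T)) / maxPlays I.A i) * (a t ω i : ℝ) ∂μ := by
        refine integral_mono_ae i3 i4 ?_
        filter_upwards [hr.path, hG0] with ω hp h0
        have h1 := hp.alpha_le_mul_min ht i
        calc _ ≤ G ω * _ := mul_le_mul_of_nonneg_left h1 h0
          _ = _ := by simp only [traj]; ring
    _ = ∫ ω, G ω * (min 1 (2 * (1 - x t ω i / maxPlays I.A i) /
      ((x t ω i / maxPlays I.A i) ^ 2 * Real.log T)) / maxPlays I.A i) * x t ω i ∂μ :=
        hr.integral_mul_play ht i hm i4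
    _ ≤ ∫ ω, 4 / √(Real.log T) * (G ω * (1 - x t ω i / maxPlays I.A i)) ∂μ := by
        refine integral_mono_ae ?_ (i2.const_mul _) ?_
        · refine i1.mul_bdd (c := maxPlays I.A i)
            (hx.mono (hr.history_le t) le_rfl).aestronglyMeasurable ?_
          filter_upwards [hr.path] with ω hp
          obtain ⟨h1, h2⟩ := hp.x_bounds ht i
          rw [Real.norm_of_nonneg h1.le]; exact h2
        · filter_upwards [hr.path, hG0] with ω hp h0
          have h1 := mul_min_le (hp.w_pos ht i) (hp.w_le ht i)
            (by linarith [hp.two_le_log] : 1 ≤ Real.log T)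
          calc _ = G ω * (x t ω i / maxPlays I.A i *
                min 1 (2 * (1 - x t ω i / maxPlays I.A i) /
                  ((x t ω i / maxPlays I.A i) ^ 2 * Real.log T))) := by ring
            _ ≤ G ω * _ := mul_le_mul_of_nonneg_left h1 h0
            _ = _ := by simp only [traj]; ring
    _ = _ := integral_const_mul _ _

lemma measurable_sum_noise (t e : ℕ) (i : Fin d) : Measurable[history a l e] (fun ω =>
    ∑ s ∈ Finset.Ico t e, noise I (traj q ω) (traj a ω) (traj l ω) (traj x ω) s i) :=
  Finset.measurable_sum _ fun _ hs => hr.measurable_noise (Finset.mem_Ico.1 hs).2 i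

lemma ae_abs_sum_noise_le {t e : ℕ} (he : e ≤ T) (i : Fin d) : ∀ᵐ ω ∂μ,
    |∑ s ∈ Finset.Ico t e, noise I (traj q ω) (traj a ω) (traj l ω) (traj x ω) s i| ≤
      (e - t : ℕ) * (3 * I.Wr) := by
  filter_upwards [hr.path] with ω hp
  calc _ ≤ ∑ s ∈ Finset.Ico t e, |noise I (traj q ω) (traj a ω) (traj l ω) (traj x ω) s i| :=
        Finset.abs_sum_le_sum_abs _ _
    _ ≤ ∑ _s ∈ Finset.Ico t e, 3 * I.Wr := Finset.sum_le_sum fun s hs =>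
        hp.abs_noise_le ((Finset.mem_Ico.1 hs).2.trans_le he) i
    _ = _ := by simp

/-- The variance of a sum of truncated estimation errors grows linearly. -/
lemma integral_mul_sq_sum_noise_le {t e : ℕ} (hte : t ≤ e) (he : e ≤ T) (i : Fin d) {G : Ω → ℝ}
    {C : ℝ} (hG : Measurable[history a l t] G) (hC : ∀ᵐ ω ∂μ, |G ω| ≤ C)
    (hG0 : ∀ᵐ ω ∂μ, 0 ≤ G ω) :
    Integrable (fun ω => G ω * (∑ s ∈ Finset.Ico t e,
      noise I (traj q ω) (traj a ω) (traj l ω) (traj x ω) s i) ^ 2) μ ∧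
    ∫ ω, G ω * (∑ s ∈ Finset.Ico t e,
      noise I (traj q ω) (traj a ω) (traj l ω) (traj x ω) s i) ^ 2 ∂μ ≤
      9 * I.Wr ^ 2 * (e - t : ℕ) * ∫ ω, G ω ∂μ := by
  have hint : ∀ e ≤ T, t ≤ e → Integrable (fun ω => G ω * (∑ s ∈ Finset.Ico t e,
      noise I (traj q ω) (traj a ω) (traj l ω) (traj x ω) s i) ^ 2) μ := by
    intro e he hte
    refine (hr.integrable_of_bdd hG hC).mul_bdd (c := ((e - t : ℕ) * (3 * I.Wr)) ^ 2)
      (((hr.measurable_sum_noise t e i).mono (hr.history_le e) le_rfl).pow_const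
        2).aestronglyMeasurable ?_
    filter_upwards [hr.ae_abs_sum_noise_le (t := t) he i] with ω h
    rw [norm_pow, Real.norm_eq_abs]
    gcongr
  refine ⟨hint e he hte, ?_⟩
  induction e, hte using Nat.le_induction with
  | base => simp
  | succ k hk ih =>
    have hk' : k < T := by omega
    have h1 := ih hk'.le
    have hGk := hG.mono (history_mono hk) le_rfl
    have hGM : Measurable[history a l k] (fun ω => G ω * ∑ s ∈ Finset.Ico t k,
      noise I (traj q ω) (traj a ω) (traj l ω) (traj x ω) s i) :=
      hGk.mul (hr.measurable_sum_noise t k i)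
    have hGMC : ∀ᵐ ω ∂μ, |G ω * ∑ s ∈ Finset.Ico t k,
        noise I (traj q ω) (traj a ω) (traj l ω) (traj x ω) s i| ≤
          C * ((k - t : ℕ) * (3 * I.Wr)) := by
      filter_upwards [hr.ae_abs_sum_noise_le (t := t) hk'.le i, hC] with ω h1 h2
      rw [abs_mul]
      exact mul_le_mul h2 h1 (abs_nonneg _) ((abs_nonneg _).trans h2)
    obtain ⟨i2, e2⟩ := hr.integral_mul_noise hk' i hGM hGMC
    have i3 : Integrable (fun ω => G ω *
        noise I (traj q ω) (traj a ω) (traj l ω) (traj x ω) k i ^ 2) μ := by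
      refine (hr.integrable_of_bdd hG hC).mul_bdd (c := (3 * I.Wr) ^ 2)
        (((hr.measurable_noise (Nat.lt_succ_self k) i).mono (hr.history_le _) le_rfl).pow_const
          2).aestronglyMeasurable ?_
      filter_upwards [hr.ae_abs_noise_le hk' i] with ω h
      rw [norm_pow, Real.norm_eq_abs]
      gcongr
    have e3 : ∫ ω, G ω * noise I (traj q ω) (traj a ω) (traj l ω) (traj x ω) k i ^ 2 ∂μ ≤
        9 * I.Wr ^ 2 * ∫ ω, G ω ∂μ := by
      rw [← integral_const_mul]
      refine integral_mono_ae i3 ((hr.integrable_of_bdd hG hC).const_mul _) ?_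
      filter_upwards [hr.ae_abs_noise_le hk' i, hG0] with ω h h0
      have h2 : noise I (traj q ω) (traj a ω) (traj l ω) (traj x ω) k i ^ 2 ≤ (3 * I.Wr) ^ 2 := by
        rw [← sq_abs]; gcongr
      nlinarith
    have e4 : ∀ ω, G ω * (∑ s ∈ Finset.Ico t (k + 1),
        noise I (traj q ω) (traj a ω) (traj l ω) (traj x ω) s i) ^ 2 =
        G ω * (∑ s ∈ Finset.Ico t k,
          noise I (traj q ω) (traj a ω) (traj l ω) (traj x ω) s i) ^ 2 +
        2 * (G ω * (∑ s ∈ Finset.Ico t k,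
          noise I (traj q ω) (traj a ω) (traj l ω) (traj x ω) s i) *
            noise I (traj q ω) (traj a ω) (traj l ω) (traj x ω) k i) +
        G ω * noise I (traj q ω) (traj a ω) (traj l ω) (traj x ω) k i ^ 2 := by
      intro ω
      rw [Finset.sum_Ico_succ_top hk]; ring
    simp only [e4]
    have i1 := hint k hk'.le hk
    have i12 : Integrable (fun ω => G ω * (∑ s ∈ Finset.Ico t k,
          noise I (traj q ω) (traj a ω) (traj l ω) (traj x ω) s i) ^ 2 +
        2 * (G ω * (∑ s ∈ Finset.Ico t k,
          noise I (traj q ω) (traj a ω) (traj l ω) (traj x ω) s i) *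
            noise I (traj q ω) (traj a ω) (traj l ω) (traj x ω) k i)) μ :=
      i1.add (i2.const_mul 2)
    rw [integral_add i12 i3, integral_add i1 (i2.const_mul 2), integral_const_mul, e2]
    have e5 : ((k + 1 - t : ℕ) : ℝ) = (k - t : ℕ) + 1 := by
      rw [Nat.succ_sub hk]; push_cast; ring
    rw [e5]
    linarith

/-- Near `a*`, the noise of a block has mean zero also after weighting it with the movement of the
points, since this movement is determined by the past. -/
lemma integral_closeInd_mul_noiseTerm {t e : ℕ} (he : e ≤ T) :
    Integrable (fun ω => closeInd I (x t ω) *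
      noiseTerm I (traj q ω) (traj a ω) (traj l ω) (traj x ω) t e) μ ∧
    ∫ ω, closeInd I (x t ω) *
      noiseTerm I (traj q ω) (traj a ω) (traj l ω) (traj x ω) t e ∂μ = 0 := by
  have h1 : ∀ i, ∀ s ∈ Finset.Ico t e, Integrable (fun ω => closeInd I (x t ω) *
      (x s ω i - x t ω i) * noise I (traj q ω) (traj a ω) (traj l ω) (traj x ω) s i) μ ∧
      ∫ ω, closeInd I (x t ω) * (x s ω i - x t ω i) *
        noise I (traj q ω) (traj a ω) (traj l ω) (traj x ω) s i ∂μ = 0 := by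
    intro i s hs
    rw [Finset.mem_Ico] at hs
    have hsT : s < T := by omega
    refine hr.integral_mul_noise hsT i (C := maxPlays I.A i)
      (((hr.measurable_closeInd t).mono (history_mono hs.1) le_rfl).mul
        ((hr.measurable_x_apply s i).sub
          ((hr.measurable_x_apply t i).mono (history_mono hs.1) le_rfl))) ?_
    filter_upwards [hr.path] with ω hp
    obtain ⟨a1, a2⟩ := hp.x_bounds hsT i
    obtain ⟨b1, b2⟩ := hp.x_bounds (by omega : t < T) i
    rw [abs_mul, abs_of_nonneg (closeInd_nonneg I _)]
    refine (mul_le_of_le_one_left (abs_nonneg _) (closeInd_le_one I _)).trans ?_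
    rw [abs_le]; constructor <;> simp only [traj] at * <;> linarith
  have e1 : ∀ ω, closeInd I (x t ω) *
      noiseTerm I (traj q ω) (traj a ω) (traj l ω) (traj x ω) t e =
      ∑ i, ∑ s ∈ Finset.Ico t e, if I.aStar i = 0 then 0 else
        (closeInd I (x t ω) * (x s ω i - x t ω i) *
          noise I (traj q ω) (traj a ω) (traj l ω) (traj x ω) s i) := by
    intro ω
    unfold noiseTerm
    rw [Finset.mul_sum]
    refine Finset.sum_congr rfl fun i _ => ?_
    split_ifs
    · simp
    · rw [Finset.mul_sum]
      exact Finset.sum_congr rfl fun s _ => by simp only [traj]; ring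
  simp only [e1]
  have h2 : ∀ i, ∀ s ∈ Finset.Ico t e, Integrable (fun ω => if I.aStar i = 0 then (0 : ℝ) else
        (closeInd I (x t ω) * (x s ω i - x t ω i) *
          noise I (traj q ω) (traj a ω) (traj l ω) (traj x ω) s i)) μ := by
    intro i s hs
    split_ifs
    · exact integrable_zero _ _ _
    · exact (h1 i s hs).1
  refine ⟨integrable_finsetSum _ fun i _ => integrable_finsetSum _ fun s hs => h2 i s hs, ?_⟩
  rw [integral_finsetSum _ fun i _ => integrable_finsetSum _ fun s hs => h2 i s hs]
  apply Finset.sum_eq_zero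
  intro i _
  rw [integral_finsetSum _ fun s hs => h2 i s hs]
  apply Finset.sum_eq_zero
  intro s hs
  split_ifs
  · simp
  · exact (h1 i s hs).2

/-- The noise of a block of length `B` is of order `√B`. -/
lemma integral_mul_abs_sum_noise_le {t B : ℕ} (hB : 1 ≤ B) (he : t + B ≤ T) (i : Fin d)
    {G : Ω → ℝ} {C : ℝ} (hG : Measurable[history a l t] G) (hC : ∀ᵐ ω ∂μ, |G ω| ≤ C)
    (hG0 : ∀ᵐ ω ∂μ, 0 ≤ G ω) :
    Integrable (fun ω => G ω * |∑ s ∈ Finset.Ico t (t + B),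
      noise I (traj q ω) (traj a ω) (traj l ω) (traj x ω) s i|) μ ∧
    ∫ ω, G ω * |∑ s ∈ Finset.Ico t (t + B),
      noise I (traj q ω) (traj a ω) (traj l ω) (traj x ω) s i| ∂μ ≤
      3 * I.Wr * √B * ∫ ω, G ω ∂μ := by
  obtain ⟨i1, e1⟩ := hr.integral_mul_sq_sum_noise_le (Nat.le_add_right t B) he i hG hC hG0
  have iG := hr.integrable_of_bdd hG hC
  have i2 : Integrable (fun ω => G ω * |∑ s ∈ Finset.Ico t (t + B),
      noise I (traj q ω) (traj a ω) (traj l ω) (traj x ω) s i|) μ := by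
    refine iG.mul_bdd (c := (t + B - t : ℕ) * (3 * I.Wr))
      ((hr.measurable_sum_noise t (t + B) i).mono (hr.history_le _) le_rfl).abs.aestronglyMeasurable
      ?_
    filter_upwards [hr.ae_abs_sum_noise_le (t := t) he i] with ω h
    rwa [Real.norm_eq_abs, abs_abs]
  refine ⟨i2, ?_⟩
  have hW : 0 < I.Wr := zero_lt_one.trans_le (I.one_le_Wr i)
  have hB' : (0 : ℝ) < B := by exact_mod_cast hB
  have hθ : 0 < 3 * I.Wr * √B := by positivity
  have hθ2 : (3 * I.Wr * √B) ^ 2 = 9 * I.Wr ^ 2 * B := by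
    rw [mul_pow, Real.sq_sqrt hB'.le]; ring
  rw [Nat.add_sub_cancel_left] at e1
  calc _ ≤ ∫ ω, (1 / (2 * (3 * I.Wr * √B)) * (G ω * (∑ s ∈ Finset.Ico t (t + B),
        noise I (traj q ω) (traj a ω) (traj l ω) (traj x ω) s i) ^ 2) +
        3 * I.Wr * √B / 2 * G ω) ∂μ := by
        refine integral_mono_ae i2 ((i1.const_mul _).add (iG.const_mul _)) ?_
        filter_upwards [hG0] with ω h0
        generalize (∑ s ∈ Finset.Ico t (t + B),
          noise I (traj q ω) (traj a ω) (traj l ω) (traj x ω) s i) = M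
        generalize 3 * I.Wr * √B = θ at *
        have h1 : |M| ≤ 1 / (2 * θ) * M ^ 2 + θ / 2 := by
          rw [← sub_nonneg]
          have : 1 / (2 * θ) * M ^ 2 + θ / 2 - |M| = (|M| - θ) ^ 2 / (2 * θ) := by
            rw [← sq_abs M]; field_simp; ring
          rw [this]; positivity
        calc _ ≤ G ω * (1 / (2 * θ) * M ^ 2 + θ / 2) := mul_le_mul_of_nonneg_left h1 h0
          _ = _ := by ring
    _ = 1 / (2 * (3 * I.Wr * √B)) * ∫ ω, G ω * (∑ s ∈ Finset.Ico t (t + B),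
        noise I (traj q ω) (traj a ω) (traj l ω) (traj x ω) s i) ^ 2 ∂μ +
        3 * I.Wr * √B / 2 * ∫ ω, G ω ∂μ := by
        rw [integral_add (i1.const_mul _) (iG.const_mul _), integral_const_mul, integral_const_mul]
    _ ≤ 1 / (2 * (3 * I.Wr * √B)) * ((3 * I.Wr * √B) ^ 2 * ∫ ω, G ω ∂μ) +
        3 * I.Wr * √B / 2 * ∫ ω, G ω ∂μ := by
        rw [hθ2]; gcongr
    _ = _ := by field_simp; ring

end RegularRun

/-! ### Ties, self-bounding and the comparator -/

section Ties

variable {d : ℕ} (I : Instance d)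

lemma sum_ite_lt_le {X : ℝ} (hX : 0 ≤ X) (N : ℕ) :
    ∑ e ∈ Finset.Ico 1 N, (if (e : ℝ) < X then (1 : ℝ) else 0) ≤ X := by
  rw [Finset.sum_boole]
  have h1 : ((Finset.Ico 1 N).filter fun e : ℕ => (e : ℝ) < X) ⊆ Finset.Ico 1 ⌈X⌉₊ := by
    intro e he
    rw [Finset.mem_filter, Finset.mem_Ico] at he
    exact Finset.mem_Ico.2 ⟨he.1.1, Nat.lt_ceil.2 he.2⟩
  have h2 := Finset.card_le_card h1
  rw [Nat.card_Ico] at h2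
  rcases hX.eq_or_lt with rfl | hX
  · simp only [Nat.ceil_zero] at h2
    simp
  · have h3 : 1 ≤ ⌈X⌉₊ := Nat.one_le_ceil_iff.2 hX
    have h4 := Nat.ceil_lt_add_one hX.le
    have h5 : (((Finset.Ico 1 N).filter fun e : ℕ => (e : ℝ) < X).card : ℝ) ≤ (⌈X⌉₊ - 1 : ℕ) := by
      exact_mod_cast h2
    rw [Nat.cast_sub h3] at h5
    push_cast at h5
    linarith

/-- The number of rounds with a tie: after `K log T` rounds, either the bounded estimation errors of
some arm deviate, or the unbounded ones, which occur away from `a*`, accumulate. -/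
lemma sum_tieInd_le {K c L : ℝ} (hK : 0 ≤ K * L) (hc : 0 < c) (q : ℕ → Fin d → ℝ)
    (a : ℕ → Fin d → ℕ) (l : ℕ → LossArray I.A) (x : ℕ → Fin d → ℝ) {N B : ℕ} (hB : 1 ≤ B) :
    ∑ t ∈ Finset.range (N - B), tieInd I K c L q a l x (t + B) ≤ K * L +
      ∑ i, if I.IsMid i then (∑ e ∈ Finset.Ico 1 N, 4 / (c ^ 2 * (e : ℝ) ^ 2) *
        (∑ s ∈ Finset.Ico 0 e, noise I q a l x s i) ^ 2 +
          2 / c * ∑ s ∈ Finset.range N, farError I q a l x s i) else 0 := by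
  have h1 : ∑ t ∈ Finset.range (N - B), tieInd I K c L q a l x (t + B) ≤
      ∑ e ∈ Finset.Ico 1 N, tieInd I K c L q a l x e := by
    calc _ = ∑ e ∈ Finset.Ico B N, tieInd I K c L q a l x e := by
          rw [Finset.sum_Ico_eq_sum_range]
          exact Finset.sum_congr rfl fun t _ => by rw [add_comm]
      _ ≤ _ := Finset.sum_le_sum_of_subset_of_nonneg (Finset.Ico_subset_Ico_left hB)
          fun e _ _ => tieInd_nonneg ..
  have hR : ∀ i, 0 ≤ 2 / c * ∑ s ∈ Finset.range N, farError I q a l x s i := fun i =>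
    mul_nonneg (by positivity) (Finset.sum_nonneg fun s _ => farError_nonneg ..)
  have h2 : ∀ e ∈ Finset.Ico 1 N, tieInd I K c L q a l x e ≤
      (if (e : ℝ) < K * L then (1 : ℝ) else 0) + ∑ i, if I.IsMid i then
        (4 / (c ^ 2 * (e : ℝ) ^ 2) * (∑ s ∈ Finset.Ico 0 e, noise I q a l x s i) ^ 2 +
          if (e : ℝ) < 2 / c * ∑ s ∈ Finset.range N, farError I q a l x s i then (1 : ℝ) else 0)
        else 0 := by
    intro e he
    rw [Finset.mem_Ico] at he
    have he0 : (0 : ℝ) < e := by exact_mod_cast he.1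
    have hnn : ∀ i, 0 ≤ if I.IsMid i then
        (4 / (c ^ 2 * (e : ℝ) ^ 2) * (∑ s ∈ Finset.Ico 0 e, noise I q a l x s i) ^ 2 +
          if (e : ℝ) < 2 / c * ∑ s ∈ Finset.range N, farError I q a l x s i then (1 : ℝ) else 0)
        else 0 := by
      intro i
      split_ifs <;> positivity
    unfold tieInd
    split_ifs with h h3 h3
    · exact add_nonneg zero_le_one (Finset.sum_nonneg fun i _ => hnn i)
    · exact add_nonneg le_rfl (Finset.sum_nonneg fun i _ => hnn i)
    · linarith [Finset.sum_nonneg fun i (_ : i ∈ Finset.univ) => hnn i]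
    · rw [not_and] at h
      have h4 := h (not_lt.1 h3)
      push Not at h4
      obtain ⟨i, hi, h5⟩ := h4
      rw [zero_add]
      refine le_trans ?_ (Finset.single_le_sum (fun i _ => hnn i) (Finset.mem_univ i))
      simp only [if_pos hi]
      have h6 : cumLoss q a l x e i - e * I.mean i = ∑ s ∈ Finset.Ico 0 e, noise I q a l x s i +
          ∑ s ∈ Finset.range e, if 1 / 2 ≤ x s i then 0 else lossEst q a l x s i - I.mean i := by
        unfold cumLoss noise
        rw [← Finset.range_eq_Ico, ← Finset.sum_add_distrib]
        have : (e : ℝ) * I.mean i = ∑ _s ∈ Finset.range e, I.mean i := by simp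
        rw [this, ← Finset.sum_sub_distrib]
        exact Finset.sum_congr rfl fun s _ => by split_ifs <;> simp
      have h7 : |∑ s ∈ Finset.range e, if 1 / 2 ≤ x s i then 0 else
          lossEst q a l x s i - I.mean i| ≤ ∑ s ∈ Finset.range N, farError I q a l x s i := by
        calc _ ≤ ∑ s ∈ Finset.range e, |if 1 / 2 ≤ x s i then 0 else
              lossEst q a l x s i - I.mean i| := Finset.abs_sum_le_sum_abs _ _
          _ = ∑ s ∈ Finset.range e, farError I q a l x s i :=
              Finset.sum_congr rfl fun s _ => by unfold farError; split_ifs <;> simp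
          _ ≤ _ := Finset.sum_le_sum_of_subset_of_nonneg
              (Finset.range_subset_range.2 he.2.le) fun s _ _ => farError_nonneg ..
      rw [h6] at h5
      have h8 := abs_add_le (∑ s ∈ Finset.Ico 0 e, noise I q a l x s i)
        (∑ s ∈ Finset.range e, if 1 / 2 ≤ x s i then 0 else lossEst q a l x s i - I.mean i)
      generalize (∑ s ∈ Finset.Ico 0 e, noise I q a l x s i) = M at *
      generalize (∑ s ∈ Finset.range N, farError I q a l x s i) = R at *
      by_cases h9 : (e : ℝ) < 2 / c * R
      · rw [if_pos h9]
        have : 0 ≤ 4 / (c ^ 2 * (e : ℝ) ^ 2) * M ^ 2 := by positivity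
        linarith
      · rw [if_neg h9, add_zero]
        rw [not_lt, div_mul_eq_mul_div, div_le_iff₀ hc] at h9
        have h10 : c * e / 2 ≤ |M| := by linarith
        rw [div_mul_eq_mul_div, le_div_iff₀ (by positivity), ← sq_abs M]
        nlinarith [mul_pos hc he0]
  have h3 := Finset.sum_le_sum h2
  rw [Finset.sum_add_distrib, Finset.sum_comm (s := Finset.Ico 1 N)] at h3
  have h4 := sum_ite_lt_le hK N
  have h5 : ∀ i, (∑ e ∈ Finset.Ico 1 N, if I.IsMid i then
        (4 / (c ^ 2 * (e : ℝ) ^ 2) * (∑ s ∈ Finset.Ico 0 e, noise I q a l x s i) ^ 2 +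
          if (e : ℝ) < 2 / c * ∑ s ∈ Finset.range N, farError I q a l x s i then (1 : ℝ) else 0)
        else 0) ≤ if I.IsMid i then (∑ e ∈ Finset.Ico 1 N, 4 / (c ^ 2 * (e : ℝ) ^ 2) *
        (∑ s ∈ Finset.Ico 0 e, noise I q a l x s i) ^ 2 +
          2 / c * ∑ s ∈ Finset.range N, farError I q a l x s i) else 0 := by
    intro i
    split_ifs with h
    · rw [Finset.sum_add_distrib]
      linarith [sum_ite_lt_le (hR i) N]
    · simp
  have h6 := Finset.sum_le_sum fun i (_ : i ∈ Finset.univ) => h5 i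
  linarith

end Ties

namespace Instance

variable {d : ℕ} (I : Instance d)

lemma mem_J {i : Fin d} : i ∈ I.J ↔ I.aStar i = 0 := by simp [J]

lemma finite_gaps (i : Fin d) : (I.gap '' {a | a ∈ I.A ∧ 1 ≤ a i}).Finite :=
  (I.A.finite_toSet.subset fun _ h => h.1).image _

lemma Delta_le {b : Fin d → ℕ} (hb : b ∈ I.A) {i : Fin d} (hi : 1 ≤ b i) : I.Delta i ≤ I.gap b :=
  csInf_le (I.finite_gaps i).bddBelow ⟨b, ⟨hb, hi⟩, rfl⟩

lemma Delta_pos {i : Fin d} (hi : I.aStar i = 0) : 0 < I.Delta i := by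
  obtain ⟨b, hb, h1⟩ := I.arm_playable i
  have hne : (I.gap '' {a | a ∈ I.A ∧ 1 ≤ a i}).Nonempty := ⟨I.gap b, b, ⟨hb, h1⟩, rfl⟩
  obtain ⟨c, ⟨hc, h2⟩, h3⟩ := hne.csInf_mem (I.finite_gaps i)
  unfold Delta
  rw [← h3]
  refine I.gap_pos hc ?_
  rintro rfl
  omega

lemma sum_J_le_lam {b : Fin d → ℕ} (hb : b ∈ I.A) : ∑ i ∈ I.J, b i ≤ I.lam := by
  apply le_min
  · calc _ ≤ ∑ i, b i := Finset.sum_le_sum_of_subset (Finset.subset_univ _)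
      _ ≤ _ := Finset.le_sup (f := fun a : Fin d → ℕ => ∑ i, a i) hb
  · exact Finset.sum_le_sum fun i _ => le_maxPlays hb i

lemma lam_pos {i : Fin d} (hi : I.aStar i = 0) : 0 < I.lam := by
  obtain ⟨b, hb, h1⟩ := I.arm_playable i
  exact lt_of_lt_of_le (h1.trans (Finset.single_le_sum (f := fun i => b i)
    (fun _ _ => Nat.zero_le _) (I.mem_J.2 hi))) (I.sum_J_le_lam hb)

/-- The self-bounding property that turns a bound in terms of the plays of suboptimal arms into a
logarithmic regret bound. -/
lemma sum_Delta_mul_le {z : Fin d → ℝ} (hz : z ∈ feasible I.A) :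
    ∑ i ∈ I.J, I.Delta i * z i ≤ I.lam * I.excess z := by
  obtain ⟨δ, h0, h1, h2⟩ := exists_weights hz.1
  rw [I.excess_eq_sum h1 h2, Finset.mul_sum]
  calc _ = ∑ b ∈ I.A, δ b * ∑ i ∈ I.J, I.Delta i * b i := by
        simp only [h2, Finset.mul_sum]
        rw [Finset.sum_comm]
        exact Finset.sum_congr rfl fun b _ => Finset.sum_congr rfl fun i _ => by ring
    _ ≤ ∑ b ∈ I.A, δ b * (I.lam * I.gap b) := by
        refine Finset.sum_le_sum fun b hb => mul_le_mul_of_nonneg_left ?_ (h0 b hb)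
        calc _ ≤ ∑ i ∈ I.J, I.gap b * b i := by
              refine Finset.sum_le_sum fun i _ => ?_
              rcases Nat.eq_zero_or_pos (b i) with h | h
              · simp [h]
              · exact mul_le_mul_of_nonneg_right (I.Delta_le hb h) (Nat.cast_nonneg _)
          _ = (∑ i ∈ I.J, b i : ℕ) * I.gap b := by
              rw [← Finset.mul_sum]; push_cast; ring
          _ ≤ _ := mul_le_mul_of_nonneg_right (by exact_mod_cast I.sum_J_le_lam hb)
              (I.gap_nonneg hb)
    _ = _ := Finset.sum_congr rfl fun b _ => by ring

lemma sigmaSq_nonneg (i : Fin d) : 0 ≤ I.sigmaSq i := variance_nonneg _ _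

lemma complexity_nonneg : 0 ≤ I.complexity := Finset.sum_nonneg fun i hi =>
  div_nonneg (mul_nonneg (Nat.cast_nonneg _) (I.sigmaSq_nonneg i)) (I.Delta_pos (I.mem_J.1 hi)).le

/-- A point close to `a*` at which the barrier is of order `log T`: the mixture of `a*` with the
actions that play the individual arms as often as possible. -/
lemma exists_comparator (hd : 0 < d) {T : ℕ} (hdT : d ≤ T) (hnT : 2 * I.Wr ≤ T) :
    ∃ u ∈ feasible I.A,
      (∀ i, phi (maxPlays I.A i) T (u i) ≤ 3 * maxPlays I.A i * Real.log T) ∧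
      (∀ i, I.IsMid i → u i ∈ Set.Icc (1 / 2 : ℝ) (maxPlays I.A i - 1 / 2)) ∧
      I.optDist u ≤ I.Wr / T := by
  have hd' : (0 : ℝ) < d := by exact_mod_cast hd
  have hT0 : (0 : ℝ) < T := hd'.trans_le (by exact_mod_cast hdT)
  have hT1 : (1 : ℝ) ≤ T := by exact_mod_cast (by omega : 1 ≤ T)
  have hmax : ∀ i, ∃ b ∈ I.A, b i = maxPlays I.A i := fun i => by
    obtain ⟨b, hb, h⟩ := Finset.exists_mem_eq_sup I.A ⟨_, I.aStar_mem⟩ (fun a => a i)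
    exact ⟨b, hb, h.symm⟩
  choose b hbA hbn using hmax
  set z : Fin d → ℝ := fun i => ∑ k : Fin d, 1 / (d : ℝ) * (b k i : ℝ) with hz
  have hzmem : z ∈ convexHull ℝ
      ((fun b : Fin d → ℕ => fun i => (b i : ℝ)) '' (I.A : Set (Fin d → ℕ))) := by
    have : z = ∑ k : Fin d, (1 / (d : ℝ)) • (fun i => (b k i : ℝ)) := by
      ext i; rw [Finset.sum_apply]; simp [hz]
    rw [this]
    apply (convex_convexHull ℝ _).sum_mem
    · intro k _; positivity
    · simp [hd'.ne']
    · intro k _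
      exact subset_convexHull _ _ (Set.mem_image_of_mem _ (hbA k))
  have hz0 : ∀ i, (maxPlays I.A i : ℝ) / d ≤ z i := by
    intro i
    calc (maxPlays I.A i : ℝ) / d = 1 / (d : ℝ) * (b i i : ℝ) := by rw [hbn]; ring
      _ ≤ _ := Finset.single_le_sum (f := fun k => 1 / (d : ℝ) * (b k i : ℝ))
          (fun k _ => by positivity) (Finset.mem_univ i)
  have hz1 : ∀ i, z i ≤ maxPlays I.A i := by
    intro i
    calc z i ≤ ∑ _k : Fin d, 1 / (d : ℝ) * (maxPlays I.A i : ℝ) := by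
          refine Finset.sum_le_sum fun k _ => mul_le_mul_of_nonneg_left ?_ (by positivity)
          exact_mod_cast le_maxPlays (hbA k) i
      _ = _ := by simp [hd'.ne']
  have hn0 : ∀ i, (0 : ℝ) < maxPlays I.A i := fun i => zero_lt_one.trans_le (I.one_le_n i)
  have hTinv : 1 / (T : ℝ) ≤ 1 := by rw [div_le_one hT0]; exact hT1
  set u : Fin d → ℝ := fun i => (1 - 1 / (T : ℝ)) * I.aStar i + 1 / (T : ℝ) * z i with hu
  have hulow : ∀ i, (maxPlays I.A i : ℝ) / (T * d) ≤ u i := by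
    intro i
    have h1 : 0 ≤ (1 - 1 / (T : ℝ)) * I.aStar i := mul_nonneg (by linarith) (Nat.cast_nonneg _)
    have h2 : 1 / (T : ℝ) * ((maxPlays I.A i : ℝ) / d) ≤ 1 / (T : ℝ) * z i :=
      mul_le_mul_of_nonneg_left (hz0 i) (by positivity)
    calc _ = 1 / (T : ℝ) * ((maxPlays I.A i : ℝ) / d) := by field_simp
      _ ≤ _ := by simp only [hu]; linarith
  have hu0 : ∀ i, 0 < u i := fun i => lt_of_lt_of_le
    (div_pos (hn0 i) (mul_pos hT0 hd')) (hulow i)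
  have hfeas : u ∈ feasible I.A := by
    refine ⟨?_, hu0⟩
    have := (convex_convexHull ℝ ((fun b : Fin d → ℕ => fun i => (b i : ℝ)) ''
      (I.A : Set (Fin d → ℕ)))) (subset_convexHull _ _ (Set.mem_image_of_mem _ I.aStar_mem)) hzmem
      (by linarith : 0 ≤ 1 - 1 / (T : ℝ)) (by positivity : 0 ≤ 1 / (T : ℝ)) (by ring)
    have e : u = (1 - 1 / (T : ℝ)) • (fun i => (I.aStar i : ℝ)) + (1 / (T : ℝ)) • z := rfl
    rw [e]; exact this
  have hdist : ∀ i, |u i - I.aStar i| ≤ maxPlays I.A i / T := by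
    intro i
    have h1 : u i - I.aStar i = 1 / (T : ℝ) * (z i - I.aStar i) := by simp only [hu]; ring
    have h2 : (I.aStar i : ℝ) ≤ maxPlays I.A i := by exact_mod_cast I.aStar_le i
    have h3 : (0 : ℝ) ≤ I.aStar i := Nat.cast_nonneg _
    have h4 : 0 ≤ z i := le_trans (by positivity) (hz0 i)
    rw [h1, abs_mul, abs_of_pos (by positivity : 0 < 1 / (T : ℝ)), div_mul_eq_mul_div, one_mul]
    gcongr
    rw [abs_le]
    constructor <;> linarith [hz1 i]
  refine ⟨u, hfeas, ?_, ?_, ?_⟩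
  · intro i
    obtain ⟨h1, h2⟩ := feasible_bounds hfeas i
    have v2 : 1 / (T * d : ℝ) ≤ u i / maxPlays I.A i := by
      rw [le_div_iff₀ (hn0 i)]
      calc _ = (maxPlays I.A i : ℝ) / (T * d) := by ring
        _ ≤ _ := hulow i
    have h5 : Real.log d ≤ Real.log T := Real.log_le_log hd' (by exact_mod_cast hdT)
    refine (phi_le (I.n_pos i) (by positivity) v2 h2).trans ?_
    rw [one_div, Real.log_inv, Real.log_mul hT0.ne' hd'.ne', mul_comm 3, mul_assoc]
    exact mul_le_mul_of_nonneg_left (by linarith) (hn0 i).le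
  · intro i hi
    have h1 := abs_le.1 (hdist i)
    have h2 : (maxPlays I.A i : ℝ) / T ≤ 1 / 2 := by
      rw [div_le_iff₀ hT0]; linarith [I.n_le_Wr i]
    have h3 : (1 : ℝ) ≤ I.aStar i := by exact_mod_cast hi.1
    have h4 : (I.aStar i : ℝ) + 1 ≤ maxPlays I.A i := by exact_mod_cast hi.2
    constructor <;> linarith
  · unfold optDist Wr
    rw [Finset.sum_div]
    exact Finset.sum_le_sum fun i _ => hdist i

/-- After `K log T` rounds, the accumulated gap between `a*` and any other action dominates the
regularization. -/
lemma exists_burn_in {Δ : ℝ} (hΔ : 0 < Δ) : ∃ K : ℝ, 0 < K ∧ ∀ L : ℝ, 0 < L → I.Wr ≤ L →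
    ∀ t : ℕ, K * L ≤ t → I.Wr + 4 * I.Wr ^ 2 * (3 / 2 * L + √(t * L)) < t * (Δ / 2) := by
  have hW := I.Wr_nonneg
  set k : ℝ := 1 + 64 * I.Wr ^ 2 / Δ + 8 / Δ with hk
  have h1 : 1 ≤ k := by
    have : 0 ≤ 64 * I.Wr ^ 2 / Δ + 8 / Δ := by positivity
    linarith
  have hkΔ : k * Δ = Δ + 64 * I.Wr ^ 2 + 8 := by rw [hk]; field_simp
  refine ⟨k ^ 2, by positivity, fun L hL hWL t ht => ?_⟩
  have ht0 : (0 : ℝ) < t := lt_of_lt_of_le (by positivity) ht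
  have hkk : k ≤ k ^ 2 := by nlinarith
  have e1 : I.Wr ≤ t * (Δ / 8) := by
    have : k * L ≤ t := (mul_le_mul_of_nonneg_right hkk hL.le).trans ht
    have : k * Δ * L ≤ t * Δ := by nlinarith
    nlinarith [mul_nonneg (sq_nonneg I.Wr) hL.le]
  have e2 : 4 * I.Wr ^ 2 * (3 / 2 * L) ≤ t * (Δ / 8) := by
    have : k * L ≤ t := (mul_le_mul_of_nonneg_right hkk hL.le).trans ht
    have : k * Δ * L ≤ t * Δ := by nlinarith
    nlinarith [mul_nonneg (sq_nonneg I.Wr) hL.le]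
  have e3 : √(t * L) ≤ t / k := by
    apply Real.sqrt_le_iff.2 ⟨by positivity, ?_⟩
    rw [div_pow, le_div_iff₀ (by positivity)]
    nlinarith
  have e4 : 4 * I.Wr ^ 2 * √(t * L) ≤ t * (Δ / 8) := by
    calc _ ≤ 4 * I.Wr ^ 2 * (t / k) := by gcongr
      _ = t * (4 * I.Wr ^ 2 / k) := by ring
      _ ≤ _ := by
        refine mul_le_mul_of_nonneg_left ?_ ht0.le
        rw [div_le_iff₀ (by linarith)]
        nlinarith
  have e5 : t * (Δ / 8) * 4 = t * (Δ / 2) := by ring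
  have e6 : 0 < t * (Δ / 8) := by positivity
  linarith

end Instance

namespace IsPath

variable {d : ℕ} {I : Instance d} {ρ : ℝ} {ε : Fin d → ℝ} {T : ℕ} {q : ℕ → Fin d → ℝ}
  {a : ℕ → Fin d → ℕ} {l : ℕ → LossArray I.A} {x : ℕ → Fin d → ℝ} (hp : IsPath I.A ρ ε T q a l x)

include hp

/-- The growth of the regularization parameter of one arm, with a free parameter `θ` for the
inequality between the arithmetic and the geometric mean. -/
lemma mul_log_mul_beta_sub_le {N : ℕ} (hN : N ≤ T) (i : Fin d) {θ : ℝ} (hθ : 0 < θ) :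
    maxPlays I.A i * Real.log T * (beta q ε T a l x N i - beta q ε T a l x 0 i) ≤
      (θ + Real.log T * (∑ s ∈ Finset.range N, ((a s i : ℝ) * (avgLoss (a s) (l s) i - q s i)) ^ 2)
        / θ) / 2 := by
  have hn := hp.n_cast_pos i
  have hL := hp.log_pos
  have h1 := hp.beta_sq hN i
  have h2 := hp.beta_sq (Nat.zero_le T) i
  have h3 := hp.beta_mono (Nat.zero_le N) hN i
  have h4 := hp.one_le_beta (Nat.zero_le T) i
  simp only [Finset.range_zero, Finset.sum_empty, mul_zero, add_zero] at h2
  have h5 : maxPlays I.A i ^ 2 * ∑ s ∈ Finset.range N, alpha q T a l x s i ≤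
      ∑ s ∈ Finset.range N, ((a s i : ℝ) * (avgLoss (a s) (l s) i - q s i)) ^ 2 := by
    rw [Finset.mul_sum]
    refine Finset.sum_le_sum fun s hs => ?_
    have e1 : alpha q T a l x s i ≤
        ((a s i : ℝ) / maxPlays I.A i) ^ 2 * (avgLoss (a s) (l s) i - q s i) ^ 2 :=
      mul_le_of_le_one_right (by positivity) (min_le_left _ _)
    calc _ ≤ (maxPlays I.A i : ℝ) ^ 2 * (((a s i : ℝ) / maxPlays I.A i) ^ 2 *
          (avgLoss (a s) (l s) i - q s i) ^ 2) := by gcongr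
      _ = _ := by field_simp
  set S := ∑ s ∈ Finset.range N, ((a s i : ℝ) * (avgLoss (a s) (l s) i - q s i)) ^ 2
  set y := maxPlays I.A i * Real.log T * (beta q ε T a l x N i - beta q ε T a l x 0 i) with hy
  have h6 : (beta q ε T a l x N i - beta q ε T a l x 0 i) ^ 2 ≤
      1 / Real.log T * ∑ s ∈ Finset.range N, alpha q T a l x s i := by nlinarith
  have h7 : y ^ 2 ≤ Real.log T * S := by
    calc y ^ 2 = maxPlays I.A i ^ 2 * Real.log T ^ 2 *
          (beta q ε T a l x N i - beta q ε T a l x 0 i) ^ 2 := by rw [hy]; ring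
      _ ≤ maxPlays I.A i ^ 2 * Real.log T ^ 2 *
          (1 / Real.log T * ∑ s ∈ Finset.range N, alpha q T a l x s i) := by gcongr
      _ = Real.log T * (maxPlays I.A i ^ 2 * ∑ s ∈ Finset.range N, alpha q T a l x s i) := by
          field_simp
      _ ≤ _ := by gcongr
  have h8 : y * θ ≤ (θ * θ + y ^ 2) / 2 := by nlinarith [sq_nonneg (y - θ)]
  calc y = y * θ / θ := by field_simp
    _ ≤ (θ * θ + y ^ 2) / 2 / θ := by gcongr
    _ ≤ (θ * θ + Real.log T * S) / 2 / θ := by gcongr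
    _ = _ := by field_simp

lemma growthTerm_zero_le {N : ℕ} (hN : N ≤ T) {θ : Fin d → ℝ} (hθ : ∀ i, 0 < θ i) :
    growthTerm I ρ q ε T a l x 0 N ≤ (3 * ((1 + ρ) / ρ) + 3) *
      (∑ i ∈ I.J, (θ i + Real.log T *
        (∑ s ∈ Finset.range N, ((a s i : ℝ) * (avgLoss (a s) (l s) i - q s i)) ^ 2) / θ i) / 2 +
      ∑ i, if I.aStar i = maxPlays I.A i then
        ∑ s ∈ Finset.range N, maxPlays I.A i * alpha q T a l x s i else 0) := by
  have hρ := hp.rho_pos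
  have hL := hp.log_pos
  have hα : ∀ i, ∀ s ∈ Finset.range N, 0 ≤ maxPlays I.A i * alpha q T a l x s i := fun i s hs =>
    mul_nonneg (Nat.cast_nonneg _) (hp.alpha_nonneg ((Finset.mem_range.1 hs).trans_le hN) i)
  have hX : ∀ i, 0 ≤ (θ i + Real.log T *
        (∑ s ∈ Finset.range N, ((a s i : ℝ) * (avgLoss (a s) (l s) i - q s i)) ^ 2) / θ i) / 2 := by
    intro i
    have := hθ i
    positivity
  unfold Instance.J growthTerm
  rw [Finset.sum_filter, ← Finset.sum_add_distrib, Finset.mul_sum]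
  refine Finset.sum_le_sum fun i _ => ?_
  split_ifs with h1 h2 h3 h4 h5
  · exact mul_nonneg (by positivity) (add_nonneg (hX i) (Finset.sum_nonneg (hα i)))
  · exact mul_nonneg (by positivity) (add_nonneg (hX i) le_rfl)
  · exact mul_nonneg (by positivity) (add_nonneg le_rfl (Finset.sum_nonneg (hα i)))
  · simp
  · rw [mul_assoc, mul_assoc, ← mul_assoc (maxPlays I.A i : ℝ)]
    refine mul_le_mul_of_nonneg_left ?_ (by positivity)
    exact (hp.mul_log_mul_beta_sub_le hN i (hθ i)).trans
      (le_add_of_nonneg_right (Finset.sum_nonneg (hα i)))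
  · rw [mul_assoc, mul_assoc, ← mul_assoc (maxPlays I.A i : ℝ), add_zero]
    exact mul_le_mul_of_nonneg_left (hp.mul_log_mul_beta_sub_le hN i (hθ i)) (by positivity)
  · rw [mul_assoc, mul_assoc, zero_add, ← Finset.mul_sum]
    refine mul_le_mul_of_nonneg_left (mul_le_mul_of_nonneg_left ?_ (Nat.cast_nonneg _))
      (by positivity)
    have h6 := hp.log_mul_beta_sub_le (Nat.zero_le N) hN i
    rw [← Finset.range_eq_Ico] at h6
    have h7 : 0 ≤ ∑ s ∈ Finset.range N, alpha q T a l x s i := Finset.sum_nonneg fun s hs =>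
      hp.alpha_nonneg ((Finset.mem_range.1 hs).trans_le hN) i
    linarith
  · have := I.aStar_le i
    omega

end IsPath

/-! ### The expected cost of all blocks -/

/-- The expected distance of the points of the algorithm to `a*`, summed over the rounds. -/
noncomputable def expDist {d : ℕ} (I : Instance d) {Ω : Type*} [MeasurableSpace Ω] (μ : Measure Ω)
    (x : ℕ → Ω → Fin d → ℝ) (N : ℕ) : ℝ :=
  ∑ t ∈ Finset.range N, ∫ ω, I.optDist (x t ω) ∂μ

/-- The expected excess loss of the points of the algorithm, summed over the rounds. -/
noncomputable def expRegret {d : ℕ} (I : Instance d) {Ω : Type*} [MeasurableSpace Ω]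
    (μ : Measure Ω) (x : ℕ → Ω → Fin d → ℝ) (N : ℕ) : ℝ :=
  ∑ t ∈ Finset.range N, ∫ ω, I.excess (x t ω) ∂μ

lemma sum_one_div_le {N T : ℕ} (hN : N ≤ T) :
    ∑ e ∈ Finset.Ico 1 N, 1 / (e : ℝ) ≤ 1 + Real.log T := by
  rcases Nat.eq_zero_or_pos T with rfl | hT
  · have : N = 0 := by omega
    subst this; simp
  · calc _ ≤ ∑ e ∈ Finset.Icc 1 T, 1 / (e : ℝ) := by
          apply Finset.sum_le_sum_of_subset_of_nonneg
          · intro e he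
            rw [Finset.mem_Ico] at he
            exact Finset.mem_Icc.2 ⟨he.1, by omega⟩
          · intro e _ _; positivity
      _ = (harmonic T : ℝ) := by
          rw [harmonic_eq_sum_Icc]; push_cast
          exact Finset.sum_congr rfl fun e _ => one_div _
      _ ≤ _ := harmonic_le_one_add_log T

namespace RegularRun

variable {d : ℕ} {I : Instance d} {ρ : ℝ} {ε : Fin d → ℝ} {T : ℕ} {Ω : Type*}
  [mΩ : MeasurableSpace Ω] {μ : Measure Ω} [IsProbabilityMeasure μ] {q : ℕ → Ω → Fin d → ℝ}
  {a : ℕ → Ω → Fin d → ℕ} {l : ℕ → Ω → LossArray I.A} {x : ℕ → Ω → Fin d → ℝ}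
  (hr : RegularRun I ρ ε T μ q a l x)

include hr

lemma integral_optDist_nonneg (t : ℕ) : 0 ≤ ∫ ω, I.optDist (x t ω) ∂μ :=
  integral_nonneg fun _ => I.optDist_nonneg _

lemma expDist_nonneg (N : ℕ) : 0 ≤ expDist I μ x N :=
  Finset.sum_nonneg fun t _ => hr.integral_optDist_nonneg t

lemma expDist_mono {N N' : ℕ} (h : N ≤ N') : expDist I μ x N ≤ expDist I μ x N' :=
  Finset.sum_le_sum_of_subset_of_nonneg (Finset.range_subset_range.2 h)
    fun t _ _ => hr.integral_optDist_nonneg t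

lemma expDist_le {K : ℝ} (hK : ∀ z ∈ feasible I.A, I.optDist z ≤ K * I.excess z) {N : ℕ}
    (hN : N ≤ T) : expDist I μ x N ≤ K * expRegret I μ x N := by
  unfold expDist expRegret
  rw [Finset.mul_sum]
  refine Finset.sum_le_sum fun t ht => ?_
  have ht' : t < T := (Finset.mem_range.1 ht).trans_le hN
  rw [← integral_const_mul]
  refine integral_mono_ae (hr.integrable_optDist ht') ((hr.integrable_excess ht').const_mul K) ?_
  filter_upwards [hr.path] with ω hp
  exact hK _ (hp.x_mem t ht')

lemma integral_sum_lossEst_mul_sub {u : Fin d → ℝ} {N : ℕ} (hN : N ≤ T) :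
    Integrable (fun ω => ∑ t ∈ Finset.range N, ∑ i,
      lossEst (traj q ω) (traj a ω) (traj l ω) (traj x ω) t i * (x t ω i - u i)) μ ∧
    ∫ ω, ∑ t ∈ Finset.range N, ∑ i,
      lossEst (traj q ω) (traj a ω) (traj l ω) (traj x ω) t i * (x t ω i - u i) ∂μ =
      expRegret I μ x N - N * I.excess u := by
  have h1 : ∀ t ∈ Finset.range N, ∀ i, Integrable (fun ω =>
      lossEst (traj q ω) (traj a ω) (traj l ω) (traj x ω) t i * (x t ω i - u i)) μ ∧
      ∫ ω, lossEst (traj q ω) (traj a ω) (traj l ω) (traj x ω) t i * (x t ω i - u i) ∂μ =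
        ∫ ω, (x t ω i - u i) * I.mean i ∂μ := by
    intro t ht i
    have ht' : t < T := (Finset.mem_range.1 ht).trans_le hN
    have := hr.integral_mul_lossEst ht' i (G := fun ω => x t ω i - u i)
      (C := maxPlays I.A i + |u i|) ((hr.measurable_x_apply t i).sub_const _) (by
        filter_upwards [hr.path] with ω hp
        obtain ⟨h1, h2⟩ := hp.x_bounds ht' i
        refine (abs_sub _ _).trans ?_
        rw [abs_of_pos (show 0 < x t ω i from h1)]
        exact add_le_add_left h2 _)
    simp only [mul_comm (lossEst _ _ _ _ t i)]
    rw [integral_mul_const, mul_comm]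
    exact this
  have h2 : ∀ t ∈ Finset.range N, Integrable (fun ω => ∑ i,
      lossEst (traj q ω) (traj a ω) (traj l ω) (traj x ω) t i * (x t ω i - u i)) μ :=
    fun t ht => integrable_finsetSum _ fun i _ => (h1 t ht i).1
  refine ⟨integrable_finsetSum _ h2, ?_⟩
  rw [integral_finsetSum _ h2]
  unfold expRegret
  have h3 : (N : ℝ) * I.excess u = ∑ _t ∈ Finset.range N, I.excess u := by simp
  rw [h3, ← Finset.sum_sub_distrib]
  refine Finset.sum_congr rfl fun t ht => ?_
  have ht' : t < T := (Finset.mem_range.1 ht).trans_le hN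
  rw [integral_finsetSum _ fun i _ => (h1 t ht i).1]
  have h4 : ∫ ω, I.excess (x t ω) ∂μ - I.excess u = ∫ ω, (I.excess (x t ω) - I.excess u) ∂μ := by
    rw [integral_sub (hr.integrable_excess ht') (integrable_const _)]; simp
  rw [h4]
  have h5 : ∀ ω, I.excess (x t ω) - I.excess u = ∑ i, (x t ω i - u i) * I.mean i := by
    intro ω
    unfold Instance.excess
    rw [← Finset.sum_sub_distrib]
    exact Finset.sum_congr rfl fun i _ => by ring
  simp only [h5]
  rw [integral_finsetSum]
  · exact Finset.sum_congr rfl fun i _ => (h1 t ht i).2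
  · intro i _
    exact ((hr.integrable_x ht' i).sub (integrable_const _)).mul_const _

lemma integrable_sq_play_mul {t : ℕ} (ht : t < T) (i : Fin d) : Integrable (fun ω =>
    ((a t ω i : ℝ) * (avgLoss (a t ω) (l t ω) i - q t ω i)) ^ 2) μ := by
  refine Integrable.of_bound ?_ ((maxPlays I.A i : ℝ) ^ 2) ?_
  · have h2 := (hr.measurable_q_apply t i).mono (hr.history_le t) le_rfl
    have h5 : Measurable (fun ω => avgLoss (a t ω) (l t ω) i) :=
      measurable_avgLoss ((hr.measurable_a t).prodMk (hr.measurable_l t)) i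
    exact (((hr.measurable_play t i).mul (h5.sub h2)).pow_const 2).aestronglyMeasurable
  · filter_upwards [hr.path] with ω hp
    have h1 := hp.abs_avgLoss_sub_le ht i
    have h2 : (a t ω i : ℝ) ≤ maxPlays I.A i := by exact_mod_cast le_maxPlays (hp.a_mem t ht) i
    rw [norm_pow, norm_mul, Real.norm_of_nonneg (by positivity), Real.norm_eq_abs]
    gcongr
    exact (mul_le_of_le_one_right (by positivity) h1).trans h2

/-- The expected growth of the regularization parameters, if the squared errors of the predictions
are of the order of the variances. -/
lemma exists_growthTerm_le {N : ℕ} (hN : N ≤ T) {κ : ℝ} (hκ : 0 ≤ κ) (hL : 2 ≤ Real.log T)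
    (hρ : 0 < ρ)
    (hpred : ∀ i, ∑ s ∈ Finset.range N,
      ∫ ω, ((a s ω i : ℝ) * (avgLoss (a s ω) (l s ω) i - q s ω i)) ^ 2 ∂μ ≤
        κ * I.sigmaSq i * ∑ s ∈ Finset.range N, ∫ ω, x s ω i ∂μ +
          6 * maxPlays I.A i ^ 2 * Real.log T) :
    ∃ Z : Ω → ℝ, Integrable Z μ ∧ (∀ᵐ ω ∂μ,
      growthTerm I ρ (traj q ω) ε T (traj a ω) (traj l ω) (traj x ω) 0 N ≤ Z ω) ∧
      ∫ ω, Z ω ∂μ ≤ (3 * ((1 + ρ) / ρ) + 3) ^ 2 * κ * I.complexity * Real.log T +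
        4 * (3 * ((1 + ρ) / ρ) + 3) * I.Wr * Real.log T + 1 / 4 * expRegret I μ x N +
        (3 * ((1 + ρ) / ρ) + 3) * (4 * I.Wr / √(Real.log T)) * expDist I μ x N := by
  have hL0 : 0 < Real.log T := by linarith
  have hC : 1 ≤ 3 * ((1 + ρ) / ρ) + 3 := by
    have : 0 ≤ (1 + ρ) / ρ := by positivity
    linarith
  set C := 3 * ((1 + ρ) / ρ) + 3 with hCdef
  have hC0 : 0 < C := by linarith
  have hθ0 : ∀ i, 0 ≤ 2 * C * κ * I.sigmaSq i * I.lam * Real.log T / I.Delta i ∨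
      I.aStar i ≠ 0 := by
    intro i
    by_cases hi : I.aStar i = 0
    · left
      have := (I.Delta_pos hi)
      have := I.sigmaSq_nonneg i
      positivity
    · exact Or.inr hi
  -- the optimal weight in the inequality between the means, up to constants
  set θ : Fin d → ℝ := fun i => (if I.aStar i = 0 then
    2 * C * κ * I.sigmaSq i * I.lam * Real.log T / I.Delta i else 0) +
      maxPlays I.A i * Real.log T with hθdef
  have hnL : ∀ i, 0 < maxPlays I.A i * Real.log T := fun i =>
    mul_pos (zero_lt_one.trans_le (I.one_le_n i)) hL0
  have hθ : ∀ i, 0 < θ i := by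
    intro i
    simp only [hθdef]
    split_ifs with h
    · rcases hθ0 i with h1 | h1
      · linarith [hnL i]
      · exact absurd h h1
    · linarith [hnL i]
  have iS : ∀ i, ∀ s ∈ Finset.range N, Integrable (fun ω =>
      ((a s ω i : ℝ) * (avgLoss (a s ω) (l s ω) i - q s ω i)) ^ 2) μ := fun i s hs =>
    hr.integrable_sq_play_mul ((Finset.mem_range.1 hs).trans_le hN) i
  have iSs : ∀ i, Integrable (fun ω => (θ i + Real.log T * (∑ s ∈ Finset.range N,
      ((a s ω i : ℝ) * (avgLoss (a s ω) (l s ω) i - q s ω i)) ^ 2) / θ i) / 2) μ := fun i =>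
    ((integrable_const _).add
      (((integrable_finsetSum _ (iS i)).const_mul _).div_const _)).div_const _
  have hα : ∀ i, ∀ s ∈ Finset.range N, Integrable (fun ω => (maxPlays I.A i : ℝ) *
      alpha (traj q ω) T (traj a ω) (traj l ω) (traj x ω) s i) μ ∧
      ∫ ω, (maxPlays I.A i : ℝ) * alpha (traj q ω) T (traj a ω) (traj l ω) (traj x ω) s i ∂μ ≤
        4 / √(Real.log T) * ∫ ω, (maxPlays I.A i - x s ω i) ∂μ := by
    intro i s hs
    obtain ⟨h1, h2⟩ := hr.integral_mul_alpha_le ((Finset.mem_range.1 hs).trans_le hN) i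
      (G := fun _ => (maxPlays I.A i : ℝ)) (C := maxPlays I.A i) measurable_const
      (by filter_upwards with ω; rw [abs_of_nonneg (by positivity)])
      (by filter_upwards with ω; positivity)
    refine ⟨h1, h2.trans (le_of_eq ?_)⟩
    congr 2
    ext ω
    have : (maxPlays I.A i : ℝ) ≠ 0 := (zero_lt_one.trans_le (I.one_le_n i)).ne'
    field_simp
  have iF : ∀ i, Integrable (fun ω => if I.aStar i = maxPlays I.A i then
      ∑ s ∈ Finset.range N, (maxPlays I.A i : ℝ) *
        alpha (traj q ω) T (traj a ω) (traj l ω) (traj x ω) s i else 0) μ := by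
    intro i
    split_ifs
    · exact integrable_finsetSum _ fun s hs => (hα i s hs).1
    · exact integrable_zero _ _ _
  have i1 : Integrable (fun ω => ∑ i ∈ I.J, (θ i + Real.log T * (∑ s ∈ Finset.range N,
      ((a s ω i : ℝ) * (avgLoss (a s ω) (l s ω) i - q s ω i)) ^ 2) / θ i) / 2) μ :=
    integrable_finsetSum _ fun i _ => iSs i
  have i2 : Integrable (fun ω => ∑ i, if I.aStar i = maxPlays I.A i then
      ∑ s ∈ Finset.range N, (maxPlays I.A i : ℝ) *
        alpha (traj q ω) T (traj a ω) (traj l ω) (traj x ω) s i else 0) μ :=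
    integrable_finsetSum _ fun i _ => iF i
  refine ⟨_, (i1.add i2).const_mul C, ?_, ?_⟩
  · filter_upwards [hr.path] with ω hp
    exact hp.growthTerm_zero_le hN hθ
  rw [integral_const_mul]
  simp only [Pi.add_apply]
  rw [integral_add i1 i2, integral_finsetSum _ fun i _ => iSs i,
    integral_finsetSum _ fun i _ => iF i, mul_add]
  have hfull : ∑ i, ∫ ω, (if I.aStar i = maxPlays I.A i then ∑ s ∈ Finset.range N,
      (maxPlays I.A i : ℝ) * alpha (traj q ω) T (traj a ω) (traj l ω) (traj x ω) s i else 0) ∂μ ≤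
      4 * I.Wr / √(Real.log T) * expDist I μ x N := by
    have h1 : ∀ i, ∫ ω, (if I.aStar i = maxPlays I.A i then ∑ s ∈ Finset.range N,
      (maxPlays I.A i : ℝ) * alpha (traj q ω) T (traj a ω) (traj l ω) (traj x ω) s i else 0) ∂μ ≤
        4 / √(Real.log T) * expDist I μ x N := by
      intro i
      have h0 : 0 ≤ 4 / √(Real.log T) * expDist I μ x N :=
        mul_nonneg (by positivity) (hr.expDist_nonneg N)
      split_ifs with h
      · rw [integral_finsetSum _ fun s hs => (hα i s hs).1]
        unfold expDist
        rw [Finset.mul_sum]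
        refine Finset.sum_le_sum fun s hs => (hα i s hs).2.trans ?_
        have hs' : s < T := (Finset.mem_range.1 hs).trans_le hN
        refine mul_le_mul_of_nonneg_left ?_ (by positivity)
        refine integral_mono ((integrable_const _).sub (hr.integrable_x hs' i))
          (hr.integrable_optDist hs') fun ω => ?_
        have h2 := (abs_le.1 (I.abs_sub_le_optDist (x s ω) i)).1
        rw [h] at h2
        dsimp only
        linarith
      · simpa using h0
    calc _ ≤ ∑ _i : Fin d, 4 / √(Real.log T) * expDist I μ x N :=
          Finset.sum_le_sum fun i _ => h1 i
      _ = d * (4 / √(Real.log T) * expDist I μ x N) := by simp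
      _ ≤ I.Wr * (4 / √(Real.log T) * expDist I μ x N) := by
          refine mul_le_mul_of_nonneg_right I.card_le_Wr
            (mul_nonneg (by positivity) (hr.expDist_nonneg N))
      _ = _ := by ring
  have hself : ∑ i ∈ I.J, I.Delta i / I.lam * ∑ s ∈ Finset.range N, ∫ ω, x s ω i ∂μ ≤
      expRegret I μ x N := by
    simp only [Finset.mul_sum]
    rw [Finset.sum_comm]
    refine Finset.sum_le_sum fun s hs => ?_
    have hs' : s < T := (Finset.mem_range.1 hs).trans_le hN
    have h1 : ∀ i, I.Delta i / I.lam * ∫ ω, x s ω i ∂μ =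
        ∫ ω, I.Delta i / I.lam * x s ω i ∂μ := fun i => (integral_const_mul _ _).symm
    simp only [h1]
    rw [← integral_finsetSum _ fun i _ => (hr.integrable_x hs' i).const_mul _]
    refine integral_mono_ae (integrable_finsetSum _ fun i _ => (hr.integrable_x hs' i).const_mul _)
      (hr.integrable_excess hs') ?_
    filter_upwards [hr.path] with ω hp
    have h2 := I.sum_Delta_mul_le (hp.x_mem s hs')
    rcases Nat.eq_zero_or_pos I.lam with h3 | h3
    · simp only [h3, Nat.cast_zero, div_zero, zero_mul, Finset.sum_const_zero]
      exact I.excess_nonneg (hp.x_mem s hs')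
    · have h4 : (0 : ℝ) < I.lam := by exact_mod_cast h3
      calc _ = (∑ i ∈ I.J, I.Delta i * x s ω i) / I.lam := by
            rw [Finset.sum_div]; exact Finset.sum_congr rfl fun i _ => by ring
        _ ≤ _ := by rw [div_le_iff₀ h4, mul_comm]; exact h2
  have hJ : ∀ i ∈ I.J, C * ∫ ω, (θ i + Real.log T * (∑ s ∈ Finset.range N,
      ((a s ω i : ℝ) * (avgLoss (a s ω) (l s ω) i - q s ω i)) ^ 2) / θ i) / 2 ∂μ ≤
      C ^ 2 * κ * Real.log T * (I.lam * I.sigmaSq i / I.Delta i) +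
        4 * C * Real.log T * maxPlays I.A i +
        1 / 4 * (I.Delta i / I.lam * ∑ s ∈ Finset.range N, ∫ ω, x s ω i ∂μ) := by
    intro i hi
    have hi0 := I.mem_J.1 hi
    have hΔ := I.Delta_pos hi0
    have hlam : (0 : ℝ) < I.lam := by exact_mod_cast I.lam_pos hi0
    have hσ := I.sigmaSq_nonneg i
    have hn : (0 : ℝ) < maxPlays I.A i := zero_lt_one.trans_le (I.one_le_n i)
    have hP : 0 ≤ ∑ s ∈ Finset.range N, ∫ ω, x s ω i ∂μ := by
      refine Finset.sum_nonneg fun s hs => integral_nonneg_of_ae ?_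
      filter_upwards [hr.path] with ω hp
      exact (hp.x_bounds ((Finset.mem_range.1 hs).trans_le hN) i).1.le
    have e1 : ∫ ω, (θ i + Real.log T * (∑ s ∈ Finset.range N,
        ((a s ω i : ℝ) * (avgLoss (a s ω) (l s ω) i - q s ω i)) ^ 2) / θ i) / 2 ∂μ =
        (θ i + Real.log T * (∑ s ∈ Finset.range N,
        ∫ ω, ((a s ω i : ℝ) * (avgLoss (a s ω) (l s ω) i - q s ω i)) ^ 2 ∂μ) / θ i) / 2 := by
      rw [integral_div, integral_add (integrable_const _)
        (((integrable_finsetSum _ (iS i)).const_mul _).div_const _), integral_div,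
        integral_const_mul, integral_finsetSum _ (iS i)]
      simp
    rw [e1]
    have e2 := hpred i
    set P := ∑ s ∈ Finset.range N, ∫ ω, x s ω i ∂μ
    set Y := 2 * C * κ * I.sigmaSq i * I.lam * Real.log T / I.Delta i with hY
    have hY0 : 0 ≤ Y := by positivity
    have hθi : θ i = Y + maxPlays I.A i * Real.log T := by
      simp only [hθdef, if_pos hi0]; rfl
    have hnLi := hnL i
    have hθi0 := hθ i
    have e3 : Real.log T * (κ * I.sigmaSq i * P + 6 * maxPlays I.A i ^ 2 * Real.log T) / θ i ≤
        I.Delta i / (2 * C * I.lam) * P + 6 * maxPlays I.A i * Real.log T := by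
      rw [div_le_iff₀ hθi0, hθi]
      have e4 : Y * (I.Delta i / (2 * C * I.lam)) = κ * I.sigmaSq i * Real.log T := by
        rw [hY]; field_simp
      have e5 : 0 ≤ I.Delta i / (2 * C * I.lam) := by positivity
      have e6 : (I.Delta i / (2 * C * I.lam) * P + 6 * maxPlays I.A i * Real.log T) *
          (Y + maxPlays I.A i * Real.log T) = Y * (I.Delta i / (2 * C * I.lam)) * P +
          6 * maxPlays I.A i ^ 2 * Real.log T * Real.log T +
          I.Delta i / (2 * C * I.lam) * P * (maxPlays I.A i * Real.log T) +
          6 * (maxPlays I.A i * Real.log T) * Y := by ring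
      rw [e6, e4]
      have e7 : 0 ≤ I.Delta i / (2 * C * I.lam) * P * (maxPlays I.A i * Real.log T) := by
        positivity
      have e8 : 0 ≤ 6 * (maxPlays I.A i * Real.log T) * Y := by positivity
      linarith
    have e9 : Real.log T * (∑ s ∈ Finset.range N,
        ∫ ω, ((a s ω i : ℝ) * (avgLoss (a s ω) (l s ω) i - q s ω i)) ^ 2 ∂μ) / θ i ≤
        Real.log T * (κ * I.sigmaSq i * P + 6 * maxPlays I.A i ^ 2 * Real.log T) / θ i := by
      gcongr
    calc _ ≤ C * ((θ i + (I.Delta i / (2 * C * I.lam) * P +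
          6 * maxPlays I.A i * Real.log T)) / 2) := by
          refine mul_le_mul_of_nonneg_left ?_ hC0.le
          linarith
      _ = C ^ 2 * κ * Real.log T * (I.lam * I.sigmaSq i / I.Delta i) +
          7 / 2 * C * Real.log T * maxPlays I.A i + 1 / 4 * (I.Delta i / I.lam * P) := by
          rw [hθi, hY]; field_simp; ring
      _ ≤ _ := by
          have : 0 ≤ C * Real.log T * maxPlays I.A i := by positivity
          linarith
  have h1 := Finset.sum_le_sum hJ
  rw [Finset.sum_add_distrib, Finset.sum_add_distrib, ← Finset.mul_sum, ← Finset.mul_sum,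
    ← Finset.mul_sum, ← Finset.mul_sum] at h1
  have h2 : ∑ i ∈ I.J, (maxPlays I.A i : ℝ) ≤ I.Wr :=
    Finset.sum_le_sum_of_subset_of_nonneg (Finset.subset_univ _) fun i _ _ => Nat.cast_nonneg _
  have h3 : 4 * C * Real.log T * ∑ i ∈ I.J, (maxPlays I.A i : ℝ) ≤ 4 * C * Real.log T * I.Wr :=
    mul_le_mul_of_nonneg_left h2 (by positivity)
  have h4 := mul_le_mul_of_nonneg_left hfull hC0.le
  have h5 : C ^ 2 * κ * Real.log T * ∑ i ∈ I.J, I.lam * I.sigmaSq i / I.Delta i =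
      C ^ 2 * κ * I.complexity * Real.log T := by
    unfold Instance.complexity; ring
  linarith

/-- The accumulated noise of the blocks, weighted with the distance to `a*`, has a factor `√B` only,
instead of `B`. -/
lemma integral_block_residual_le {N B : ℕ} (hB : 1 ≤ B) (hN : N ≤ T) :
    Integrable (fun ω => ∑ t ∈ Finset.range (N - B), closeInd I (x t ω) *
      (I.Wr * (3 * (∑ i, |∑ s ∈ Finset.Ico t (t + B),
        noise I (traj q ω) (traj a ω) (traj l ω) (traj x ω) s i|) + 9) * I.optDist (x t ω))) μ ∧
    ∫ ω, ∑ t ∈ Finset.range (N - B), closeInd I (x t ω) *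
      (I.Wr * (3 * (∑ i, |∑ s ∈ Finset.Ico t (t + B),
        noise I (traj q ω) (traj a ω) (traj l ω) (traj x ω) s i|) + 9) * I.optDist (x t ω)) ∂μ ≤
      I.Wr * (9 * I.Wr ^ 2 * √B + 9) * expDist I μ x N := by
  have hW := I.Wr_nonneg
  have hGm : ∀ t, Measurable[history a l t]
      (fun ω => closeInd I (x t ω) * I.optDist (x t ω)) := fun t =>
    (hr.measurable_closeInd t).mul (hr.measurable_optDist t)
  have hGle : ∀ z, closeInd I z * I.optDist z ≤ I.optDist z := fun z =>
    mul_le_of_le_one_left (I.optDist_nonneg z) (closeInd_le_one I z)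
  have hG0 : ∀ z, 0 ≤ closeInd I z * I.optDist z := fun z =>
    mul_nonneg (closeInd_nonneg I z) (I.optDist_nonneg z)
  have h1 : ∀ t ∈ Finset.range (N - B), Integrable (fun ω => closeInd I (x t ω) *
      (I.Wr * (3 * (∑ i, |∑ s ∈ Finset.Ico t (t + B),
        noise I (traj q ω) (traj a ω) (traj l ω) (traj x ω) s i|) + 9) * I.optDist (x t ω))) μ ∧
      ∫ ω, closeInd I (x t ω) *
      (I.Wr * (3 * (∑ i, |∑ s ∈ Finset.Ico t (t + B),
        noise I (traj q ω) (traj a ω) (traj l ω) (traj x ω) s i|) + 9) * I.optDist (x t ω)) ∂μ ≤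
        I.Wr * (9 * I.Wr ^ 2 * √B + 9) * ∫ ω, I.optDist (x t ω) ∂μ := by
    intro t ht
    rw [Finset.mem_range] at ht
    have htT : t < T := by omega
    have hC : ∀ᵐ ω ∂μ, |closeInd I (x t ω) * I.optDist (x t ω)| ≤ I.Wr := by
      filter_upwards [hr.ae_abs_optDist_le htT] with ω h
      rw [abs_of_nonneg (hG0 _)]
      exact (hGle _).trans ((le_abs_self _).trans h)
    have h2 := fun i => hr.integral_mul_abs_sum_noise_le hB (by omega : t + B ≤ T) i (hGm t) hC
      (Filter.Eventually.of_forall fun ω => hG0 _)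
    have iG := hr.integrable_of_bdd (hGm t) hC
    have hle : ∫ ω, closeInd I (x t ω) * I.optDist (x t ω) ∂μ ≤ ∫ ω, I.optDist (x t ω) ∂μ :=
      integral_mono iG (hr.integrable_optDist htT) fun ω => hGle _
    have hpos : 0 ≤ ∫ ω, closeInd I (x t ω) * I.optDist (x t ω) ∂μ :=
      integral_nonneg fun ω => hG0 _
    have e : ∀ ω, closeInd I (x t ω) *
      (I.Wr * (3 * (∑ i, |∑ s ∈ Finset.Ico t (t + B),
        noise I (traj q ω) (traj a ω) (traj l ω) (traj x ω) s i|) + 9) * I.optDist (x t ω)) =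
        3 * I.Wr * (∑ i, closeInd I (x t ω) * I.optDist (x t ω) * |∑ s ∈ Finset.Ico t (t + B),
          noise I (traj q ω) (traj a ω) (traj l ω) (traj x ω) s i|) +
        9 * I.Wr * (closeInd I (x t ω) * I.optDist (x t ω)) := by
      intro ω
      rw [← Finset.mul_sum]; ring
    simp only [e]
    have i1 := (integrable_finsetSum Finset.univ fun i _ => (h2 i).1).const_mul (3 * I.Wr)
    have i2 := iG.const_mul (9 * I.Wr)
    refine ⟨i1.add i2, ?_⟩
    rw [integral_add i1 i2, integral_const_mul, integral_const_mul,
      integral_finsetSum _ fun i _ => (h2 i).1]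
    have h3 := Finset.sum_le_sum fun i (_ : i ∈ Finset.univ) => (h2 i).2
    simp only [Finset.sum_const, Finset.card_univ, Fintype.card_fin, nsmul_eq_mul] at h3
    have h4 : (d : ℝ) * (3 * I.Wr * √B * ∫ ω, closeInd I (x t ω) * I.optDist (x t ω) ∂μ) ≤
        I.Wr * (3 * I.Wr * √B * ∫ ω, I.optDist (x t ω) ∂μ) := by
      have := I.card_le_Wr
      gcongr
    calc _ ≤ 3 * I.Wr * (I.Wr * (3 * I.Wr * √B * ∫ ω, I.optDist (x t ω) ∂μ)) +
          9 * I.Wr * ∫ ω, I.optDist (x t ω) ∂μ := by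
          gcongr
          exact h3.trans h4
      _ = _ := by ring
  refine ⟨integrable_finsetSum _ fun t ht => (h1 t ht).1, ?_⟩
  rw [integral_finsetSum _ fun t ht => (h1 t ht).1]
  refine (Finset.sum_le_sum fun t ht => (h1 t ht).2).trans ?_
  rw [← Finset.mul_sum]
  exact mul_le_mul_of_nonneg_left (hr.expDist_mono (Nat.sub_le N B)) (by positivity)

lemma integral_one_sub_closeInd_le {t : ℕ} (ht : t < T) :
    Integrable (fun ω => 1 - closeInd I (x t ω)) μ ∧
    ∫ ω, (1 - closeInd I (x t ω)) ∂μ ≤ 8 * ∫ ω, I.optDist (x t ω) ∂μ := by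
  have h1 : Integrable (fun ω => 1 - closeInd I (x t ω)) μ := by
    refine hr.integrable_of_bdd (C := 1) (measurable_const.sub (hr.measurable_closeInd t)) ?_
    filter_upwards with ω
    have h1 := closeInd_nonneg I (x t ω)
    have h2 := closeInd_le_one I (x t ω)
    rw [abs_le]; constructor <;> linarith
  refine ⟨h1, ?_⟩
  rw [← integral_const_mul]
  exact integral_mono h1 ((hr.integrable_optDist ht).const_mul 8) fun ω =>
    one_sub_closeInd_le I _

/-- The expected number of plays of arms outside `a*` is at most the distance to `a*`. A play
counts in at most `B` blocks. -/
lemma exists_extraPlays_le {N B : ℕ} (hBN : B ≤ N) (hN : N ≤ T) :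
    ∃ Z : Ω → ℝ, Integrable Z μ ∧
      (∀ ω, ∑ t ∈ Finset.range (N - B), extraPlays I (traj a ω) t (t + B) ≤ Z ω) ∧
      ∫ ω, Z ω ∂μ ≤ B * expDist I μ x N := by
  have h1 : ∀ s ∈ Finset.range N, ∀ i,
      Integrable (fun ω => if I.aStar i = 0 then (a s ω i : ℝ) else 0) μ := by
    intro s hs i
    split_ifs
    · exact hr.integrable_play ((Finset.mem_range.1 hs).trans_le hN) i
    · exact integrable_zero _ _ _
  have h2 : ∀ s ∈ Finset.range N,
      Integrable (fun ω => ∑ i, if I.aStar i = 0 then (a s ω i : ℝ) else 0) μ := fun s hs =>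
    integrable_finsetSum _ fun i _ => h1 s hs i
  refine ⟨fun ω => B * ∑ s ∈ Finset.range N, ∑ i, if I.aStar i = 0 then (a s ω i : ℝ) else 0,
    (integrable_finsetSum _ h2).const_mul _, fun ω => ?_, ?_⟩
  · exact sum_blocks_le_mul_sum hBN (fun s _ => Finset.sum_nonneg fun i _ => by
      split_ifs <;> positivity)
  · rw [integral_const_mul, integral_finsetSum _ h2]
    refine mul_le_mul_of_nonneg_left (Finset.sum_le_sum fun s hs => ?_) (Nat.cast_nonneg _)
    have hs' : s < T := (Finset.mem_range.1 hs).trans_le hN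
    rw [integral_finsetSum _ fun i _ => h1 s hs i]
    have h3 : ∀ i, ∫ ω, (if I.aStar i = 0 then (a s ω i : ℝ) else 0) ∂μ =
        ∫ ω, (if I.aStar i = 0 then x s ω i else 0) ∂μ := by
      intro i
      split_ifs
      · have := hr.integral_mul_play hs' i (G := fun _ => 1) measurable_const
          (by simpa using hr.integrable_play hs' i)
        simpa using this
      · rfl
    simp only [h3]
    have h4 : ∀ i, Integrable (fun ω => if I.aStar i = 0 then x s ω i else 0) μ := by
      intro i
      split_ifs
      · exact hr.integrable_x hs' i
      · exact integrable_zero _ _ _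
    rw [← integral_finsetSum _ fun i _ => h4 i]
    refine integral_mono (integrable_finsetSum _ fun i _ => h4 i) (hr.integrable_optDist hs')
      fun ω => Finset.sum_le_sum fun i _ => ?_
    split_ifs with h
    · rw [h]; simpa using le_abs_self (x s ω i)
    · exact abs_nonneg _

/-- The expected number of rounds with a tie. -/
lemma exists_tieInd_le {K c : ℝ} (hK : 0 < K) (hc : 0 < c) (hL : 2 ≤ Real.log T) {N B : ℕ}
    (hB : 1 ≤ B) (hN : N ≤ T) :
    ∃ Z : Ω → ℝ, Integrable Z μ ∧
      (∀ ω, ∑ t ∈ Finset.range (N - B),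
        tieInd I K c (Real.log T) (traj q ω) (traj a ω) (traj l ω) (traj x ω) (t + B) ≤ Z ω) ∧
      ∫ ω, Z ω ∂μ ≤ K * Real.log T +
        I.Wr * (36 * I.Wr ^ 2 / c ^ 2 * (1 + Real.log T) + 8 / c * expDist I μ x N) := by
  have hW := I.Wr_nonneg
  have hL0 : 0 < Real.log T := by linarith
  have h1 : ∀ i, ∀ e ∈ Finset.Ico 1 N, Integrable (fun ω => 4 / (c ^ 2 * (e : ℝ) ^ 2) *
      (∑ s ∈ Finset.Ico 0 e, noise I (traj q ω) (traj a ω) (traj l ω) (traj x ω) s i) ^ 2) μ ∧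
      ∫ ω, 4 / (c ^ 2 * (e : ℝ) ^ 2) *
      (∑ s ∈ Finset.Ico 0 e, noise I (traj q ω) (traj a ω) (traj l ω) (traj x ω) s i) ^ 2 ∂μ ≤
        36 * I.Wr ^ 2 / c ^ 2 * (1 / e) := by
    intro i e he
    rw [Finset.mem_Ico] at he
    have he0 : (0 : ℝ) < e := by exact_mod_cast he.1
    obtain ⟨h2, h3⟩ := hr.integral_mul_sq_sum_noise_le (Nat.zero_le e) (by omega : e ≤ T) i
      (G := fun _ => 1) (C := 1) measurable_const (by simp) (by simp)
    simp only [one_mul, integral_const, probReal_univ, smul_eq_mul, mul_one, Nat.sub_zero] at h2 h3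
    refine ⟨h2.const_mul _, ?_⟩
    rw [integral_const_mul]
    calc _ ≤ 4 / (c ^ 2 * (e : ℝ) ^ 2) * (9 * I.Wr ^ 2 * e) := by gcongr
      _ = _ := by field_simp; ring
  have h2 : ∀ i, Integrable (fun ω => if I.IsMid i then (∑ e ∈ Finset.Ico 1 N,
      4 / (c ^ 2 * (e : ℝ) ^ 2) *
        (∑ s ∈ Finset.Ico 0 e, noise I (traj q ω) (traj a ω) (traj l ω) (traj x ω) s i) ^ 2 +
          2 / c * ∑ s ∈ Finset.range N,
            farError I (traj q ω) (traj a ω) (traj l ω) (traj x ω) s i) else 0) μ ∧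
      ∫ ω, (if I.IsMid i then (∑ e ∈ Finset.Ico 1 N,
      4 / (c ^ 2 * (e : ℝ) ^ 2) *
        (∑ s ∈ Finset.Ico 0 e, noise I (traj q ω) (traj a ω) (traj l ω) (traj x ω) s i) ^ 2 +
          2 / c * ∑ s ∈ Finset.range N,
            farError I (traj q ω) (traj a ω) (traj l ω) (traj x ω) s i) else 0) ∂μ ≤
        36 * I.Wr ^ 2 / c ^ 2 * (1 + Real.log T) + 8 / c * expDist I μ x N := by
    intro i
    have h0 : 0 ≤ 36 * I.Wr ^ 2 / c ^ 2 * (1 + Real.log T) + 8 / c * expDist I μ x N :=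
      add_nonneg (by positivity) (mul_nonneg (by positivity) (hr.expDist_nonneg N))
    split_ifs with h
    · have hf : ∀ s ∈ Finset.range N, _ := fun s hs =>
        hr.integral_farError_le ((Finset.mem_range.1 hs).trans_le hN) h.1.ne'
      have i1 := integrable_finsetSum _ fun e he => (h1 i e he).1
      have i2 := (integrable_finsetSum _ fun s hs => (hf s hs).1).const_mul (2 / c)
      refine ⟨i1.add i2, ?_⟩
      rw [integral_add i1 i2, integral_const_mul, integral_finsetSum _ fun e he => (h1 i e he).1,
        integral_finsetSum _ fun s hs => (hf s hs).1]
      have e1 := Finset.sum_le_sum fun e he => (h1 i e he).2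
      rw [← Finset.mul_sum] at e1
      have e2 := Finset.sum_le_sum fun s hs => (hf s hs).2
      rw [← Finset.mul_sum] at e2
      have e3 := mul_le_mul_of_nonneg_left (sum_one_div_le hN)
        (by positivity : 0 ≤ 36 * I.Wr ^ 2 / c ^ 2)
      have e4 := mul_le_mul_of_nonneg_left e2 (by positivity : 0 ≤ 2 / c)
      have e5 : 2 / c * (4 * ∑ t ∈ Finset.range N, ∫ ω, I.optDist (x t ω) ∂μ) =
          8 / c * expDist I μ x N := by unfold expDist; ring
      linarith
    · exact ⟨integrable_zero _ _ _, by simpa using h0⟩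
  have i1 := integrable_finsetSum Finset.univ fun i _ => (h2 i).1
  refine ⟨_, (integrable_const (K * Real.log T)).add i1, fun ω => ?_, ?_⟩
  · exact sum_tieInd_le I (by positivity) hc _ _ _ _ hB
  · simp only [Pi.add_apply]
    rw [integral_add (integrable_const _) i1, integral_finsetSum _ fun i _ => (h2 i).1]
    simp only [integral_const, probReal_univ, smul_eq_mul, one_mul]
    refine add_le_add_right ?_ _
    refine (Finset.sum_le_sum fun i (_ : i ∈ Finset.univ) => (h2 i).2).trans ?_
    simp only [Finset.sum_const, Finset.card_univ, Fintype.card_fin, nsmul_eq_mul]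
    refine mul_le_mul_of_nonneg_right I.card_le_Wr ?_
    exact add_nonneg (by positivity) (mul_nonneg (by positivity) (hr.expDist_nonneg N))

/-- The growth of the regularization parameters in the blocks that start far from `a*`. -/
lemma integral_far_alphaSum_le {N B : ℕ} (hN : N ≤ T) :
    Integrable (fun ω => ∑ t ∈ Finset.range (N - B), (1 - closeInd I (x t ω)) *
      alphaSum I (traj q ω) T (traj a ω) (traj l ω) (traj x ω) t (t + B)) μ ∧
    ∫ ω, ∑ t ∈ Finset.range (N - B), (1 - closeInd I (x t ω)) *
      alphaSum I (traj q ω) T (traj a ω) (traj l ω) (traj x ω) t (t + B) ∂μ ≤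
      32 * B * I.Wr / √(Real.log T) * expDist I μ x N := by
  have hW := I.Wr_nonneg
  have h1 : ∀ t ∈ Finset.range (N - B), ∀ s ∈ Finset.Ico t (t + B), ∀ i,
      Integrable (fun ω => (1 - closeInd I (x t ω)) *
        alpha (traj q ω) T (traj a ω) (traj l ω) (traj x ω) s i) μ ∧
      ∫ ω, (1 - closeInd I (x t ω)) *
        alpha (traj q ω) T (traj a ω) (traj l ω) (traj x ω) s i ∂μ ≤
        4 / √(Real.log T) * (8 * ∫ ω, I.optDist (x t ω) ∂μ) := by
    intro t ht s hs i
    rw [Finset.mem_range] at ht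
    rw [Finset.mem_Ico] at hs
    have hsT : s < T := by omega
    have htT : t < T := by omega
    obtain ⟨i0, e0⟩ := hr.integral_one_sub_closeInd_le htT
    have hG0 : ∀ ω, 0 ≤ 1 - closeInd I (x t ω) := fun ω => sub_nonneg.2 (closeInd_le_one I _)
    obtain ⟨i1, e1⟩ := hr.integral_mul_alpha_le hsT i (G := fun ω => 1 - closeInd I (x t ω))
      (C := 1) ((measurable_const.sub (hr.measurable_closeInd t)).mono (history_mono hs.1) le_rfl)
      (Filter.Eventually.of_forall fun ω => by
        rw [abs_of_nonneg (hG0 ω)]; linarith [closeInd_nonneg I (x t ω)])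
      (Filter.Eventually.of_forall hG0)
    refine ⟨i1, e1.trans (mul_le_mul_of_nonneg_left (le_trans ?_ e0) (by positivity))⟩
    refine integral_mono_of_nonneg ?_ i0 ?_
    · filter_upwards [hr.path] with ω hp
      exact mul_nonneg (hG0 ω) (sub_nonneg.2 (hp.w_le hsT i))
    · filter_upwards [hr.path] with ω hp
      refine mul_le_of_le_one_right (hG0 ω) ?_
      have := hp.w_pos hsT i
      simp only [traj] at this
      linarith
  have e : ∀ ω, ∑ t ∈ Finset.range (N - B), (1 - closeInd I (x t ω)) *
      alphaSum I (traj q ω) T (traj a ω) (traj l ω) (traj x ω) t (t + B) =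
      ∑ t ∈ Finset.range (N - B), ∑ s ∈ Finset.Ico t (t + B), ∑ i, (1 - closeInd I (x t ω)) *
        alpha (traj q ω) T (traj a ω) (traj l ω) (traj x ω) s i := by
    intro ω
    unfold alphaSum
    simp only [Finset.mul_sum]
  simp only [e]
  have i3 : ∀ t ∈ Finset.range (N - B), ∀ s ∈ Finset.Ico t (t + B), Integrable (fun ω =>
      ∑ i, (1 - closeInd I (x t ω)) *
        alpha (traj q ω) T (traj a ω) (traj l ω) (traj x ω) s i) μ := fun t ht s hs =>
    integrable_finsetSum _ fun i _ => (h1 t ht s hs i).1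
  have i4 : ∀ t ∈ Finset.range (N - B), Integrable (fun ω => ∑ s ∈ Finset.Ico t (t + B),
      ∑ i, (1 - closeInd I (x t ω)) *
        alpha (traj q ω) T (traj a ω) (traj l ω) (traj x ω) s i) μ := fun t ht =>
    integrable_finsetSum _ fun s hs => i3 t ht s hs
  refine ⟨integrable_finsetSum _ i4, ?_⟩
  rw [integral_finsetSum _ i4]
  have h5 : ∀ t ∈ Finset.range (N - B), ∫ ω, ∑ s ∈ Finset.Ico t (t + B),
      ∑ i, (1 - closeInd I (x t ω)) *
        alpha (traj q ω) T (traj a ω) (traj l ω) (traj x ω) s i ∂μ ≤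
      32 * B * I.Wr / √(Real.log T) * ∫ ω, I.optDist (x t ω) ∂μ := by
    intro t ht
    have hD := hr.integral_optDist_nonneg t
    rw [integral_finsetSum _ (i3 t ht)]
    calc _ ≤ ∑ s ∈ Finset.Ico t (t + B), ∑ _i : Fin d,
          4 / √(Real.log T) * (8 * ∫ ω, I.optDist (x t ω) ∂μ) := by
          refine Finset.sum_le_sum fun s hs => ?_
          rw [integral_finsetSum _ fun i _ => (h1 t ht s hs i).1]
          exact Finset.sum_le_sum fun i _ => (h1 t ht s hs i).2
      _ = B * (d * (4 / √(Real.log T) * (8 * ∫ ω, I.optDist (x t ω) ∂μ))) := by simp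
      _ ≤ B * (I.Wr * (4 / √(Real.log T) * (8 * ∫ ω, I.optDist (x t ω) ∂μ))) := by
          have := I.card_le_Wr
          gcongr
      _ = _ := by ring
  refine (Finset.sum_le_sum h5).trans ?_
  rw [← Finset.mul_sum]
  exact mul_le_mul_of_nonneg_left (hr.expDist_mono (Nat.sub_le N B)) (by positivity)

end RegularRun

/-! ### The regret bound for accurate predictions -/

namespace IsPath

variable {d : ℕ} {I : Instance d} {ρ : ℝ} {ε : Fin d → ℝ} {T : ℕ} {q : ℕ → Fin d → ℝ}
  {a : ℕ → Fin d → ℕ} {l : ℕ → LossArray I.A} {x : ℕ → Fin d → ℝ} (hp : IsPath I.A ρ ε T q a l x)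

include hp

/-- The estimated regret on one sample path, as an average over all blocks of length `B`. -/
lemma mul_sum_lossEst_mul_sub_le {u : Fin d → ℝ} (hu : u ∈ feasible I.A)
    (hphi : ∀ i, phi (maxPlays I.A i) T (u i) ≤ 3 * maxPlays I.A i * Real.log T)
    (hu_mid : ∀ i, I.IsMid i → u i ∈ Set.Icc (1 / 2 : ℝ) (maxPlays I.A i - 1 / 2))
    {Δ c K : ℝ} (hgap : ∀ b ∈ I.A, b ≠ I.aStar → Δ ≤ I.gap b) (hc : c * I.Wr ≤ Δ / 2)
    (hreg : ∀ t : ℕ, K * Real.log T ≤ t →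
      I.Wr + 4 * I.Wr ^ 2 * (3 / 2 * Real.log T + √(t * Real.log T)) < t * (Δ / 2))
    {N B : ℕ} (hB1 : 1 ≤ B) (hBN : B ≤ N) (hN : N < T) (hlarge : LargeLog I ρ B (Real.log T)) :
    B * ∑ t ∈ Finset.range N, ∑ i, lossEst q a l x t i * (x t i - u i) ≤
      B * (I.Wr + 9 / 2 * I.Wr * Real.log T) + B * (B * ((3 * ((1 + ρ) / ρ) + 3) * I.Wr)) +
      B * growthTerm I ρ q ε T a l x 0 N + B * (B * I.Wr) +
      ∑ t ∈ Finset.range (N - B), closeInd I (x t) * noiseTerm I q a l x t (t + B) +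
      ∑ t ∈ Finset.range (N - B), closeInd I (x t) *
        (I.Wr * (3 * (∑ i, |∑ s ∈ Finset.Ico t (t + B), noise I q a l x s i|) + 9) *
          I.optDist (x t)) +
      N * I.optDist u +
      badConst I ρ B / √(Real.log T) * (∑ t ∈ Finset.range (N - B), (1 - closeInd I (x t)) +
        ∑ t ∈ Finset.range (N - B), extraPlays I a t (t + B) +
        ∑ t ∈ Finset.range (N - B), tieInd I K c (Real.log T) q a l x (t + B)) +
      (3 * ((1 + ρ) / ρ) + 3) * I.Wr * ∑ t ∈ Finset.range (N - B), (1 - closeInd I (x t)) *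
        alphaSum I q T a l x t (t + B) := by
  have h1 := hp.potential_diff_le hu hphi hN
  have h2 := mul_sum_le_sum_blocks (c := stepCost q ε T a l x u) hBN
    (fun s hs => hp.stepCost_le_const hphi (by omega : s + 1 < T))
  have h3 : ∑ t ∈ Finset.range (N - B), ∑ s ∈ Finset.Ico t (t + B), stepCost q ε T a l x u s ≤ _ :=
    Finset.sum_le_sum fun t ht => hp.sum_stepCost_block_le hphi hu_mid hgap hc hreg hB1
      (by rw [Finset.mem_range] at ht; omega : t + B < T) hlarge
  simp only [Finset.sum_add_distrib, ← Finset.mul_sum] at h3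
  have h4 := hp.sum_growthTerm_le hBN hN.le
  have h5 := hp.sum_driftTerm_le hBN hN.le
  have h6 : ∑ _t ∈ Finset.range (N - B), I.optDist u ≤ N * I.optDist u := by
    simp only [Finset.sum_const, Finset.card_range, nsmul_eq_mul]
    refine mul_le_mul_of_nonneg_right ?_ (I.optDist_nonneg u)
    exact_mod_cast Nat.sub_le N B
  have h7 : ∑ t ∈ Finset.range (N - B), (1 - closeInd I (x t)) *
      ((3 * ((1 + ρ) / ρ) + 3) * I.Wr * alphaSum I q T a l x t (t + B)) =
      (3 * ((1 + ρ) / ρ) + 3) * I.Wr * ∑ t ∈ Finset.range (N - B), (1 - closeInd I (x t)) *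
        alphaSum I q T a l x t (t + B) := by
    rw [Finset.mul_sum]
    exact Finset.sum_congr rfl fun t _ => by ring
  rw [h7] at h3
  have h8 := mul_le_mul_of_nonneg_left h1 (Nat.cast_nonneg (α := ℝ) B)
  linarith

end IsPath

namespace RegularRun

variable {d : ℕ} {I : Instance d} {ρ : ℝ} {ε : Fin d → ℝ} {T : ℕ} {Ω : Type*}
  [mΩ : MeasurableSpace Ω] {μ : Measure Ω} [IsProbabilityMeasure μ] {q : ℕ → Ω → Fin d → ℝ}
  {a : ℕ → Ω → Fin d → ℕ} {l : ℕ → Ω → LossArray I.A} {x : ℕ → Ω → Fin d → ℝ}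
  (hr : RegularRun I ρ ε T μ q a l x)

include hr

lemma expRegret_nonneg {N : ℕ} (hN : N ≤ T) : 0 ≤ expRegret I μ x N :=
  Finset.sum_nonneg fun t ht => integral_nonneg_of_ae (by
    filter_upwards [hr.path] with ω hp
    exact I.excess_nonneg (hp.x_mem t ((Finset.mem_range.1 ht).trans_le hN)))

/-- The regret bound for blocks of a fixed length `B`, before the terms that are linear in the
distance to `a*` are absorbed. -/
lemma mul_expRegret_le {u : Fin d → ℝ} (hu : u ∈ feasible I.A)
    (hphi : ∀ i, phi (maxPlays I.A i) T (u i) ≤ 3 * maxPlays I.A i * Real.log T)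
    (hu_mid : ∀ i, I.IsMid i → u i ∈ Set.Icc (1 / 2 : ℝ) (maxPlays I.A i - 1 / 2))
    {N B : ℕ} (hB1 : 1 ≤ B) (hBN : B ≤ N) (hN : N < T) (hudist : N * I.optDist u ≤ I.Wr)
    {Δ c K κ : ℝ} (hgap : ∀ b ∈ I.A, b ≠ I.aStar → Δ ≤ I.gap b) (hc0 : 0 < c)
    (hc : c * I.Wr ≤ Δ / 2) (hK : 0 < K)
    (hreg : ∀ t : ℕ, K * Real.log T ≤ t →
      I.Wr + 4 * I.Wr ^ 2 * (3 / 2 * Real.log T + √(t * Real.log T)) < t * (Δ / 2))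
    (hlarge : LargeLog I ρ B (Real.log T)) (hρ : 0 < ρ) (hL : 2 ≤ Real.log T) (hκ : 0 ≤ κ)
    (hpred : ∀ i, ∑ s ∈ Finset.range N,
      ∫ ω, ((a s ω i : ℝ) * (avgLoss (a s ω) (l s ω) i - q s ω i)) ^ 2 ∂μ ≤
        κ * I.sigmaSq i * ∑ s ∈ Finset.range N, ∫ ω, x s ω i ∂μ +
          6 * maxPlays I.A i ^ 2 * Real.log T) :
    B * expRegret I μ x N ≤
      B * (2 * I.Wr + 9 / 2 * I.Wr * Real.log T) + B * (B * ((3 * ((1 + ρ) / ρ) + 3) * I.Wr)) +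
      B * ((3 * ((1 + ρ) / ρ) + 3) ^ 2 * κ * I.complexity * Real.log T +
        4 * (3 * ((1 + ρ) / ρ) + 3) * I.Wr * Real.log T + 1 / 4 * expRegret I μ x N +
        (3 * ((1 + ρ) / ρ) + 3) * (4 * I.Wr / √(Real.log T)) * expDist I μ x N) +
      B * (B * I.Wr) + I.Wr * (9 * I.Wr ^ 2 * √B + 9) * expDist I μ x N + I.Wr +
      badConst I ρ B / √(Real.log T) * (8 * expDist I μ x N + B * expDist I μ x N +
        (K * Real.log T +
          I.Wr * (36 * I.Wr ^ 2 / c ^ 2 * (1 + Real.log T) + 8 / c * expDist I μ x N))) +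
      (3 * ((1 + ρ) / ρ) + 3) * I.Wr * (32 * B * I.Wr / √(Real.log T) * expDist I μ x N) := by
  have hW := I.Wr_nonneg
  have hbc := badConst_nonneg I hρ B
  have hbs : 0 ≤ badConst I ρ B / √(Real.log T) := by positivity
  obtain ⟨i0, e0⟩ := hr.integral_sum_lossEst_mul_sub (u := u) hN.le
  obtain ⟨Zg, ig, hg, eg⟩ := hr.exists_growthTerm_le hN.le hκ hL hρ hpred
  obtain ⟨im, em⟩ := hr.integral_block_residual_le (N := N) hB1 hN.le
  obtain ⟨Ze, ie, he, ee⟩ := hr.exists_extraPlays_le hBN hN.le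
  obtain ⟨Zt, it, ht, et⟩ := hr.exists_tieInd_le hK hc0 hL hB1 hN.le
  obtain ⟨ia, ea⟩ := hr.integral_far_alphaSum_le (N := N) (B := B) hN.le
  have hnoise : ∀ t ∈ Finset.range (N - B), _ := fun t ht =>
    hr.integral_closeInd_mul_noiseTerm (t := t) (e := t + B)
      (by rw [Finset.mem_range] at ht; omega)
  have hfar : ∀ t ∈ Finset.range (N - B), _ := fun t ht =>
    hr.integral_one_sub_closeInd_le (t := t) (by rw [Finset.mem_range] at ht; omega)
  have inn := integrable_finsetSum _ fun t ht => (hnoise t ht).1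
  have en := integral_finsetSum _ fun t ht => (hnoise t ht).1
  rw [Finset.sum_eq_zero fun t ht => (hnoise t ht).2] at en
  have ifa := integrable_finsetSum _ fun t ht => (hfar t ht).1
  have ef : ∫ ω, ∑ t ∈ Finset.range (N - B), (1 - closeInd I (x t ω)) ∂μ ≤
      8 * expDist I μ x N := by
    rw [integral_finsetSum _ fun t ht => (hfar t ht).1]
    refine (Finset.sum_le_sum fun t ht => (hfar t ht).2).trans ?_
    rw [← Finset.mul_sum]
    exact mul_le_mul_of_nonneg_left (hr.expDist_mono (Nat.sub_le N B)) (by norm_num)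
  set c0 : ℝ := B * (I.Wr + 9 / 2 * I.Wr * Real.log T) +
    B * (B * ((3 * ((1 + ρ) / ρ) + 3) * I.Wr)) + B * (B * I.Wr) + N * I.optDist u with hc0def
  have j1 := (integrable_const (μ := μ) c0).add (ig.const_mul (B : ℝ))
  have j2 := j1.add inn
  have j3 := j2.add im
  have jb := ((ifa.add ie).add it).const_mul (badConst I ρ B / √(Real.log T))
  have j4 := j3.add jb
  have ja := ia.const_mul ((3 * ((1 + ρ) / ρ) + 3) * I.Wr)
  have j5 := j4.add ja
  have hmono := integral_mono_ae (i0.const_mul (B : ℝ)) j5 (by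
    filter_upwards [hr.path, hg] with ω hp hgω
    have h1 := hp.mul_sum_lossEst_mul_sub_le hu hphi hu_mid hgap hc hreg hB1 hBN hN hlarge
    have h2 := mul_le_mul_of_nonneg_left hgω (Nat.cast_nonneg (α := ℝ) B)
    have h3 := mul_le_mul_of_nonneg_left (add_le_add (add_le_add_right (he ω)
      (∑ t ∈ Finset.range (N - B), (1 - closeInd I (x t ω)))) (ht ω)) hbs
    simp only [Pi.add_apply]
    simp only [traj] at *
    linarith)
  rw [integral_const_mul, e0] at hmono
  rw [integral_add' j4 ja, integral_add' j3 jb, integral_add' j2 im, integral_add' j1 inn,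
    integral_add' (integrable_const _) (ig.const_mul _), integral_const_mul, integral_const_mul,
    integral_const_mul, integral_add' (ifa.add ie) it, integral_add' ifa ie, en] at hmono
  simp only [integral_const, probReal_univ, smul_eq_mul, one_mul, add_zero] at hmono
  have h1 : N * I.excess u ≤ I.Wr :=
    (mul_le_mul_of_nonneg_left (I.excess_le_optDist u) (Nat.cast_nonneg N)).trans hudist
  have hB0 : (0 : ℝ) ≤ B := Nat.cast_nonneg B
  have h2 := mul_le_mul_of_nonneg_left h1 hB0
  have h3 := mul_le_mul_of_nonneg_left eg hB0
  have h4 := mul_le_mul_of_nonneg_left (add_le_add (add_le_add ef ee) et) hbs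
  have h5 := mul_le_mul_of_nonneg_left ea
    (by positivity : 0 ≤ (3 * ((1 + ρ) / ρ) + 3) * I.Wr)
  rw [hc0def] at hmono
  linarith

end RegularRun

section Thresholds

lemma eventually_div_sqrt_le (X : ℝ) {y : ℝ} (hy : 0 < y) :
    ∀ᶠ L in Filter.atTop, X / √L ≤ y :=
  ((tendsto_const_nhds (x := X)).div_atTop Real.tendsto_sqrt_atTop).eventually_le_const hy

lemma eventually_largeLog {d : ℕ} (I : Instance d) (ρ : ℝ) {B : ℕ} (hB : 1 ≤ B) :
    ∀ᶠ L in Filter.atTop, LargeLog I ρ B L := by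
  have hB' : (0 : ℝ) < B := by exact_mod_cast hB
  filter_upwards [eventually_div_sqrt_le (I.Wr * (B * moveConst I ρ)) (y := 1 / 8) (by norm_num),
    eventually_div_sqrt_le (I.Wr * (4 * I.Wr * B * (B * moveConst I ρ) + 12 * B * I.Wr ^ 4))
      (y := (1 / (3 * B)) ^ 2) (by positivity),
    Filter.eventually_ge_atTop ((4 * B * I.Wr ^ 2 + 1) * I.Wr ^ 2 + 16 * B * I.Wr ^ 5),
    Filter.eventually_ge_atTop (32 * B * I.Wr ^ 4)] with L h1 h2 h3 h4
  exact ⟨le_trans (le_of_eq (by ring)) h1, h2, h3, h4⟩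

/-- For long blocks, the accumulated noise `X (9 X² √B + 9)` is small compared with `B`. -/
lemma exists_block_length (X K : ℝ) :
    ∃ B : ℕ, 1 ≤ B ∧ X * (9 * X ^ 2 * √B + 9) * K ≤ B * (1 / 8) := by
  have h : ∀ᶠ L in Filter.atTop, 9 * X ^ 3 * K / √L ≤ 1 / 16 :=
    eventually_div_sqrt_le _ (by norm_num)
  have h2 := tendsto_natCast_atTop_atTop (R := ℝ) |>.eventually (h.and
    (Filter.eventually_ge_atTop (16 * (9 * X * K))))
  obtain ⟨B, ⟨hB1, hB2⟩, hB⟩ := (h2.and (Filter.eventually_ge_atTop 1)).exists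
  refine ⟨B, hB, ?_⟩
  have hB' : (0 : ℝ) < B := by exact_mod_cast hB
  have hs : 0 < √(B : ℝ) := Real.sqrt_pos.2 hB'
  rw [div_le_iff₀ hs] at hB1
  have h3 := mul_le_mul_of_nonneg_right hB1 hs.le
  have h4 : √(B : ℝ) * √(B : ℝ) = B := Real.mul_self_sqrt hB'.le
  calc _ = 9 * X ^ 3 * K * √B + 9 * X * K := by ring
    _ ≤ 1 / 16 * √B * √B + B / 16 := add_le_add h3 (by linarith)
    _ = B * (1 / 8) := by rw [mul_assoc, h4]; ring

end Thresholds

/-- Logarithmic regret, with a constant that depends only on `ρ`, whenever the squared errors of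
the predictions are of the order of the variances of the losses. -/
theorem exists_expRegret_le {ρ κ : ℝ} (hρ : 0 < ρ) (hκ : 0 ≤ κ) : ∃ C : ℝ, 0 < C ∧
    ∀ (d : ℕ) (I : Instance d), ∃ T₀ : ℕ, ∀ T ≥ T₀, ∀ (ε : Fin d → ℝ) (Ω : Type*)
      [MeasurableSpace Ω] (μ : Measure Ω) [IsProbabilityMeasure μ] (q : ℕ → Ω → Fin d → ℝ)
      (a : ℕ → Ω → Fin d → ℕ) (l : ℕ → Ω → LossArray I.A) (x : ℕ → Ω → Fin d → ℝ),
      RegularRun I ρ ε T μ q a l x →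
      (∀ i, ∑ s ∈ Finset.range (T - 1),
        ∫ ω, ((a s ω i : ℝ) * (avgLoss (a s ω) (l s ω) i - q s ω i)) ^ 2 ∂μ ≤
          κ * I.sigmaSq i * ∑ s ∈ Finset.range (T - 1), ∫ ω, x s ω i ∂μ +
            6 * maxPlays I.A i ^ 2 * Real.log T) →
      expRegret I μ x T ≤ C * (I.complexity + I.W) * Real.log T := by
  set C := 3 * ((1 + ρ) / ρ) + 3 with hC
  have hC0 : 0 < C := by positivity
  refine ⟨2 * C ^ 2 * κ + 8 * C + 14, by positivity, fun d I => ?_⟩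
  rcases Nat.eq_zero_or_pos d with rfl | hd
  · refine ⟨1, fun T _ ε Ω _ μ _ q a l x _ _ => ?_⟩
    have h1 : expRegret I μ x T = 0 := by simp [expRegret, Instance.excess]
    rw [h1]
    have := I.complexity_nonneg
    have := Real.log_natCast_nonneg T
    positivity
  obtain ⟨Δ, hΔ, hgap⟩ := I.exists_gap_lower_bound
  obtain ⟨KD, hKD, hdist⟩ := I.exists_optDist_le
  obtain ⟨K, hK, hburn⟩ := I.exists_burn_in hΔ
  obtain ⟨B, hB, hBlarge⟩ := exists_block_length I.Wr KD
  have hW1 : 1 ≤ I.Wr := I.one_le_Wr ⟨0, hd⟩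
  have hW := I.Wr_nonneg
  have hB0 : (1 : ℝ) ≤ B := by exact_mod_cast hB
  set c := Δ / (2 * I.Wr) with hcdef
  have hc0 : 0 < c := by positivity
  have hc : c * I.Wr ≤ Δ / 2 := by rw [hcdef]; exact le_of_eq (by field_simp)
  have hbc := badConst_nonneg I hρ B
  set Y₁ := 4 * C * I.Wr * KD + badConst I ρ B * (8 + B + 8 * I.Wr / c) * KD +
    32 * C * B * I.Wr ^ 2 * KD with hY₁
  set Y₂ := badConst I ρ B * (K + 72 * I.Wr ^ 3 / c ^ 2) with hY₂
  have hev : ∀ᶠ L in Filter.atTop, LargeLog I ρ B L ∧ Y₁ / √L ≤ 1 / 8 ∧ Y₂ / √L ≤ 1 ∧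
      2 ≤ L ∧ I.Wr ≤ L ∧ 3 + B * C + B ≤ L := by
    filter_upwards [eventually_largeLog I ρ hB, eventually_div_sqrt_le Y₁ (y := 1 / 8)
      (by norm_num), eventually_div_sqrt_le Y₂ one_pos, Filter.eventually_ge_atTop 2,
      Filter.eventually_ge_atTop I.Wr, Filter.eventually_ge_atTop (3 + B * C + B)]
      with L h1 h2 h3 h4 h5 h6
    exact ⟨h1, h2, h3, h4, h5, h6⟩
  have hevT := (Real.tendsto_log_atTop.comp (tendsto_natCast_atTop_atTop (R := ℝ))).eventually hev
  have hevT2 := (tendsto_natCast_atTop_atTop (R := ℝ)).eventually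
    (Filter.eventually_ge_atTop (2 * I.Wr))
  obtain ⟨T₀, hT₀⟩ := Filter.eventually_atTop.1 (hevT.and (hevT2.and
    ((Filter.eventually_ge_atTop d).and (Filter.eventually_ge_atTop (B + 1)))))
  refine ⟨T₀, fun T hT ε Ω _ μ _ q a l x hr hpred => ?_⟩
  obtain ⟨⟨hlarge, hy1, hy2, hL2, hLW, hLB⟩, hTW, hTd, hTB⟩ := hT₀ T hT
  simp only [Function.comp_apply] at hlarge hy1 hy2 hL2 hLW hLB
  obtain ⟨u, hu, hphi, hu_mid, hudist⟩ := I.exists_comparator hd hTd hTW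
  have hT0 : (0 : ℝ) < T := by exact_mod_cast (by omega : 0 < T)
  have hNT : (T - 1 : ℕ) * I.optDist u ≤ I.Wr := by
    rw [le_div_iff₀ hT0] at hudist
    refine le_trans ?_ hudist
    rw [mul_comm]
    refine mul_le_mul_of_nonneg_left ?_ (I.optDist_nonneg u)
    exact_mod_cast Nat.sub_le T 1
  have hL0 : 0 < Real.log T := by linarith
  have hmain := hr.mul_expRegret_le hu hphi hu_mid hB (by omega : B ≤ T - 1) (by omega : T - 1 < T)
    hNT hgap hc0 hc hK (hburn _ hL0 hLW) hlarge hρ hL2 hκ hpred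
  have hD := hr.expDist_le hdist (Nat.sub_le T 1)
  have hD0 := hr.expDist_nonneg (T - 1)
  have hR0 := hr.expRegret_nonneg (Nat.sub_le T 1)
  -- the blocks end before round `T`, since the point of the round after a block is needed
  have hlast : expRegret I μ x T ≤ expRegret I μ x (T - 1) + I.Wr := by
    have e : T = T - 1 + 1 := by omega
    have h1 : ∫ ω, I.excess (x (T - 1) ω) ∂μ ≤ I.Wr := by
      calc _ ≤ ∫ _ω, I.Wr ∂μ := by
            refine integral_mono_ae (hr.integrable_excess (by omega)) (integrable_const _) ?_
            filter_upwards [hr.path] with ω hp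
            exact I.excess_le_Wr (hp.x_mem (T - 1) (by omega))
        _ = _ := by simp
    unfold expRegret at *
    conv_lhs => rw [e]
    rw [Finset.sum_range_succ]
    linarith
  rw [← I.Wr_eq]
  have hcompl := I.complexity_nonneg
  rw [← hC] at hmain
  set R := expRegret I μ x (T - 1)
  set D := expDist I μ x (T - 1)
  set L := Real.log T
  have hs : 0 < √L := Real.sqrt_pos.2 hL0
  have hB0' : (0 : ℝ) < B := by linarith
  -- everything that is linear in the distance is absorbed, the rest is of order `W log T`
  have t1 : I.Wr * (9 * I.Wr ^ 2 * √B + 9) * D ≤ B * (1 / 8 * R) := by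
    calc _ ≤ I.Wr * (9 * I.Wr ^ 2 * √B + 9) * (KD * R) := by gcongr
      _ = I.Wr * (9 * I.Wr ^ 2 * √B + 9) * KD * R := by ring
      _ ≤ B * (1 / 8) * R := by gcongr
      _ = _ := by ring
  have t2 : B * (C * (4 * I.Wr / √L) * D) + badConst I ρ B / √L * (8 * D + B * D + (K * L +
      I.Wr * (36 * I.Wr ^ 2 / c ^ 2 * (1 + L) + 8 / c * D))) +
      C * I.Wr * (32 * B * I.Wr / √L * D) ≤ B * (Y₁ / √L * R + Y₂ / √L * L) := by
    have e1 : B * (C * (4 * I.Wr / √L) * D) + badConst I ρ B / √L * (8 * D + B * D + (K * L +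
      I.Wr * (36 * I.Wr ^ 2 / c ^ 2 * (1 + L) + 8 / c * D))) +
      C * I.Wr * (32 * B * I.Wr / √L * D) =
      (B * (4 * C * I.Wr * D) + (badConst I ρ B * (8 + B + 8 * I.Wr / c) * D +
        badConst I ρ B * (K * L + 36 * I.Wr ^ 3 / c ^ 2 * (1 + L))) +
        32 * C * B * I.Wr ^ 2 * D) / √L := by
      field_simp; ring
    have e2 : B * (Y₁ / √L * R + Y₂ / √L * L) = (B * (4 * C * I.Wr * (KD * R)) +
        B * (badConst I ρ B * (8 + B + 8 * I.Wr / c) * (KD * R) +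
          badConst I ρ B * (K * L + 36 * I.Wr ^ 3 / c ^ 2 * (2 * L))) +
        B * (32 * C * B * I.Wr ^ 2 * (KD * R))) / √L := by
      rw [hY₁, hY₂]; field_simp; ring
    rw [e1, e2]
    have m1 : 0 ≤ badConst I ρ B * (8 + B + 8 * I.Wr / c) * (KD * R) +
          badConst I ρ B * (K * L + 36 * I.Wr ^ 3 / c ^ 2 * (2 * L)) := by positivity
    have m2 : 0 ≤ 32 * C * B * I.Wr ^ 2 * (KD * R) := by positivity
    have m3 := le_mul_of_one_le_left m1 hB0
    have m4 := le_mul_of_one_le_left m2 hB0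
    have m5 : badConst I ρ B * (8 + B + 8 * I.Wr / c) * D ≤
      badConst I ρ B * (8 + B + 8 * I.Wr / c) * (KD * R) := by gcongr
    have m6 : badConst I ρ B * (K * L + 36 * I.Wr ^ 3 / c ^ 2 * (1 + L)) ≤
      badConst I ρ B * (K * L + 36 * I.Wr ^ 3 / c ^ 2 * (2 * L)) := by gcongr; linarith
    have m7 : 32 * C * B * I.Wr ^ 2 * D ≤ 32 * C * B * I.Wr ^ 2 * (KD * R) := by gcongr
    have m8 : B * (4 * C * I.Wr * D) ≤ B * (4 * C * I.Wr * (KD * R)) := by gcongr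
    refine div_le_div_of_nonneg_right ?_ hs.le
    linarith
  have t3 : Y₁ / √L * R ≤ 1 / 8 * R := by gcongr
  have t4 : Y₂ / √L * L ≤ I.Wr * L := by
    refine mul_le_mul_of_nonneg_right (hy2.trans hW1) hL0.le
  have t5 : B * (Y₁ / √L * R + Y₂ / √L * L) ≤ B * (1 / 8 * R + I.Wr * L) := by gcongr
  have t6 : I.Wr ≤ B * I.Wr := le_mul_of_one_le_left hW hB0
  have hfin : B * R ≤ B * (3 * I.Wr + 9 / 2 * I.Wr * L + B * (C * I.Wr) + (C ^ 2 * κ *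
      I.complexity * L + 4 * C * I.Wr * L + 1 / 4 * R) + B * I.Wr + 1 / 8 * R +
      (1 / 8 * R + I.Wr * L)) := by
    linarith
  have hfin2 := le_of_mul_le_mul_left hfin hB0'
  have t7 : I.Wr * (3 + B * C + B) ≤ I.Wr * L := by gcongr
  have t8 : I.Wr * 1 ≤ I.Wr * L := by gcongr; linarith
  have hfin3 : R + I.Wr ≤ (2 * C ^ 2 * κ) * I.complexity * L + (8 * C + 14) * (I.Wr * L) := by
    linarith
  have t9 : 0 ≤ (8 * C + 14) * (I.complexity * L) := by positivity
  have t10 : 0 ≤ (2 * C ^ 2 * κ) * (I.Wr * L) := by positivity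
  calc _ ≤ R + I.Wr := hlast
    _ ≤ (2 * C ^ 2 * κ) * I.complexity * L + (8 * C + 14) * (I.Wr * L) := hfin3
    _ ≤ _ := by linarith

/-! ### The two prediction rules -/

section Predictions

variable {d : ℕ} {A : Finset (Fin d → ℕ)} {a : ℕ → Fin d → ℕ} {l : ℕ → LossArray A}

lemma lsPred_mem {t : ℕ} (h : ∀ s < t, ∀ i j, l s i j ∈ Set.Icc (0 : ℝ) 1) (i : Fin d) :
    lsPred A a l t i ∈ Set.Icc (0 : ℝ) 1 := by
  have h1 : ∀ s ∈ Finset.range t, 0 ≤ armLoss (a s) (l s) i ∧ armLoss (a s) (l s) i ≤ a s i :=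
    fun s hs => armLoss_mem (h s (Finset.mem_range.1 hs) i)
  have h2 := Finset.sum_nonneg fun s hs => (h1 s hs).1
  have h3 := Finset.sum_le_sum fun s hs => (h1 s hs).2
  unfold lsPred
  constructor
  · positivity
  · rw [div_le_one (by positivity)]
    linarith

lemma lsPred_succ_of_eq_zero {t : ℕ} {i : Fin d} (h : a t i = 0) :
    lsPred A a l (t + 1) i = lsPred A a l t i := by
  unfold lsPred
  rw [Finset.sum_range_succ, Finset.sum_range_succ]
  simp [h, armLoss]

lemma gdPred_mem {η : ℝ} (h0 : 0 ≤ η) (h1 : η ≤ 1) {t : ℕ}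
    (h : ∀ s < t, ∀ i j, l s i j ∈ Set.Icc (0 : ℝ) 1) (i : Fin d) :
    gdPred A η a l t i ∈ Set.Icc (0 : ℝ) 1 := by
  induction t with
  | zero => simp only [gdPred]; constructor <;> norm_num
  | succ t ih =>
    obtain ⟨h2, h3⟩ := ih fun s hs => h s (by omega)
    obtain ⟨h4, h5⟩ := avgLoss_mem (a := a t) (h t (Nat.lt_succ_self t) i)
    unfold gdPred
    split_ifs
    · constructor <;> nlinarith
    · exact ⟨h2, h3⟩

lemma gdPred_succ_of_eq_zero {η : ℝ} {t : ℕ} {i : Fin d} (h : a t i = 0) :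
    gdPred A η a l (t + 1) i = gdPred A η a l t i := by
  rw [gdPred]
  simp [h]

end Predictions

section Measurability

variable {d : ℕ} {A : Finset (Fin d → ℕ)} {Ω : Type*}
  [mΩ : MeasurableSpace Ω] {a : ℕ → Ω → Fin d → ℕ} {l : ℕ → Ω → LossArray A}

lemma measurable_lsPred (t : ℕ) :
    Measurable[history a l t] (fun ω => lsPred A (traj a ω) (traj l ω) t) := by
  refine @measurable_pi_lambda Ω _ _ (history a l t) _ _ fun i => ?_
  unfold lsPred
  refine Measurable.div (measurable_const.add (Finset.measurable_sum _ fun s hs => ?_))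
    (measurable_const.add (Finset.measurable_sum _ fun s hs => ?_))
  · exact (measurable_armLoss i).comp (measurable_history (Finset.mem_range.1 hs))
  · exact measurable_from_top.comp ((measurable_pi_apply i).comp
      (measurable_fst.comp (measurable_history (Finset.mem_range.1 hs))))

lemma measurable_gdPred (η : ℝ) (t : ℕ) :
    Measurable[history a l t] (fun ω => gdPred A η (traj a ω) (traj l ω) t) := by
  refine @measurable_pi_lambda Ω _ _ (history a l t) _ _ fun i => ?_
  induction t with
  | zero => simp only [gdPred]; exact measurable_const
  | succ t ih =>
    have h1 := ih.mono (history_mono (Nat.le_succ t)) le_rfl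
    have h2 := measurable_history (a := a) (l := l) (Nat.lt_succ_self t)
    simp only [gdPred]
    refine Measurable.ite ?_ ((h1.const_mul _).add
      ((measurable_avgLoss h2 i).const_mul η)) h1
    exact measurableSet_le measurable_const
      ((measurable_pi_apply i).comp (measurable_fst.comp h2))

end Measurability

namespace RegularRun

variable {d : ℕ} {I : Instance d} {ρ : ℝ} {ε : Fin d → ℝ} {T : ℕ} {Ω : Type*}
  [mΩ : MeasurableSpace Ω] {μ : Measure Ω} [IsProbabilityMeasure μ] {q : ℕ → Ω → Fin d → ℝ}
  {a : ℕ → Ω → Fin d → ℕ} {l : ℕ → Ω → LossArray I.A} {x : ℕ → Ω → Fin d → ℝ}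
  (hr : RegularRun I ρ ε T μ q a l x)

include hr

lemma integrable_sq_armLoss_sub {t : ℕ} (ht : t < T) (i : Fin d) :
    Integrable (fun ω => (armLoss (a t ω) (l t ω) i - a t ω i * I.mean i) ^ 2) μ := by
  refine Integrable.of_bound ?_ ((maxPlays I.A i : ℝ) ^ 2) ?_
  · exact ((((measurable_armLoss i).comp ((hr.measurable_a t).prodMk (hr.measurable_l t))).sub
      ((hr.measurable_play t i).mul_const _)).pow_const 2).aestronglyMeasurable
  · filter_upwards [hr.path] with ω hp
    obtain ⟨h1, h2⟩ := armLoss_mem (a := a t ω) (hp.l_mem t ht i)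
    obtain ⟨m0, m1⟩ := I.mean_mem i
    have h3 : (a t ω i : ℝ) ≤ maxPlays I.A i := by exact_mod_cast le_maxPlays (hp.a_mem t ht) i
    have h4 : (0 : ℝ) ≤ a t ω i := Nat.cast_nonneg _
    have h5 : (a t ω i : ℝ) * I.mean i ≤ a t ω i := mul_le_of_le_one_right h4 m1
    have h6 : 0 ≤ (a t ω i : ℝ) * I.mean i := mul_nonneg h4 m0
    rw [norm_pow, Real.norm_eq_abs]
    gcongr
    simp only [traj] at h1 h2
    rw [abs_le]; constructor <;> linarith

/-- The errors of the observed losses are uncorrelated with the past. -/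
lemma integral_mul_armLoss_sub {t : ℕ} (ht : t < T) (i : Fin d) {G : Ω → ℝ} {C : ℝ}
    (hG : Measurable[history a l t] G) (hC : ∀ᵐ ω ∂μ, |G ω| ≤ C) :
    Integrable (fun ω => G ω * (armLoss (a t ω) (l t ω) i - a t ω i * I.mean i)) μ ∧
    ∫ ω, G ω * (armLoss (a t ω) (l t ω) i - a t ω i * I.mean i) ∂μ = 0 := by
  have i1 : Integrable (fun ω => G ω * (a t ω i : ℝ)) μ :=
    (hr.integrable_play ht i).bdd_mul (c := C)
      (hG.mono (hr.history_le t) le_rfl).aestronglyMeasurable hC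
  obtain ⟨i2, e2⟩ := hr.integral_mul_armLoss ht i (measurable_past_a t)
    (by filter_upwards [hr.path] with ω hp using le_maxPlays (hp.a_mem t ht) i)
    (hG.mono le_sup_left le_rfl) i1
  have e : ∀ ω, G ω * (armLoss (a t ω) (l t ω) i - a t ω i * I.mean i) =
      G ω * armLoss (a t ω) (l t ω) i - G ω * (a t ω i : ℝ) * I.mean i := fun ω => by ring
  simp only [e]
  refine ⟨i2.sub (i1.mul_const _), ?_⟩
  rw [integral_sub i2 (i1.mul_const _), e2, integral_mul_const]
  ring

/-- The least-squares predictions are almost as accurate as the means: the potential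
`(1 + ∑ a) (q - ℓ)²` pays for the difference, up to a logarithm. -/
lemma sum_sq_le_of_lsPred (hq : ∀ t ω, q t ω = lsPred I.A (traj a ω) (traj l ω) t) {N : ℕ}
    (hN : N ≤ T) (i : Fin d) (hT : 1 + (maxPlays I.A i : ℝ) ≤ T) (hL : 2 ≤ Real.log T) :
    ∑ s ∈ Finset.range N, ∫ ω, ((a s ω i : ℝ) * (avgLoss (a s ω) (l s ω) i - q s ω i)) ^ 2 ∂μ ≤
      2 * I.sigmaSq i * ∑ s ∈ Finset.range N, ∫ ω, x s ω i ∂μ +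
        6 * maxPlays I.A i ^ 2 * Real.log T := by
  have hn := I.one_le_n i
  obtain ⟨m0, m1⟩ := I.mean_mem i
  have hlt : ∀ s ∈ Finset.range N, s < T := fun s hs => (Finset.mem_range.1 hs).trans_le hN
  have i1 := fun s (hs : s ∈ Finset.range N) => hr.integrable_sq_armLoss_sub (hlt s hs) i
  have i2 : ∀ s ∈ Finset.range N, _ := fun s hs => hr.integral_mul_armLoss_sub (hlt s hs) i
    (G := fun ω => q s ω i - I.mean i) (C := 1) ((hr.measurable_q_apply s i).sub_const _) (by
      filter_upwards [hr.path] with ω hp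
      obtain ⟨h1, h2⟩ := hp.q_mem s (hlt s hs).le i
      simp only [traj] at h1 h2
      rw [abs_le]; constructor <;> linarith)
  have i3 := fun s (hs : s ∈ Finset.range N) => hr.integrable_sq_play_mul (hlt s hs) i
  have j1 := (integrable_finsetSum _ i1).const_mul 2
  have j2 := (integrable_finsetSum _ fun s hs => (i2 s hs).1).const_mul (4 * (maxPlays I.A i : ℝ))
  have j3 := integrable_const (μ := μ) (6 * (maxPlays I.A i : ℝ) ^ 2 * Real.log T)
  have hmono := integral_mono_ae (integrable_finsetSum _ i3) ((j1.add j2).add j3) (by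
    filter_upwards [hr.path] with ω hp
    set y : ℕ → ℝ := fun s => q s ω i - I.mean i with hy
    set b : ℕ → ℝ := fun s => armLoss (a s ω) (l s ω) i - a s ω i * I.mean i with hb
    set S : ℕ → ℝ := fun s => 1 + ∑ r ∈ Finset.range s, (a r ω i : ℝ) with hS
    have hSpos : ∀ s, 0 < S s := fun s => by simp only [hS]; positivity
    have hS1 : ∀ s, S (s + 1) = S s + a s ω i := fun s => by
      simp only [hS]; rw [Finset.sum_range_succ]; ring
    have hSq : ∀ s, S s * q s ω i =
        1 / 2 + ∑ r ∈ Finset.range s, armLoss (a r ω) (l r ω) i := fun s => by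
      rw [hq]; exact mul_div_cancel₀ _ (hSpos s).ne'
    have hyrec : ∀ s, S (s + 1) * y (s + 1) = S s * y s + b s := fun s => by
      simp only [hy, hb, mul_sub]
      rw [hSq, hSq, Finset.sum_range_succ, hS1]; ring
    have hstep : ∀ s ∈ Finset.range N, (a s ω i : ℝ) * y s ^ 2 ≤
        (S s * y s ^ 2 - S (s + 1) * y (s + 1) ^ 2) + 2 * (y s * b s) +
          maxPlays I.A i * (Real.log (S (s + 1)) - Real.log (S s)) := by
      intro s hs
      have hT := hlt s hs
      have h1 := hp.abs_avgLoss_sub_le hT i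
      have h2 : (a s ω i : ℝ) ≤ maxPlays I.A i := by exact_mod_cast le_maxPlays (hp.a_mem s hT) i
      have h0 : (0 : ℝ) ≤ a s ω i := Nat.cast_nonneg _
      have h3 : b s - a s ω i * y s =
          (a s ω i : ℝ) * (avgLoss (a s ω) (l s ω) i - q s ω i) := by
        simp only [hb, hy, ← play_mul_avgLoss]; ring
      have h4 : (b s - a s ω i * y s) ^ 2 ≤ maxPlays I.A i * a s ω i := by
        rw [h3, mul_pow]
        have : (avgLoss (a s ω) (l s ω) i - q s ω i) ^ 2 ≤ 1 := by
          rw [sq_le_one_iff_abs_le_one]; exact h1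
        nlinarith [sq_nonneg (a s ω i : ℝ)]
      have hSs := hSpos s
      have hSs1 := hSpos (s + 1)
      have h5 : S (s + 1) * y (s + 1) ^ 2 = (S s * y s + b s) ^ 2 / S (s + 1) := by
        rw [← hyrec]; field_simp
      have h6 : (a s ω i : ℝ) * y s ^ 2 = (S s * y s ^ 2 - S (s + 1) * y (s + 1) ^ 2) +
          2 * (y s * b s) + (b s - a s ω i * y s) ^ 2 / S (s + 1) := by
        rw [h5, hS1] at *
        field_simp
        ring
      have h7 : (a s ω i : ℝ) / S (s + 1) ≤ Real.log (S (s + 1)) - Real.log (S s) := by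
        rw [← Real.log_div hSs1.ne' hSs.ne']
        refine le_trans (le_of_eq ?_) (Real.one_sub_inv_le_log_of_pos (div_pos hSs1 hSs))
        rw [inv_div, hS1] at *
        field_simp
        ring
      have h8 : (b s - a s ω i * y s) ^ 2 / S (s + 1) ≤
          maxPlays I.A i * (Real.log (S (s + 1)) - Real.log (S s)) := by
        calc _ ≤ maxPlays I.A i * a s ω i / S (s + 1) := by gcongr
          _ = maxPlays I.A i * (a s ω i / S (s + 1)) := by ring
          _ ≤ _ := by gcongr
      linarith
    have hsum := Finset.sum_le_sum hstep
    rw [Finset.sum_add_distrib, Finset.sum_add_distrib,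
      Finset.sum_range_sub' (fun s => S s * y s ^ 2), ← Finset.mul_sum, ← Finset.mul_sum,
      Finset.sum_range_sub (fun s => Real.log (S s))] at hsum
    have hS0 : S 0 = 1 := by simp [hS]
    have hy0 : y 0 ^ 2 ≤ 1 := by
      obtain ⟨h1, h2⟩ := hp.q_mem 0 (Nat.zero_le T) i
      rw [sq_le_one_iff_abs_le_one, abs_le]
      simp only [hy, traj] at *
      constructor <;> linarith
    have hyN : 0 ≤ S N * y N ^ 2 := mul_nonneg (hSpos N).le (sq_nonneg _)
    have hSN : Real.log (S N) ≤ 2 * Real.log T := by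
      have hT0 : (1 : ℝ) ≤ T := by linarith
      have h1 : S N ≤ T ^ 2 := by
        have h2 : ∑ r ∈ Finset.range N, (a r ω i : ℝ) ≤ N * maxPlays I.A i := by
          calc _ ≤ ∑ _r ∈ Finset.range N, (maxPlays I.A i : ℝ) := Finset.sum_le_sum fun r hr' => by
                exact_mod_cast le_maxPlays (hp.a_mem r (hlt r hr')) i
            _ = _ := by simp
        have h3 : (N : ℝ) ≤ T := by exact_mod_cast hN
        simp only [hS]
        nlinarith
      calc _ ≤ Real.log ((T : ℝ) ^ 2) := Real.log_le_log (hSpos N) h1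
        _ = _ := by rw [Real.log_pow]; norm_num
    rw [hS0, Real.log_one, sub_zero, one_mul] at hsum
    have hfin : ∑ s ∈ Finset.range N,
        ((a s ω i : ℝ) * (avgLoss (a s ω) (l s ω) i - q s ω i)) ^ 2 ≤
        2 * ∑ s ∈ Finset.range N, b s ^ 2 +
          2 * maxPlays I.A i * ∑ s ∈ Finset.range N, (a s ω i : ℝ) * y s ^ 2 := by
      rw [Finset.mul_sum, Finset.mul_sum, ← Finset.sum_add_distrib]
      refine Finset.sum_le_sum fun s hs => ?_
      have h2 : (a s ω i : ℝ) ≤ maxPlays I.A i := by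
        exact_mod_cast le_maxPlays (hp.a_mem s (hlt s hs)) i
      have h3 : (a s ω i : ℝ) * (avgLoss (a s ω) (l s ω) i - q s ω i) =
          b s - a s ω i * y s := by
        simp only [hb, hy, ← play_mul_avgLoss]; ring
      rw [h3]
      have h4 : (a s ω i : ℝ) * (a s ω i * y s ^ 2) ≤ maxPlays I.A i * (a s ω i * y s ^ 2) := by
        gcongr
      nlinarith [sq_nonneg (b s + a s ω i * y s)]
    have hlast : 2 * maxPlays I.A i * ∑ s ∈ Finset.range N, (a s ω i : ℝ) * y s ^ 2 ≤
        2 * maxPlays I.A i * (1 + 2 * ∑ s ∈ Finset.range N, y s * b s +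
          maxPlays I.A i * (2 * Real.log T)) := by
      refine mul_le_mul_of_nonneg_left ?_ (by positivity)
      have : maxPlays I.A i * Real.log (S N) ≤ maxPlays I.A i * (2 * Real.log T) := by gcongr
      linarith
    have h9 : 2 * (maxPlays I.A i : ℝ) ≤ 2 * maxPlays I.A i ^ 2 * Real.log T := by
      nlinarith
    simp only [Pi.add_apply]
    linarith)
  rw [integral_finsetSum _ i3] at hmono
  refine hmono.trans (le_of_eq ?_)
  rw [integral_add' (j1.add j2) j3, integral_add' j1 j2, integral_const_mul, integral_const_mul,
    integral_finsetSum _ i1, integral_finsetSum _ fun s hs => (i2 s hs).1,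
    Finset.sum_eq_zero fun s hs => (i2 s hs).2,
    Finset.sum_congr rfl fun s hs => hr.integral_sq_armLoss_sub (hlt s hs) i, ← Finset.mul_sum]
  simp only [integral_const, probReal_univ, smul_eq_mul, one_mul]
  ring

/-- The gradient-descent predictions are almost as accurate as the means: the potential
`(q - ℓ)²` pays for the difference. -/
lemma sum_sq_le_of_gdPred {η : ℝ} (h0 : 0 < η) (h1 : η ≤ 1 / 2)
    (hq : ∀ t ω, q t ω = gdPred I.A η (traj a ω) (traj l ω) t) {N : ℕ}
    (hN : N ≤ T) (i : Fin d) (hη : 2 / η ≤ Real.log T) :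
    ∑ s ∈ Finset.range N, ∫ ω, ((a s ω i : ℝ) * (avgLoss (a s ω) (l s ω) i - q s ω i)) ^ 2 ∂μ ≤
      2 * maxPlays I.A i ^ 2 * I.sigmaSq i * ∑ s ∈ Finset.range N, ∫ ω, x s ω i ∂μ +
        6 * maxPlays I.A i ^ 2 * Real.log T := by
  have hlt : ∀ s ∈ Finset.range N, s < T := fun s hs => (Finset.mem_range.1 hs).trans_le hN
  obtain ⟨m0, m1⟩ := I.mean_mem i
  have i1 := fun s (hs : s ∈ Finset.range N) => hr.integrable_sq_armLoss_sub (hlt s hs) i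
  have i3 := fun s (hs : s ∈ Finset.range N) => hr.integrable_sq_play_mul (hlt s hs) i
  have j1 := (integrable_finsetSum _ i1).const_mul (2 * (maxPlays I.A i : ℝ) ^ 2)
  have j3 := integrable_const (μ := μ) ((maxPlays I.A i : ℝ) ^ 2 * Real.log T)
  have hL0 : 0 < Real.log T := lt_of_lt_of_le (by positivity) hη
  have hmono := integral_mono_ae (integrable_finsetSum _ i3) (j1.add j3) (by
    filter_upwards [hr.path] with ω hp
    set y : ℕ → ℝ := fun s => q s ω i - I.mean i with hy
    set b : ℕ → ℝ := fun s => armLoss (a s ω) (l s ω) i - a s ω i * I.mean i with hb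
    have hstep : ∀ s ∈ Finset.range N,
        ((a s ω i : ℝ) * (avgLoss (a s ω) (l s ω) i - q s ω i)) ^ 2 ≤
        2 * maxPlays I.A i ^ 2 * b s ^ 2 +
          maxPlays I.A i ^ 2 * (2 / η) * (y s ^ 2 - y (s + 1) ^ 2) := by
      intro s hs
      have hqs : q (s + 1) ω i = if 1 ≤ a s ω i then
          (1 - η) * q s ω i + η * avgLoss (a s ω) (l s ω) i else q s ω i := by
        rw [hq, hq, gdPred]
      rcases Nat.eq_zero_or_pos (a s ω i) with ha | ha
      · rw [if_neg (by omega)] at hqs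
        simp only [hy, hqs, ha]
        have : 0 ≤ 2 * (maxPlays I.A i : ℝ) ^ 2 * b s ^ 2 := by positivity
        simpa using this
      · rw [if_pos (by omega)] at hqs
        have ha1 : (1 : ℝ) ≤ a s ω i := by exact_mod_cast ha
        have h2 : (a s ω i : ℝ) ≤ maxPlays I.A i := by
          exact_mod_cast le_maxPlays (hp.a_mem s (hlt s hs)) i
        set z := avgLoss (a s ω) (l s ω) i - I.mean i with hz
        have h3 : b s = a s ω i * z := by
          simp only [hb, hz, ← play_mul_avgLoss]; ring
        have h4 : avgLoss (a s ω) (l s ω) i - q s ω i = z - y s := by simp only [hz, hy]; ring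
        have h5 : y (s + 1) = y s + η * (z - y s) := by
          simp only [hy, hz, hqs]; ring
        have h6 : (z - y s) ^ 2 ≤ 2 * z ^ 2 + 2 / η * (y s ^ 2 - y (s + 1) ^ 2) := by
          have e1 : y s ^ 2 - y (s + 1) ^ 2 =
              η * ((y s) ^ 2 - z ^ 2 + (1 - η) * (z - y s) ^ 2) := by
            rw [h5]; ring
          have e2 : 2 / η * (y s ^ 2 - y (s + 1) ^ 2) =
              2 * ((y s) ^ 2 - z ^ 2 + (1 - η) * (z - y s) ^ 2) := by
            rw [e1]; field_simp
          rw [e2]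
          nlinarith [sq_nonneg (y s), sq_nonneg (z - y s)]
        have h7 : z ^ 2 ≤ b s ^ 2 := by
          rw [h3, mul_pow]
          exact le_mul_of_one_le_left (sq_nonneg z) (one_le_pow₀ ha1)
        rw [h4, mul_pow]
        calc _ ≤ (maxPlays I.A i : ℝ) ^ 2 * (z - y s) ^ 2 := by gcongr
          _ ≤ (maxPlays I.A i : ℝ) ^ 2 * (2 * b s ^ 2 + 2 / η * (y s ^ 2 - y (s + 1) ^ 2)) := by
              refine mul_le_mul_of_nonneg_left ?_ (by positivity)
              linarith
          _ = _ := by ring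
    have hsum := Finset.sum_le_sum hstep
    rw [Finset.sum_add_distrib, ← Finset.mul_sum, ← Finset.mul_sum,
      Finset.sum_range_sub' (fun s => y s ^ 2)] at hsum
    have hy0 : y 0 ^ 2 ≤ 1 := by
      obtain ⟨h1, h2⟩ := hp.q_mem 0 (Nat.zero_le T) i
      rw [sq_le_one_iff_abs_le_one, abs_le]
      simp only [hy, traj] at *
      constructor <;> linarith
    have hlast : (maxPlays I.A i : ℝ) ^ 2 * (2 / η) * (y 0 ^ 2 - y N ^ 2) ≤
        (maxPlays I.A i : ℝ) ^ 2 * Real.log T * 1 := by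
      have h8 : y 0 ^ 2 - y N ^ 2 ≤ 1 := by nlinarith [sq_nonneg (y N)]
      calc _ ≤ (maxPlays I.A i : ℝ) ^ 2 * (2 / η) * 1 := by gcongr
        _ ≤ _ := by gcongr
    simp only [Pi.add_apply]
    linarith)
  rw [integral_finsetSum _ i3] at hmono
  refine hmono.trans ?_
  rw [integral_add' j1 j3, integral_const_mul, integral_finsetSum _ i1,
    Finset.sum_congr rfl fun s hs => hr.integral_sq_armLoss_sub (hlt s hs) i, ← Finset.mul_sum]
  simp only [integral_const, probReal_univ, smul_eq_mul, one_mul]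
  have : 0 ≤ (maxPlays I.A i : ℝ) ^ 2 * Real.log T := by positivity
  linarith

/-- The regret is the expected excess loss of the points of the algorithm. -/
lemma regret_eq : regret I T μ a l = expRegret I μ x T := by
  have h1 : ∀ t ∈ Finset.range T, ∀ i, Integrable (fun ω => armLoss (a t ω) (l t ω) i -
      armLoss I.aStar (l t ω) i) μ ∧
      ∫ ω, (armLoss (a t ω) (l t ω) i - armLoss I.aStar (l t ω) i) ∂μ =
        ∫ ω, (x t ω i - I.aStar i) * I.mean i ∂μ := by
    intro t ht i
    rw [Finset.mem_range] at ht
    have e1 := hr.integral_mul_armLoss ht i (G := fun _ => 1) (measurable_past_a t)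
      (by filter_upwards [hr.path] with ω hp using le_maxPlays (hp.a_mem t ht) i)
      measurable_const (by simpa using hr.integrable_play ht i)
    have e2 := hr.integral_mul_armLoss ht i (G := fun _ => 1) (b := fun _ => I.aStar)
      measurable_const (Filter.Eventually.of_forall fun _ => I.aStar_le i)
      measurable_const (integrable_const _)
    have e3 := hr.integral_mul_play ht i (G := fun _ => 1) measurable_const
      (by simpa using hr.integrable_play ht i)
    simp only [one_mul] at e1 e2 e3
    refine ⟨e1.1.sub e2.1, ?_⟩
    rw [integral_sub e1.1 e2.1, e1.2, e2.2, e3, integral_mul_const,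
      integral_sub (hr.integrable_x ht i) (integrable_const _)]
    ring
  have h2 : ∀ ω, ∑ t ∈ Finset.range T, (linLoss (a t ω) (l t ω) - linLoss I.aStar (l t ω)) =
      ∑ t ∈ Finset.range T, ∑ i, (armLoss (a t ω) (l t ω) i - armLoss I.aStar (l t ω) i) := by
    intro ω
    unfold linLoss
    simp only [Finset.sum_sub_distrib]
  unfold regret expRegret
  simp only [h2]
  rw [integral_finsetSum _ fun t ht => integrable_finsetSum _ fun i _ => (h1 t ht i).1]
  refine Finset.sum_congr rfl fun t ht => ?_
  have ht' := Finset.mem_range.1 ht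
  rw [integral_finsetSum _ fun i _ => (h1 t ht i).1]
  unfold Instance.excess
  have h3 : ∀ i, Integrable (fun ω => (x t ω i - I.aStar i) * I.mean i) μ := fun i =>
    ((hr.integrable_x ht' i).sub (integrable_const _)).mul_const _
  rw [integral_finsetSum _ fun i _ => h3 i]
  exact Finset.sum_congr rfl fun i _ => (h1 t ht i).2

end RegularRun

/-! ### From runs to regular runs -/

lemma objective_congr {d : ℕ} {A : Finset (Fin d → ℕ)} (q : ℕ → Fin d → ℝ) (ε : Fin d → ℝ)
    (T : ℕ) (a : ℕ → Fin d → ℕ) (l : ℕ → LossArray A) {x y : ℕ → Fin d → ℝ} {t : ℕ}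
    (h : ∀ s < t, x s = y s) : objective q ε T a l x t = objective q ε T a l y t := by
  have h1 : ∀ i, ∑ s ∈ Finset.range t, lossEst q a l x s i =
      ∑ s ∈ Finset.range t, lossEst q a l y s i := fun i =>
    Finset.sum_congr rfl fun s hs => by unfold lossEst; rw [h s (Finset.mem_range.1 hs)]
  have h2 : ∀ i, beta q ε T a l x t i = beta q ε T a l y t i := fun i => by
    unfold beta
    congr 3
    exact Finset.sum_congr rfl fun s hs => by rw [h s (Finset.mem_range.1 hs)]
  ext z
  unfold objective
  simp only [h1, h2]

/-- The points of a run agree almost surely with a version that is measurable with respect to the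
past, namely the conditional means of the actions. -/
lemma IsRun.exists_regularRun {d : ℕ} {I : Instance d} {pred : Prediction I.A} {ρ : ℝ}
    {ε : Fin d → ℝ} {T : ℕ} {Ω : Type*} [MeasurableSpace Ω] {μ : Measure Ω}
    [IsProbabilityMeasure μ] {a : ℕ → Ω → Fin d → ℕ} {l : ℕ → Ω → LossArray I.A}
    {x : ℕ → Ω → Fin d → ℝ} (h : IsRun I pred ε T μ a l x) (hρ : 0 < ρ)
    (hε : ∀ i, ρ * I.n i ≤ ε i ∧ ε i ≤ I.n i / 2) (hL : 2 ≤ Real.log T)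
    (hmeas : ∀ t, Measurable[history a l t] (fun ω => pred (traj a ω) (traj l ω) t))
    (hmem : ∀ (b : ℕ → Fin d → ℕ) (y : ℕ → LossArray I.A) (t : ℕ),
      (∀ s < t, ∀ i j, y s i j ∈ Set.Icc (0 : ℝ) 1) → ∀ i, pred b y t i ∈ Set.Icc (0 : ℝ) 1)
    (hsucc : ∀ (b : ℕ → Fin d → ℕ) (y : ℕ → LossArray I.A) (t : ℕ) (i : Fin d), b t i = 0 →
      pred b y (t + 1) i = pred b y t i) :
    ∃ x' : ℕ → Ω → Fin d → ℝ,
      RegularRun I ρ ε T μ (fun t ω => pred (traj a ω) (traj l ω) t) a l x' := by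
  set x' : ℕ → Ω → Fin d → ℝ := fun t ω i => (μ[fun ω => (a t ω i : ℝ) | history a l t]) ω with hx'
  have hae : ∀ᵐ ω ∂μ, ∀ t < T, x' t ω = x t ω := by
    rw [ae_all_iff]
    intro t
    by_cases ht : t < T
    · have : ∀ᵐ ω ∂μ, ∀ i, x' t ω i = x t ω i := ae_all_iff.2 fun i => h.sampling t ht i
      filter_upwards [this] with ω hω _
      exact funext hω
    · filter_upwards with ω ht'
      exact absurd ht' ht
  have hae2 : ∀ᵐ ω ∂μ, ∀ t < T, x t ω ∈ feasible I.A ∧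
      IsMinOn (objective (pred (fun s => a s ω) (fun s => l s ω)) ε T
        (fun s => a s ω) (fun s => l s ω) (fun s => x s ω) t) (feasible I.A) (x t ω) ∧
      a t ω ∈ I.A ∧ ∀ i j, l t ω i j ∈ Set.Icc (0 : ℝ) 1 := by
    rw [ae_all_iff]
    intro t
    by_cases ht : t < T
    · have h1 : ∀ᵐ ω ∂μ, ∀ i j, l t ω i j ∈ Set.Icc (0 : ℝ) 1 := by
        rw [ae_all_iff]
        intro i
        rw [ae_all_iff]
        intro j
        have h2 : Measurable (fun ω => l t ω i j) :=
          (measurable_pi_apply j).comp ((measurable_pi_apply i).comp (h.measurable_l t))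
        have h3 := I.D_supp i
        rw [← h.law t ht i j] at h3
        exact ae_of_ae_map h2.aemeasurable h3
      filter_upwards [h.oftrl t ht, h.mem t ht, h1] with ω h2 h3 h4 _
      exact ⟨h2.1, h2.2, h3, h4⟩
    · filter_upwards with ω ht'
      exact absurd ht' ht
  refine ⟨x', h.measurable_a, h.measurable_l, hmeas, fun t => ?_, h.law, h.indep_samples,
    h.indep_rounds, fun t _ i => ?_, ?_⟩
  · exact @measurable_pi_lambda Ω _ _ (history a l t) _ _ fun i =>
      (stronglyMeasurable_condExp (m := history a l t) (μ := μ)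
        (f := fun ω => (a t ω i : ℝ))).measurable
  · exact Filter.EventuallyEq.rfl
  · filter_upwards [hae, hae2] with ω h1 h2
    refine ⟨hρ, I.n_pos, hε, hL, fun t ht => ?_, fun t ht => ?_, fun t ht => (h2 t ht).2.2.1,
      fun t ht => (h2 t ht).2.2.2, fun t ht => ?_, fun t _ i hi => hsucc _ _ t i hi⟩
    · change x' t ω ∈ feasible I.A
      rw [h1 t ht]
      exact (h2 t ht).1
    · have h3 := (h2 t ht).2.1
      have h4 : ∀ s < t, x s ω = x' s ω := fun s hs => (h1 s (hs.trans ht)).symm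
      rw [objective_congr _ _ _ _ _ (y := traj x' ω) h4, ← h1 t ht] at h3
      exact h3
    · exact hmem _ _ t fun s hs => (h2 s (by omega)).2.2.2

end MPCSB

theorem theorem2 (ρ : ℝ) (hρ : 0 < ρ) :
    (∃ C : ℝ, 0 < C ∧
      ∀ (d : ℕ) (I : MPCSB.Instance d) (ε : Fin d → ℝ),
        (∀ i, ρ * I.n i ≤ ε i ∧ ε i ≤ I.n i / 2) →
        ∃ T₀ : ℕ, ∀ T ≥ T₀, ∀ (Ω : Type*) [MeasurableSpace Ω] (μ : Measure Ω)
          [IsProbabilityMeasure μ] (a : ℕ → Ω → Fin d → ℕ) (l : ℕ → Ω → MPCSB.LossArray I.A)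
          (x : ℕ → Ω → Fin d → ℝ),
          MPCSB.IsRun I (MPCSB.lsPred I.A) ε T μ a l x →
          MPCSB.regret I T μ a l ≤ C * (I.complexity + I.W) * Real.log T) ∧
    (∀ N : ℕ, ∃ C : ℝ, 0 < C ∧
      ∀ (d : ℕ) (I : MPCSB.Instance d) (ε : Fin d → ℝ) (η : ℝ),
        (∀ i, I.n i ≤ N) →
        (∀ i, ρ * I.n i ≤ ε i ∧ ε i ≤ I.n i / 2) →
        0 < η → η < 1 / 2 →
        ∃ T₀ : ℕ, ∀ T ≥ T₀, ∀ (Ω : Type*) [MeasurableSpace Ω] (μ : Measure Ω)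
          [IsProbabilityMeasure μ] (a : ℕ → Ω → Fin d → ℕ) (l : ℕ → Ω → MPCSB.LossArray I.A)
          (x : ℕ → Ω → Fin d → ℝ),
          MPCSB.IsRun I (MPCSB.gdPred I.A η) ε T μ a l x →
          MPCSB.regret I T μ a l ≤
            C * (1 / (1 - 2 * η) * I.complexity + I.W) * Real.log T) := by
  have hlog : ∀ y : ℝ, ∃ T₁ : ℕ, ∀ T ≥ T₁, y ≤ Real.log T := fun y =>
    Filter.eventually_atTop.1 ((Real.tendsto_log_atTop.comp
      (tendsto_natCast_atTop_atTop (R := ℝ))).eventually_ge_atTop y)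
  constructor
  -- the predictions only enter through the factor `κ` at the variance in the sum of the squared
  -- prediction errors: `κ = 2` for least squares, and `κ = 2 N²` for gradient descent
  · obtain ⟨C, hC, h⟩ := MPCSB.exists_expRegret_le hρ (zero_le_two (α := ℝ))
    refine ⟨C, hC, fun d I ε hε => ?_⟩
    obtain ⟨T₀, hT₀⟩ := h d I
    obtain ⟨T₁, hT₁⟩ := hlog 2
    obtain ⟨T₂, hT₂⟩ := exists_nat_ge (1 + I.Wr)
    refine ⟨max T₀ (max T₁ T₂), fun T hT Ω _ μ _ a l x hrun => ?_⟩
    have hL := hT₁ T (by omega)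
    have hTW : 1 + I.Wr ≤ T := hT₂.trans (by exact_mod_cast (by omega : T₂ ≤ T))
    obtain ⟨x', hr⟩ := hrun.exists_regularRun hρ hε hL (fun t => MPCSB.measurable_lsPred t)
      (fun _ _ _ h i => MPCSB.lsPred_mem h i) (fun _ _ _ _ h => MPCSB.lsPred_succ_of_eq_zero h)
    rw [hr.regret_eq]
    exact hT₀ T (by omega) ε Ω μ _ a l x' hr fun i =>
      hr.sum_sq_le_of_lsPred (fun _ _ => rfl) (Nat.sub_le T 1) i
        (by linarith [I.n_le_Wr i]) hL
  · intro N
    obtain ⟨C, hC, h⟩ := MPCSB.exists_expRegret_le hρ (by positivity : (0 : ℝ) ≤ 2 * (N : ℝ) ^ 2)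
    refine ⟨C, hC, fun d I ε η hN hε h0 h1 => ?_⟩
    obtain ⟨T₀, hT₀⟩ := h d I
    obtain ⟨T₁, hT₁⟩ := hlog (max 2 (2 / η))
    refine ⟨max T₀ T₁, fun T hT Ω _ μ _ a l x hrun => ?_⟩
    have hL := hT₁ T (by omega)
    rw [max_le_iff] at hL
    obtain ⟨x', hr⟩ := hrun.exists_regularRun hρ hε hL.1 (fun t => MPCSB.measurable_gdPred η t)
      (fun _ _ _ h i => MPCSB.gdPred_mem h0.le (by linarith) h i)
      (fun _ _ _ _ h => MPCSB.gdPred_succ_of_eq_zero h)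
    rw [hr.regret_eq]
    have hP : ∀ i, 0 ≤ ∑ s ∈ Finset.range (T - 1), ∫ ω, x' s ω i ∂μ := fun i =>
      Finset.sum_nonneg fun s hs => integral_nonneg_of_ae (by
        filter_upwards [hr.path] with ω hp
        exact (hp.x_bounds ((Finset.mem_range.1 hs).trans_le (Nat.sub_le T 1)) i).1.le)
    refine (hT₀ T (by omega) ε Ω μ _ a l x' hr fun i => ?_).trans ?_
    · refine (hr.sum_sq_le_of_gdPred h0 h1.le (fun _ _ => rfl) (Nat.sub_le T 1) i hL.2).trans ?_
      have h2 : (MPCSB.maxPlays I.A i : ℝ) ≤ N := by exact_mod_cast hN i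
      have h3 := I.sigmaSq_nonneg i
      have h4 := hP i
      gcongr
    -- the potential argument already gives the bound without the factor `1 / (1 - 2 η) ≥ 1`
    · have h2 : 1 ≤ 1 / (1 - 2 * η) := by
        rw [le_div_iff₀ (by linarith)]; linarith
      have h3 := le_mul_of_one_le_left I.complexity_nonneg h2
      have h4 : 0 ≤ Real.log T := by linarith
      gcongr
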